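/- Let $X$ be a compact complex manifold of dimension $n$ with a Kähler form $\omega$, and let $\alpha$ be a smooth closed real $(1,1)$-form on $X$. Write $\alpha_\varphi=\alpha+\sqrt{-1}\,\partial\bar\partial\varphi$ for $\varphi\in C^\infty(X,\mathbb R)$. Assume $\int_X(\omega+\sqrt{-1}\alpha)^n\neq 0$ and let $\hat\theta$ be an angle with $\int_X(\omega+\sqrt{-1}\alpha)^n\in\mathbb R_{>0}\,e^{\sqrt{-1}\hat\theta}$. Put $$\mathcal H=\{\varphi\in C^\infty(X,\mathbb R):\ \mathrm{Re}\big(e^{-\sqrt{-1}\hat\theta}(\omega+\sqrt{-1}\alpha_\varphi)^n\big)>0\}.$$ Let $CY_{\mathbb C}:C^\infty(X,\mathbb R)\to\mathbb C$ be the functional with differential $dCY_{\mathbb C}(\varphi)(\psi)=\int_X\psi\,(\omega+\sqrt{-1}\alpha_\varphi)^n$, normalized to vanish at a fixed base point $\varphi_b$, that is, $$CY_{\mathbb C}(\varphi)=\int_0^1\int_X(\varphi-\varphi_b)\,\big(\omega+\sqrt{-1}\alpha_{\varphi_b+\tau(\varphi-\varphi_b)}\big)^n\,d\tau,$$ and set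 $\mathcal J=-\mathrm{Im}(e^{-\sqrt{-1}\hat\theta}CY_{\mathbb C})$, $\mathcal C=\mathrm{Re}(e^{-\sqrt{-1}\hat\theta}CY_{\mathbb C})$. Let $\mathcal A=\{t\in\mathbb C: e^{-1}<|t|<1\}$ and $\mathcal X=X\times\mathcal A$, with projections $\pi_X,\pi_{\mathcal A}$; let $D\overline D$ be the $\partial\bar\partial$-operator of $\mathcal X$, and let $(\pi_{\mathcal A})_*$ be integration along the fibres of $\pi_{\mathcal A}$. A curve $\phi(x,s)$ of functions on $X$ is viewed as an $S^1$-invariant function on $\mathcal X$ by $s=-\log|t|$. (1) Let $\phi(\cdot,s)\in\mathcal H$, $0<s<1$, be a smooth curve. Then $\mathcal J(\phi(s))$ and $\mathcal C(\phi(s))$ are twice continuously differentiable in $s$ and, as $(1,1)$-forms on $\mathcal A$, $$\sqrt{-1}\,\partial_t\bar\partial_t\,\mathcal J(\phi)=\frac1{n+1}(\pi_{\mathcal A})_*\mathrm{Re}\Big[e^{-\sqrt{-1}\hat\theta}\big(\pi_X^*\omega+\sqrt{-1}(\pi_X^*\alpha+\sqrt{-1}D\overline D\phi)\big)^{n+1}\Big],$$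 $$\sqrt{-1}\,\partial_t\bar\partial_t\,\mathcal C(\phi)=\frac1{n+1}(\pi_{\mathcal A})_*\mathrm{Im}\Big[e^{-\sqrt{-1}\hat\theta}\big(\pi_X^*\omega+\sqrt{-1}(\pi_X^*\alpha+\sqrt{-1}D\overline D\phi)\big)^{n+1}\Big].$$ (2) For $\varepsilon\ge 0$, a smooth $\varepsilon$-geodesic is a curve $\phi(x,s)$, smooth on $X\times[0,1]$, with $\phi(\cdot,s)\in\mathcal H$ for all $s\in[0,1]$, such that on $\mathcal X$ $$\mathrm{Im}\Big[e^{-\sqrt{-1}\hat\theta}\big(\pi_X^*\omega+\varepsilon^2\sqrt{-1}\,dt\wedge d\bar t+\sqrt{-1}(\pi_X^*\alpha+\sqrt{-1}D\overline D\phi)\big)^{n+1}\Big]=0.$$ It is called non-trivial if the form $\alpha_{\phi(s)}$ is not constant in $s$. For every $\varepsilon\ge0$ and every smooth $\varepsilon$-geodesic $\phi$, the function $s\mapsto\mathcal J(\phi(s))$ is convex on $[0,1]$, and it is strictly convex on $[0,1]$ if $\phi$ is non-trivial; the function $s\mapsto\mathcal C(\phi(s))$ is affine on $[0,1]$. -/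

import Mathlib

open Set MeasureTheory
open scoped Manifold ContDiff

namespace DHYM

/-- The model space `ℂⁿ` of an `n`-dimensional complex manifold.  Throughout, the tangent space at a
point `x` of a manifold is the model vector space, identified through the preferred chart at `x`
(Mathlib's convention for `TangentSpace`). -/
abbrev Cn (n : ℕ) : Type := Fin n → ℂ

/-! ### Linear algebra of forms -/

/-- The `m`-th wedge power `η ∧ ⋯ ∧ η` of a complex valued 2-form `η` on a real vector space `V`,
evaluated on `2m` vectors, which are indexed by `Fin m × Fin 2` (in lexicographic order):
`2⁻ᵐ ∑_σ sign σ ∏ⱼ η (v_{σ(j,0)}, v_{σ(j,1)})`, so that `(a ∧ b)(u,v) = a u * b v - a v * b u` for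
1-forms. -/
noncomputable def wedgePow {V : Type*} (η : V → V → ℂ) (m : ℕ) (v : Fin m × Fin 2 → V) : ℂ :=
  ((2 : ℂ) ^ m)⁻¹ * ∑ σ : Equiv.Perm (Fin m × Fin 2),
    ((Equiv.Perm.sign σ : ℤ) : ℂ) * ∏ j : Fin m, η (v (σ (j, 0))) (v (σ (j, 1)))

/-- The positively oriented real frame `e₁, i e₁, …, eₙ, i eₙ` of `ℂⁿ`. -/
noncomputable def stdFrame (n : ℕ) (p : Fin n × Fin 2) : Cn n :=
  Pi.single p.1 (if p.2 = 0 then 1 else Complex.I)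

/-- The real `(1,1)`-form `√-1 dt ∧ dt̄` on `ℂ`, i.e. `(u, v) ↦ √-1 (u v̄ - v ū)`. -/
noncomputable def idtdtbar (u v : ℂ) : ℝ := -2 * (u * (starRingEnd ℂ) v).im

/-- The real `(1,1)`-form `√-1 ∂∂̄ f` of a real function `f` on a complex manifold `M`, at the point
`x` and on the tangent vectors `u, v`.  In a holomorphic chart let `H` be the real Hessian of `f`.
From `∂̄f (v) = (df v + √-1 df (i v)) / 2` and `√-1 ∂∂̄f = √-1 d(∂̄f)` one gets
`√-1 ∂∂̄f (u, v) = (H (i u, v) - H (u, i v)) / 2`, which in coordinates is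
`√-1 ∑ f_{j k̄} (u_j v̄_k - v_j ū_k)`. -/
noncomputable def iddbar {E H M : Type*} [NormedAddCommGroup E] [NormedSpace ℝ E] [NormedSpace ℂ E]
    [TopologicalSpace H] [TopologicalSpace M] [ChartedSpace H M]
    (I : ModelWithCorners ℝ E H) (f : M → ℝ) (x : M) (u v : E) : ℝ :=
  let hess := fderiv ℝ (fderiv ℝ (f ∘ (extChartAt I x).symm)) (extChartAt I x x)
  (hess (Complex.I • u) v - hess u (Complex.I • v)) / 2

section Manifold

variable {n : ℕ} {X : Type*} [TopologicalSpace X] [ChartedSpace (Cn n) X]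

/-! ### Forms on a complex manifold -/

/-- The differential at `y` of the inverse of the chart `e`, as a map from `ℂⁿ` to the tangent
space at `e.symm y`. -/
noncomputable def dChartSymm (e : OpenPartialHomeomorph X (Cn n)) (y : Cn n) : Cn n →L[ℝ] Cn n :=
  mfderiv 𝓘(ℝ, Cn n) 𝓘(ℝ, Cn n) e.symm y

/-- The expression in the chart `e` of a real 2-form on `X`, i.e. its pull-back under `e.symm`. -/
noncomputable def pullbackTwoForm (η : X → (Cn n) [⋀^Fin 2]→L[ℝ] ℝ)
    (e : OpenPartialHomeomorph X (Cn n)) (y : Cn n) : (Cn n) [⋀^Fin 2]→L[ℝ] ℝ :=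
  (η (e.symm y)).compContinuousLinearMap (dChartSymm e y)

variable (n X) in
/-- A smooth closed real `(1,1)`-form on the complex manifold `X`. -/
structure ClosedRealForm11 where
  toForm : X → (Cn n) [⋀^Fin 2]→L[ℝ] ℝ
  smooth : ∀ p : X, ContDiffOn ℝ ∞ (pullbackTwoForm toForm (chartAt (Cn n) p))
    (chartAt (Cn n) p).target
  type11 : ∀ (x : X) (u v : Cn n),
    toForm x ![Complex.I • u, Complex.I • v] = toForm x ![u, v]
  closed : ∀ p : X, ∀ y ∈ (chartAt (Cn n) p).target,
    extDeriv (pullbackTwoForm toForm (chartAt (Cn n) p)) y = 0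

variable (n X) in
/-- A Kähler form: a closed real `(1,1)`-form `ω` with `ω (u, i u) > 0` for all `u ≠ 0`. -/
structure KahlerForm extends ClosedRealForm11 n X where
  pos : ∀ (x : X) (u : Cn n), u ≠ 0 → 0 < toForm x ![u, Complex.I • u]

/-! ### Integration of top degree forms -/

variable (n X) in
theorem exists_finite_chart_cover [CompactSpace X] :
    ∃ k : ℕ, ∃ p : Fin k → X, ⋃ i, (chartAt (Cn n) (p i)).source = univ := by
  obtain ⟨t, ht⟩ := isCompact_univ.elim_finite_subcover
    (fun x : X => (chartAt (Cn n) x).source) (fun x => (chartAt (Cn n) x).open_source)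
    (fun x _ => mem_iUnion.2 ⟨x, mem_chart_source (Cn n) x⟩)
  refine ⟨t.card, fun i => (t.equivFin.symm i : X), eq_univ_of_forall fun x => ?_⟩
  obtain ⟨y, hy, hxy⟩ := mem_iUnion₂.1 (ht (mem_univ x))
  exact mem_iUnion.2 ⟨t.equivFin ⟨y, hy⟩, by simpa using hxy⟩

variable (n X) in
/-- The number of charts in a finite cover of `X` by charts. -/
noncomputable def coverCard [CompactSpace X] : ℕ := (exists_finite_chart_cover n X).choose

variable (n X) in
/-- The centres of the charts in a finite cover of `X` by charts. -/
noncomputable def coverPt [CompactSpace X] : Fin (coverCard n X) → X :=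
  (exists_finite_chart_cover n X).choose_spec.choose

variable (n X) in
/-- The pieces of the partition of `X` obtained by making the chart cover disjoint. -/
noncomputable def coverPiece [CompactSpace X] (i : Fin (coverCard n X)) : Set X :=
  (chartAt (Cn n) (coverPt n X i)).source \
    ⋃ j : Fin (coverCard n X), ⋃ _ : j < i, (chartAt (Cn n) (coverPt n X j)).source

/-- The integral `∫_X η` of a top degree form `η` on the compact complex manifold `X`, with its
complex orientation.  `X` is partitioned into finitely many pieces, each in the domain of a chart,
and on each piece the coefficient of `η` in that chart is integrated against Lebesgue measure (the
result does not depend on the partition, by the change of variables formula). -/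
noncomputable def integralX [CompactSpace X] {F : Type*} [NormedAddCommGroup F] [NormedSpace ℝ F]
    (η : X → (Fin n × Fin 2 → Cn n) → F) : F :=
  ∑ i : Fin (coverCard n X),
    ∫ y in (chartAt (Cn n) (coverPt n X i)) '' coverPiece n X i,
      η ((chartAt (Cn n) (coverPt n X i)).symm y)
        (fun p => dChartSymm (chartAt (Cn n) (coverPt n X i)) y (stdFrame n p))

/-! ### The complexified forms and the space `𝓗` -/

/-- `α_φ = α + √-1 ∂∂̄ φ`. -/
noncomputable def alphaPhi (α : ClosedRealForm11 n X) (φ : X → ℝ) (x : X) (u v : Cn n) : ℝ :=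
  α.toForm x ![u, v] + iddbar 𝓘(ℝ, Cn n) φ x u v

/-- The top degree form `(ω + √-1 α_φ)ⁿ` on `X`. -/
noncomputable def topForm (ω₀ : KahlerForm n X) (α : ClosedRealForm11 n X) (φ : X → ℝ)
    (x : X) (w : Fin n × Fin 2 → Cn n) : ℂ :=
  wedgePow (fun u v => (ω₀.toForm x ![u, v] : ℂ) + Complex.I * (alphaPhi α φ x u v : ℂ)) n w

/-- The number `e^{-√-1 θ}`. -/
noncomputable def phase (θ : ℝ) : ℂ := Complex.exp (-(Complex.I * (θ : ℂ)))

/-- `θ` is an angle `θ̂` of the classes `[ω], [α]`: `∫_X (ω + √-1 α)ⁿ ∈ ℝ_{>0} e^{√-1 θ}`. -/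
def IsPhaseAngle [CompactSpace X] (ω₀ : KahlerForm n X) (α : ClosedRealForm11 n X) (θ : ℝ) : Prop :=
  ∃ r : ℝ, 0 < r ∧
    integralX (fun (x : X) (w : Fin n × Fin 2 → Cn n) =>
      wedgePow (fun u v => (ω₀.toForm x ![u, v] : ℂ) + Complex.I * (α.toForm x ![u, v] : ℂ)) n w)
      = (r : ℂ) * Complex.exp (Complex.I * (θ : ℂ))

/-- The space `𝓗` of smooth `φ : X → ℝ` with `Re (e^{-√-1 θ} (ω + √-1 α_φ)ⁿ) > 0`. -/
def spaceH (ω₀ : KahlerForm n X) (α : ClosedRealForm11 n X) (θ : ℝ) : Set (X → ℝ) :=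
  {φ | ContMDiff 𝓘(ℝ, Cn n) 𝓘(ℝ, ℝ) ∞ φ ∧
    ∀ x : X, 0 < (phase θ * topForm ω₀ α φ x (stdFrame n)).re}

/-! ### The functionals -/

/-- The complexified Calabi-Yau functional, normalized to vanish at the base point `φb`: the
integral of its differential `ψ ↦ ∫_X ψ (ω + √-1 α_φ)ⁿ` along the segment from `φb` to `φ`. -/
noncomputable def CY [CompactSpace X] (ω₀ : KahlerForm n X) (α : ClosedRealForm11 n X)
    (φb φ : X → ℝ) : ℂ :=
  ∫ τ in (0 : ℝ)..1, integralX (fun (x : X) (w : Fin n × Fin 2 → Cn n) =>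
    ((φ x - φb x : ℝ) : ℂ) * topForm ω₀ α (fun y => φb y + τ * (φ y - φb y)) x w)

/-- `𝒥 = - Im (e^{-√-1 θ} CY)`. -/
noncomputable def funcJ [CompactSpace X] (ω₀ : KahlerForm n X) (α : ClosedRealForm11 n X) (θ : ℝ)
    (φb φ : X → ℝ) : ℝ :=
  -(phase θ * CY ω₀ α φb φ).im

/-- `𝒞 = Re (e^{-√-1 θ} CY)`. -/
noncomputable def funcC [CompactSpace X] (ω₀ : KahlerForm n X) (α : ClosedRealForm11 n X) (θ : ℝ)
    (φb φ : X → ℝ) : ℝ :=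
  (phase θ * CY ω₀ α φb φ).re

/-! ### Curves, the product with the annulus, and `ε`-geodesics

A curve of functions is `φ : ℝ → X → ℝ`, `s ↦ φ s`, considered for `0 ≤ s ≤ 1`. -/

/-- The annulus `{e⁻¹ < |t| < 1}` in `ℂ`. -/
def annulus : Set ℂ := {t | Real.exp (-1) < ‖t‖ ∧ ‖t‖ < 1}

/-- The `S¹`-invariant function `(x, t) ↦ φ (x, s)`, `s = - log |t|`. -/
noncomputable def lift (φ : ℝ → X → ℝ) (q : X × ℂ) : ℝ := φ (-Real.log ‖q.2‖) q.1

/-- The complex 2-form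
`π_X^* ω + ε² √-1 dt ∧ dt̄ + √-1 (π_X^* α + √-1 D D̄ φ)` on `X × ℂ`, where `φ` is viewed as an
`S¹`-invariant function and `D D̄` is the `∂∂̄`-operator of the product. -/
noncomputable def spaceTimeForm (ω₀ : KahlerForm n X) (α : ClosedRealForm11 n X) (ε : ℝ)
    (φ : ℝ → X → ℝ) (q : X × ℂ) (a b : Cn n × ℂ) : ℂ :=
  ((ω₀.toForm q.1 ![a.1, b.1] + ε ^ 2 * idtdtbar a.2 b.2 : ℝ) : ℂ) +
    Complex.I *
      ((α.toForm q.1 ![a.1, b.1] +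
        iddbar (𝓘(ℝ, Cn n).prod 𝓘(ℝ, ℂ)) (lift φ) q a b : ℝ) : ℂ)

/-- Integration along the fibres of `π_𝒜 : X × ℂ → ℂ` of a form `η` of degree `2n + 2`: the
2-form on `ℂ` with value `∫_X η (⋯, u, v)` at `t` on `u, v`. -/
noncomputable def fibreIntegral [CompactSpace X] (η : X × ℂ → (Fin (n + 1) × Fin 2 → Cn n × ℂ) → ℝ)
    (t : ℂ) (u v : ℂ) : ℝ :=
  integralX (fun (x : X) (w : Fin n × Fin 2 → Cn n) =>
    η (x, t) (fun p => Fin.lastCases (motive := fun _ => Cn n × ℂ)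
      ((0 : Cn n), ![u, v] p.2) (fun j => (w (j, p.2), (0 : ℂ))) p.1))

/-- A smooth curve in `𝓗`, parametrized by `0 < s < 1`. -/
structure IsSmoothCurve (ω₀ : KahlerForm n X) (α : ClosedRealForm11 n X) (θ : ℝ)
    (φ : ℝ → X → ℝ) : Prop where
  smooth : ContMDiffOn (𝓘(ℝ, Cn n).prod 𝓘(ℝ, ℝ)) 𝓘(ℝ, ℝ) ∞
    (fun q : X × ℝ => φ q.2 q.1) (univ ×ˢ Ioo (0 : ℝ) 1)
  mem : ∀ s ∈ Ioo (0 : ℝ) 1, φ s ∈ spaceH ω₀ α θ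

/-- A smooth (up to the boundary) `ε`-regularized geodesic in `𝓗` joining `φ 0` and `φ 1`:
`Im (e^{-√-1 θ} (π_X^* ω + ε² √-1 dt ∧ dt̄ + √-1 (π_X^* α + √-1 D D̄ φ))ⁿ⁺¹) = 0` on the product of
`X` with the annulus.  For `ε = 0` these are the smooth geodesics. -/
structure IsEpsGeodesic (ω₀ : KahlerForm n X) (α : ClosedRealForm11 n X) (θ ε : ℝ)
    (φ : ℝ → X → ℝ) : Prop where
  smooth : ContMDiffOn (𝓘(ℝ, Cn n).prod 𝓘(ℝ, ℝ)) 𝓘(ℝ, ℝ) ∞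
    (fun q : X × ℝ => φ q.2 q.1) (univ ×ˢ Icc (0 : ℝ) 1)
  mem : ∀ s ∈ Icc (0 : ℝ) 1, φ s ∈ spaceH ω₀ α θ
  eqn : ∀ (x : X), ∀ t ∈ annulus, ∀ v : Fin (n + 1) × Fin 2 → Cn n × ℂ,
    (phase θ * wedgePow (spaceTimeForm ω₀ α ε φ (x, t)) (n + 1) v).im = 0

/-- The curve `φ` is non-trivial: the form `α_{φ(s)}` is not constant in `s`. -/
def IsNontrivial (α : ClosedRealForm11 n X) (φ : ℝ → X → ℝ) : Prop :=
  ∃ s ∈ Icc (0 : ℝ) 1, alphaPhi α (φ s) ≠ alphaPhi α (φ 0)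

end Manifold

end DHYM

/-! In local coordinates a form of type (1,1) is a matrix. Let `W` be the matrix of `ω`, `A` that of
`α_φ`, and `h = W + iA`. Since `W > 0` and `A` is Hermitian, `h` is invertible and `Re h⁻¹ > 0`. The
wedge power is a determinant (`wedgePow_eq_det`), so `e^{-iθ}(ω + iα_φ)ⁿ = D ωⁿ` with `D = e^{-iθ}
det h / det W` (`ratio`). The linearization of `D` in a direction `f` is `i L f` with `L f = e^{-iθ}
tr(adj(h) f_{jk̄}) / det W` (`lin`). Because `ω + iα_φ` is closed, `adj(h)` is divergence free
(`piola`), hence `L` is symmetric for the measure `ωⁿ` (`green`).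

The Hessian of the functionals: symmetry of `L` gives `d/ds (e^{-iθ} CY) = ∫ φ̇ D`, and
differentiating again gives `∫ (φ̈ D + i φ̇ Lφ̇)`. With the carré du champ `Γ(f,g) = L(fg) - f Lg -
g Lf` (`gam`) and `∫ Γ(f,f) = -2 ∫ f Lf`, this equals `-i ∫ (i φ̈ D + Γ(φ̇,φ̇)/2)`. On the product
with the annulus a Schur complement shows that the top power of the form has the same density, up to
the factor `(n+1) √-1 dt ∧ dt̄ / (4|t|²)` (`phase_mul_wedgePow_spaceTimeForm`). Real and imaginary
parts give the two formulas.

Convexity: the geodesic equation reads `φ̈ Re D + Im Γ/2 + E Im D = 0` with `E = 4ε²e^{-2s}`. Put `ρ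
= Im D / Re D` (`slope`). Eliminating `φ̈` gives `𝒥'' = Y + Z` with `Y = ∫ E ρ² Re D` and `Z = ½ ∫
(Re Γ + ρ Im Γ)`. As `Γ(f,f) = 2 D h⁻¹(∂f,∂f)`, the integrand of `Z` is `|D|²/Re D` times the real
part of `h⁻¹(∂φ̇,∂φ̇)`, so it is nonnegative and vanishes only where `dφ̇ = 0`. Similarly `𝒞'' = -E
∫ Im D`, which is zero because `∫ D` is independent of `φ` and real by the choice of `θ`.

Strict convexity: it is shown that `𝒥'' > 0` at every interior time. If `𝒥''(s₀) = 0`, then `φ̇(s₀)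
= c` is locally constant and `E ρ² Re D = 0` at `s₀`. Subtracting `s c` gives another solution,
whose velocity vanishes at `s₀`. A unique continuation argument then shows that its velocity
vanishes always: with `a = ∫ φ̇² Re D` and `p = 𝒥'` one has `a' = 2Ep`, `p' = Y + Z`, `E p² ≤ a Y`
(Cauchy-Schwarz) and `|(Y - Z)'| ≤ C (Y + Z)`. The last estimate is the delicate one
(`hasDerivAt_gap`, `abs_gapDot_le`): in the difference, unlike in the sum, the terms with
uncontrolled second derivatives of `φ̇` cancel after integration by parts. The inequalities force `a
= 0` (`eq_zero_of_differential_inequality`, through an almost monotone quotient `p / a`). Hence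
`φ(s) = φ(0) + s c` and `α_φ` is constant. -/

namespace DHYM

/-! ### Wedge powers as determinants -/

section WedgePow

variable {V : Type*} {m : ℕ}

/-- The antisymmetrization of the factors of a wedge power is absorbed by the sum over
permutations. -/
theorem sum_perm_prod_antisymm (f : V → V → ℂ) (v : Fin m × Fin 2 → V) :
    ∑ σ : Equiv.Perm (Fin m × Fin 2), ((Equiv.Perm.sign σ : ℤ) : ℂ) *
        ∏ j : Fin m, (f (v (σ (j, 0))) (v (σ (j, 1))) - f (v (σ (j, 1))) (v (σ (j, 0)))) =
      2 ^ m * ∑ σ : Equiv.Perm (Fin m × Fin 2), ((Equiv.Perm.sign σ : ℤ) : ℂ) *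
        ∏ j : Fin m, f (v (σ (j, 0))) (v (σ (j, 1))) := by
  have h1 : ∀ (σ : Equiv.Perm (Fin m × Fin 2)) (j : Fin m),
      f (v (σ (j, 0))) (v (σ (j, 1))) - f (v (σ (j, 1))) (v (σ (j, 0))) =
        ∑ ρ : Equiv.Perm (Fin 2), ((Equiv.Perm.sign ρ : ℤ) : ℂ) *
          f (v (σ (j, ρ 0))) (v (σ (j, ρ 1))) := by
    intro σ j
    rw [show (Finset.univ : Finset (Equiv.Perm (Fin 2))) = {1, Equiv.swap 0 1} by decide,
      Finset.sum_pair (by decide)]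
    simp [sub_eq_add_neg]
  simp_rw [h1, Finset.prod_univ_sum, Finset.mul_sum]
  rw [Finset.sum_comm]
  have h2 : ∀ ρ : Fin m → Equiv.Perm (Fin 2),
      ∑ σ : Equiv.Perm (Fin m × Fin 2), ((Equiv.Perm.sign σ : ℤ) : ℂ) *
        ∏ j, (((Equiv.Perm.sign (ρ j) : ℤ) : ℂ) * f (v (σ (j, ρ j 0))) (v (σ (j, ρ j 1)))) =
      ∑ σ : Equiv.Perm (Fin m × Fin 2), ((Equiv.Perm.sign σ : ℤ) : ℂ) *
        ∏ j : Fin m, f (v (σ (j, 0))) (v (σ (j, 1))) := by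
    intro ρ
    -- Under `σ ↦ σ ∘ ρ`, with `ρ j` acting inside the `j`-th pair, the sign of `σ` changes by
    -- exactly the product of the signs of the `ρ j`.
    refine Fintype.sum_equiv (Equiv.mulRight (Equiv.prodCongrRight ρ)) _ _ fun σ => ?_
    simp only [Equiv.coe_mulRight, Equiv.Perm.sign_mul, Equiv.Perm.coe_mul, Function.comp_apply,
      Equiv.prodCongrRight_apply, Finset.prod_mul_distrib, Equiv.Perm.sign_prodCongrRight]
    push_cast
    ring
  rw [Finset.sum_congr rfl fun ρ _ => h2 ρ, Finset.sum_const, ← Finset.mul_sum]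
  simp [Fintype.card_perm]

/-- The wedge power of `∑ k, a k ∧ b k` is a determinant. -/
theorem wedgePow_sum (a b : Fin m → V → ℂ) (v : Fin m × Fin 2 → V) :
    wedgePow (fun u w => ∑ k, (a k u * b k w - a k w * b k u)) m v =
      (m.factorial : ℂ) * Matrix.det (Matrix.of fun p q : Fin m × Fin 2 =>
        if p.2 = 0 then a p.1 (v q) else b p.1 (v q)) := by
  set N : Matrix (Fin m × Fin 2) (Fin m × Fin 2) ℂ := Matrix.of fun q p : Fin m × Fin 2 =>
    if p.2 = 0 then a p.1 (v q) else b p.1 (v q) with hN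
  have hNt : (Matrix.of fun p q : Fin m × Fin 2 =>
      if p.2 = 0 then a p.1 (v q) else b p.1 (v q)) = N.transpose := rfl
  rw [hNt, Matrix.det_transpose, wedgePow]
  have h0 := sum_perm_prod_antisymm (fun u w => ∑ k, a k u * b k w) v
  simp only [← Finset.sum_sub_distrib] at h0
  rw [h0, inv_mul_cancel_left₀ (pow_ne_zero _ two_ne_zero)]
  simp_rw [Finset.prod_univ_sum, Finset.mul_sum]
  rw [Finset.sum_comm]
  have h1 : ∀ κ : Fin m → Fin m, ∑ σ : Equiv.Perm (Fin m × Fin 2),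
      ((Equiv.Perm.sign σ : ℤ) : ℂ) * ∏ j, (a (κ j) (v (σ (j, 0))) * b (κ j) (v (σ (j, 1)))) =
      (N.submatrix id fun p => (κ p.1, p.2)).det := by
    intro κ
    rw [Matrix.det_apply']
    refine Finset.sum_congr rfl fun σ _ => ?_
    rw [Fintype.prod_prod_type]
    simp [hN]
  rw [Fintype.piFinset_univ, Finset.sum_congr rfl fun κ _ => h1 κ]
  -- If `κ` is not injective two columns coincide. If it is bijective, it permutes the columns in
  -- pairs, which is an even permutation; there are `m!` such `κ`.
  have h2 : ∀ κ : Fin m → Fin m, (N.submatrix id fun p => (κ p.1, p.2)).det =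
      if Function.Bijective κ then N.det else 0 := by
    intro κ
    split_ifs with hκ
    · have := Matrix.det_permute' (Equiv.prodCongrLeft fun _ : Fin 2 => Equiv.ofBijective κ hκ) N
      rw [Equiv.Perm.sign_prodCongrLeft] at this
      simp only [Finset.prod_const, Finset.card_univ, Fintype.card_fin, Int.units_sq] at this
      rw [Units.val_one, Int.cast_one, one_mul] at this
      exact this
    · rw [← Finite.injective_iff_bijective] at hκ
      simp only [Function.Injective, not_forall] at hκ
      obtain ⟨i, j, hij, hne⟩ := hκ
      exact Matrix.det_zero_of_column_eq (i := (i, 0)) (j := (j, 0)) (by simpa using hne)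
        (fun q => by simp [hij])
  rw [Finset.sum_congr rfl fun κ _ => h2 κ, ← Finset.sum_filter, Finset.sum_const, nsmul_eq_mul]
  congr 2
  rw [← Fintype.card_fin m, ← Fintype.card_perm, ← Fintype.card_subtype, Fintype.card_fin]
  exact Fintype.card_congr
    { toFun := fun κ => Equiv.ofBijective κ.1 κ.2
      invFun := fun σ => ⟨σ, σ.bijective⟩
      left_inv := fun κ => rfl
      right_inv := fun σ => by ext; rfl }

end WedgePow

/-! ### Forms of type `(1,1)` -/

section Form11

variable {V : Type*} [AddCommGroup V] [Module ℂ V]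

/-- A complex valued real-bilinear alternating form of type `(1,1)`. -/
structure IsForm11 (η : V → V → ℂ) : Prop where
  add_left : ∀ u v w, η (u + v) w = η u w + η v w
  smul_left : ∀ (r : ℝ) u w, η ((r : ℂ) • u) w = r * η u w
  swap : ∀ u w, η w u = -η u w
  type11 : ∀ u w, η (Complex.I • u) (Complex.I • w) = η u w

/-- The sesquilinear form `M` such that `η (u, v) = √-1 (M (u, v) - M (v, u))`. -/
noncomputable def sesq (η : V → V → ℂ) (u v : V) : ℂ :=
  (η u (Complex.I • v) - Complex.I * η u v) / 2

/-- The matrix of `sesq η` on a family of vectors. -/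
noncomputable def sesqMat {ι : Type*} (b : ι → V) (η : V → V → ℂ) : Matrix ι ι ℂ :=
  Matrix.of fun j k => sesq η (b j) (b k)

namespace IsForm11

variable {η : V → V → ℂ} (h : IsForm11 η)
include h

theorem I_left (u w : V) : η (Complex.I • u) w = -η u (Complex.I • w) := by
  have h1 := h.smul_left (-1) w (Complex.I • u)
  rw [Complex.ofReal_neg, Complex.ofReal_one, neg_one_smul] at h1
  rw [← h.type11 u (Complex.I • w), smul_smul, Complex.I_mul_I, neg_one_smul,
    h.swap (-w) (Complex.I • u), h1, h.swap w]
  ring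

theorem sesq_add_left (u v w : V) : sesq η (u + v) w = sesq η u w + sesq η v w := by
  simp only [sesq, h.add_left]; ring

theorem add_right (u v w : V) : η u (v + w) = η u v + η u w := by
  rw [h.swap (v + w), h.add_left, h.swap v, h.swap w]; ring

theorem smul_right (r : ℝ) (u w : V) : η u ((r : ℂ) • w) = r * η u w := by
  rw [h.swap _ u, h.smul_left, h.swap _ u]; ring

theorem sesq_smul_left (c : ℂ) (u w : V) : sesq η (c • u) w = c * sesq η u w := by
  have hc : c • u = (c.re : ℂ) • u + (c.im : ℂ) • (Complex.I • u) := by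
    rw [smul_smul, ← add_smul, Complex.re_add_im]
  have hI : sesq η (Complex.I • u) w = Complex.I * sesq η u w := by
    simp only [sesq, h.type11, h.I_left]
    linear_combination ((1 / 2) * η u w) * Complex.I_mul_I
  have hr : ∀ (r : ℝ) (u : V), sesq η ((r : ℂ) • u) w = r * sesq η u w := by
    intro r u; simp only [sesq, h.smul_left]; ring
  rw [hc, h.sesq_add_left, hr, hr, hI]
  conv_rhs => rw [← Complex.re_add_im c]
  ring

theorem sesq_add_right (u v w : V) : sesq η u (v + w) = sesq η u v + sesq η u w := by
  simp only [sesq, smul_add, h.add_right]; ring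

theorem sesq_smul_right (c : ℂ) (u w : V) :
    sesq η u (c • w) = (starRingEnd ℂ) c * sesq η u w := by
  have hc : c • w = (c.re : ℂ) • w + (c.im : ℂ) • (Complex.I • w) := by
    rw [smul_smul, ← add_smul, Complex.re_add_im]
  have hI : sesq η u (Complex.I • w) = -Complex.I * sesq η u w := by
    have h1 : η u (Complex.I • Complex.I • w) = -η u w := by
      rw [smul_smul, Complex.I_mul_I]
      simpa using h.smul_right (-1) u w
    simp only [sesq, h1]
    linear_combination (-(1 / 2) * η u w) * Complex.I_mul_I
  have hr : ∀ (r : ℝ) (w : V), sesq η u ((r : ℂ) • w) = r * sesq η u w := by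
    intro r w; rw [sesq, smul_comm, h.smul_right, h.smul_right, sesq]; ring
  rw [hc, h.sesq_add_right, hr, hr, hI]
  conv_rhs => rw [← Complex.re_add_im c]
  simp only [map_add, map_mul, Complex.conj_ofReal, Complex.conj_I]
  ring

theorem eq_sesq (u w : V) : η u w = Complex.I * (sesq η u w - sesq η w u) := by
  simp only [sesq]
  rw [h.swap (Complex.I • u) w, h.I_left, h.swap u w]
  linear_combination (η u w) * Complex.I_mul_I

theorem sesq_sum {ι κ : Type*} (s : Finset ι) (t : Finset κ) (x : ι → ℂ) (y : κ → ℂ)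
    (b : ι → V) (b' : κ → V) :
    sesq η (∑ i ∈ s, x i • b i) (∑ j ∈ t, y j • b' j) =
      ∑ i ∈ s, ∑ j ∈ t, x i * sesq η (b i) (b' j) * (starRingEnd ℂ) (y j) := by
  let A : V →+ (V →+ ℂ) := AddMonoidHom.mk' (fun u => AddMonoidHom.mk' (sesq η u)
    (h.sesq_add_right u)) fun u v => by ext w; exact h.sesq_add_left u v w
  change A _ _ = _
  rw [map_sum A, AddMonoidHom.finsetSum_apply]
  refine Finset.sum_congr rfl fun i _ => ?_
  rw [map_sum]
  refine Finset.sum_congr rfl fun j _ => ?_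
  change sesq η _ _ = _
  rw [h.sesq_smul_left, h.sesq_smul_right]; ring

end IsForm11

/-- The matrix of the coordinates and their conjugates. -/
def coordMat {m : ℕ} (z : V → Fin m → ℂ) (v : Fin m × Fin 2 → V) :
    Matrix (Fin m × Fin 2) (Fin m × Fin 2) ℂ :=
  Matrix.of fun p q => if p.2 = 0 then z (v q) p.1 else (starRingEnd ℂ) (z (v q) p.1)

/-- In coordinates `η = ∑ z_k ∧ β_k` with `β_k = √-1 ∑ M_{kl} z̄_l`, so `wedgePow_sum` applies and
the matrix factors as `diag(1, √-1 M)` times the coordinate matrix. The form enters only through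
`det M`, the vectors only through `coordMat`. -/
theorem wedgePow_eq_det {m : ℕ} {η : V → V → ℂ} (h : IsForm11 η) (b : Fin m → V)
    (z : V → Fin m → ℂ) (hz : ∀ u, u = ∑ k, z u k • b k) (v : Fin m × Fin 2 → V) :
    wedgePow η m v =
      m.factorial * Complex.I ^ m * (sesqMat b η).det * (coordMat z v).det := by
  have h1 : η = fun u w => ∑ k, (z u k * (∑ l, Complex.I * sesqMat b η k l *
        (starRingEnd ℂ) (z w l)) -
      z w k * (∑ l, Complex.I * sesqMat b η k l * (starRingEnd ℂ) (z u l))) := by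
    funext u w
    rw [h.eq_sesq]
    conv_lhs => rw [hz u, hz w]
    rw [h.sesq_sum, h.sesq_sum, ← Finset.sum_sub_distrib, Finset.mul_sum]
    refine Finset.sum_congr rfl fun k _ => ?_
    rw [mul_sub, Finset.mul_sum, Finset.mul_sum, Finset.mul_sum, Finset.mul_sum]
    congr 1 <;>
    · refine Finset.sum_congr rfl fun l _ => ?_
      simp only [sesqMat, Matrix.of_apply]; ring
  conv_lhs => rw [h1]
  rw [wedgePow_sum]
  have h2 : (Matrix.of fun p q : Fin m × Fin 2 => if p.2 = 0 then z (v q) p.1 else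
      ∑ l, Complex.I * sesqMat b η p.1 l * (starRingEnd ℂ) (z (v q) l)) =
      Matrix.blockDiagonal (fun i : Fin 2 => if i = 0 then 1 else Complex.I • sesqMat b η) *
        coordMat z v := by
    ext ⟨j, i⟩ q
    fin_cases i <;>
    simp [Matrix.mul_apply, Fintype.sum_prod_type, Matrix.blockDiagonal_apply, coordMat,
      Matrix.one_apply]
  rw [h2, Matrix.det_mul, Matrix.det_blockDiagonal, Fin.prod_univ_two]
  simp
  ring

end Form11

/-! ### Frames -/

/-- The coordinate matrix is the Kronecker product of the identity with a 2×2 matrix of determinant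
`-2√-1`. -/
theorem det_coordMat_stdFrame (n : ℕ) :
    Complex.I ^ n * (coordMat (fun u : Cn n => u) (stdFrame n)).det = 2 ^ n := by
  have : coordMat (fun u : Cn n => u) (stdFrame n) =
      Matrix.kroneckerMap (· * ·) (1 : Matrix (Fin n) (Fin n) ℂ)
        !![1, Complex.I; 1, -Complex.I] := by
    ext ⟨j, i⟩ ⟨k, l⟩
    fin_cases i <;> fin_cases l <;> by_cases hjk : j = k <;>
      simp [coordMat, stdFrame, hjk, Matrix.kroneckerMap_apply]
  rw [this, Matrix.det_kronecker, Matrix.det_one, Matrix.det_fin_two_of]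
  simp only [one_pow, Fintype.card_fin, one_mul, ← mul_pow]
  congr 1
  linear_combination (-2) * Complex.I_mul_I

/-- On coordinates and their conjugates `T` acts as `diag(T, T̄)`, whose determinant is `|det T|²`.
-/
theorem det_coordMat_linear {n : ℕ} (T : Cn n →ₗ[ℂ] Cn n) (w : Fin n × Fin 2 → Cn n) :
    (coordMat (fun u : Cn n => u) (fun p => T (w p))).det =
      (Complex.normSq T.toMatrix'.det : ℂ) * (coordMat (fun u : Cn n => u) w).det := by
  have : coordMat (fun u : Cn n => u) (fun p => T (w p)) =
      Matrix.blockDiagonal (fun i : Fin 2 => if i = 0 then T.toMatrix' else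
        T.toMatrix'.map (starRingEnd ℂ)) * coordMat (fun u : Cn n => u) w := by
    ext ⟨j, i⟩ q
    have h1 : T (w q) j = ∑ k, T.toMatrix' j k * w q k := by
      rw [← LinearMap.toMatrix'_mulVec T]; rfl
    fin_cases i <;>
    simp [Matrix.mul_apply, Fintype.sum_prod_type, Matrix.blockDiagonal_apply, coordMat, h1]
  rw [this, Matrix.det_mul, Matrix.det_blockDiagonal, Fin.prod_univ_two]
  have h2 : (T.toMatrix'.map (starRingEnd ℂ)).det = (starRingEnd ℂ) T.toMatrix'.det := by
    rw [RingHom.map_det]; rfl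
  simp [h2, Complex.mul_conj]

/-- For vectors that are horizontal in the first `n` pairs and vertical in the last one, the
coordinate matrix is block diagonal; the vertical block has determinant `u v̄ - v ū`. -/
theorem det_coordMat_snoc {n : ℕ} (w : Fin n × Fin 2 → Cn n) (u v : ℂ) :
    Complex.I * (coordMat (fun a : Cn n × ℂ => Fin.snoc (α := fun _ => ℂ) a.1 a.2)
      (fun p : Fin (n + 1) × Fin 2 => Fin.lastCases (motive := fun _ => Cn n × ℂ)
        ((0 : Cn n), ![u, v] p.2) (fun j => (w (j, p.2), (0 : ℂ))) p.1)).det =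
      (idtdtbar u v : ℂ) * (coordMat (fun a : Cn n => a) w).det := by
  let e : (Fin n × Fin 2) ⊕ (Fin 1 × Fin 2) ≃ Fin (n + 1) × Fin 2 :=
    (Equiv.sumProdDistrib _ _ _).symm.trans (Equiv.prodCongr finSumFinEquiv (Equiv.refl _))
  have el : ∀ p, e (Sum.inl p) = (p.1.castSucc, p.2) := fun p => rfl
  have er : ∀ p, e (Sum.inr p) = (Fin.last n, p.2) := by
    rintro ⟨i, k⟩
    have : i = 0 := Subsingleton.elim _ _
    subst this; rfl
  rw [← Matrix.det_submatrix_equiv_self e]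
  have h1 : (coordMat (fun a : Cn n × ℂ => Fin.snoc (α := fun _ => ℂ) a.1 a.2)
      (fun p : Fin (n + 1) × Fin 2 => Fin.lastCases (motive := fun _ => Cn n × ℂ)
        ((0 : Cn n), ![u, v] p.2) (fun j => (w (j, p.2), (0 : ℂ))) p.1)).submatrix e e =
      Matrix.fromBlocks (coordMat (fun a : Cn n => a) w) 0 0
        ((!![u, v; (starRingEnd ℂ) u, (starRingEnd ℂ) v]).submatrix Prod.snd Prod.snd) := by
    ext p q
    rcases p with ⟨j, i⟩ | ⟨j, i⟩ <;> rcases q with ⟨k, l⟩ | ⟨k, l⟩ <;>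
      simp only [Matrix.submatrix_apply, el, er, coordMat, Matrix.of_apply, Fin.lastCases_castSucc,
        Fin.lastCases_last, Fin.snoc_castSucc, Fin.snoc_last, Matrix.fromBlocks_apply₁₁,
        Matrix.fromBlocks_apply₁₂, Matrix.fromBlocks_apply₂₁, Matrix.fromBlocks_apply₂₂] <;>
      fin_cases i <;> fin_cases l <;> simp
  have h2 : (((!![u, v; (starRingEnd ℂ) u, (starRingEnd ℂ) v] : Matrix (Fin 2) (Fin 2) ℂ)).submatrix
      (Prod.snd : Fin 1 × Fin 2 → Fin 2) Prod.snd).det =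
      u * (starRingEnd ℂ) v - v * (starRingEnd ℂ) u := by
    rw [← Matrix.det_fin_two_of]
    exact Matrix.det_submatrix_equiv_self (Equiv.uniqueProd (Fin 2) (Fin 1)) _
  rw [h1, Matrix.det_fromBlocks_zero₁₂, h2, ← mul_assoc, mul_comm Complex.I, mul_assoc, mul_comm]
  congr 1
  apply Complex.ext <;> simp [idtdtbar] <;> ring

/-! ### Determinants of complexified Hermitian matrices -/

section Matrices

variable {n : ℕ}

/-- Jacobi's formula: replacing the `i`-th column by its derivative gives, by Cramer's rule, the
`i`-th diagonal entry of `adj(h) h'`. -/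
theorem hasDerivAt_det {h : ℝ → Matrix (Fin n) (Fin n) ℂ} {h' : Matrix (Fin n) (Fin n) ℂ} {t : ℝ}
    (hh : ∀ i j, HasDerivAt (fun s => h s i j) (h' i j) t) :
    HasDerivAt (fun s => (h s).det) (((h t).adjugate * h').trace) t := by
  simp_rw [Matrix.det_apply']
  have h1 : HasDerivAt (fun s => ∑ σ : Equiv.Perm (Fin n), ((Equiv.Perm.sign σ : ℤ) : ℂ) *
      ∏ i, h s (σ i) i) (∑ σ : Equiv.Perm (Fin n), ((Equiv.Perm.sign σ : ℤ) : ℂ) *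
      ∑ i, (∏ j ∈ Finset.univ.erase i, h t (σ j) j) • h' (σ i) i) t :=
    HasDerivAt.fun_sum fun σ _ => (HasDerivAt.fun_finsetProd fun i _ => hh (σ i) i).const_mul _
  convert h1 using 1
  simp_rw [Finset.mul_sum]
  rw [Finset.sum_comm, Matrix.trace]
  refine Finset.sum_congr rfl fun i _ => ?_
  have h2 : ((h t).adjugate * h') i i = (h t).adjugate.mulVec (fun k => h' k i) i := rfl
  rw [Matrix.diag_apply, h2, ← Matrix.cramer_eq_adjugate_mulVec, Matrix.cramer_apply,
    Matrix.det_apply']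
  refine Finset.sum_congr rfl fun σ _ => ?_
  rw [← Finset.mul_prod_erase _ _ (Finset.mem_univ i), Matrix.updateCol_self, smul_eq_mul,
    mul_comm (h' _ _)]
  congr 2
  refine Finset.prod_congr rfl fun j hj => ?_
  rw [Matrix.updateCol_ne (Finset.ne_of_mem_erase hj)]

/-- The algebraic form of the Piola identity: if `a` is the adjugate of `h`, `H l` and `A l` are the
derivatives of `h` and `a` in the `l`-th direction and `H` is symmetric in its first two indices,
then `a` is divergence free. -/
theorem piola {h a : Matrix (Fin n) (Fin n) ℂ} {H A : Fin n → Matrix (Fin n) (Fin n) ℂ}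
    (hd : h.det ≠ 0) (hA : ∀ l, H l * a + h * A l = (a * H l).trace • 1)
    (hH : ∀ l p q, H l p q = H p l q) (k : Fin n) : ∑ l, A l k l = 0 := by
  -- Since `h` is invertible it is enough that `h` annihilates the divergence vector. By `hA` the
  -- image is a difference of two double sums, which agree by the symmetry `hH`.
  have h1 : h.mulVec (fun k => ∑ l, A l k l) = 0 := by
    funext m
    have h2 : ∀ l, (h * A l) m l = (if m = l then (a * H l).trace else 0) - (H l * a) m l := by
      intro l
      have := congrFun (congrFun (hA l) m) l
      simp only [Matrix.add_apply, Matrix.smul_apply, Matrix.one_apply, smul_eq_mul, mul_ite,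
        mul_one, mul_zero] at this
      rw [← this]; ring
    calc h.mulVec (fun k => ∑ l, A l k l) m = ∑ l, (h * A l) m l := by
          simp only [Matrix.mulVec, dotProduct, Matrix.mul_apply, Finset.mul_sum]
          rw [Finset.sum_comm]
      _ = 0 := by
          simp_rw [h2, Finset.sum_sub_distrib]
          rw [Finset.sum_ite_eq, if_pos (Finset.mem_univ _), sub_eq_zero, Matrix.trace]
          simp only [Matrix.diag_apply, Matrix.mul_apply]
          rw [Finset.sum_comm]
          refine Finset.sum_congr rfl fun l _ => Finset.sum_congr rfl fun q _ => ?_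
          rw [hH l m q]; ring
  exact congrFun (Matrix.eq_zero_of_mulVec_eq_zero hd h1) k

/-- A positive definite Hermitian matrix. -/
def PosHerm (W : Matrix (Fin n) (Fin n) ℂ) : Prop :=
  W.IsHermitian ∧ ∀ v : Fin n → ℂ, v ≠ 0 → 0 < (star v ⬝ᵥ W.mulVec v).re

variable {W A : Matrix (Fin n) (Fin n) ℂ}

theorem re_star_dotProduct_I_smul (hA : A.IsHermitian) (v : Fin n → ℂ) :
    (star v ⬝ᵥ (Complex.I • A).mulVec v).re = 0 := by
  have h1 := hA.im_star_dotProduct_mulVec_self v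
  rw [Matrix.smul_mulVec, dotProduct_smul, smul_eq_mul, Complex.mul_re]
  simpa using h1

/-- For a kernel vector `v` the number `v* (W + √-1 A) v` would vanish, but its real part is `v* W v
> 0`. -/
theorem det_add_I_smul_ne_zero (hW : PosHerm W) (hA : A.IsHermitian) :
    (W + Complex.I • A).det ≠ 0 := by
  intro h0
  obtain ⟨v, hv, hv0⟩ := Matrix.exists_mulVec_eq_zero_iff.2 h0
  have h1 := hW.2 v hv
  have h2 : (star v ⬝ᵥ (W + Complex.I • A).mulVec v).re = 0 := by rw [hv0]; simp
  rw [Matrix.add_mulVec, dotProduct_add, Complex.add_re, re_star_dotProduct_I_smul hA] at h2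
  linarith

/-- With `v = h u` one has `v* h⁻¹ v = conj (u* h u)`, whose real part is `u* W u`. This is the
source of the convexity of `𝒥`. -/
theorem re_inv_pos (hW : PosHerm W) (hA : A.IsHermitian) {v : Fin n → ℂ} (hv : v ≠ 0) :
    0 < (star v ⬝ᵥ (W + Complex.I • A)⁻¹.mulVec v).re := by
  set h := W + Complex.I • A with hh
  have hd : IsUnit h.det := (det_add_I_smul_ne_zero hW hA).isUnit
  set u := h⁻¹.mulVec v with hu
  have hvu : v = h.mulVec u := by rw [hu, Matrix.mulVec_mulVec, Matrix.mul_nonsing_inv _ hd,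
    Matrix.one_mulVec]
  have hu0 : u ≠ 0 := fun h0 => hv (by rw [hvu, h0, Matrix.mulVec_zero])
  have h1 : star v ⬝ᵥ u = star (star u ⬝ᵥ h.mulVec u) := by
    rw [← hvu, Matrix.star_dotProduct]
  rw [h1]
  have h2 := hW.2 u hu0
  rw [Complex.star_def, Complex.conj_re, hh, Matrix.add_mulVec, dotProduct_add, Complex.add_re,
    re_star_dotProduct_I_smul hA]
  linarith

/-- The determinant of a bordered matrix. -/
theorem det_snoc {M : Matrix (Fin (n + 1)) (Fin (n + 1)) ℂ} {h : Matrix (Fin n) (Fin n) ℂ}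
    (hM : ∀ j k, M (Fin.castSucc j) (Fin.castSucc k) = h j k) (hd : h.det ≠ 0) :
    M.det = h.det * M (Fin.last n) (Fin.last n) -
      ∑ j, ∑ k, M (Fin.last n) (Fin.castSucc k) * h.adjugate k j *
        M (Fin.castSucc j) (Fin.last n) := by
  rw [← Matrix.det_submatrix_equiv_self (finSumFinEquiv (m := n) (n := 1))]
  have h1 : M.submatrix (finSumFinEquiv (m := n) (n := 1)) (finSumFinEquiv (m := n) (n := 1)) =
      Matrix.fromBlocks h (Matrix.of fun j _ => M (Fin.castSucc j) (Fin.last n))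
        (Matrix.of fun _ k => M (Fin.last n) (Fin.castSucc k))
        (Matrix.of fun _ _ => M (Fin.last n) (Fin.last n)) := by
    ext p q
    rcases p with p | p <;> rcases q with q | q <;>
      simp [← hM, Fin.castSucc, Fin.last, Fin.natAdd]
  let _ := Matrix.invertibleOfIsUnitDet h hd.isUnit
  -- Schur complement; writing `h⁻¹ = adj(h) / det h` removes the denominator.
  rw [h1, Matrix.det_fromBlocks₁₁, Matrix.det_unique (n := Fin 1), Matrix.invOf_eq_nonsing_inv,
    Matrix.inv_def, Ring.inverse_eq_inv']
  simp only [Matrix.sub_apply, Matrix.mul_apply, Matrix.of_apply, Matrix.smul_apply, smul_eq_mul,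
    mul_sub, Finset.mul_sum, Finset.sum_mul]
  congr 1
  refine Finset.sum_congr rfl fun j _ => Finset.sum_congr rfl fun k _ => ?_
  field_simp

end Matrices

/-! ### Real forms of type `(1,1)` -/

section RealForm

variable {n : ℕ} {V : Type*} [AddCommGroup V] [Module ℂ V]

theorem sesqMat_isHermitian {ι : Type*} (b : ι → V) {η : V → V → ℝ}
    (h : IsForm11 fun u v => (η u v : ℂ)) : (sesqMat b fun u v => (η u v : ℂ)).IsHermitian := by
  refine Matrix.IsHermitian.ext fun j k => ?_
  have h1 := h.I_left (b k) (b j)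
  have h2 := h.swap (Complex.I • b k) (b j)
  have h3 := h.swap (b k) (b j)
  beta_reduce at h1 h2 h3
  change star (sesq (fun u v => (η u v : ℂ)) (b k) (b j)) =
    sesq (fun u v => (η u v : ℂ)) (b j) (b k)
  simp only [sesq, Complex.star_def, map_div₀,
    map_sub, map_mul, Complex.conj_ofReal, Complex.conj_I, map_ofNat]
  rw [h2, h1, h3]; ring

theorem sesqMat_posDef {η : Cn n → Cn n → ℝ} (h : IsForm11 fun u v => (η u v : ℂ))
    (hpos : ∀ u, u ≠ 0 → 0 < η u (Complex.I • u)) :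
    PosHerm (sesqMat (fun j => Pi.single j (1 : ℂ)) fun u v : Cn n => (η u v : ℂ)) := by
  refine ⟨sesqMat_isHermitian _ h, fun x hx => ?_⟩
  -- `sesq` is linear in its first argument, which carries the row index, so the quadratic form of
  -- the matrix at `x` is `sesq` at the conjugate vector.
  have h1 : (star x ⬝ᵥ (sesqMat (fun j => Pi.single j (1 : ℂ)) fun u v : Cn n =>
      (η u v : ℂ)).mulVec x) = sesq (fun u v : Cn n => (η u v : ℂ)) (star x) (star x) := by
    have h2 : (star x : Cn n) = ∑ j, (star x) j • (Pi.single j (1 : ℂ) : Cn n) := by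
      ext k; simp [Pi.single_apply]
    conv_rhs => rw [h2]
    rw [h.sesq_sum, dotProduct]
    refine Finset.sum_congr rfl fun j _ => ?_
    rw [Matrix.mulVec, dotProduct, Finset.mul_sum]
    refine Finset.sum_congr rfl fun k _ => ?_
    simp [sesqMat]; ring
  have h3 : η (star x) (star x) = 0 := by
    have := h.swap (star x) (star x)
    have : η (star x) (star x) = - η (star x) (star x) := by exact_mod_cast this
    linarith
  rw [h1, sesq, h3]
  have h4 := hpos (star x) (by simpa using hx)
  simpa using h4

end RealForm

/-! ### The operator `√-1 ∂∂̄` under changes of coordinates -/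

section Calculus

open Filter Topology

variable {E E' F : Type*} [NormedAddCommGroup E] [NormedSpace ℝ E] [NormedAddCommGroup E']
  [NormedSpace ℝ E'] [NormedAddCommGroup F] [NormedSpace ℝ F]

theorem fderiv_fderiv_comp {f : E' → F} {g : E → E'} {y : E} (hf : ContDiffAt ℝ 2 f (g y))
    (hg : ContDiffAt ℝ 2 g y) (u v : E) :
    fderiv ℝ (fderiv ℝ (f ∘ g)) y u v =
      fderiv ℝ (fderiv ℝ f) (g y) (fderiv ℝ g y u) (fderiv ℝ g y v) +
        fderiv ℝ f (g y) (fderiv ℝ (fderiv ℝ g) y u v) := by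
  have h1 : fderiv ℝ (f ∘ g) =ᶠ[𝓝 y] fun z => (fderiv ℝ f (g z)).comp (fderiv ℝ g z) := by
    have hg' : ∀ᶠ z in 𝓝 y, ContDiffAt ℝ 2 g z := hg.eventually (by simp)
    have hf' : ∀ᶠ z in 𝓝 y, ContDiffAt ℝ 2 f (g z) :=
      hg.continuousAt.eventually (hf.eventually (by simp))
    filter_upwards [hg', hf'] with z hz hz'
    exact fderiv_comp z (hz'.differentiableAt (by simp)) (hz.differentiableAt (by simp))
  rw [h1.fderiv_eq]
  have h2 : DifferentiableAt ℝ (fderiv ℝ f) (g y) :=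
    (hf.fderiv_right (m := 1) (by norm_num)).differentiableAt (by simp)
  have h3 : DifferentiableAt ℝ (fderiv ℝ g) y :=
    (hg.fderiv_right (m := 1) (by norm_num)).differentiableAt (by simp)
  have h4 := (h2.hasFDerivAt.comp y (hg.differentiableAt (by simp)).hasFDerivAt).clm_comp
    h3.hasFDerivAt
  have h5 := h4.fderiv
  simp only [Function.comp_def] at h5
  rw [h5]
  simp [add_comm]

/-- The Levi form `√-1 ∂∂̄ f` of a function on a complex vector space. -/
noncomputable def iddb [NormedSpace ℂ E] (f : E → ℝ) (y u v : E) : ℝ :=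
  (fderiv ℝ (fderiv ℝ f) y (Complex.I • u) v - fderiv ℝ (fderiv ℝ f) y u (Complex.I • v)) / 2

/-- The condition `hh` makes the term of the chain rule with second derivatives of `g` cancel. It is
met by holomorphic maps, and also by the real linear map `reSnd`, which is not holomorphic. -/
theorem iddb_comp_pluriharmonic [NormedSpace ℂ E] {f : E' → ℝ} {g : E → E'} {y : E}
    (hf : ContDiffAt ℝ 2 f (g y)) (hg : ContDiffAt ℝ 2 g y)
    (hh : ∀ u v, fderiv ℝ (fderiv ℝ g) y (Complex.I • u) v =
      fderiv ℝ (fderiv ℝ g) y u (Complex.I • v)) (u v : E) :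
    iddb (f ∘ g) y u v =
      (fderiv ℝ (fderiv ℝ f) (g y) (fderiv ℝ g y (Complex.I • u)) (fderiv ℝ g y v) -
        fderiv ℝ (fderiv ℝ f) (g y) (fderiv ℝ g y u) (fderiv ℝ g y (Complex.I • v))) / 2 := by
  simp only [iddb, fderiv_fderiv_comp hf hg, hh]
  ring

/-- The second real derivative of a holomorphic map is the restriction of a complex bilinear one. -/
theorem fderiv_fderiv_I_smul [NormedSpace ℂ E] [NormedSpace ℂ E'] {g : E → E'} {y : E}
    (hg : ContDiffAt ℂ 2 g y) (u v : E) :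
    fderiv ℝ (fderiv ℝ g) y (Complex.I • u) v = fderiv ℝ (fderiv ℝ g) y u (Complex.I • v) := by
  have h1 : fderiv ℝ g =ᶠ[𝓝 y] fun z =>
      ContinuousLinearMap.restrictScalarsL ℂ E E' ℝ ℝ (fderiv ℂ g z) := by
    filter_upwards [hg.eventually (by simp)] with z hz
    exact (hz.differentiableAt (by simp)).fderiv_restrictScalars ℝ
  have h2 : DifferentiableAt ℂ (fderiv ℂ g) y :=
    (hg.fderiv_right (m := 1) (by norm_num)).differentiableAt (by simp)
  rw [h1.fderiv_eq]
  have h3 := ((ContinuousLinearMap.restrictScalarsL ℂ E E' ℝ ℝ).hasFDerivAt.comp y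
    (h2.hasFDerivAt.restrictScalars ℝ)).fderiv
  simp only [Function.comp_def] at h3
  rw [h3]
  simp

theorem iddb_comp_holomorphic [NormedSpace ℂ E] [NormedSpace ℂ E'] {f : E' → ℝ} {g : E → E'} {y : E}
    (hf : ContDiffAt ℝ 2 f (g y)) (hg : ContDiffAt ℂ 2 g y) (u v : E) :
    iddb (f ∘ g) y u v = iddb f (g y) (fderiv ℝ g y u) (fderiv ℝ g y v) := by
  rw [iddb_comp_pluriharmonic hf (hg.restrict_scalars ℝ) (fderiv_fderiv_I_smul hg), iddb]
  have h1 : fderiv ℝ g y = (fderiv ℂ g y).restrictScalars ℝ :=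
    (hg.differentiableAt (by simp)).fderiv_restrictScalars ℝ
  simp [h1]

theorem iddb_congr [NormedSpace ℂ E] {f f' : E → ℝ} {y : E} (h : f =ᶠ[𝓝 y] f') (u v : E) :
    iddb f y u v = iddb f' y u v := by
  simp only [iddb, h.fderiv.fderiv_eq]

theorem isForm11_iddb [NormedSpace ℂ E] [IsScalarTower ℝ ℂ E] {f : E → ℝ} {y : E}
    (hf : ContDiffAt ℝ 2 f y) : IsForm11 fun u v => (iddb f y u v : ℂ) where
  add_left u v w := by simp only [iddb, smul_add, map_add, add_apply]; push_cast; ring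
  smul_left r u w := by
    have h1 : (r : ℂ) • u = r • u := algebraMap_smul ℂ r u
    rw [h1]
    simp only [iddb, smul_comm Complex.I r, map_smul, smul_apply, smul_eq_mul]
    push_cast; ring
  swap u w := by
    have hs := hf.isSymmSndFDerivAt (by simp)
    simp only [iddb]
    rw [hs.eq (Complex.I • w) u, hs.eq w (Complex.I • u)]
    push_cast; ring
  type11 u w := by
    have hneg : ∀ u : E, Complex.I • Complex.I • u = -u := fun u => by
      rw [smul_smul, Complex.I_mul_I, neg_one_smul]
    simp only [iddb, hneg, map_neg, neg_apply]
    push_cast; ring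

end Calculus

/-! ### Charts -/

section Charts

variable {n : ℕ} {X : Type*} [TopologicalSpace X] [ChartedSpace (Cn n) X]

/-- The change of charts from the chart at `p` to the chart at `q`. -/
noncomputable def transition (p q : X) : Cn n → Cn n :=
  chartAt (Cn n) q ∘ (chartAt (Cn n) p).symm

section Complex

variable [IsManifold 𝓘(ℂ, Cn n) ω X]

theorem contDiffAt_transition (p q : X) {y : Cn n} (hy : y ∈ (chartAt (Cn n) p).target)
    (hq : (chartAt (Cn n) p).symm y ∈ (chartAt (Cn n) q).source) :
    ContDiffAt ℂ ω (transition p q) y := by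
  have h1 := contDiffOn_ext_coord_change (I := 𝓘(ℂ, Cn n)) (n := ω) q p
  have h2 : ((extChartAt 𝓘(ℂ, Cn n) p).symm ≫ extChartAt 𝓘(ℂ, Cn n) q).source =
      ((chartAt (Cn n) p).symm ≫ₕ chartAt (Cn n) q).source := by simp [mfld_simps]
  rw [h2] at h1
  exact h1.contDiffAt (IsOpen.mem_nhds ((chartAt (Cn n) p).symm ≫ₕ chartAt (Cn n) q).open_source
    (by simp [hy, hq]))

variable (n X) in
theorem isManifold_real : IsManifold 𝓘(ℝ, Cn n) ∞ X := by
  refine isManifold_of_contDiffOn _ _ _ fun e e' he he' => ?_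
  have h1 := (contDiffGroupoid ω 𝓘(ℂ, Cn n)).compatible he he'
  rw [contDiffGroupoid, mem_groupoid_of_pregroupoid] at h1
  exact (ContDiffOn.restrict_scalars (𝕜 := ℝ) (𝕜' := ℂ) h1.1).of_le le_top

/-- The tangent space at a point is identified with `ℂⁿ` through the preferred chart there, so the
differential of an inverse chart is that of the transition to the preferred chart of the image
point. -/
theorem dChartSymm_chartAt (p : X) {y : Cn n} (hy : y ∈ (chartAt (Cn n) p).target) :
    dChartSymm (chartAt (Cn n) p) y =
      fderiv ℝ (transition p ((chartAt (Cn n) p).symm y)) y := by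
  have := isManifold_real n X
  have h1 : MDifferentiableAt 𝓘(ℝ, Cn n) 𝓘(ℝ, Cn n) (chartAt (Cn n) p).symm y :=
    mdifferentiableAt_atlas_symm (chart_mem_atlas _ p) hy
  have h2 : writtenInExtChartAt 𝓘(ℝ, Cn n) 𝓘(ℝ, Cn n) y (chartAt (Cn n) p).symm =
      transition p ((chartAt (Cn n) p).symm y) := rfl
  refine h1.mfderiv.trans ?_
  rw [h2]
  change fderivWithin ℝ _ (range id) y = _
  rw [range_id, fderivWithin_univ]

/-- The complex linear map underlying `dChartSymm`. -/
noncomputable def chartMap (p : X) (y : Cn n) : Cn n →ₗ[ℂ] Cn n :=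
  (fderiv ℂ (transition p ((chartAt (Cn n) p).symm y)) y).toLinearMap

theorem contDiffAt_transition_self (p : X) {y : Cn n} (hy : y ∈ (chartAt (Cn n) p).target) :
    ContDiffAt ℂ ω (transition p ((chartAt (Cn n) p).symm y)) y :=
  contDiffAt_transition p _ hy (mem_chart_source _ _)

theorem dChartSymm_apply (p : X) {y : Cn n} (hy : y ∈ (chartAt (Cn n) p).target) (u : Cn n) :
    dChartSymm (chartAt (Cn n) p) y u = chartMap p y u := by
  rw [dChartSymm_chartAt p hy, ((contDiffAt_transition_self p hy).differentiableAt
    (by simp)).fderiv_restrictScalars ℝ]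
  rfl

omit [IsManifold 𝓘(ℂ, Cn n) ω X] in
theorem transition_comp_eventuallyEq (p q r : X) {y : Cn n} (hy : y ∈ (chartAt (Cn n) p).target)
    (hq : (chartAt (Cn n) p).symm y ∈ (chartAt (Cn n) q).source) :
    transition q r ∘ transition p q =ᶠ[nhds y] transition p r := by
  have h1 : ((chartAt (Cn n) p).symm ≫ₕ chartAt (Cn n) q).source ∈ nhds y :=
    ((chartAt (Cn n) p).symm ≫ₕ chartAt (Cn n) q).open_source.mem_nhds (by simp [hy, hq])
  filter_upwards [h1] with z hz
  simp only [mfld_simps] at hz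
  simp [transition, hz.2]

/-- The cocycle identity for differentials of charts. -/
theorem chartMap_comp (p q : X) {y : Cn n} (hy : y ∈ (chartAt (Cn n) p).target)
    (hq : (chartAt (Cn n) p).symm y ∈ (chartAt (Cn n) q).source) :
    chartMap p y = (chartMap q (transition p q y)).comp
      (fderiv ℂ (transition p q) y).toLinearMap := by
  have hx : (chartAt (Cn n) q).symm (transition p q y) = (chartAt (Cn n) p).symm y :=
    (chartAt (Cn n) q).left_inv hq
  have hy' : transition p q y ∈ (chartAt (Cn n) q).target := (chartAt (Cn n) q).map_source hq
  simp only [chartMap, hx]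
  rw [← (transition_comp_eventuallyEq p q ((chartAt (Cn n) p).symm y) hy hq).fderiv_eq]
  have h1 := (contDiffAt_transition_self q hy').differentiableAt (n := ω) (by simp)
  rw [hx] at h1
  rw [fderiv_comp y h1 ((contDiffAt_transition p q hy hq).differentiableAt (by simp))]
  rfl

omit [IsManifold 𝓘(ℂ, Cn n) ω X] in
theorem chartMap_self (p : X) : chartMap p (chartAt (Cn n) p p) = LinearMap.id := by
  have h1 : transition p p =ᶠ[nhds (chartAt (Cn n) p p)] id := by
    filter_upwards [(chartAt (Cn n) p).open_target.mem_nhds (mem_chart_target _ p)] with z hz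
    simp [transition, hz]
  have h2 : (chartAt (Cn n) p).symm (chartAt (Cn n) p p) = p :=
    (chartAt (Cn n) p).left_inv (mem_chart_source _ p)
  rw [chartMap, h2, h1.fderiv_eq, fderiv_id]
  rfl

/-- By the cocycle identity, composing with the differential of the reverse transition gives the
identity. -/
theorem det_chartMap_ne_zero (p : X) {y : Cn n} (hy : y ∈ (chartAt (Cn n) p).target) :
    (chartMap p y).toMatrix'.det ≠ 0 := by
  set x := (chartAt (Cn n) p).symm y with hx
  have hy' : transition p x y ∈ (chartAt (Cn n) x).target :=
    (chartAt (Cn n) x).map_source (mem_chart_source _ x)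
  have h0 : (chartAt (Cn n) x).symm (transition p x y) = x :=
    (chartAt (Cn n) x).left_inv (mem_chart_source _ x)
  have hp : (chartAt (Cn n) x).symm (transition p x y) ∈ (chartAt (Cn n) p).source := by
    rw [h0, hx]; exact (chartAt (Cn n) p).map_target hy
  have hz : transition x p (transition p x y) = y := by
    simp only [transition, Function.comp_apply] at h0 ⊢
    rw [h0, hx]; exact (chartAt (Cn n) p).right_inv hy
  have h1 := chartMap_comp x p hy' hp
  rw [hz] at h1
  have h2 : transition p x y = chartAt (Cn n) x x := rfl
  rw [h2, chartMap_self] at h1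
  have h3 := congrArg (fun T => (LinearMap.toMatrix' T).det) h1
  simp only [LinearMap.toMatrix'_id, Matrix.det_one, LinearMap.toMatrix'_comp, Matrix.det_mul] at h3
  exact left_ne_zero_of_mul (h3 ▸ one_ne_zero)

/-- `iddbar` is computed in a chart that varies with the point. As transitions are holomorphic, `√-1
∂∂̄f` is a tensor, and in one fixed chart it becomes the smooth expression `iddb`. -/
theorem iddbar_dChartSymm {f : X → ℝ} (p : X) {y : Cn n} (hy : y ∈ (chartAt (Cn n) p).target)
    (hf : ContDiffAt ℝ 2 (f ∘ (chartAt (Cn n) ((chartAt (Cn n) p).symm y)).symm)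
      (chartAt (Cn n) ((chartAt (Cn n) p).symm y) ((chartAt (Cn n) p).symm y))) (u v : Cn n) :
    iddb (f ∘ (chartAt (Cn n) p).symm) y u v =
      iddbar 𝓘(ℝ, Cn n) f ((chartAt (Cn n) p).symm y) (chartMap p y u) (chartMap p y v) := by
  set x := (chartAt (Cn n) p).symm y with hx
  have h1 : f ∘ (chartAt (Cn n) p).symm =ᶠ[nhds y]
      (f ∘ (chartAt (Cn n) x).symm) ∘ transition p x := by
    have h1 : ((chartAt (Cn n) p).symm ≫ₕ chartAt (Cn n) x).source ∈ nhds y :=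
      ((chartAt (Cn n) p).symm ≫ₕ chartAt (Cn n) x).open_source.mem_nhds
        (by simp [hy, ← hx])
    filter_upwards [h1] with z hz
    simp only [mfld_simps] at hz
    simp [transition, hz.2]
  have h2 := contDiffAt_transition_self p hy
  rw [iddb_congr h1, iddb_comp_holomorphic (f := f ∘ (chartAt (Cn n) x).symm) (g := transition p x) hf (h2.of_le le_top),
    ← dChartSymm_chartAt p hy, dChartSymm_apply p hy, dChartSymm_apply p hy]
  rfl

end Complex

end Charts

/-! ### The complexified form as a matrix -/

theorem two_le_infty : (2 : WithTop ℕ∞) ≤ ∞ :=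
  WithTop.coe_le_coe.2 (le_top : (2 : ℕ∞) ≤ ⊤)

section Matrices

variable {n : ℕ}

open scoped ComplexOrder in
theorem PosHerm.det_pos {W : Matrix (Fin n) (Fin n) ℂ} (hW : PosHerm W) :
    0 < W.det.re ∧ W.det.im = 0 := by
  have h1 : W.PosDef := Matrix.PosDef.of_dotProduct_mulVec_pos hW.1 fun v hv => by
    rw [Complex.lt_def]
    exact ⟨hW.2 v hv, (hW.1.im_star_dotProduct_mulVec_self v).symm⟩
  have h2 := Complex.lt_def.1 h1.det_pos
  exact ⟨h2.1, h2.2.symm⟩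

theorem PosHerm.det_ne_zero {W : Matrix (Fin n) (Fin n) ℂ} (hW : PosHerm W) : W.det ≠ 0 :=
  fun h => hW.det_pos.1.ne' (by rw [h]; rfl)

/-- The standard basis of `ℂⁿ`. -/
def stdB (j : Fin n) : Cn n := Pi.single j 1

theorem eq_sum_stdB (u : Cn n) : u = ∑ k, u k • (stdB k : Cn n) := by
  ext k; simp [stdB, Pi.single_apply]

theorem isForm11_comp {V V' : Type*} [AddCommGroup V] [Module ℂ V] [AddCommGroup V'] [Module ℂ V']
    {η : V' → V' → ℂ} (h : IsForm11 η) (T : V →ₗ[ℂ] V') : IsForm11 fun u v => η (T u) (T v) where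
  add_left u v w := by rw [map_add, h.add_left]
  smul_left r u w := by rw [map_smul, h.smul_left]
  swap u w := h.swap _ _
  type11 u w := by rw [map_smul, map_smul, h.type11]

theorem isForm11_add {V : Type*} [AddCommGroup V] [Module ℂ V] {η η' : V → V → ℂ}
    (h : IsForm11 η) (h' : IsForm11 η') : IsForm11 fun u v => η u v + η' u v where
  add_left u v w := by rw [h.add_left, h'.add_left]; ring
  smul_left r u w := by rw [h.smul_left, h'.smul_left]; ring
  swap u w := by rw [h.swap u w, h'.swap u w]; ring
  type11 u w := by rw [h.type11, h'.type11]

theorem isForm11_const_mul {V : Type*} [AddCommGroup V] [Module ℂ V] {η : V → V → ℂ} (c : ℂ)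
    (h : IsForm11 η) : IsForm11 fun u v => c * η u v where
  add_left u v w := by rw [h.add_left]; ring
  smul_left r u w := by rw [h.smul_left]; ring
  swap u w := by rw [h.swap u w]; ring
  type11 u w := by rw [h.type11]

theorem sesqMat_add {ι V : Type*} [AddCommGroup V] [Module ℂ V] (b : ι → V) (η η' : V → V → ℂ) :
    sesqMat b (fun u v => η u v + η' u v) = sesqMat b η + sesqMat b η' := by
  ext j k; simp only [sesqMat, sesq, Matrix.of_apply, Matrix.add_apply]; ring

theorem sesqMat_const_mul {ι V : Type*} [AddCommGroup V] [Module ℂ V] (b : ι → V) (c : ℂ)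
    (η : V → V → ℂ) : sesqMat b (fun u v => c * η u v) = c • sesqMat b η := by
  ext j k; simp only [sesqMat, sesq, Matrix.of_apply, Matrix.smul_apply, smul_eq_mul]; ring

theorem sesqMat_comp {η : Cn n → Cn n → ℂ} (h : IsForm11 η) (T : Cn n →ₗ[ℂ] Cn n) :
    sesqMat stdB (fun u v => η (T u) (T v)) =
      T.toMatrix'.transpose * sesqMat stdB η * T.toMatrix'.map (starRingEnd ℂ) := by
  ext j k
  have hT : ∀ j, T (stdB j) = ∑ i, T.toMatrix' i j • (stdB i : Cn n) := by
    intro j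
    conv_lhs => rw [eq_sum_stdB (T (stdB j))]
    simp [LinearMap.toMatrix'_apply, stdB]
  have h1 : sesqMat stdB (fun u v => η (T u) (T v)) j k = sesq η (T (stdB j)) (T (stdB k)) := by
    simp [sesqMat, sesq]
  rw [h1, hT, hT, h.sesq_sum, Finset.sum_comm]
  simp only [Matrix.mul_apply, Matrix.transpose_apply, Matrix.map_apply, Finset.sum_mul, sesqMat,
    Matrix.of_apply]

theorem det_conj_transform (P M : Matrix (Fin n) (Fin n) ℂ) :
    (P.transpose * M * P.map (starRingEnd ℂ)).det = Complex.normSq P.det * M.det := by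
  have h2 : (P.map (starRingEnd ℂ)).det = (starRingEnd ℂ) P.det := by
    rw [RingHom.map_det]; rfl
  rw [Matrix.det_mul, Matrix.det_mul, Matrix.det_transpose, h2, ← Complex.mul_conj]; ring

/-- Under a change of coordinates the linearized determinant scales by `|det P|²`, like the
determinant itself; hence its quotient by `det W` is a function on `X`. -/
theorem trace_conj_transform (P M N : Matrix (Fin n) (Fin n) ℂ) :
    ((P.transpose * M * P.map (starRingEnd ℂ)).adjugate *
      (P.transpose * N * P.map (starRingEnd ℂ))).trace =
      Complex.normSq P.det * (M.adjugate * N).trace := by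
  have h2 : (P.map (starRingEnd ℂ)).det = (starRingEnd ℂ) P.det := by
    rw [RingHom.map_det]; rfl
  set Q := P.map (starRingEnd ℂ)
  rw [Matrix.adjugate_mul_distrib, Matrix.adjugate_mul_distrib]
  calc (Q.adjugate * (M.adjugate * P.transpose.adjugate) * (P.transpose * N * Q)).trace
      = (Q.adjugate * (M.adjugate * (P.transpose.adjugate * P.transpose) * N * Q)).trace := by
        simp only [Matrix.mul_assoc]
    _ = P.det * (Q.adjugate * (M.adjugate * N * Q)).trace := by
        rw [Matrix.adjugate_mul, Matrix.det_transpose]; simp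
    _ = P.det * (M.adjugate * N * (Q * Q.adjugate)).trace := by
        rw [Matrix.trace_mul_comm, Matrix.mul_assoc]
    _ = _ := by
        rw [Matrix.mul_adjugate, h2, ← Complex.mul_conj]
        simp [mul_assoc]

end Matrices

/-! ### Densities of the forms at points and in charts -/

section Forms

variable {n : ℕ} {X : Type*} [TopologicalSpace X] [ChartedSpace (Cn n) X]

theorem update_cons_zero' {V : Type*} (u v w : V) :
    Function.update ![u, w] 0 v = ![v, w] := by
  ext i; fin_cases i <;> simp

theorem isForm11_alternating (η : (Cn n) [⋀^Fin 2]→L[ℝ] ℝ)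
    (h : ∀ u v, η ![Complex.I • u, Complex.I • v] = η ![u, v]) :
    IsForm11 fun u v => (η ![u, v] : ℂ) where
  add_left u v w := by
    have := η.map_update_add ![u, w] 0 u v
    simp only [update_cons_zero'] at this
    rw [this]; push_cast; ring
  smul_left r u w := by
    have h1 : (r : ℂ) • u = r • u := algebraMap_smul ℂ r u
    have := η.map_update_smul ![u, w] 0 r u
    simp only [update_cons_zero'] at this
    rw [h1, this]; simp
  swap u w := by
    have := η.map_swap ![u, w] (i := 0) (j := 1) (by decide)
    have h1 : ![u, w] ∘ ⇑(Equiv.swap (0 : Fin 2) 1) = ![w, u] := by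
      ext i; fin_cases i <;> simp
    rw [h1] at this
    change η ![w, u] = -η ![u, w] at this
    rw [this]; push_cast; ring
  type11 u w := by rw [h]

/-- The matrix of a `(1,1)`-form at a point. -/
noncomputable def formAt (α : ClosedRealForm11 n X) (x : X) : Matrix (Fin n) (Fin n) ℂ :=
  sesqMat stdB fun u v => (α.toForm x ![u, v] : ℂ)

/-- The complex Hessian of a function at a point. -/
noncomputable def hessAt (f : X → ℝ) (x : X) : Matrix (Fin n) (Fin n) ℂ :=
  sesqMat stdB fun u v => (iddbar 𝓘(ℝ, Cn n) f x u v : ℂ)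

/-- The matrix of a `(1,1)`-form in the chart at `p`. -/
noncomputable def formChart (α : ClosedRealForm11 n X) (p : X) (y : Cn n) :
    Matrix (Fin n) (Fin n) ℂ :=
  sesqMat stdB fun u v => (pullbackTwoForm α.toForm (chartAt (Cn n) p) y ![u, v] : ℂ)

/-- The complex Hessian of a function on `ℂⁿ`. -/
noncomputable def hessC (F : Cn n → ℝ) (y : Cn n) : Matrix (Fin n) (Fin n) ℂ :=
  sesqMat stdB fun u v => (iddb F y u v : ℂ)

/-- The matrix of `ω + √-1 α_φ` at a point. -/
noncomputable def cplxAt (ω₀ α : ClosedRealForm11 n X) (φ : X → ℝ) (x : X) :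
    Matrix (Fin n) (Fin n) ℂ :=
  formAt ω₀ x + Complex.I • (formAt α x + hessAt φ x)

/-- The matrix of `ω + √-1 α_φ` in the chart at `p`, where `F` represents `φ`. -/
noncomputable def cplxChart (ω₀ α : ClosedRealForm11 n X) (F : Cn n → ℝ) (p : X) (y : Cn n) :
    Matrix (Fin n) (Fin n) ℂ :=
  formChart ω₀ p y + Complex.I • (formChart α p y + hessC F y)

/-- The smooth functions on `X`, in terms of the preferred charts. -/
def IsSm (f : X → ℝ) : Prop :=
  ∀ p : X, ContDiffOn ℝ ∞ (f ∘ (chartAt (Cn n) p).symm) (chartAt (Cn n) p).target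

/-- The ratio of `e^{-√-1 θ} (ω + √-1 α_φ)ⁿ` and `ωⁿ`. -/
noncomputable def ratio (θ : ℝ) (ω₀ α : ClosedRealForm11 n X) (φ : X → ℝ) (x : X) : ℂ :=
  phase θ * (cplxAt ω₀ α φ x).det / (formAt ω₀ x).det

/-- The linearization of `ratio` in the direction `f` is `√-1` times `lin`. -/
noncomputable def lin (θ : ℝ) (ω₀ α : ClosedRealForm11 n X) (φ f : X → ℝ) (x : X) : ℂ :=
  phase θ * ((cplxAt ω₀ α φ x).adjugate * hessAt f x).trace / (formAt ω₀ x).det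

/-- The density of `ωⁿ` in the chart at `p`. -/
noncomputable def dens (ω₀ : ClosedRealForm11 n X) (p : X) (y : Cn n) : ℝ :=
  n.factorial * 2 ^ n * (formChart ω₀ p y).det.re

theorem isForm11_form (α : ClosedRealForm11 n X) (x : X) :
    IsForm11 fun u v => (α.toForm x ![u, v] : ℂ) :=
  isForm11_alternating _ (α.type11 x)

theorem formAt_posHerm (ω₀ : KahlerForm n X) (x : X) :
    PosHerm (formAt ω₀.toClosedRealForm11 x) :=
  sesqMat_posDef (isForm11_form _ x) fun u hu => ω₀.pos x u hu

theorem IsSm.contDiffAt {f : X → ℝ} (hf : IsSm (n := n) f) (p : X) {y : Cn n}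
    (hy : y ∈ (chartAt (Cn n) p).target) : ContDiffAt ℝ ∞ (f ∘ (chartAt (Cn n) p).symm) y :=
  (hf p).contDiffAt ((chartAt (Cn n) p).open_target.mem_nhds hy)

theorem IsSm.contDiffAt_self {f : X → ℝ} (hf : IsSm (n := n) f) (x : X) :
    ContDiffAt ℝ 2 (f ∘ (chartAt (Cn n) x).symm) (chartAt (Cn n) x x) :=
  (hf.contDiffAt x (mem_chart_target _ x)).of_le two_le_infty

theorem isForm11_iddbar {f : X → ℝ} (hf : IsSm (n := n) f) (x : X) :
    IsForm11 fun u v => (iddbar 𝓘(ℝ, Cn n) f x u v : ℂ) :=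
  isForm11_iddb (hf.contDiffAt_self x)

theorem formAt_isHermitian (α : ClosedRealForm11 n X) (x : X) : (formAt α x).IsHermitian :=
  sesqMat_isHermitian _ (isForm11_form _ x)

theorem hessAt_isHermitian {f : X → ℝ} (hf : IsSm (n := n) f) (x : X) :
    (hessAt f x : Matrix (Fin n) (Fin n) ℂ).IsHermitian :=
  sesqMat_isHermitian _ (isForm11_iddbar hf x)

theorem isForm11_top (ω₀ : KahlerForm n X) (α : ClosedRealForm11 n X) {φ : X → ℝ}
    (hφ : IsSm (n := n) φ) (x : X) : IsForm11 fun u v => (ω₀.toForm x ![u, v] : ℂ) +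
      Complex.I * (alphaPhi α φ x u v : ℂ) := by
  have h1 := isForm11_add (isForm11_form ω₀.toClosedRealForm11 x) (isForm11_const_mul Complex.I
    (isForm11_add (isForm11_form α x) (isForm11_iddbar hφ x)))
  simpa [alphaPhi] using h1

theorem sesqMat_top (ω₀ : KahlerForm n X) (α : ClosedRealForm11 n X) (φ : X → ℝ) (x : X) :
    sesqMat stdB (fun u v => (ω₀.toForm x ![u, v] : ℂ) + Complex.I * (alphaPhi α φ x u v : ℂ)) =
      cplxAt ω₀.toClosedRealForm11 α φ x := by
  simp only [alphaPhi, Complex.ofReal_add]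
  rw [sesqMat_add, sesqMat_const_mul, sesqMat_add]
  rfl

/-- The factor by which the wedge power of a form differs from the determinant of its matrix. -/
noncomputable def frameFactor (w : Fin n × Fin 2 → Cn n) : ℂ :=
  n.factorial * Complex.I ^ n * (coordMat (fun u : Cn n => u) w).det

theorem topForm_eq (ω₀ : KahlerForm n X) (α : ClosedRealForm11 n X) {φ : X → ℝ}
    (hφ : IsSm (n := n) φ) (x : X) (w : Fin n × Fin 2 → Cn n) :
    topForm ω₀ α φ x w = (cplxAt ω₀.toClosedRealForm11 α φ x).det * frameFactor w := by
  rw [topForm, wedgePow_eq_det (isForm11_top ω₀ α hφ x) stdB (fun u => u) eq_sum_stdB,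
    sesqMat_top, frameFactor]
  ring

theorem frameFactor_stdFrame : frameFactor (stdFrame n) = (n.factorial * 2 ^ n : ℝ) := by
  rw [frameFactor, mul_assoc, det_coordMat_stdFrame]; push_cast; ring

section Transform

variable [IsManifold 𝓘(ℂ, Cn n) ω X] (p : X) {y : Cn n} (hy : y ∈ (chartAt (Cn n) p).target)
include hy

theorem pullbackTwoForm_eq (α : ClosedRealForm11 n X) (u v : Cn n) :
    pullbackTwoForm α.toForm (chartAt (Cn n) p) y ![u, v] =
      α.toForm ((chartAt (Cn n) p).symm y) ![chartMap p y u, chartMap p y v] := by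
  rw [pullbackTwoForm, ContinuousAlternatingMap.compContinuousLinearMap_apply]
  congr 1
  ext i; fin_cases i <;> simp [dChartSymm_apply p hy]

theorem isForm11_pullback (α : ClosedRealForm11 n X) :
    IsForm11 fun u v => (pullbackTwoForm α.toForm (chartAt (Cn n) p) y ![u, v] : ℂ) := by
  simp_rw [pullbackTwoForm_eq p hy]
  exact isForm11_comp (isForm11_form α _) (chartMap p y)

theorem formChart_eq (α : ClosedRealForm11 n X) :
    formChart α p y = (chartMap p y).toMatrix'.transpose * formAt α ((chartAt (Cn n) p).symm y) *
      (chartMap p y).toMatrix'.map (starRingEnd ℂ) := by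
  rw [formChart, formAt, ← sesqMat_comp (isForm11_form α _)]
  simp_rw [pullbackTwoForm_eq p hy]

theorem formChart_posHerm (ω₀ : KahlerForm n X) :
    PosHerm (formChart ω₀.toClosedRealForm11 p y) := by
  refine sesqMat_posDef (isForm11_pullback p hy _) fun u hu => ?_
  rw [pullbackTwoForm_eq p hy, map_smul]
  refine ω₀.pos _ _ fun h0 => hu ?_
  have h1 : (chartMap p y).toMatrix'.mulVec u = 0 := by rw [LinearMap.toMatrix'_mulVec, h0]
  exact Matrix.eq_zero_of_mulVec_eq_zero (det_chartMap_ne_zero p hy) h1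

theorem formChart_isHermitian (α : ClosedRealForm11 n X) : (formChart α p y).IsHermitian :=
  sesqMat_isHermitian _ (isForm11_pullback p hy α)

omit [IsManifold 𝓘(ℂ, Cn n) ω X] in
theorem hessC_isHermitian {f : X → ℝ} (hf : IsSm (n := n) f) :
    (hessC (f ∘ (chartAt (Cn n) p).symm) y).IsHermitian :=
  sesqMat_isHermitian _ (isForm11_iddb ((hf.contDiffAt p hy).of_le two_le_infty))

theorem hessC_eq {f : X → ℝ} (hf : IsSm (n := n) f) :
    hessC (f ∘ (chartAt (Cn n) p).symm) y =
      (chartMap p y).toMatrix'.transpose * hessAt f ((chartAt (Cn n) p).symm y) *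
      (chartMap p y).toMatrix'.map (starRingEnd ℂ) := by
  rw [hessC, hessAt, ← sesqMat_comp (isForm11_iddbar hf _)]
  simp_rw [iddbar_dChartSymm p hy (hf.contDiffAt_self _)]

theorem cplxChart_eq (ω₀ α : ClosedRealForm11 n X) {φ : X → ℝ} (hφ : IsSm (n := n) φ) :
    cplxChart ω₀ α (φ ∘ (chartAt (Cn n) p).symm) p y =
      (chartMap p y).toMatrix'.transpose * cplxAt ω₀ α φ ((chartAt (Cn n) p).symm y) *
      (chartMap p y).toMatrix'.map (starRingEnd ℂ) := by
  simp only [cplxChart, cplxAt, formChart_eq p hy, hessC_eq p hy hφ, Matrix.mul_add,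
    Matrix.add_mul, Matrix.mul_smul, Matrix.smul_mul]

theorem normSq_det_chartMap_ne_zero :
    (Complex.normSq (chartMap p y).toMatrix'.det : ℂ) ≠ 0 := by
  exact_mod_cast (Complex.normSq_pos.2 (det_chartMap_ne_zero p hy)).ne'

/-- Numerator and denominator pick up the same factor `|det|²`, so the pointwise ratio can be
computed in any chart, where it is visibly smooth. -/
theorem ratio_chart (θ : ℝ) (ω₀ α : ClosedRealForm11 n X) {φ : X → ℝ} (hφ : IsSm (n := n) φ) :
    ratio θ ω₀ α φ ((chartAt (Cn n) p).symm y) =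
      phase θ * (cplxChart ω₀ α (φ ∘ (chartAt (Cn n) p).symm) p y).det /
        (formChart ω₀ p y).det := by
  rw [ratio, cplxChart_eq p hy ω₀ α hφ, formChart_eq p hy, det_conj_transform, det_conj_transform,
    mul_left_comm, mul_div_mul_left _ _ (normSq_det_chartMap_ne_zero p hy)]

theorem lin_chart (θ : ℝ) (ω₀ α : ClosedRealForm11 n X) {φ f : X → ℝ} (hφ : IsSm (n := n) φ)
    (hf : IsSm (n := n) f) :
    lin θ ω₀ α φ f ((chartAt (Cn n) p).symm y) =
      phase θ * ((cplxChart ω₀ α (φ ∘ (chartAt (Cn n) p).symm) p y).adjugate *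
        hessC (f ∘ (chartAt (Cn n) p).symm) y).trace / (formChart ω₀ p y).det := by
  rw [lin, cplxChart_eq p hy ω₀ α hφ, formChart_eq p hy, hessC_eq p hy hf, trace_conj_transform,
    det_conj_transform, mul_left_comm, mul_div_mul_left _ _ (normSq_det_chartMap_ne_zero p hy)]

/-- The left side is `ωⁿ` evaluated on the coordinate frame of the chart. This turns `integralX`
into an integral against the measure of density `dens`. -/
theorem det_formAt_mul_frameFactor (ω₀ : KahlerForm n X) :
    (formAt ω₀.toClosedRealForm11 ((chartAt (Cn n) p).symm y)).det *
      frameFactor (fun q => dChartSymm (chartAt (Cn n) p) y (stdFrame n q)) =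
      (dens ω₀.toClosedRealForm11 p y : ℂ) := by
  simp_rw [dChartSymm_apply p hy]
  rw [frameFactor, det_coordMat_linear]
  have h1 := det_coordMat_stdFrame n
  have h2 := (formChart_posHerm p hy ω₀).det_pos.2
  have h3 : ((formChart ω₀.toClosedRealForm11 p y).det.re : ℂ) =
      (formChart ω₀.toClosedRealForm11 p y).det := by
    apply Complex.ext <;> simp [h2]
  rw [dens]
  push_cast
  rw [h3, formChart_eq p hy, det_conj_transform, ← h1]
  ring

theorem dens_pos (ω₀ : KahlerForm n X) : 0 < dens ω₀.toClosedRealForm11 p y := by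
  have h2 := (formChart_posHerm p hy ω₀).det_pos.1
  unfold dens; positivity

end Transform

/-- The factor on the right is positive, so membership in `𝓗` amounts to smoothness together with
positivity of `Re ratio`. -/
theorem phase_mul_topForm_stdFrame (θ : ℝ) (ω₀ : KahlerForm n X) (α : ClosedRealForm11 n X)
    {φ : X → ℝ} (hφ : IsSm (n := n) φ) (x : X) :
    phase θ * topForm ω₀ α φ x (stdFrame n) =
      ((n.factorial * 2 ^ n * (formAt ω₀.toClosedRealForm11 x).det.re : ℝ) : ℂ) *
        ratio θ ω₀.toClosedRealForm11 α φ x := by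
  have h2 := formAt_posHerm ω₀ x
  have h3 : ((formAt ω₀.toClosedRealForm11 x).det.re : ℂ) =
      (formAt ω₀.toClosedRealForm11 x).det := by
    apply Complex.ext <;> simp [h2.det_pos.2]
  rw [topForm_eq ω₀ α hφ, frameFactor_stdFrame, ratio]
  push_cast
  rw [h3]
  have := h2.det_ne_zero
  field_simp

end Forms

/-! ### Partial derivatives of smooth functions of several variables -/

section Partial

open Topology

variable {E P G : Type*} [NormedAddCommGroup E] [NormedSpace ℝ E] [NormedAddCommGroup P]
  [NormedSpace ℝ P] [NormedAddCommGroup G] [NormedSpace ℝ G]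

/-- The parameter set `S` need not be open, because only the variable in `U` is differentiated. This
allows the closed time interval, with its endpoints. -/
theorem contDiffOn_fderiv_fst {F : E × P → G} {U : Set E} {S : Set P} (hU : IsOpen U)
    (hF : ContDiffOn ℝ ∞ F (U ×ˢ S)) :
    ContDiffOn ℝ ∞ (fun z : E × P => fderiv ℝ (fun y => F (y, z.2)) z.1) (U ×ˢ S) := by
  intro z hz
  have h1 : ContDiffWithinAt ℝ ∞ (Function.uncurry fun (z : E × P) y => F (y, z.2))
      ((U ×ˢ S) ×ˢ U) (z, z.1) := by
    have h2 : ContDiffOn ℝ ∞ (fun q : (E × P) × E => F (q.2, q.1.2)) ((U ×ˢ S) ×ˢ U) :=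
      hF.comp (by fun_prop) fun q hq => ⟨hq.2, hq.1.2⟩
    exact h2 (z, z.1) ⟨hz, hz.1⟩
  have h3 : ContDiffWithinAt ℝ ∞ (fun z : E × P => fderivWithin ℝ (fun y => F (y, z.2)) U z.1)
      (U ×ˢ S) z :=
    h1.fderivWithin contDiffWithinAt_fst hU.uniqueDiffOn (by simp) hz fun q hq => hq.1
  exact h3.congr (fun q hq => (fderivWithin_of_isOpen hU hq.1).symm)
    (fderivWithin_of_isOpen hU hz.1).symm

theorem contDiffOn_fderiv_snd {F : E × P → G} {U : Set E} {S : Set P} (hS : IsOpen S)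
    (hF : ContDiffOn ℝ ∞ F (U ×ˢ S)) :
    ContDiffOn ℝ ∞ (fun z : E × P => fderiv ℝ (fun s => F (z.1, s)) z.2) (U ×ˢ S) := by
  have h1 : ContDiffOn ℝ ∞ (F ∘ Prod.swap) (S ×ˢ U) :=
    hF.comp (contDiff_snd.prodMk contDiff_fst).contDiffOn fun q hq => ⟨hq.2, hq.1⟩
  exact (contDiffOn_fderiv_fst hS h1).comp (contDiff_snd.prodMk contDiff_fst).contDiffOn
    fun q hq => ⟨hq.2, hq.1⟩

theorem contDiffOn_deriv_snd {F : E × ℝ → G} {U : Set E} {S : Set ℝ} (hS : IsOpen S)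
    (hF : ContDiffOn ℝ ∞ F (U ×ˢ S)) :
    ContDiffOn ℝ ∞ (fun z : E × ℝ => deriv (fun s => F (z.1, s)) z.2) (U ×ˢ S) :=
  (contDiffOn_fderiv_snd hS hF).clm_apply contDiffOn_const

theorem fderiv_fst_eq {F : E × P → G} {y : E} {s : P} (hF : DifferentiableAt ℝ F (y, s)) :
    fderiv ℝ (fun y => F (y, s)) y = (fderiv ℝ F (y, s)).comp (ContinuousLinearMap.inl ℝ E P) :=
  (hF.hasFDerivAt.comp y (hasFDerivAt_prodMk_left y s)).fderiv

theorem deriv_snd_eq {F : E × ℝ → G} {y : E} {s : ℝ} (hF : DifferentiableAt ℝ F (y, s)) :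
    deriv (fun s => F (y, s)) s = fderiv ℝ F (y, s) (0, 1) := by
  have := hF.hasFDerivAt.comp s (hasFDerivAt_prodMk_right y s)
  exact this.hasDerivAt.deriv.trans (by simp)

/-- Interchange of the derivative in a parameter and the differential in the other variable. -/
theorem hasDerivAt_fderiv_fst {F : E × ℝ → G} {U : Set E} {S : Set ℝ} (hU : IsOpen U)
    (hS : IsOpen S) (hF : ContDiffOn ℝ ∞ F (U ×ˢ S)) {y : E} {s : ℝ} (hy : y ∈ U) (hs : s ∈ S) :
    HasDerivAt (fun s => fderiv ℝ (fun y => F (y, s)) y)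
      (fderiv ℝ (fun y => deriv (fun s => F (y, s)) s) y) s := by
  have hat : ∀ z ∈ U ×ˢ S, ContDiffAt ℝ ∞ F z := fun z hz =>
    hF.contDiffAt ((hU.prod hS).mem_nhds hz)
  have hne : (∞ : WithTop ℕ∞) ≠ 0 := by simp
  have hFd : ContDiffAt ℝ ∞ (fderiv ℝ F) (y, s) := (hat _ ⟨hy, hs⟩).fderiv_right (by simp)
  have h2 := (hFd.differentiableAt hne).hasFDerivAt
  have h1 : HasDerivAt (fun s => (fderiv ℝ F (y, s)).comp (ContinuousLinearMap.inl ℝ E ℝ))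
      ((fderiv ℝ (fderiv ℝ F) (y, s) (0, 1)).comp (ContinuousLinearMap.inl ℝ E ℝ)) s := by
    have h3 := (h2.comp s (hasFDerivAt_prodMk_right y s)).hasDerivAt
    have h4 := ((ContinuousLinearMap.compL ℝ E (E × ℝ) G).flip
      (ContinuousLinearMap.inl ℝ E ℝ)).hasFDerivAt.comp_hasDerivAt s h3
    simpa [Function.comp_def] using h4
  have h5 : fderiv ℝ (fun y => deriv (fun s => F (y, s)) s) y =
      (fderiv ℝ (fderiv ℝ F) (y, s) (0, 1)).comp (ContinuousLinearMap.inl ℝ E ℝ) := by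
    have h6 : (fun y => deriv (fun s => F (y, s)) s) =ᶠ[𝓝 y]
        fun y => fderiv ℝ F (y, s) (0, 1) := by
      filter_upwards [hU.mem_nhds hy] with z hz
      exact deriv_snd_eq ((hat _ ⟨hz, hs⟩).differentiableAt hne)
    have h8 : HasFDerivAt (fun y => fderiv ℝ F (y, s)) _ y :=
      HasFDerivAt.comp y h2 (hasFDerivAt_prodMk_left (𝕜 := ℝ) y s)
    have h7 := h8.clm_apply (hasFDerivAt_const ((0 : E), (1 : ℝ)) y)
    rw [h6.fderiv_eq]
    refine (HasFDerivAt.fderiv h7).trans ?_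
    ext u
    have hsymm := (hat (y, s) ⟨hy, hs⟩).isSymmSndFDerivAt (by simpa using two_le_infty)
    simp [hsymm.eq (u, 0) (0, 1)]
  rw [h5]
  refine h1.congr_of_eventuallyEq ?_
  filter_upwards [hS.mem_nhds hs] with t ht
  exact fderiv_fst_eq ((hat _ ⟨hy, ht⟩).differentiableAt hne)

/-- Interchange of the derivative in a parameter and the second differential. -/
theorem hasDerivAt_fderiv_fderiv_fst {F : E × ℝ → G} {U : Set E} {S : Set ℝ} (hU : IsOpen U)
    (hS : IsOpen S) (hF : ContDiffOn ℝ ∞ F (U ×ˢ S)) {y : E} {s : ℝ} (hy : y ∈ U) (hs : s ∈ S) :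
    HasDerivAt (fun s => fderiv ℝ (fderiv ℝ (fun y => F (y, s))) y)
      (fderiv ℝ (fderiv ℝ (fun y => deriv (fun s => F (y, s)) s)) y) s := by
  have h1 := hasDerivAt_fderiv_fst hU hS (contDiffOn_fderiv_fst hU hF) hy hs
  have h2 : (fun y => deriv (fun s => fderiv ℝ (fun y => F (y, s)) y) s) =ᶠ[𝓝 y]
      fderiv ℝ (fun y => deriv (fun s => F (y, s)) s) := by
    filter_upwards [hU.mem_nhds hy] with z hz
    exact (hasDerivAt_fderiv_fst hU hS hF hz hs).deriv
  simp only at h1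
  rw [h2.fderiv_eq] at h1
  exact h1

end Partial

/-! ### Smooth families of functions -/

theorem contDiffOn_div {E A : Type*} [NormedAddCommGroup E] [NormedSpace ℝ E] [NormedField A]
    [NormedAlgebra ℝ A] {f g : E → A} {s : Set E} (hf : ContDiffOn ℝ ∞ f s)
    (hg : ContDiffOn ℝ ∞ g s) (h0 : ∀ z ∈ s, g z ≠ 0) :
    ContDiffOn ℝ ∞ (fun z => f z / g z) s := by
  simp_rw [div_eq_mul_inv]
  exact hf.mul (hg.inv h0)

section Matrices

variable {n : ℕ} {E : Type*} [NormedAddCommGroup E] [NormedSpace ℝ E] {s : Set E}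

theorem contDiffOn_det {M : E → Matrix (Fin n) (Fin n) ℂ}
    (h : ∀ i j, ContDiffOn ℝ ∞ (fun z => M z i j) s) : ContDiffOn ℝ ∞ (fun z => (M z).det) s := by
  simp_rw [Matrix.det_apply']
  exact ContDiffOn.sum fun σ _ => contDiffOn_const.mul (contDiffOn_prod fun i _ => h _ _)

theorem contDiffOn_adjugate {M : E → Matrix (Fin n) (Fin n) ℂ}
    (h : ∀ i j, ContDiffOn ℝ ∞ (fun z => M z i j) s) (i j : Fin n) :
    ContDiffOn ℝ ∞ (fun z => (M z).adjugate i j) s := by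
  simp_rw [Matrix.adjugate_apply]
  refine contDiffOn_det fun k l => ?_
  by_cases hk : k = j
  · subst hk; simp only [Matrix.updateRow_self]; exact contDiffOn_const
  · simp only [Matrix.updateRow_ne hk]; exact h k l

theorem contDiffOn_trace_mul {M N : E → Matrix (Fin n) (Fin n) ℂ}
    (h : ∀ i j, ContDiffOn ℝ ∞ (fun z => M z i j) s)
    (h' : ∀ i j, ContDiffOn ℝ ∞ (fun z => N z i j) s) :
    ContDiffOn ℝ ∞ (fun z => (M z * N z).trace) s := by
  simp only [Matrix.trace, Matrix.diag_apply, Matrix.mul_apply]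
  exact ContDiffOn.sum fun i _ => ContDiffOn.sum fun j _ => (h _ _).mul (h' _ _)

end Matrices

section Families

variable {n : ℕ} {X : Type*} [TopologicalSpace X] [ChartedSpace (Cn n) X]
  {P G : Type*} [NormedAddCommGroup P] [NormedSpace ℝ P] [NormedAddCommGroup G] [NormedSpace ℝ G]

variable (n) in
/-- A smooth family of functions on `X`, parametrized by the set `S`. -/
def Fam (S : Set P) (F : P → X → G) : Prop :=
  ∀ p : X, ContDiffOn ℝ ∞ (fun z : Cn n × P => F z.2 ((chartAt (Cn n) p).symm z.1))
    ((chartAt (Cn n) p).target ×ˢ S)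

theorem ofReal_contDiff : ContDiff ℝ ∞ (fun x : ℝ => (x : ℂ)) := Complex.ofRealCLM.contDiff
theorem re_contDiff : ContDiff ℝ ∞ (fun x : ℂ => x.re) := Complex.reCLM.contDiff
theorem im_contDiff : ContDiff ℝ ∞ (fun x : ℂ => x.im) := Complex.imCLM.contDiff

namespace Fam

variable {S : Set P} {F F' : P → X → G}

theorem add (h : Fam n S F) (h' : Fam n S F') : Fam n S fun s x => F s x + F' s x :=
  fun p => (h p).add (h' p)

theorem sub (h : Fam n S F) (h' : Fam n S F') : Fam n S fun s x => F s x - F' s x :=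
  fun p => (h p).sub (h' p)

theorem mul {A : Type*} [NormedRing A] [NormedAlgebra ℝ A] {F F' : P → X → A}
    (h : Fam n S F) (h' : Fam n S F') : Fam n S fun s x => F s x * F' s x :=
  fun p => (h p).mul (h' p)

theorem div {A : Type*} [NormedField A] [NormedAlgebra ℝ A] {F F' : P → X → A}
    (h : Fam n S F) (h' : Fam n S F') (h0 : ∀ s ∈ S, ∀ x, F' s x ≠ 0) :
    Fam n S fun s x => F s x / F' s x :=
  fun p => contDiffOn_div (h p) (h' p) fun _ hz => h0 _ hz.2 _

theorem of_param {g : P → G} (hg : ContDiffOn ℝ ∞ g S) : Fam n S fun s (_ : X) => g s :=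
  fun _ => hg.comp contDiffOn_snd fun _ hz => hz.2

theorem const (c : G) : Fam n S fun _ (_ : X) => c := of_param contDiffOn_const

theorem ofReal {F : P → X → ℝ} (h : Fam n S F) : Fam n S fun s x => (F s x : ℂ) :=
  fun p => ofReal_contDiff.comp_contDiffOn (h p)

theorem re {F : P → X → ℂ} (h : Fam n S F) : Fam n S fun s x => (F s x).re :=
  fun p => re_contDiff.comp_contDiffOn (h p)

theorem im {F : P → X → ℂ} (h : Fam n S F) : Fam n S fun s x => (F s x).im :=
  fun p => im_contDiff.comp_contDiffOn (h p)

theorem comp {P' : Type*} [NormedAddCommGroup P'] [NormedSpace ℝ P'] {S' : Set P'} {g : P' → P}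
    (h : Fam n S F) (hg : ContDiffOn ℝ ∞ g S') (hm : MapsTo g S' S) :
    Fam n S' fun s x => F (g s) x :=
  fun p => (h p).comp (contDiffOn_fst.prodMk (hg.comp contDiffOn_snd fun _ hz => hz.2))
    fun _ hz => ⟨hz.1, hm hz.2⟩

theorem mono {S' : Set P} (h : Fam n S F) (hS : S' ⊆ S) : Fam n S' F :=
  h.comp contDiffOn_id hS

theorem isSm {F : P → X → ℝ} (h : Fam n S F) {s : P} (hs : s ∈ S) : IsSm (n := n) (F s) :=
  fun p => (h p).comp (contDiffOn_id.prodMk contDiffOn_const) fun _ hy => ⟨hy, hs⟩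

theorem _root_.DHYM.IsSm.fam {f : X → ℝ} (h : IsSm (n := n) f) : Fam n S fun _ => f :=
  fun p => (h p).comp contDiffOn_fst fun _ hz => hz.1

theorem deriv {S : Set ℝ} {F : ℝ → X → G} (hS : IsOpen S) (h : Fam n S F) :
    Fam n S fun s x => deriv (fun s => F s x) s :=
  fun p => contDiffOn_deriv_snd hS (h p)

theorem continuousOn (h : Fam n S F) : ContinuousOn (fun q : P × X => F q.1 q.2) (S ×ˢ univ) := by
  rintro ⟨s, x⟩ ⟨hs, -⟩
  have h1 := (h x).continuousOn (chartAt (Cn n) x x, s) ⟨mem_chart_target _ x, hs⟩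
  have h2 : ContinuousWithinAt (fun q : P × X => (chartAt (Cn n) x q.2, q.1)) (S ×ˢ univ) (s, x) :=
    ((ContinuousAt.comp (f := Prod.snd) ((chartAt (Cn n) x).continuousAt (mem_chart_source _ x))
      continuousAt_snd).prodMk continuousAt_fst).continuousWithinAt
  have h3 : (S ×ˢ univ) ∩ Prod.snd ⁻¹' (chartAt (Cn n) x).source ∈
      nhdsWithin (s, x) (S ×ˢ (univ : Set X)) :=
    inter_mem_nhdsWithin _ ((((chartAt (Cn n) x).open_source.preimage continuous_snd)).mem_nhds
      (mem_chart_source _ x))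
  have h4 := h1.comp (t := (chartAt (Cn n) x).target ×ˢ S)
    (s := (S ×ˢ univ) ∩ Prod.snd ⁻¹' (chartAt (Cn n) x).source) (x := (s, x))
    (h2.mono inter_subset_left) fun q hq => ⟨(chartAt (Cn n) x).map_source hq.2, hq.1.1⟩
  refine (h4.congr_of_mem (fun q hq => ?_) ⟨⟨hs, mem_univ _⟩, mem_chart_source _ x⟩).mono_of_mem_nhdsWithin h3
  simp [(chartAt (Cn n) x).left_inv hq.2]

theorem continuous {F : P → X → G} (h : Fam n S F) {s : P} (hs : s ∈ S) : Continuous (F s) := by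
  rw [← continuousOn_univ]
  exact h.continuousOn.comp (f := fun x => (s, x)) (by fun_prop) fun x _ => ⟨hs, mem_univ _⟩

theorem hasDerivAt {S : Set ℝ} {F : ℝ → X → G} (hS : IsOpen S) (h : Fam n S F) {s : ℝ} (hs : s ∈ S)
    (x : X) : HasDerivAt (fun s => F s x) (_root_.deriv (fun s => F s x) s) s := by
  have h1 : ContDiffOn ℝ ∞ (fun s => F s ((chartAt (Cn n) x).symm (chartAt (Cn n) x x))) S :=
    (h x).comp (contDiffOn_const.prodMk contDiffOn_id) fun _ ht => ⟨mem_chart_target _ x, ht⟩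
  rw [(chartAt (Cn n) x).left_inv (mem_chart_source _ x)] at h1
  exact ((h1.contDiffAt (hS.mem_nhds hs)).differentiableAt (by simp)).hasDerivAt

end Fam

theorem contDiffOn_formChart (α : ClosedRealForm11 n X) (p : X) (j k : Fin n) :
    ContDiffOn ℝ ∞ (fun y => formChart α p y j k) (chartAt (Cn n) p).target := by
  have h1 : ∀ u v : Cn n, ContDiffOn ℝ ∞ (fun y =>
      (pullbackTwoForm α.toForm (chartAt (Cn n) p) y ![u, v] : ℂ)) (chartAt (Cn n) p).target := by
    intro u v
    exact ofReal_contDiff.comp_contDiffOn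
      ((ContinuousAlternatingMap.apply ℝ (Cn n) ℝ ![u, v]).contDiff.comp_contDiffOn (α.smooth p))
  simp only [formChart, sesqMat, sesq, Matrix.of_apply]
  exact ((h1 _ _).sub (contDiffOn_const.mul (h1 _ _))).div_const _

theorem Fam.hessC {S : Set P} {F : P → X → ℝ} (h : Fam n S F) (p : X) (j k : Fin n) :
    ContDiffOn ℝ ∞ (fun z : Cn n × P => hessC (F z.2 ∘ (chartAt (Cn n) p).symm) z.1 j k)
      ((chartAt (Cn n) p).target ×ˢ S) := by
  have h1 := contDiffOn_fderiv_fst (chartAt (Cn n) p).open_target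
    (contDiffOn_fderiv_fst (chartAt (Cn n) p).open_target (h p))
  have h2 : ∀ u v : Cn n, ContDiffOn ℝ ∞ (fun z : Cn n × P =>
      (iddb (F z.2 ∘ (chartAt (Cn n) p).symm) z.1 u v : ℂ))
      ((chartAt (Cn n) p).target ×ˢ S) := fun u v =>
    ofReal_contDiff.comp_contDiffOn ((((h1.clm_apply contDiffOn_const).clm_apply
      contDiffOn_const).sub ((h1.clm_apply contDiffOn_const).clm_apply
      contDiffOn_const)).div_const _)
  simp only [DHYM.hessC, sesqMat, sesq, Matrix.of_apply]
  exact ((h2 _ _).sub (contDiffOn_const.mul (h2 _ _))).div_const _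

theorem Fam.cplxChart {S : Set P} {φ : P → X → ℝ} (h : Fam n S φ) (ω₀ α : ClosedRealForm11 n X)
    (p : X) (j k : Fin n) :
    ContDiffOn ℝ ∞ (fun z : Cn n × P => cplxChart ω₀ α (φ z.2 ∘ (chartAt (Cn n) p).symm) p z.1 j k)
      ((chartAt (Cn n) p).target ×ˢ S) := by
  have h1 : ∀ α : ClosedRealForm11 n X, ContDiffOn ℝ ∞ (fun z : Cn n × P => formChart α p z.1 j k)
      ((chartAt (Cn n) p).target ×ˢ S) := fun α =>
    (contDiffOn_formChart α p j k).comp contDiffOn_fst fun _ hz => hz.1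
  exact (h1 ω₀).add (contDiffOn_const.mul ((h1 α).add (h.hessC p j k)))

section Manifold

variable [IsManifold 𝓘(ℂ, Cn n) ω X]

omit [IsManifold 𝓘(ℂ, Cn n) ω X] in
theorem contDiffOn_det_formChart (ω₀ : KahlerForm n X) (p : X) {S : Set P} :
    ContDiffOn ℝ ∞ (fun z : Cn n × P => (formChart ω₀.toClosedRealForm11 p z.1).det)
      ((chartAt (Cn n) p).target ×ˢ S) :=
  (contDiffOn_det fun j k => contDiffOn_formChart _ p j k).comp contDiffOn_fst fun _ hz => hz.1

theorem Fam.ratio {S : Set P} {φ : P → X → ℝ} (h : Fam n S φ) (θ : ℝ) (ω₀ : KahlerForm n X)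
    (α : ClosedRealForm11 n X) : Fam n S fun s => ratio θ ω₀.toClosedRealForm11 α (φ s) := by
  intro p
  refine ContDiffOn.congr (contDiffOn_div (contDiffOn_const.mul (contDiffOn_det fun j k =>
    h.cplxChart ω₀.toClosedRealForm11 α p j k)) (contDiffOn_det_formChart ω₀ p)
    fun z hz => (formChart_posHerm p hz.1 ω₀).det_ne_zero)
    fun z hz => ratio_chart p hz.1 θ _ α (h.isSm hz.2)

theorem Fam.lin {S : Set P} {φ f : P → X → ℝ} (h : Fam n S φ) (hf : Fam n S f) (θ : ℝ)
    (ω₀ : KahlerForm n X) (α : ClosedRealForm11 n X) :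
    Fam n S fun s => lin θ ω₀.toClosedRealForm11 α (φ s) (f s) := by
  intro p
  refine ContDiffOn.congr (contDiffOn_div (contDiffOn_const.mul (contDiffOn_trace_mul
    (contDiffOn_adjugate fun j k => h.cplxChart ω₀.toClosedRealForm11 α p j k)
    fun j k => hf.hessC p j k)) (contDiffOn_det_formChart ω₀ p)
    fun z hz => (formChart_posHerm p hz.1 ω₀).det_ne_zero)
    fun z hz => lin_chart p hz.1 θ _ α (h.isSm hz.2) (hf.isSm hz.2)

end Manifold

theorem hasDerivAt_hessC {S : Set ℝ} {φ : ℝ → X → ℝ} (hS : IsOpen S) (h : Fam n S φ) {s : ℝ}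
    (hs : s ∈ S) (p : X) {y : Cn n} (hy : y ∈ (chartAt (Cn n) p).target) (j k : Fin n) :
    HasDerivAt (fun s => hessC (φ s ∘ (chartAt (Cn n) p).symm) y j k)
      (hessC ((fun x => deriv (fun s => φ s x) s) ∘ (chartAt (Cn n) p).symm) y j k) s := by
  have h1 := hasDerivAt_fderiv_fderiv_fst (chartAt (Cn n) p).open_target hS (h p) hy hs
  have h2 : ∀ u v : Cn n, HasDerivAt (fun s =>
      fderiv ℝ (fderiv ℝ (φ s ∘ (chartAt (Cn n) p).symm)) y u v)
      (fderiv ℝ (fderiv ℝ ((fun x => deriv (fun s => φ s x) s) ∘ (chartAt (Cn n) p).symm)) y u v)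
      s := fun u v => by
    have h3 := (h1.clm_apply (hasDerivAt_const s u)).clm_apply (hasDerivAt_const s v)
    simp only [map_zero, add_zero] at h3
    exact h3
  have h3 : ∀ u v : Cn n, HasDerivAt (fun s => (iddb (φ s ∘ (chartAt (Cn n) p).symm) y u v : ℂ))
      (iddb ((fun x => deriv (fun s => φ s x) s) ∘ (chartAt (Cn n) p).symm) y u v : ℂ) s :=
    fun u v => (((h2 _ _).sub (h2 _ _)).div_const 2).ofReal_comp
  exact ((h3 _ _).sub ((h3 _ _).const_mul _)).div_const _

variable [IsManifold 𝓘(ℂ, Cn n) ω X]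

/-- Jacobi's formula in the preferred chart at `x`. The factor `√-1` is the coefficient of the
Hessian in the matrix of `ω + √-1 α_φ`. -/
theorem hasDerivAt_ratio {S : Set ℝ} {φ : ℝ → X → ℝ} (hS : IsOpen S) (h : Fam n S φ) {s : ℝ}
    (hs : s ∈ S) (θ : ℝ) (ω₀ α : ClosedRealForm11 n X) (x : X) :
    HasDerivAt (fun s => ratio θ ω₀ α (φ s) x)
      (Complex.I * lin θ ω₀ α (φ s) (fun x => deriv (fun s => φ s x) s) x) s := by
  have hy := mem_chart_target (Cn n) x
  have hx : (chartAt (Cn n) x).symm (chartAt (Cn n) x x) = x :=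
    (chartAt (Cn n) x).left_inv (mem_chart_source _ x)
  have h0 := lin_chart x hy θ ω₀ α (h.isSm hs) ((h.deriv hS).isSm hs)
  rw [hx] at h0
  have h1 : ∀ j k, HasDerivAt (fun s => cplxChart ω₀ α (φ s ∘ (chartAt (Cn n) x).symm) x
      (chartAt (Cn n) x x) j k) ((Complex.I • hessC ((fun x => deriv (fun s => φ s x) s) ∘
        (chartAt (Cn n) x).symm) (chartAt (Cn n) x x)) j k) s := fun j k =>
    (((hasDerivAt_hessC hS h hs x hy j k).const_add _).const_mul Complex.I).const_add _
  have h2 := ((hasDerivAt_det h1).const_mul (phase θ)).div_const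
    (formChart ω₀ x (chartAt (Cn n) x x)).det
  rw [h0]
  refine (h2.congr_of_eventuallyEq ?_).congr_deriv ?_
  · filter_upwards [hS.mem_nhds hs] with t ht
    have := ratio_chart x hy θ ω₀ α (h.isSm ht)
    rwa [hx] at this
  · simp only [Matrix.mul_smul, Matrix.trace_smul, smul_eq_mul]
    ring

end Families

/-! ### The measure of `ωⁿ` -/

section Volume

variable {n : ℕ} {X : Type*} [TopologicalSpace X] [ChartedSpace (Cn n) X]

theorem continuousOn_dens (ω₀ : ClosedRealForm11 n X) (p : X) :
    ContinuousOn (dens ω₀ p) (chartAt (Cn n) p).target :=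
  continuousOn_const.mul (Complex.continuous_re.comp_continuousOn
    (contDiffOn_det fun j k => contDiffOn_formChart _ p j k).continuousOn)

/-- The real Jacobian of a holomorphic map is `|det|²` of its complex derivative, which is also the
factor by which `det W` changes. -/
theorem dens_transition [IsManifold 𝓘(ℂ, Cn n) ω X] (ω₀ : KahlerForm n X) (p q : X) {y : Cn n}
    (hy : y ∈ (chartAt (Cn n) p).target)
    (hq : (chartAt (Cn n) p).symm y ∈ (chartAt (Cn n) q).source) :
    dens ω₀.toClosedRealForm11 p y = |(fderiv ℝ (transition p q) y).det| *
      dens ω₀.toClosedRealForm11 q (transition p q y) := by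
  have hx : (chartAt (Cn n) q).symm (transition p q y) = (chartAt (Cn n) p).symm y :=
    (chartAt (Cn n) q).left_inv hq
  have hy' : transition p q y ∈ (chartAt (Cn n) q).target := (chartAt (Cn n) q).map_source hq
  set T := fderiv ℂ (transition p q) y with hT
  have h1 : (fderiv ℝ (transition p q) y).det =
      Complex.normSq (LinearMap.toMatrix' (T : Cn n →ₗ[ℂ] Cn n)).det := by
    rw [((contDiffAt_transition p q hy hq).differentiableAt (by simp)).fderiv_restrictScalars ℝ]
    change LinearMap.det ((T : Cn n →ₗ[ℂ] Cn n).restrictScalars ℝ) = _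
    rw [LinearMap.det_restrictScalars, Algebra.norm_complex_apply, LinearMap.det_toMatrix']
  have h2 : formChart ω₀.toClosedRealForm11 p y =
      (LinearMap.toMatrix' (T : Cn n →ₗ[ℂ] Cn n)).transpose *
        formChart ω₀.toClosedRealForm11 q (transition p q y) *
        (LinearMap.toMatrix' (T : Cn n →ₗ[ℂ] Cn n)).map (starRingEnd ℂ) := by
    rw [formChart, formChart, ← sesqMat_comp (isForm11_pullback q hy' _)]
    simp_rw [pullbackTwoForm_eq p hy, pullbackTwoForm_eq q hy', hx, chartMap_comp p q hy hq]
    rfl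
  rw [dens, dens, h2, det_conj_transform, h1, abs_of_nonneg (Complex.normSq_nonneg _),
    Complex.re_ofReal_mul]
  ring

variable [MeasurableSpace X] [BorelSpace X]

theorem measurableSet_chart_preimage (p : X) {B : Set X} (hB : MeasurableSet B) :
    MeasurableSet ((chartAt (Cn n) p).target ∩ (chartAt (Cn n) p).symm ⁻¹' B) := by
  have h1 : Measurable ((chartAt (Cn n) p).target.domRestrict (chartAt (Cn n) p).symm) :=
    (continuousOn_iff_continuous_domRestrict.1 (chartAt (Cn n) p).continuousOn_symm).measurable
  have h2 := (chartAt (Cn n) p).open_target.measurableSet.subtype_image (h1 hB)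
  convert h2 using 1
  ext y
  simp [Set.domRestrict, and_comm]

theorem aemeasurable_chart_symm (p : X) (μ : Measure (Cn n)) {A : Set (Cn n)}
    (hA : A ⊆ (chartAt (Cn n) p).target) :
    AEMeasurable (chartAt (Cn n) p).symm (μ.restrict A) :=
  ((chartAt (Cn n) p).continuousOn_symm.aemeasurable
    (chartAt (Cn n) p).open_target.measurableSet).mono_measure (Measure.restrict_mono_set _ hA)

/-- The measure of density `dens` in the chart at `p`. -/
noncomputable def chartMeasure (ω₀ : ClosedRealForm11 n X) (p : X) : Measure (Cn n) :=
  (volume : Measure (Cn n)).withDensity fun y => ENNReal.ofReal (dens ω₀ p y)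

variable [CompactSpace X]

theorem measurableSet_coverPiece (i : Fin (coverCard n X)) : MeasurableSet (coverPiece n X i) :=
  (chartAt (Cn n) (coverPt n X i)).open_source.measurableSet.diff
    (MeasurableSet.iUnion fun j => MeasurableSet.iUnion fun _ =>
      (chartAt (Cn n) (coverPt n X j)).open_source.measurableSet)

omit [MeasurableSpace X] [BorelSpace X] in
theorem image_coverPiece (i : Fin (coverCard n X)) :
    (chartAt (Cn n) (coverPt n X i)) '' coverPiece n X i =
      (chartAt (Cn n) (coverPt n X i)).target ∩
        (chartAt (Cn n) (coverPt n X i)).symm ⁻¹' coverPiece n X i :=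
  (chartAt (Cn n) (coverPt n X i)).image_eq_target_inter_inv_preimage sdiff_subset

omit [MeasurableSpace X] [BorelSpace X] in
theorem iUnion_coverPiece : ⋃ i, coverPiece n X i = univ := by
  refine eq_univ_of_forall fun x => ?_
  have h1 : ∃ i, x ∈ (chartAt (Cn n) (coverPt n X i)).source := by
    have := (exists_finite_chart_cover n X).choose_spec.choose_spec
    exact mem_iUnion.1 (this ▸ mem_univ x)
  have hw := WellFounded.has_min (wellFounded_lt (α := Fin (coverCard n X)))
    {i | x ∈ (chartAt (Cn n) (coverPt n X i)).source} h1
  obtain ⟨i, hi, hmin⟩ := hw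
  refine mem_iUnion.2 ⟨i, hi, ?_⟩
  simp only [mem_iUnion, not_exists]
  exact fun j hj hx => hmin j hx hj

omit [MeasurableSpace X] [BorelSpace X] in
theorem pairwise_disjoint_coverPiece : Pairwise (Function.onFun Disjoint (coverPiece n X)) := by
  have key : ∀ i j, i < j → Disjoint (coverPiece n X i) (coverPiece n X j) := by
    intro i j hij
    rw [Set.disjoint_left]
    intro x hx hx'
    exact hx'.2 (mem_iUnion₂.2 ⟨i, hij, hx.1⟩)
  intro i j hij
  rcases lt_or_gt_of_ne hij with h | h
  · exact key i j h
  · exact (key j i h).symm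

/-- The measure on `X` given by `ωⁿ`. -/
noncomputable def volX (ω₀ : ClosedRealForm11 n X) : Measure X :=
  ∑ i : Fin (coverCard n X), Measure.map (chartAt (Cn n) (coverPt n X i)).symm
    ((chartMeasure ω₀ (coverPt n X i)).restrict
      ((chartAt (Cn n) (coverPt n X i)) '' coverPiece n X i))

/-- `volX` is assembled from pieces in different charts. Changing variables on each piece by
`dens_transition` and summing shows that in any single chart it has density `dens`, independently of
the chosen cover. -/
theorem volX_chart [IsManifold 𝓘(ℂ, Cn n) ω X] (ω₀ : KahlerForm n X) (p : X) {B : Set X}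
    (hB : MeasurableSet B) :
    volX ω₀.toClosedRealForm11 (B ∩ (chartAt (Cn n) p).source) =
      ∫⁻ y in (chartAt (Cn n) p).target ∩ (chartAt (Cn n) p).symm ⁻¹' B,
        ENNReal.ofReal (dens ω₀.toClosedRealForm11 p y) := by
  set e := chartAt (Cn n) p with he
  set R : Fin (coverCard n X) → Set (Cn n) := fun i =>
    e.target ∩ e.symm ⁻¹' (coverPiece n X i ∩ B) with hR
  have hBs : MeasurableSet (B ∩ e.source) := hB.inter e.open_source.measurableSet
  have hRm : ∀ i, MeasurableSet (R i) := fun i =>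
    measurableSet_chart_preimage p ((measurableSet_coverPiece i).inter hB)
  have hpiece : ∀ i, Measure.map (chartAt (Cn n) (coverPt n X i)).symm
      ((chartMeasure ω₀.toClosedRealForm11 (coverPt n X i)).restrict
        ((chartAt (Cn n) (coverPt n X i)) '' coverPiece n X i)) (B ∩ e.source) =
      ∫⁻ y in R i, ENNReal.ofReal (dens ω₀.toClosedRealForm11 p y) := by
    intro i
    set q := coverPt n X i with hq
    set e' := chartAt (Cn n) q with he'
    have hsub : e' '' coverPiece n X i ⊆ e'.target := by
      rw [image_coverPiece]; exact inter_subset_left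
    have hAm : MeasurableSet (e' '' coverPiece n X i) := by
      rw [image_coverPiece]; exact measurableSet_chart_preimage q (measurableSet_coverPiece i)
    have himg : e'.symm ⁻¹' (B ∩ e.source) ∩ e' '' coverPiece n X i = transition p q '' R i := by
      ext z
      constructor
      · rintro ⟨⟨hzB, hzs⟩, x, hx, rfl⟩
        have hx' : e'.symm (e' x) = x := e'.left_inv hx.1
        rw [hx'] at hzB hzs
        exact ⟨e x, ⟨e.map_source hzs, by simpa [e.left_inv hzs] using ⟨hx, hzB⟩⟩,
          by simp [transition, ← he, e.left_inv hzs, ← he']⟩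
      · rintro ⟨y, ⟨hy, hyi, hyB⟩, rfl⟩
        have hx' : e'.symm (transition p q y) = e.symm y := e'.left_inv hyi.1
        exact ⟨by simpa [hx'] using ⟨hyB, e.map_target hy⟩, ⟨e.symm y, hyi, rfl⟩⟩
    have hZm : MeasurableSet (transition p q '' R i) := by
      have h2 : transition p q '' R i =
          (e'.target ∩ e'.symm ⁻¹' (B ∩ e.source)) ∩ e' '' coverPiece n X i := by
        rw [← himg]
        ext z
        exact ⟨fun h => ⟨⟨hsub h.2, h.1⟩, h.2⟩, fun h => ⟨h.1.2, h.2⟩⟩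
      rw [h2]
      exact (measurableSet_chart_preimage q hBs).inter hAm
    rw [Measure.map_apply_of_aemeasurable (aemeasurable_chart_symm q _ hsub) hBs,
      Measure.restrict_apply' hAm, himg, chartMeasure, withDensity_apply _ hZm,
      lintegral_image_eq_lintegral_abs_det_fderiv_mul volume (hRm i)
        (f' := fun y => fderiv ℝ (transition p q) y)]
    · refine setLIntegral_congr_fun (hRm i) fun y hy => ?_
      rw [dens_transition ω₀ p q hy.1 hy.2.1.1, ENNReal.ofReal_mul (abs_nonneg _)]
    · intro y hy
      exact (((contDiffAt_transition p q hy.1 hy.2.1.1).restrict_scalars ℝ).differentiableAt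
        (by simp)).hasFDerivAt.hasFDerivWithinAt
    · intro y hy z hz hyz
      have h1 := congrArg e'.symm hyz
      simp only [transition, Function.comp_apply] at h1
      rw [← he', ← he, e'.left_inv hy.2.1.1, e'.left_inv hz.2.1.1] at h1
      exact e.symm.injOn hy.1 hz.1 h1
  have hU : e.target ∩ e.symm ⁻¹' B = ⋃ i, R i := by
    simp only [hR, ← inter_iUnion, ← preimage_iUnion, ← iUnion_inter, iUnion_coverPiece, univ_inter]
  have hdisj : Pairwise (Function.onFun Disjoint R) := by
    intro i j hij
    have := pairwise_disjoint_coverPiece (n := n) (X := X) hij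
    rw [Function.onFun, Set.disjoint_left] at this ⊢
    exact fun y hy hy' => this hy.2.1 hy'.2.1
  rw [volX, Measure.finsetSum_apply, Finset.sum_congr rfl fun i _ => hpiece i, hU,
    lintegral_iUnion hRm hdisj, tsum_fintype]

variable [IsManifold 𝓘(ℂ, Cn n) ω X] (ω₀ : KahlerForm n X)

theorem volX_restrict_source (p : X) :
    (volX ω₀.toClosedRealForm11).restrict (chartAt (Cn n) p).source =
      Measure.map (chartAt (Cn n) p).symm
        ((chartMeasure ω₀.toClosedRealForm11 p).restrict (chartAt (Cn n) p).target) := by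
  ext B hB
  rw [Measure.restrict_apply hB, volX_chart ω₀ p hB,
    Measure.map_apply_of_aemeasurable (aemeasurable_chart_symm p _ Subset.rfl) hB,
    Measure.restrict_apply' (chartAt (Cn n) p).open_target.measurableSet, inter_comm _ (_ ⁻¹' B),
    chartMeasure, withDensity_apply]
  rw [inter_comm]
  exact measurableSet_chart_preimage p hB

instance isLocallyFiniteMeasure_volX : IsLocallyFiniteMeasure (volX ω₀.toClosedRealForm11) := by
  refine ⟨fun x => ?_⟩
  set e := chartAt (Cn n) x with he
  obtain ⟨r, hr, hball⟩ := Metric.nhds_basis_closedBall.mem_iff.1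
    (e.open_target.mem_nhds (mem_chart_target _ x))
  have hc : ContinuousOn (dens ω₀.toClosedRealForm11 x) (Metric.closedBall (e x) r) :=
    (continuousOn_dens _ x).mono hball
  refine ⟨e.source ∩ e ⁻¹' Metric.ball (e x) r, ?_, ?_⟩
  · exact (e.isOpen_inter_preimage Metric.isOpen_ball).mem_nhds
      ⟨mem_chart_source _ x, Metric.mem_ball_self hr⟩
  · have hB : MeasurableSet (e.source ∩ e ⁻¹' Metric.ball (e x) r) :=
      (e.isOpen_inter_preimage Metric.isOpen_ball).measurableSet
    have h1 := volX_chart ω₀ x hB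
    rw [inter_eq_left.2 inter_subset_left] at h1
    rw [h1]
    have h2 : e.target ∩ e.symm ⁻¹' (e.source ∩ e ⁻¹' Metric.ball (e x) r) ⊆
        Metric.closedBall (e x) r := by
      rintro y ⟨hy, -, hy'⟩
      rw [mem_preimage, e.right_inv hy] at hy'
      exact Metric.ball_subset_closedBall hy'
    refine (lintegral_mono_set h2).trans_lt ?_
    exact (hc.integrableOn_compact (isCompact_closedBall _ _)).lintegral_lt_top

/-- Needed to conclude that a continuous nonnegative function with zero integral vanishes at every
point. -/
instance isOpenPosMeasure_volX : (volX ω₀.toClosedRealForm11).IsOpenPosMeasure := by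
  refine ⟨fun U hU ⟨x, hx⟩ h0 => ?_⟩
  set e := chartAt (Cn n) x with he
  have h1 := volX_chart ω₀ x hU.measurableSet
  rw [measure_mono_null inter_subset_left h0, eq_comm] at h1
  have hopen : IsOpen (e.target ∩ e.symm ⁻¹' U) := e.symm.isOpen_inter_preimage hU
  have h2 : 0 < volume (e.target ∩ e.symm ⁻¹' U) :=
    hopen.measure_pos _ ⟨e x, mem_chart_target _ x, by
      simpa [he, (chartAt (Cn n) x).left_inv (mem_chart_source _ x)] using hx⟩
  have hm : AEMeasurable (fun y => ENNReal.ofReal (dens ω₀.toClosedRealForm11 x y))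
      (volume.restrict (e.target ∩ e.symm ⁻¹' U)) :=
    (((continuousOn_dens _ x).mono inter_subset_left).aemeasurable hopen.measurableSet).ennreal_ofReal
  rw [lintegral_eq_zero_iff' hm] at h1
  have h3 : ∀ᵐ y ∂(volume.restrict (e.target ∩ e.symm ⁻¹' U)), False := by
    filter_upwards [h1, ae_restrict_mem hopen.measurableSet] with y hy hy'
    have := dens_pos x hy'.1 ω₀
    simp only [Pi.zero_apply, ENNReal.ofReal_eq_zero] at hy
    linarith
  rw [ae_iff] at h3
  simp only [not_false_eq_true, ofPred_true, Measure.restrict_apply_univ] at h3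
  exact h2.ne' h3

variable {F : Type*} [NormedAddCommGroup F] [NormedSpace ℝ F] [SecondCountableTopology F]

omit [NormedSpace ℝ F] [SecondCountableTopology F] in
theorem integrable_volX {G : X → F} (hG : Continuous G) :
    Integrable G (volX ω₀.toClosedRealForm11) :=
  hG.integrable_of_hasCompactSupport (HasCompactSupport.of_compactSpace G)

omit [CompactSpace X] [IsManifold 𝓘(ℂ, Cn n) ω X] in
theorem integral_chartMeasure [IsManifold 𝓘(ℂ, Cn n) ω X] {G : X → F} (hG : Continuous G) (p : X)
    {A : Set (Cn n)} (hAm : MeasurableSet A) (hA : A ⊆ (chartAt (Cn n) p).target) :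
    ∫ x, G x ∂(Measure.map (chartAt (Cn n) p).symm
        ((chartMeasure ω₀.toClosedRealForm11 p).restrict A)) =
      ∫ y in A, dens ω₀.toClosedRealForm11 p y • G ((chartAt (Cn n) p).symm y) := by
  rw [integral_map (aemeasurable_chart_symm p _ hA) hG.aestronglyMeasurable, chartMeasure,
    restrict_withDensity hAm, integral_withDensity_eq_integral_toReal_smul₀]
  · refine setIntegral_congr_fun hAm fun y hy => ?_
    rw [ENNReal.toReal_ofReal (dens_pos p (hA hy) ω₀).le]
  · exact (((continuousOn_dens _ p).mono hA).aemeasurable hAm).ennreal_ofReal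
  · exact Filter.Eventually.of_forall fun _ => ENNReal.ofReal_lt_top

/-- The integral of a top degree form, as an integral against the measure of `ωⁿ`. -/
theorem integralX_eq {η : X → (Fin n × Fin 2 → Cn n) → F} {G : X → F} (hG : Continuous G)
    (h : ∀ p : X, ∀ y ∈ (chartAt (Cn n) p).target, η ((chartAt (Cn n) p).symm y)
      (fun q => dChartSymm (chartAt (Cn n) p) y (stdFrame n q)) =
        dens ω₀.toClosedRealForm11 p y • G ((chartAt (Cn n) p).symm y)) :
    integralX η = ∫ x, G x ∂(volX ω₀.toClosedRealForm11) := by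
  have hi := integrable_volX ω₀ hG
  rw [volX, integral_finsetSum_measure]
  · refine Finset.sum_congr rfl fun i _ => ?_
    have hsub : (chartAt (Cn n) (coverPt n X i)) '' coverPiece n X i ⊆
        (chartAt (Cn n) (coverPt n X i)).target := by
      rw [image_coverPiece]; exact inter_subset_left
    have hAm : MeasurableSet ((chartAt (Cn n) (coverPt n X i)) '' coverPiece n X i) := by
      rw [image_coverPiece]; exact measurableSet_chart_preimage _ (measurableSet_coverPiece i)
    rw [integral_chartMeasure ω₀ hG _ hAm hsub]
    exact setIntegral_congr_fun hAm fun y hy => h _ y (hsub hy)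
  · intro i hi'
    refine hi.mono_measure ?_
    rw [volX]
    exact Measure.le_iff.2 fun B _ => by
      rw [Measure.finsetSum_apply]
      exact Finset.single_le_sum (f := fun i => (Measure.map (chartAt (Cn n) (coverPt n X i)).symm
        ((chartMeasure ω₀.toClosedRealForm11 (coverPt n X i)).restrict
          ((chartAt (Cn n) (coverPt n X i)) '' coverPiece n X i))) B) (fun _ _ => zero_le) hi'

theorem setIntegral_source {G : X → F} (hG : Continuous G) (p : X) :
    ∫ x in (chartAt (Cn n) p).source, G x ∂(volX ω₀.toClosedRealForm11) =
      ∫ y in (chartAt (Cn n) p).target,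
        dens ω₀.toClosedRealForm11 p y • G ((chartAt (Cn n) p).symm y) := by
  rw [volX_restrict_source, integral_chartMeasure ω₀ hG p
    (chartAt (Cn n) p).open_target.measurableSet Subset.rfl]

end Volume

/-! ### Wirtinger derivatives -/

section Wirtinger

open Topology

variable {n : ℕ}

/-- The derivative `∂ / ∂ z_j`. -/
noncomputable def wz (j : Fin n) (F : Cn n → ℂ) (y : Cn n) : ℂ :=
  (fderiv ℝ F y (stdB j) - Complex.I * fderiv ℝ F y (Complex.I • stdB j)) / 2

/-- The derivative `∂ / ∂ z̄_j`. -/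
noncomputable def wzb (j : Fin n) (F : Cn n → ℂ) (y : Cn n) : ℂ :=
  (fderiv ℝ F y (stdB j) + Complex.I * fderiv ℝ F y (Complex.I • stdB j)) / 2

variable {F G : Cn n → ℂ} {y : Cn n} {j k : Fin n}

theorem wz_congr (h : F =ᶠ[𝓝 y] G) : wz j F y = wz j G y := by simp only [wz, h.fderiv_eq]

theorem wz_add (hF : DifferentiableAt ℝ F y) (hG : DifferentiableAt ℝ G y) :
    wz j (fun y => F y + G y) y = wz j F y + wz j G y := by
  simp only [wz, fderiv_fun_add hF hG, add_apply]; ring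

theorem wz_mul (hF : DifferentiableAt ℝ F y) (hG : DifferentiableAt ℝ G y) :
    wz j (fun y => F y * G y) y = F y * wz j G y + wz j F y * G y := by
  simp only [wz, fderiv_fun_mul hF hG, add_apply, smul_apply, smul_eq_mul]; ring

theorem wz_const_mul (c : ℂ) (hF : DifferentiableAt ℝ F y) :
    wz j (fun y => c * F y) y = c * wz j F y := by
  simp only [wz, fderiv_const_mul hF, smul_apply, smul_eq_mul]; ring

theorem wz_sum {ι : Type*} {s : Finset ι} {F : ι → Cn n → ℂ}
    (hF : ∀ i ∈ s, DifferentiableAt ℝ (F i) y) :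
    wz j (fun y => ∑ i ∈ s, F i y) y = ∑ i ∈ s, wz j (F i) y := by
  simp only [wz, fderiv_fun_sum hF, sum_apply, Finset.mul_sum,
    ← Finset.sum_sub_distrib, Finset.sum_div]

theorem wzb_eq_conj (hF : DifferentiableAt ℝ F y) :
    wzb j F y = (starRingEnd ℂ) (wz j (fun y => (starRingEnd ℂ) (F y)) y) := by
  have h1 : ∀ v, fderiv ℝ (fun y => (starRingEnd ℂ) (F y)) y v =
      (starRingEnd ℂ) (fderiv ℝ F y v) := fun v => by
    have := (Complex.conjCLE.toContinuousLinearMap.hasFDerivAt.comp y hF.hasFDerivAt).fderiv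
    exact (congrArg (fun T => T v) this)
  simp only [wz, wzb, h1]
  simp [Complex.conj_ofNat]

theorem wzb_add (hF : DifferentiableAt ℝ F y) (hG : DifferentiableAt ℝ G y) :
    wzb j (fun y => F y + G y) y = wzb j F y + wzb j G y := by
  simp only [wzb, fderiv_fun_add hF hG, add_apply]; ring

theorem wzb_const_mul (c : ℂ) (hF : DifferentiableAt ℝ F y) :
    wzb j (fun y => c * F y) y = c * wzb j F y := by
  simp only [wzb, fderiv_const_mul hF, smul_apply, smul_eq_mul]; ring

theorem wzb_mul (hF : DifferentiableAt ℝ F y) (hG : DifferentiableAt ℝ G y) :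
    wzb j (fun y => F y * G y) y = F y * wzb j G y + wzb j F y * G y := by
  simp only [wzb, fderiv_fun_mul hF hG, add_apply, smul_apply, smul_eq_mul]; ring

theorem wzb_sum {ι : Type*} {s : Finset ι} {F : ι → Cn n → ℂ}
    (hF : ∀ i ∈ s, DifferentiableAt ℝ (F i) y) :
    wzb j (fun y => ∑ i ∈ s, F i y) y = ∑ i ∈ s, wzb j (F i) y := by
  simp only [wzb, fderiv_fun_sum hF, sum_apply, Finset.mul_sum,
    ← Finset.sum_add_distrib, Finset.sum_div]

theorem contDiffOn_wz {U : Set (Cn n)} (hU : IsOpen U) (hF : ContDiffOn ℝ ∞ F U) :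
    ContDiffOn ℝ ∞ (wz j F) U := by
  have h1 : ContDiffOn ℝ ∞ (fderiv ℝ F) U := hF.fderiv_of_isOpen hU (by simp)
  exact ((h1.clm_apply contDiffOn_const).sub (contDiffOn_const.mul
    (h1.clm_apply contDiffOn_const))).div_const _

theorem contDiffOn_wzb {U : Set (Cn n)} (hU : IsOpen U) (hF : ContDiffOn ℝ ∞ F U) :
    ContDiffOn ℝ ∞ (wzb j F) U := by
  have h1 : ContDiffOn ℝ ∞ (fderiv ℝ F) U := hF.fderiv_of_isOpen hU (by simp)
  exact ((h1.clm_apply contDiffOn_const).add (contDiffOn_const.mul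
    (h1.clm_apply contDiffOn_const))).div_const _

theorem fderiv_fderiv_apply (hF : ContDiffAt ℝ 2 F y) (u v : Cn n) :
    fderiv ℝ (fun y => fderiv ℝ F y v) y u = fderiv ℝ (fderiv ℝ F) y u v := by
  have h2 : DifferentiableAt ℝ (fderiv ℝ F) y :=
    (hF.fderiv_right (m := 1) (by norm_num)).differentiableAt (by simp)
  have := (h2.hasFDerivAt.clm_apply (hasFDerivAt_const v y)).fderiv
  rw [this]; simp

theorem fderiv_fderiv_lin (hF : ContDiffAt ℝ 2 F y) (c d : ℂ) (u v w : Cn n) :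
    fderiv ℝ (fun y => (fderiv ℝ F y v + c * fderiv ℝ F y w) / d) y u =
      (fderiv ℝ (fderiv ℝ F) y u v + c * fderiv ℝ (fderiv ℝ F) y u w) / d := by
  have h2 : DifferentiableAt ℝ (fderiv ℝ F) y :=
    (hF.fderiv_right (m := 1) (by norm_num)).differentiableAt (by simp)
  have h3 : ∀ v, HasFDerivAt (fun y => fderiv ℝ F y v) (fderiv ℝ (fun y => fderiv ℝ F y v) y) y :=
    fun v => (h2.clm_apply (differentiableAt_const v)).hasFDerivAt
  have h4 := (((h3 v).add ((h3 w).const_mul c)).mul_const d⁻¹).fderiv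
  simp only [div_eq_mul_inv]
  refine (congrArg (fun T => T u) h4).trans ?_
  simp only [smul_apply, add_apply, fderiv_fderiv_apply hF, smul_eq_mul]
  ring

theorem wz_wzb (hF : ContDiffAt ℝ 2 F y) : wz j (wzb k F) y =
    (fderiv ℝ (fderiv ℝ F) y (stdB j) (stdB k) +
      Complex.I * fderiv ℝ (fderiv ℝ F) y (stdB j) (Complex.I • stdB k) -
      Complex.I * fderiv ℝ (fderiv ℝ F) y (Complex.I • stdB j) (stdB k) +
      fderiv ℝ (fderiv ℝ F) y (Complex.I • stdB j) (Complex.I • stdB k)) / 4 := by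
  have := fun u => fderiv_fderiv_lin hF Complex.I 2 u (stdB k) (Complex.I • stdB k)
  unfold wz wzb
  simp only [this]
  linear_combination
    (-fderiv ℝ (fderiv ℝ F) y (Complex.I • stdB j) (Complex.I • stdB k) / 4) * Complex.I_mul_I

theorem wzb_wz (hF : ContDiffAt ℝ 2 F y) : wzb k (wz j F) y = wz j (wzb k F) y := by
  have := fun u => fderiv_fderiv_lin hF (-Complex.I) 2 u (stdB j) (Complex.I • stdB j)
  simp only [neg_mul, ← sub_eq_add_neg] at this
  rw [wz_wzb hF]
  unfold wz wzb
  simp only [this]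
  have hs := hF.isSymmSndFDerivAt (by simp)
  rw [hs.eq (stdB k) (stdB j), hs.eq (Complex.I • stdB k) (stdB j),
    hs.eq (stdB k) (Complex.I • stdB j), hs.eq (Complex.I • stdB k) (Complex.I • stdB j)]
  linear_combination
    (-fderiv ℝ (fderiv ℝ F) y (Complex.I • stdB j) (Complex.I • stdB k) / 4) * Complex.I_mul_I

theorem wz_wz (hF : ContDiffAt ℝ 2 F y) : wz j (wz k F) y = wz k (wz j F) y := by
  have := fun j u => fderiv_fderiv_lin hF (-Complex.I) 2 u (stdB (n := n) j) (Complex.I • stdB j)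
  simp only [neg_mul, ← sub_eq_add_neg] at this
  unfold wz
  simp only [this]
  have hs := hF.isSymmSndFDerivAt (by simp)
  rw [hs.eq (stdB k) (stdB j), hs.eq (Complex.I • stdB k) (stdB j),
    hs.eq (stdB k) (Complex.I • stdB j), hs.eq (Complex.I • stdB k) (Complex.I • stdB j)]
  ring

theorem fderiv_ofReal {f : Cn n → ℝ} (hf : DifferentiableAt ℝ f y) (v : Cn n) :
    fderiv ℝ (fun y => (f y : ℂ)) y v = (fderiv ℝ f y v : ℂ) :=
  congrArg (fun T => T v) (Complex.ofRealCLM.hasFDerivAt.comp y hf.hasFDerivAt).fderiv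

theorem fderiv_fderiv_ofReal {f : Cn n → ℝ} (hf : ContDiffAt ℝ 2 f y) (u v : Cn n) :
    fderiv ℝ (fderiv ℝ (fun y => (f y : ℂ))) y u v = (fderiv ℝ (fderiv ℝ f) y u v : ℂ) := by
  have h1 : ContDiffAt ℝ 2 (fun y => (f y : ℂ)) y := Complex.ofRealCLM.contDiff.contDiffAt.comp y hf
  have h2 : DifferentiableAt ℝ (fderiv ℝ f) y :=
    (hf.fderiv_right (m := 1) (by norm_num)).differentiableAt (by simp)
  have h3 : (fun y => fderiv ℝ (fun y => (f y : ℂ)) y v) =ᶠ[𝓝 y] fun y => (fderiv ℝ f y v : ℂ) := by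
    filter_upwards [hf.eventually (by simp)] with z hz
    exact fderiv_ofReal (hz.differentiableAt (by simp)) v
  rw [← fderiv_fderiv_apply h1, h3.fderiv_eq,
    fderiv_ofReal (h2.clm_apply (differentiableAt_const v))]
  have := (h2.hasFDerivAt.clm_apply (hasFDerivAt_const v y)).fderiv
  rw [this]; simp

/-- The matrix of `√-1 ∂∂̄f` consists of the mixed Wirtinger derivatives, so closedness and
integration by parts can be treated by the calculus of `wz` and `wzb`. -/
theorem hessC_eq_wz {f : Cn n → ℝ} (hf : ContDiffAt ℝ 2 f y) :
    hessC f y j k = wz j (wzb k fun y => (f y : ℂ)) y := by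
  have h1 : ContDiffAt ℝ 2 (fun y => (f y : ℂ)) y := Complex.ofRealCLM.contDiff.contDiffAt.comp y hf
  have hneg : Complex.I • Complex.I • (stdB k : Cn n) = -stdB k := by
    rw [smul_smul, Complex.I_mul_I, neg_one_smul]
  rw [wz_wzb h1]
  simp only [fderiv_fderiv_ofReal hf, hessC, sesqMat, sesq, iddb, Matrix.of_apply, hneg, map_neg]
  push_cast
  ring

end Wirtinger

/-! ### The Piola identity -/

section Piola

open Topology

variable {n : ℕ} {M : Cn n → Matrix (Fin n) (Fin n) ℂ} {y : Cn n}

theorem hasDerivAt_line {F : Cn n → ℂ} (hF : DifferentiableAt ℝ F y) (v : Cn n) :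
    HasDerivAt (fun t : ℝ => F (y + t • v)) (fderiv ℝ F y v) 0 := by
  have h1 : HasFDerivAt F (fderiv ℝ F y) (y + (0 : ℝ) • v) := by simpa using hF.hasFDerivAt
  have h2 : HasDerivAt (fun t : ℝ => y + t • v) v 0 := by
    simpa using ((hasDerivAt_id (0 : ℝ)).smul_const v).const_add y
  exact h1.comp_hasDerivAt 0 h2

theorem fderiv_det (hM : ∀ i j, DifferentiableAt ℝ (fun y => M y i j) y)
    (hd : DifferentiableAt ℝ (fun y => (M y).det) y) (v : Cn n) :
    fderiv ℝ (fun y => (M y).det) y v =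
      ((M y).adjugate * Matrix.of fun i j => fderiv ℝ (fun y => M y i j) y v).trace := by
  have h1 := hasDerivAt_det (h := fun t : ℝ => M (y + t • v))
    (h' := Matrix.of fun i j => fderiv ℝ (fun y => M y i j) y v) fun i j => hasDerivAt_line (hM i j) v
  have h2 := (hasDerivAt_line hd v).unique h1
  simpa using h2

theorem wz_det (hM : ∀ i j, DifferentiableAt ℝ (fun y => M y i j) y)
    (hd : DifferentiableAt ℝ (fun y => (M y).det) y) (l : Fin n) :
    wz l (fun y => (M y).det) y =
      ((M y).adjugate * Matrix.of fun i j => wz l (fun y => M y i j) y).trace := by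
  simp only [wz, fderiv_det hM hd, Matrix.trace, Matrix.diag_apply, Matrix.mul_apply,
    Matrix.of_apply, Finset.mul_sum, ← Finset.sum_sub_distrib, Finset.sum_div]
  refine Finset.sum_congr rfl fun i _ => Finset.sum_congr rfl fun j _ => ?_
  ring

theorem differentiableAt_of_contDiffOn {E F : Type*} [NormedAddCommGroup E] [NormedSpace ℝ E]
    [NormedAddCommGroup F] [NormedSpace ℝ F] {f : E → F} {U : Set E} (hU : IsOpen U)
    (hf : ContDiffOn ℝ ∞ f U) {y : E} (hy : y ∈ U) : DifferentiableAt ℝ f y :=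
  (hf.contDiffAt (hU.mem_nhds hy)).differentiableAt (by simp)

/-- The adjugate of a matrix of functions satisfying the closedness condition is divergence
free. -/
theorem sum_wz_adjugate {U : Set (Cn n)} (hU : IsOpen U)
    (hM : ∀ i j, ContDiffOn ℝ ∞ (fun y => M y i j) U) (hy : y ∈ U) (hd : (M y).det ≠ 0)
    (hclosed : ∀ l p q, wz l (fun y => M y p q) y = wz p (fun y => M y l q) y) (k : Fin n) :
    ∑ l, wz l (fun y => (M y).adjugate k l) y = 0 := by
  have hMd := fun i j => differentiableAt_of_contDiffOn hU (hM i j) hy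
  have hdd := differentiableAt_of_contDiffOn hU (contDiffOn_det hM) hy
  have hAd := fun i j => differentiableAt_of_contDiffOn hU (contDiffOn_adjugate hM i j) hy
  refine piola (h := M y) (a := (M y).adjugate) (H := fun l => Matrix.of fun i j => wz l (fun y => M y i j) y)
    (A := fun l => Matrix.of fun i j => wz l (fun y => (M y).adjugate i j) y) hd (fun l => ?_)
    (fun l p q => hclosed l p q) k
  rw [← wz_det hMd hdd]
  ext i r
  -- Differentiating the entries of `M adj(M) = det(M) 1`, together with Jacobi's formula, gives the
  -- relation between the derivatives of `M` and of its adjugate that `piola` requires.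
  have e1 := wz_sum (j := l) (y := y) (s := Finset.univ)
    (F := fun q y => M y i q * (M y).adjugate q r) fun q _ => (hMd i q).fun_mul (hAd q r)
  have e2 := wz_const_mul (j := l) ((1 : Matrix (Fin n) (Fin n) ℂ) i r) hdd
  have e3 : (fun y => ∑ q, M y i q * (M y).adjugate q r) =
      fun y => (1 : Matrix (Fin n) (Fin n) ℂ) i r * (M y).det := by
    funext y
    rw [← Matrix.mul_apply, Matrix.mul_adjugate, Matrix.smul_apply, smul_eq_mul, mul_comm]
  rw [e3, e2] at e1
  change (∑ q, wz l (fun y => M y i q) y * (M y).adjugate q r) +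
    (∑ q, M y i q * wz l (fun y => (M y).adjugate q r) y) =
    wz l (fun y => (M y).det) y * (1 : Matrix (Fin n) (Fin n) ℂ) i r
  rw [mul_comm, e1, ← Finset.sum_add_distrib]
  refine Finset.sum_congr rfl fun q _ => ?_
  rw [wz_mul (hMd i q) (hAd q r)]
  ring

/-- The `∂`-version applied to the conjugate transpose, since conjugate transposition commutes with
the adjugate and conjugation exchanges `∂` and `∂̄`. -/
theorem sum_wzb_adjugate {U : Set (Cn n)} (hU : IsOpen U)
    (hM : ∀ i j, ContDiffOn ℝ ∞ (fun y => M y i j) U) (hy : y ∈ U) (hd : (M y).det ≠ 0)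
    (hclosed : ∀ l p q, wzb l (fun y => M y q p) y = wzb p (fun y => M y q l) y) (k : Fin n) :
    ∑ l, wzb l (fun y => (M y).adjugate l k) y = 0 := by
  have hc : ∀ i j, ContDiffOn ℝ ∞ (fun y => ((M y).conjTranspose) i j) U := fun i j =>
    Complex.conjCLE.contDiff.comp_contDiffOn (hM j i)
  have hMd := fun i j => differentiableAt_of_contDiffOn hU (hM i j) hy
  have hAd := fun i j => differentiableAt_of_contDiffOn hU (contDiffOn_adjugate hM i j) hy
  have h1 := sum_wz_adjugate (M := fun y => (M y).conjTranspose) hU hc hy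
    (by rw [Matrix.det_conjTranspose]; exact star_ne_zero.2 hd) (fun l p q => ?_) k
  · have h2 : ∀ l, wzb l (fun y => (M y).adjugate l k) y =
        (starRingEnd ℂ) (wz l (fun y => (M y).conjTranspose.adjugate k l) y) := by
      intro l
      rw [wzb_eq_conj (hAd l k)]
      simp only [← Matrix.adjugate_conjTranspose]
      rfl
    simp_rw [h2, ← map_sum, h1, map_zero]
  · have h3 := hclosed l p q
    rw [wzb_eq_conj (hMd q p), wzb_eq_conj (hMd q l)] at h3
    exact (starRingEnd ℂ).injective h3

end Piola

/-! ### Closed forms -/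

section Closed

open Topology

variable {n : ℕ} {X : Type*} [TopologicalSpace X] [ChartedSpace (Cn n) X]
  [IsManifold 𝓘(ℂ, Cn n) ω X] (α : ClosedRealForm11 n X) (p : X) {y : Cn n}
  (hy : y ∈ (chartAt (Cn n) p).target)
include hy

/-- A closed form of type `(1,1)` has `∂_l M_{a k̄} = ∂_a M_{l k̄}`. -/
theorem wz_formChart (l a k : Fin n) :
    wz l (fun y => formChart α p y a k) y = wz a (fun y => formChart α p y l k) y := by
  set U := (chartAt (Cn n) p).target with hU
  have hUo : IsOpen U := (chartAt (Cn n) p).open_target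
  set B := pullbackTwoForm α.toForm (chartAt (Cn n) p) with hB
  have hBd : DifferentiableAt ℝ B y := differentiableAt_of_contDiffOn hUo (α.smooth p) hy
  set D : Cn n → Cn n → Cn n → ℝ := fun u v w => fderiv ℝ (fun y => B y ![v, w]) y u with hD
  have hbd : ∀ v w, DifferentiableAt ℝ (fun y => B y ![v, w]) y := fun v w =>
    (ContinuousAlternatingMap.apply ℝ (Cn n) ℝ ![v, w]).differentiableAt.comp y hBd
  have hcl : ∀ u v w, D u v w - D v u w + D w u v = 0 := by
    intro u v w
    have h1 := extDeriv_apply hBd ![u, v, w]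
    rw [hB, α.closed p y hy] at h1
    have r0 : (0 : Fin 3).removeNth ![u, v, w] = ![v, w] := by ext i; fin_cases i <;> rfl
    have r1 : (1 : Fin 3).removeNth ![u, v, w] = ![u, w] := by ext i; fin_cases i <;> rfl
    have r2 : (2 : Fin 3).removeNth ![u, v, w] = ![u, v] := by ext i; fin_cases i <;> rfl
    rw [Fin.sum_univ_three, r0, r1, r2] at h1
    simp only [Fin.val_zero, pow_zero, one_smul, Fin.val_one, pow_one, Fin.val_two, even_two,
      Even.neg_pow, one_pow, neg_smul, Matrix.cons_val_zero, Matrix.cons_val_one,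
      Matrix.cons_val] at h1
    rw [sub_eq_add_neg]
    exact h1.symm
  have hform : ∀ z ∈ U, ∀ v w, B z ![Complex.I • v, w] = -B z ![v, Complex.I • w] ∧
      B z ![Complex.I • v, Complex.I • w] = B z ![v, w] := by
    intro z hz v w
    have h1 := (isForm11_pullback p hz α).I_left v w
    have h2 := (isForm11_pullback p hz α).type11 v w
    exact ⟨by exact_mod_cast h1, by exact_mod_cast h2⟩
  have hI : ∀ u v w, D u (Complex.I • v) w = -D u v (Complex.I • w) := by
    intro u v w
    have h1 : (fun y => B y ![Complex.I • v, w]) =ᶠ[𝓝 y] fun y => -B y ![v, Complex.I • w] := by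
      filter_upwards [hUo.mem_nhds hy] with z hz using (hform z hz v w).1
    simp only [hD, h1.fderiv_eq, fderiv_fun_neg, neg_apply]
  have hII : ∀ u v w, D u (Complex.I • v) (Complex.I • w) = D u v w := by
    intro u v w
    have h1 : (fun y => B y ![Complex.I • v, Complex.I • w]) =ᶠ[𝓝 y] fun y => B y ![v, w] := by
      filter_upwards [hUo.mem_nhds hy] with z hz using (hform z hz v w).2
    simp only [hD, h1.fderiv_eq]
  have hM : ∀ (a k : Fin n) (u : Cn n), fderiv ℝ (fun y => formChart α p y a k) y u =
      ((D u (stdB a) (Complex.I • stdB k) : ℂ) - Complex.I * (D u (stdB a) (stdB k) : ℂ)) / 2 := by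
    intro a k u
    have h1 : ∀ v w, HasFDerivAt (fun y => (B y ![v, w] : ℂ))
        (fderiv ℝ (fun y => (B y ![v, w] : ℂ)) y) y := fun v w =>
      (Complex.ofRealCLM.differentiableAt.comp y (hbd v w)).hasFDerivAt
    have h4 := (((h1 (stdB a) (Complex.I • stdB k)).sub
      ((h1 (stdB a) (stdB k)).const_mul Complex.I)).mul_const (2 : ℂ)⁻¹).fderiv
    refine (congrArg (fun T => T u) h4).trans ?_
    simp only [smul_apply, sub_apply, fderiv_ofReal (hbd _ _), smul_eq_mul, hD]
    ring
  simp only [wz, hM]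
  set el : Cn n := stdB l
  set ea : Cn n := stdB a
  set ek : Cn n := stdB k
  -- Closedness is a real identity on triples of vectors. The following four triples, combined with
  -- complex coefficients, isolate the component of type (2,1) of the differential.
  have c1 := hcl el ea (Complex.I • ek)
  have c2 := hcl el ea ek
  have c3 := hcl (Complex.I • el) (Complex.I • ea) ek
  have c4 := hcl (Complex.I • el) (Complex.I • ea) (Complex.I • ek)
  rw [hI, hI, hII] at c3
  rw [hII, hII, hII] at c4
  have c1' : (D el ea (Complex.I • ek) - D ea el (Complex.I • ek) +
    D (Complex.I • ek) el ea : ℂ) = 0 := by exact_mod_cast c1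
  have c2' : (D el ea ek - D ea el ek + D ek el ea : ℂ) = 0 := by exact_mod_cast c2
  have c3' : (-D (Complex.I • el) ea (Complex.I • ek) - -D (Complex.I • ea) el (Complex.I • ek) +
    D ek el ea : ℂ) = 0 := by exact_mod_cast c3
  have c4' : (D (Complex.I • el) ea ek - D (Complex.I • ea) el ek +
    D (Complex.I • ek) el ea : ℂ) = 0 := by exact_mod_cast c4
  linear_combination (1 / 4) * c1' - (Complex.I / 4) * c2' + (Complex.I / 4) * c3' -
    (1 / 4) * c4' + (1 / 4) * (D (Complex.I • el) ea ek - D (Complex.I • ea) el ek : ℂ) *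
    Complex.I_mul_I

theorem wzb_formChart (l a k : Fin n) :
    wzb l (fun y => formChart α p y k a) y = wzb a (fun y => formChart α p y k l) y := by
  have hUo : IsOpen (chartAt (Cn n) p).target := (chartAt (Cn n) p).open_target
  have hd := fun i j => differentiableAt_of_contDiffOn hUo (contDiffOn_formChart α p i j) hy
  have hc : ∀ i j, (fun y => (starRingEnd ℂ) (formChart α p y i j)) =ᶠ[𝓝 y]
      fun y => formChart α p y j i := by
    intro i j
    filter_upwards [hUo.mem_nhds hy] with z hz
    exact (formChart_isHermitian p hz α).apply j i
  rw [wzb_eq_conj (hd k a), wzb_eq_conj (hd k l), wz_congr (hc k a), wz_congr (hc k l),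
    wz_formChart α p hy]

omit hy in
omit [IsManifold 𝓘(ℂ, Cn n) ω X] in
theorem wz_hessC {f : Cn n → ℝ} {U : Set (Cn n)} (hU : IsOpen U) (hf : ContDiffOn ℝ ∞ f U)
    (hy : y ∈ U) (l a k : Fin n) :
    wz l (fun y => hessC f y a k) y = wz a (fun y => hessC f y l k) y := by
  have hF : ContDiffOn ℝ ∞ (fun y => (f y : ℂ)) U := ofReal_contDiff.comp_contDiffOn hf
  have h1 : ∀ a, (fun y => hessC f y a k) =ᶠ[𝓝 y] wz a (wzb k fun y => (f y : ℂ)) := by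
    intro a
    filter_upwards [hU.mem_nhds hy] with z hz
    exact hessC_eq_wz ((hf.contDiffAt (hU.mem_nhds hz)).of_le two_le_infty)
  rw [wz_congr (h1 a), wz_congr (h1 l)]
  exact wz_wz (((contDiffOn_wzb hU hF).contDiffAt (hU.mem_nhds hy)).of_le two_le_infty)

omit hy in
omit [IsManifold 𝓘(ℂ, Cn n) ω X] in
theorem wzb_hessC {f : Cn n → ℝ} {U : Set (Cn n)} (hU : IsOpen U) (hf : ContDiffOn ℝ ∞ f U)
    (hy : y ∈ U) (l a k : Fin n) :
    wzb l (fun y => hessC f y k a) y = wzb a (fun y => hessC f y k l) y := by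
  have hd : ∀ z ∈ U, ContDiffAt ℝ 2 f z := fun z hz =>
    (hf.contDiffAt (hU.mem_nhds hz)).of_le two_le_infty
  have hF : ContDiffOn ℝ ∞ (fun y => (f y : ℂ)) U := ofReal_contDiff.comp_contDiffOn hf
  have hs : ∀ i j, ContDiffOn ℝ ∞ (fun y => hessC f y i j) U := fun i j =>
    (contDiffOn_wz hU (contDiffOn_wzb hU hF)).congr fun z hz => hessC_eq_wz (hd z hz)
  have hc : ∀ i j, (fun y => (starRingEnd ℂ) (hessC f y i j)) =ᶠ[𝓝 y] fun y => hessC f y j i := by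
    intro i j
    filter_upwards [hU.mem_nhds hy] with z hz
    exact (sesqMat_isHermitian _ (isForm11_iddb (hd z hz))).apply j i
  have hdiff := fun i j => differentiableAt_of_contDiffOn hU (hs i j) hy
  rw [wzb_eq_conj (hdiff k a), wzb_eq_conj (hdiff k l), wz_congr (hc k a), wz_congr (hc k l),
    wz_hessC hU hf hy]

omit [IsManifold 𝓘(ℂ, Cn n) ω X] hy in
theorem contDiffOn_cplxChart (ω₀ : ClosedRealForm11 n X) {φ : X → ℝ} (hφ : IsSm (n := n) φ)
    (i j : Fin n) : ContDiffOn ℝ ∞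
      (fun y => cplxChart ω₀ α (φ ∘ (chartAt (Cn n) p).symm) p y i j) (chartAt (Cn n) p).target :=
  ((hφ.fam (S := (univ : Set ℝ))).cplxChart ω₀ α p i j).comp (f := fun y => (y, (0 : ℝ)))
    (contDiffOn_id.prodMk contDiffOn_const) fun _ hy => ⟨hy, mem_univ _⟩

theorem det_cplxChart_ne_zero (ω₀ : KahlerForm n X) {φ : X → ℝ} (hφ : IsSm (n := n) φ) :
    (cplxChart ω₀.toClosedRealForm11 α (φ ∘ (chartAt (Cn n) p).symm) p y).det ≠ 0 :=
  det_add_I_smul_ne_zero (formChart_posHerm p hy ω₀)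
    ((formChart_isHermitian p hy α).add (hessC_isHermitian p hy hφ))

/-- `ω`, `α` and `√-1 ∂∂̄φ` are all closed, hence so is their complex combination, and its matrix is
invertible. -/
theorem sum_wz_adjugate_cplxChart (ω₀ : KahlerForm n X) {φ : X → ℝ} (hφ : IsSm (n := n) φ)
    (k : Fin n) : ∑ l, wz l (fun y => (cplxChart ω₀.toClosedRealForm11 α
      (φ ∘ (chartAt (Cn n) p).symm) p y).adjugate k l) y = 0 := by
  have hUo : IsOpen (chartAt (Cn n) p).target := (chartAt (Cn n) p).open_target
  refine sum_wz_adjugate hUo (contDiffOn_cplxChart α p _ hφ) hy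
    (det_cplxChart_ne_zero α p hy ω₀ hφ) (fun l a b => ?_) k
  have hd := fun (α : ClosedRealForm11 n X) i j =>
    differentiableAt_of_contDiffOn hUo (contDiffOn_formChart α p i j) hy
  have hh : ∀ i j, DifferentiableAt ℝ (fun y => hessC (φ ∘ (chartAt (Cn n) p).symm) y i j) y :=
    fun i j => differentiableAt_of_contDiffOn hUo
    (((hφ.fam (S := (univ : Set ℝ))).hessC p i j).comp (f := fun y => (y, (0 : ℝ)))
      (contDiffOn_id.prodMk contDiffOn_const) fun _ hy => ⟨hy, mem_univ _⟩) hy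
  have key : ∀ l a, wz l (fun y => cplxChart ω₀.toClosedRealForm11 α
      (φ ∘ (chartAt (Cn n) p).symm) p y a b) y =
      wz l (fun y => formChart ω₀.toClosedRealForm11 p y a b) y + Complex.I *
        (wz l (fun y => formChart α p y a b) y +
          wz l (fun y => hessC (φ ∘ (chartAt (Cn n) p).symm) y a b) y) := by
    intro l a
    rw [← wz_add (hd _ _ _) (hh _ _), ← wz_const_mul _ ((hd _ _ _).fun_add (hh _ _)),
      ← wz_add (hd _ _ _) (((hd _ _ _).fun_add (hh _ _)).const_mul _)]
    rfl
  rw [key, key, wz_formChart _ p hy l a b, wz_formChart α p hy l a b, wz_hessC hUo (hφ p) hy]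

theorem sum_wzb_adjugate_cplxChart (ω₀ : KahlerForm n X) {φ : X → ℝ} (hφ : IsSm (n := n) φ)
    (k : Fin n) : ∑ l, wzb l (fun y => (cplxChart ω₀.toClosedRealForm11 α
      (φ ∘ (chartAt (Cn n) p).symm) p y).adjugate l k) y = 0 := by
  have hUo : IsOpen (chartAt (Cn n) p).target := (chartAt (Cn n) p).open_target
  refine sum_wzb_adjugate hUo (contDiffOn_cplxChart α p _ hφ) hy
    (det_cplxChart_ne_zero α p hy ω₀ hφ) (fun l a b => ?_) k
  have hd := fun (α : ClosedRealForm11 n X) i j =>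
    differentiableAt_of_contDiffOn hUo (contDiffOn_formChart α p i j) hy
  have hh : ∀ i j, DifferentiableAt ℝ (fun y => hessC (φ ∘ (chartAt (Cn n) p).symm) y i j) y :=
    fun i j => differentiableAt_of_contDiffOn hUo
    (((hφ.fam (S := (univ : Set ℝ))).hessC p i j).comp (f := fun y => (y, (0 : ℝ)))
      (contDiffOn_id.prodMk contDiffOn_const) fun _ hy => ⟨hy, mem_univ _⟩) hy
  have key : ∀ l a, wzb l (fun y => cplxChart ω₀.toClosedRealForm11 α
      (φ ∘ (chartAt (Cn n) p).symm) p y b a) y =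
      wzb l (fun y => formChart ω₀.toClosedRealForm11 p y b a) y + Complex.I *
        (wzb l (fun y => formChart α p y b a) y +
          wzb l (fun y => hessC (φ ∘ (chartAt (Cn n) p).symm) y b a) y) := by
    intro l a
    rw [← wzb_add (hd _ _ _) (hh _ _), ← wzb_const_mul _ ((hd _ _ _).fun_add (hh _ _)),
      ← wzb_add (hd _ _ _) (((hd _ _ _).fun_add (hh _ _)).const_mul _)]
    rfl
  rw [key, key, wzb_formChart _ p hy l a b, wzb_formChart α p hy l a b, wzb_hessC hUo (hφ p) hy]

end Closed

/-! ### Green's formula -/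

section Divergence

open Topology

variable {n : ℕ} {V : Cn n → ℂ} {U K : Set (Cn n)}

theorem contDiff_indicator (hU : IsOpen U) (hK : IsCompact K) (hKU : K ⊆ U)
    (hV : ContDiffOn ℝ ∞ V U) (h0 : ∀ y ∈ U \ K, V y = 0) : ContDiff ℝ ∞ (U.indicator V) := by
  rw [contDiff_iff_contDiffAt]
  intro y
  by_cases hy : y ∈ U
  · refine (hV.contDiffAt (hU.mem_nhds hy)).congr_of_eventuallyEq ?_
    filter_upwards [hU.mem_nhds hy] with z hz using indicator_of_mem hz V
  · refine (contDiffAt_const (c := (0 : ℂ))).congr_of_eventuallyEq ?_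
    filter_upwards [hK.isClosed.isOpen_compl.mem_nhds fun h => hy (hKU h)] with z hz
    by_cases hzU : z ∈ U
    · rw [indicator_of_mem hzU, h0 z ⟨hzU, hz⟩]
    · exact indicator_of_notMem hzU V

/-- The integral of a derivative of a compactly supported function vanishes. -/
theorem integrableOn_fderiv_and_integral_eq_zero (hU : IsOpen U) (hK : IsCompact K) (hKU : K ⊆ U)
    (hV : ContDiffOn ℝ ∞ V U) (h0 : ∀ y ∈ U \ K, V y = 0) (v : Cn n) :
    IntegrableOn (fun y => fderiv ℝ V y v) U ∧ ∫ y in U, fderiv ℝ V y v = 0 := by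
  set V' := U.indicator V with hV'
  have hc := contDiff_indicator hU hK hKU hV h0
  have hsupp : HasCompactSupport V' := by
    refine HasCompactSupport.intro hK fun y hy => ?_
    by_cases hyU : y ∈ U
    · rw [hV', indicator_of_mem hyU, h0 y ⟨hyU, hy⟩]
    · exact indicator_of_notMem hyU V
  have hfc : Continuous fun y => fderiv ℝ V' y v :=
    (hc.continuous_fderiv (by simp)).clm_apply continuous_const
  have hfi : Integrable fun y => fderiv ℝ V' y v :=
    hfc.integrable_of_hasCompactSupport (hsupp.fderiv_apply ℝ v)
  have heq : ∀ y ∈ U, fderiv ℝ V y v = fderiv ℝ V' y v := by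
    intro y hy
    have : V =ᶠ[𝓝 y] V' := by
      filter_upwards [hU.mem_nhds hy] with z hz using (indicator_of_mem hz V).symm
    rw [this.fderiv_eq]
  have hz : ∀ y, y ∉ U → fderiv ℝ V' y v = 0 := by
    intro y hy
    have : V' =ᶠ[𝓝 y] fun _ => (0 : ℂ) := by
      filter_upwards [hK.isClosed.isOpen_compl.mem_nhds fun h => hy (hKU h)] with z hz
      by_cases hzU : z ∈ U
      · rw [hV', indicator_of_mem hzU, h0 z ⟨hzU, hz⟩]
      · exact indicator_of_notMem hzU V
    rw [this.fderiv_eq]; simp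
  refine ⟨(integrableOn_congr_fun heq hU.measurableSet).2 hfi.integrableOn, ?_⟩
  rw [setIntegral_congr_fun hU.measurableSet heq, setIntegral_eq_integral_of_forall_compl_eq_zero hz]
  -- Integration by parts against the constant function `1`.
  have h1 := integral_smul_fderiv_eq_neg_fderiv_smul_of_integrable (μ := (volume : Measure (Cn n)))
    (f := fun _ => (1 : ℝ)) (g := V') (v := v) (by simp) (by simpa using hfi)
    (by simpa using hc.continuous.integrable_of_hasCompactSupport hsupp)
    (fun _ _ => differentiableAt_const _) (fun y _ => (hc.differentiable (by simp)) y)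
  simpa using h1

theorem integral_wz_eq_zero (hU : IsOpen U) (hK : IsCompact K) (hKU : K ⊆ U)
    (hV : ContDiffOn ℝ ∞ V U) (h0 : ∀ y ∈ U \ K, V y = 0) (j : Fin n) :
    IntegrableOn (wz j V) U ∧ ∫ y in U, wz j V y = 0 := by
  have h1 := integrableOn_fderiv_and_integral_eq_zero hU hK hKU hV h0 (stdB j)
  have h2 := integrableOn_fderiv_and_integral_eq_zero hU hK hKU hV h0 (Complex.I • stdB j)
  refine ⟨(h1.1.sub (h2.1.const_mul _)).div_const _, ?_⟩
  simp only [wz]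
  rw [integral_div, integral_sub h1.1 (h2.1.const_mul _), integral_const_mul, h1.2, h2.2]
  simp

theorem integral_wzb_eq_zero (hU : IsOpen U) (hK : IsCompact K) (hKU : K ⊆ U)
    (hV : ContDiffOn ℝ ∞ V U) (h0 : ∀ y ∈ U \ K, V y = 0) (j : Fin n) :
    IntegrableOn (wzb j V) U ∧ ∫ y in U, wzb j V y = 0 := by
  have h1 := integrableOn_fderiv_and_integral_eq_zero hU hK hKU hV h0 (stdB j)
  have h2 := integrableOn_fderiv_and_integral_eq_zero hU hK hKU hV h0 (Complex.I • stdB j)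
  refine ⟨(h1.1.add (h2.1.const_mul _)).div_const _, ?_⟩
  simp only [wzb]
  rw [integral_div, integral_add h1.1 (h2.1.const_mul _), integral_const_mul, h1.2, h2.2]
  simp

/-- Green's formula in a domain of `ℂⁿ`, for a divergence free matrix `a`. -/
theorem green_domain (hU : IsOpen U) (hK : IsCompact K) (hKU : K ⊆ U)
    {a : Cn n → Matrix (Fin n) (Fin n) ℂ} (ha : ∀ i j, ContDiffOn ℝ ∞ (fun y => a y i j) U)
    (ha1 : ∀ y ∈ U, ∀ k, ∑ l, wz l (fun y => a y k l) y = 0)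
    (ha2 : ∀ y ∈ U, ∀ k, ∑ l, wzb l (fun y => a y l k) y = 0) {f g : Cn n → ℝ}
    (hf : ContDiffOn ℝ ∞ f U) (hg : ContDiffOn ℝ ∞ g U) (h0 : ∀ y ∈ U \ K, f y = 0) :
    ∫ y in U, ((f y : ℂ) * (a y * hessC g y).trace - (g y : ℂ) * (a y * hessC f y).trace) = 0 := by
  set F : Cn n → ℂ := fun y => (f y : ℂ) with hF
  set G : Cn n → ℂ := fun y => (g y : ℂ) with hG
  have hFs : ContDiffOn ℝ ∞ F U := ofReal_contDiff.comp_contDiffOn hf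
  have hGs : ContDiffOn ℝ ∞ G U := ofReal_contDiff.comp_contDiffOn hg
  have hF0 : ∀ y ∈ U \ K, F =ᶠ[𝓝 y] fun _ => 0 := by
    intro y hy
    filter_upwards [(hU.sdiff hK.isClosed).mem_nhds hy] with z hz
    simp [hF, h0 z hz]
  have hV := fun j => integral_wz_eq_zero hU hK hKU
    (V := fun y => ∑ k, F y * (a y k j * wzb k G y))
    (ContDiffOn.sum fun k _ => hFs.mul ((ha k j).mul (contDiffOn_wzb hU hGs)))
    (fun y hy => by simp [(hF0 y hy).eq_of_nhds]) j
  have hV' := fun k => integral_wzb_eq_zero hU hK hKU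
    (V := fun y => ∑ j, G y * (a y k j * wz j F y))
    (ContDiffOn.sum fun j _ => hGs.mul ((ha k j).mul (contDiffOn_wz hU hFs)))
    (fun y hy => by
      have h1 : ∀ j, wz j F y = 0 := fun j => by rw [wz_congr (hF0 y hy)]; simp [wz]
      simp [h1]) k
  -- The integrand is the divergence `∂_j(F a_{kj} ∂̄_k G) - ∂̄_k(G a_{kj} ∂_j F)`: the products of
  -- first derivatives of `F` and `G` cancel, and the derivatives of `a` sum to zero. Both vector
  -- fields are supported in `K`, since `F` is.
  have key : ∀ y ∈ U, F y * (a y * hessC g y).trace - G y * (a y * hessC f y).trace =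
      ∑ j, wz j (fun y => ∑ k, F y * (a y k j * wzb k G y)) y -
        ∑ k, wzb k (fun y => ∑ j, G y * (a y k j * wz j F y)) y := by
    intro y hy
    have dF := differentiableAt_of_contDiffOn hU hFs hy
    have dG := differentiableAt_of_contDiffOn hU hGs hy
    have da := fun k j => differentiableAt_of_contDiffOn hU (ha k j) hy
    have dzF := fun j => differentiableAt_of_contDiffOn hU (contDiffOn_wz (j := j) hU hFs) hy
    have dzG := fun j => differentiableAt_of_contDiffOn hU (contDiffOn_wzb (j := j) hU hGs) hy
    have e1 : ∀ j, wz j (fun y => ∑ k, F y * (a y k j * wzb k G y)) y =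
        ∑ k, (F y * (a y k j * wz j (wzb k G) y) + F y * wzb k G y * wz j (fun y => a y k j) y +
          wz j F y * (a y k j * wzb k G y)) := by
      intro j
      rw [wz_sum fun k _ => dF.fun_mul ((da k j).fun_mul (dzG k))]
      refine Finset.sum_congr rfl fun k _ => ?_
      rw [wz_mul dF ((da k j).fun_mul (dzG k)), wz_mul (da k j) (dzG k)]
      ring
    have e2 : ∀ k, wzb k (fun y => ∑ j, G y * (a y k j * wz j F y)) y =
        ∑ j, (G y * (a y k j * wz j (wzb k F) y) + G y * wz j F y * wzb k (fun y => a y k j) y +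
          wzb k G y * (a y k j * wz j F y)) := by
      intro k
      rw [wzb_sum fun j _ => dG.fun_mul ((da k j).fun_mul (dzF j))]
      refine Finset.sum_congr rfl fun j _ => ?_
      rw [wzb_mul dG ((da k j).fun_mul (dzF j)), wzb_mul (da k j) (dzF j),
        wzb_wz ((hFs.contDiffAt (hU.mem_nhds hy)).of_le two_le_infty)]
      ring
    have m1 : ∑ j, ∑ k, F y * wzb k G y * wz j (fun y => a y k j) y = 0 := by
      rw [Finset.sum_comm]
      refine Finset.sum_eq_zero fun k _ => ?_
      rw [← Finset.mul_sum, ha1 y hy, mul_zero]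
    have m2 : ∑ k, ∑ j, G y * wz j F y * wzb k (fun y => a y k j) y = 0 := by
      rw [Finset.sum_comm]
      refine Finset.sum_eq_zero fun j _ => ?_
      rw [← Finset.mul_sum, ha2 y hy, mul_zero]
    have tr : ∀ (H : Cn n → ℝ), ContDiffOn ℝ ∞ H U → (a y * hessC H y).trace =
        ∑ k, ∑ j, a y k j * wz j (wzb k fun y => (H y : ℂ)) y := by
      intro H hH
      rw [Matrix.trace]
      refine Finset.sum_congr rfl fun k _ => ?_
      rw [Matrix.diag_apply, Matrix.mul_apply]
      refine Finset.sum_congr rfl fun j _ => ?_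
      rw [hessC_eq_wz ((hH.contDiffAt (hU.mem_nhds hy)).of_le two_le_infty)]
    simp only [e1, e2, Finset.sum_add_distrib, m1, m2, tr g hg, tr f hf, Finset.mul_sum]
    rw [Finset.sum_comm (f := fun j k => F y * (a y k j * wz j (wzb k G) y)),
      Finset.sum_comm (f := fun j k => wz j F y * (a y k j * wzb k G y))]
    have m3 : ∑ k, ∑ j, wz j F y * (a y k j * wzb k G y) =
        ∑ k, ∑ j, wzb k G y * (a y k j * wz j F y) :=
      Finset.sum_congr rfl fun k _ => Finset.sum_congr rfl fun j _ => by ring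
    rw [m3]
    ring
  rw [setIntegral_congr_fun hU.measurableSet key, integral_sub, integral_finsetSum,
    integral_finsetSum]
  · simp only [(hV _).2, (hV' _).2, Finset.sum_const_zero, sub_zero]
  · exact fun k _ => (hV' k).1
  · exact fun k _ => (hV k).1
  · exact integrable_finsetSum _ fun k _ => (hV k).1
  · exact integrable_finsetSum _ fun k _ => (hV' k).1

end Divergence

/-! ### Symmetry of the linearized operator on `X` -/

section Green

open Topology

variable {n : ℕ} {X : Type*} [TopologicalSpace X] [ChartedSpace (Cn n) X]

theorem hessAt_congr {f g : X → ℝ} {x : X} (h : f =ᶠ[𝓝 x] g) :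
    (hessAt f x : Matrix (Fin n) (Fin n) ℂ) = hessAt g x := by
  have h1 : f ∘ (chartAt (Cn n) x).symm =ᶠ[𝓝 (chartAt (Cn n) x x)]
      g ∘ (chartAt (Cn n) x).symm := by
    have hc := (chartAt (Cn n) x).continuousAt_symm (mem_chart_target _ x)
    rw [ContinuousAt, (chartAt (Cn n) x).left_inv (mem_chart_source _ x)] at hc
    exact hc.eventually h
  have h2 : ∀ u v, iddbar 𝓘(ℝ, Cn n) f x u v = iddbar 𝓘(ℝ, Cn n) g x u v := fun u v =>
    iddb_congr h1 u v
  simp only [hessAt, h2]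

theorem iddbar_add {f g : X → ℝ} (hf : IsSm (n := n) f) (hg : IsSm (n := n) g) (x : X)
    (u v : Cn n) : iddbar 𝓘(ℝ, Cn n) (fun x => f x + g x) x u v =
      iddbar 𝓘(ℝ, Cn n) f x u v + iddbar 𝓘(ℝ, Cn n) g x u v := by
  have h1 := hf.contDiffAt_self x
  have h2 := hg.contDiffAt_self x
  have h3 : fderiv ℝ (fun y => (f ∘ (chartAt (Cn n) x).symm) y + (g ∘ (chartAt (Cn n) x).symm) y)
      =ᶠ[𝓝 (chartAt (Cn n) x x)] fun y => fderiv ℝ (f ∘ (chartAt (Cn n) x).symm) y +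
        fderiv ℝ (g ∘ (chartAt (Cn n) x).symm) y := by
    filter_upwards [h1.eventually (by simp), h2.eventually (by simp)] with z hz hz'
    exact fderiv_fun_add (hz.differentiableAt (by simp)) (hz'.differentiableAt (by simp))
  have d1 : DifferentiableAt ℝ (fderiv ℝ (f ∘ (chartAt (Cn n) x).symm)) (chartAt (Cn n) x x) :=
    (h1.fderiv_right (m := 1) (by norm_num)).differentiableAt (by simp)
  have d2 : DifferentiableAt ℝ (fderiv ℝ (g ∘ (chartAt (Cn n) x).symm)) (chartAt (Cn n) x x) :=
    (h2.fderiv_right (m := 1) (by norm_num)).differentiableAt (by simp)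
  change iddb (fun y => (f ∘ (chartAt (Cn n) x).symm) y + (g ∘ (chartAt (Cn n) x).symm) y) _ u v =
    iddb (f ∘ (chartAt (Cn n) x).symm) _ u v + iddb (g ∘ (chartAt (Cn n) x).symm) _ u v
  change _ = iddb (f ∘ (chartAt (Cn n) x).symm) (chartAt (Cn n) x x) u v +
    iddb (g ∘ (chartAt (Cn n) x).symm) (chartAt (Cn n) x x) u v
  change iddb _ (chartAt (Cn n) x x) u v = _
  simp only [iddb, h3.fderiv_eq, fderiv_fun_add d1 d2, add_apply]
  ring

theorem hessAt_add {f g : X → ℝ} (hf : IsSm (n := n) f) (hg : IsSm (n := n) g) (x : X) :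
    (hessAt (fun x => f x + g x) x : Matrix (Fin n) (Fin n) ℂ) = hessAt f x + hessAt g x := by
  simp only [hessAt, iddbar_add hf hg, Complex.ofReal_add, sesqMat_add]

theorem lin_add (θ : ℝ) (ω₀ α : ClosedRealForm11 n X) (φ : X → ℝ) {f g : X → ℝ}
    (hf : IsSm (n := n) f) (hg : IsSm (n := n) g) (x : X) :
    lin θ ω₀ α φ (fun x => f x + g x) x = lin θ ω₀ α φ f x + lin θ ω₀ α φ g x := by
  simp only [lin, hessAt_add hf hg, Matrix.mul_add, Matrix.trace_add]
  ring

theorem isSm_of_contMDiff {f : X → ℝ} [IsManifold 𝓘(ℝ, Cn n) ∞ X]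
    (hf : ContMDiff 𝓘(ℝ, Cn n) 𝓘(ℝ, ℝ) ∞ f) : IsSm (n := n) f := by
  intro p
  have h1 : ContMDiffOn 𝓘(ℝ, Cn n) 𝓘(ℝ, Cn n) ∞ (chartAt (Cn n) p).symm (chartAt (Cn n) p).target :=
    contMDiffOn_chart_symm
  exact (hf.comp_contMDiffOn h1).contDiffOn

theorem IsSm.mul {f g : X → ℝ} (hf : IsSm (n := n) f) (hg : IsSm (n := n) g) :
    IsSm (n := n) fun x => f x * g x := fun p => (hf p).mul (hg p)

theorem IsSm.add {f g : X → ℝ} (hf : IsSm (n := n) f) (hg : IsSm (n := n) g) :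
    IsSm (n := n) fun x => f x + g x := fun p => (hf p).add (hg p)

theorem IsSm.sum {ι : Type*} {s : Finset ι} {f : ι → X → ℝ} (hf : ∀ i, IsSm (n := n) (f i)) :
    IsSm (n := n) fun x => ∑ i ∈ s, f i x := fun p => ContDiffOn.sum fun i _ => hf i p

theorem lin_zero (θ : ℝ) (ω₀ α : ClosedRealForm11 n X) (φ : X → ℝ) {f : X → ℝ} {x : X}
    (hf : f =ᶠ[𝓝 x] fun _ => 0) : lin θ ω₀ α φ f x = 0 := by
  have h1 : (hessAt (fun _ : X => (0 : ℝ)) x : Matrix (Fin n) (Fin n) ℂ) = 0 := by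
    have h2 : ∀ u v, iddbar 𝓘(ℝ, Cn n) (fun _ : X => (0 : ℝ)) x u v = 0 := by
      intro u v
      simp [iddbar, Function.comp_def]
    ext j k
    simp [hessAt, sesqMat, sesq, h2]
  rw [lin, hessAt_congr hf, h1]; simp

theorem lin_sum (θ : ℝ) (ω₀ α : ClosedRealForm11 n X) (φ : X → ℝ) {ι : Type*} (s : Finset ι)
    {f : ι → X → ℝ} (hf : ∀ i, IsSm (n := n) (f i)) (x : X) :
    lin θ ω₀ α φ (fun x => ∑ i ∈ s, f i x) x = ∑ i ∈ s, lin θ ω₀ α φ (f i) x := by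
  classical
  induction s using Finset.induction_on with
  | empty => simpa using lin_zero θ ω₀ α φ (f := fun _ => 0) (x := x) (Filter.EventuallyEq.refl _ _)
  | insert i s hi ih =>
    simp only [Finset.sum_insert hi]
    rw [lin_add θ ω₀ α φ (hf i) (IsSm.sum hf), ih]

variable [IsManifold 𝓘(ℂ, Cn n) ω X]

omit [IsManifold 𝓘(ℂ, Cn n) ω X] in
theorem IsSm.continuous {f : X → ℝ} (hf : IsSm (n := n) f) : Continuous f :=
  (hf.fam (S := (univ : Set ℝ))).continuous (mem_univ 0)

theorem continuous_lin (θ : ℝ) (ω₀ : KahlerForm n X) (α : ClosedRealForm11 n X) {φ f : X → ℝ}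
    (hφ : IsSm (n := n) φ) (hf : IsSm (n := n) f) :
    Continuous (lin θ ω₀.toClosedRealForm11 α φ f) :=
  ((hφ.fam (S := (univ : Set ℝ))).lin hf.fam θ ω₀ α).continuous (mem_univ 0)

theorem continuous_ratio (θ : ℝ) (ω₀ : KahlerForm n X) (α : ClosedRealForm11 n X) {φ : X → ℝ}
    (hφ : IsSm (n := n) φ) : Continuous (ratio θ ω₀.toClosedRealForm11 α φ) :=
  ((hφ.fam (S := (univ : Set ℝ))).ratio θ ω₀ α).continuous (mem_univ 0)

variable [CompactSpace X] [MeasurableSpace X] [BorelSpace X]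

omit [CompactSpace X] [MeasurableSpace X] [BorelSpace X] in
theorem dens_mul_div (ω₀ : KahlerForm n X) (p : X) {y : Cn n}
    (hy : y ∈ (chartAt (Cn n) p).target) (c : ℂ) :
    (dens ω₀.toClosedRealForm11 p y : ℂ) * (c / (formChart ω₀.toClosedRealForm11 p y).det) =
      (n.factorial * 2 ^ n : ℝ) * c := by
  have h2 := formChart_posHerm p hy ω₀
  have h3 : ((formChart ω₀.toClosedRealForm11 p y).det.re : ℂ) =
      (formChart ω₀.toClosedRealForm11 p y).det := by
    apply Complex.ext <;> simp [h2.det_pos.2]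
  have := h2.det_ne_zero
  rw [dens]
  push_cast
  rw [h3]
  field_simp

/-- It is enough to localize one of the two functions. In the chart, the denominator of `lin`
cancels against the density of the measure, and what remains is a constant multiple of the integrand
of `green_domain`. -/
theorem green_of_tsupport (θ : ℝ) (ω₀ : KahlerForm n X) (α : ClosedRealForm11 n X) {φ f g : X → ℝ}
    (hφ : IsSm (n := n) φ) (hf : IsSm (n := n) f) (hg : IsSm (n := n) g) (p : X)
    (hsupp : tsupport f ⊆ (chartAt (Cn n) p).source) :
    ∫ x, ((f x : ℂ) * lin θ ω₀.toClosedRealForm11 α φ g x -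
      (g x : ℂ) * lin θ ω₀.toClosedRealForm11 α φ f x) ∂(volX ω₀.toClosedRealForm11) = 0 := by
  set e := chartAt (Cn n) p with he
  have hcont : Continuous fun x => (f x : ℂ) * lin θ ω₀.toClosedRealForm11 α φ g x -
      (g x : ℂ) * lin θ ω₀.toClosedRealForm11 α φ f x :=
    ((Complex.continuous_ofReal.comp hf.continuous).mul (continuous_lin θ ω₀ α hφ hg)).sub
      ((Complex.continuous_ofReal.comp hg.continuous).mul (continuous_lin θ ω₀ α hφ hf))
  rw [← setIntegral_eq_integral_of_forall_compl_eq_zero (s := e.source), setIntegral_source ω₀ hcont]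
  · have hK : IsCompact (e '' tsupport f) :=
      (isClosed_tsupport f).isCompact.image_of_continuousOn (e.continuousOn.mono hsupp)
    have hKU : e '' tsupport f ⊆ e.target := by
      rintro _ ⟨x, hx, rfl⟩; exact e.map_source (hsupp hx)
    have h0 : ∀ y ∈ e.target \ e '' tsupport f, (f ∘ e.symm) y = 0 := by
      intro y hy
      by_contra h
      exact hy.2 ⟨e.symm y, subset_tsupport f h, e.right_inv hy.1⟩
    have h1 := green_domain (K := e '' tsupport f) e.open_target hK hKU
      (contDiffOn_adjugate (contDiffOn_cplxChart α p ω₀.toClosedRealForm11 hφ))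
      (fun y hy k => sum_wz_adjugate_cplxChart α p hy ω₀ hφ k)
      (fun y hy k => sum_wzb_adjugate_cplxChart α p hy ω₀ hφ k) (hf p) (hg p) h0
    have h2 : ∀ y ∈ e.target, dens ω₀.toClosedRealForm11 p y •
        ((f (e.symm y) : ℂ) * lin θ ω₀.toClosedRealForm11 α φ g (e.symm y) -
          (g (e.symm y) : ℂ) * lin θ ω₀.toClosedRealForm11 α φ f (e.symm y)) =
        ((n.factorial * 2 ^ n : ℝ) * phase θ : ℂ) * (((f ∘ e.symm) y : ℂ) *
          ((cplxChart ω₀.toClosedRealForm11 α (φ ∘ e.symm) p y).adjugate *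
            hessC (g ∘ e.symm) y).trace - ((g ∘ e.symm) y : ℂ) *
          ((cplxChart ω₀.toClosedRealForm11 α (φ ∘ e.symm) p y).adjugate *
            hessC (f ∘ e.symm) y).trace) := by
      intro y hy
      rw [lin_chart p hy θ _ α hφ hg, lin_chart p hy θ _ α hφ hf, Complex.real_smul, mul_sub,
        mul_left_comm _ (f _ : ℂ), mul_left_comm _ (g _ : ℂ), dens_mul_div ω₀ p hy,
        dens_mul_div ω₀ p hy]
      simp only [Function.comp_apply]
      ring
    rw [setIntegral_congr_fun e.open_target.measurableSet h2, integral_const_mul, h1, mul_zero]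
  · intro x hx
    have h1 : x ∉ tsupport f := fun h => hx (hsupp h)
    rw [lin_zero θ _ α φ (notMem_tsupport_iff_eventuallyEq.1 h1), image_eq_zero_of_notMem_tsupport h1]
    simp

/-- Green's formula: the linearized operator is symmetric. -/
theorem green [T2Space X] (θ : ℝ) (ω₀ : KahlerForm n X) (α : ClosedRealForm11 n X) {φ f g : X → ℝ}
    (hφ : IsSm (n := n) φ) (hf : IsSm (n := n) f) (hg : IsSm (n := n) g) :
    ∫ x, (f x : ℂ) * lin θ ω₀.toClosedRealForm11 α φ g x ∂(volX ω₀.toClosedRealForm11) =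
      ∫ x, (g x : ℂ) * lin θ ω₀.toClosedRealForm11 α φ f x ∂(volX ω₀.toClosedRealForm11) := by
  have := isManifold_real n X
  -- Only `f` is cut off by the partition of unity; both sides are linear in `f`.
  obtain ⟨ρ, hρ⟩ := SmoothPartitionOfUnity.exists_isSubordinate 𝓘(ℝ, Cn n) (s := (univ : Set X))
    isClosed_univ (fun i => (chartAt (Cn n) (coverPt n X i)).source)
    (fun i => (chartAt (Cn n) (coverPt n X i)).open_source)
    (exists_finite_chart_cover n X).choose_spec.choose_spec.ge
  have hρs : ∀ i, IsSm (n := n) (ρ i) := fun i => isSm_of_contMDiff (ρ i).contMDiff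
  have hfi : ∀ i, IsSm (n := n) fun x => ρ i x * f x := fun i => (hρs i).mul hf
  have hsum : f = fun x => ∑ i, ρ i x * f x := by
    funext x
    have h1 := ρ.sum_eq_one (mem_univ x)
    rw [finsum_eq_sum_of_fintype] at h1
    rw [← Finset.sum_mul, h1, one_mul]
  have hc : ∀ {f g : X → ℝ}, IsSm (n := n) f → IsSm (n := n) g → Integrable (fun x =>
      (f x : ℂ) * lin θ ω₀.toClosedRealForm11 α φ g x) (volX ω₀.toClosedRealForm11) :=
    fun hf hg => integrable_volX ω₀
      ((Complex.continuous_ofReal.comp hf.continuous).mul (continuous_lin θ ω₀ α hφ hg))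
  rw [← sub_eq_zero, ← integral_sub (hc hf hg) (hc hg hf)]
  have h1 : (fun x => (f x : ℂ) * lin θ ω₀.toClosedRealForm11 α φ g x -
      (g x : ℂ) * lin θ ω₀.toClosedRealForm11 α φ f x) = fun x => ∑ i,
      (((ρ i x * f x : ℝ) : ℂ) * lin θ ω₀.toClosedRealForm11 α φ g x -
      (g x : ℂ) * lin θ ω₀.toClosedRealForm11 α φ (fun x => ρ i x * f x) x) := by
    funext x
    rw [Finset.sum_sub_distrib, ← Finset.sum_mul, ← Finset.mul_sum, ← lin_sum θ _ α φ _ hfi]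
    conv_lhs => rw [hsum]
    push_cast
    rfl
  rw [h1]
  refine (integral_finsetSum _ fun i _ => (hc (hfi i) hg).sub (hc hg (hfi i))).trans ?_
  refine Finset.sum_eq_zero fun i _ => green_of_tsupport θ ω₀ α hφ (hfi i) hg (coverPt n X i) ?_
  exact (tsupport_mul_subset_left (f := ρ i) (g := f)).trans (hρ i)

end Green

/-! ### Integrals depending on a parameter -/

section Parametric

open Topology

/-- Stated for a general space because it serves twice: over `X` with the measure of `ωⁿ`, and over
the segment parameter `τ ∈ [0,1]`. On a compact set the derivative is dominated by a constant. -/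
theorem hasDerivAt_setIntegral {Y G : Type*} [TopologicalSpace Y] [MeasurableSpace Y]
    [OpensMeasurableSpace Y] [NormedAddCommGroup G] [NormedSpace ℝ G]
    [SecondCountableTopology G] (ν : Measure Y) [IsFiniteMeasureOnCompacts ν] {k : Set Y}
    (hk : IsCompact k) (hkm : MeasurableSet k) {S : Set ℝ} (hS : IsOpen S) {f f' : ℝ → Y → G}
    (hfc : ∀ s ∈ S, ContinuousOn (f s) k)
    (hf : ∀ s ∈ S, ∀ y ∈ k, HasDerivAt (fun s => f s y) (f' s y) s)
    (hf' : ContinuousOn (fun q : ℝ × Y => f' q.1 q.2) (S ×ˢ k)) {s : ℝ} (hs : s ∈ S) :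
    HasDerivAt (fun s => ∫ y in k, f s y ∂ν) (∫ y in k, f' s y ∂ν) s := by
  borelize G
  obtain ⟨δ, hδ, hball⟩ := Metric.nhds_basis_closedBall.mem_iff.1 (hS.mem_nhds hs)
  obtain ⟨C, hC⟩ := ((isCompact_closedBall s δ).prod hk).exists_bound_of_continuousOn
    (hf'.mono (prod_mono hball Subset.rfl))
  have hf's : ContinuousOn (f' s) k :=
    hf'.comp (f := fun y => (s, y)) (by fun_prop) fun y hy => ⟨hs, hy⟩
  have hfin : IsFiniteMeasure (ν.restrict k) := ⟨by simpa using hk.measure_lt_top⟩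
  refine (hasDerivAt_integral_of_dominated_loc_of_deriv_le (μ := ν.restrict k) (bound := fun _ => C)
    (Metric.closedBall_mem_nhds s hδ) ?_ ?_ ?_ ?_ ?_ ?_).2
  · filter_upwards [hS.mem_nhds hs] with t ht
    exact (hfc t ht).aestronglyMeasurable hkm
  · exact (hfc s hs).integrableOn_compact' hk hkm
  · exact hf's.aestronglyMeasurable hkm
  · filter_upwards [ae_restrict_mem hkm] with y hy t ht
    exact hC (t, y) ⟨ht, hy⟩
  · exact integrable_const C
  · filter_upwards [ae_restrict_mem hkm] with y hy t ht
    exact hf t (hball ht) y hy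

variable {n : ℕ} {X : Type*} [TopologicalSpace X] [ChartedSpace (Cn n) X]

theorem Fam.of_contMDiffOn [IsManifold 𝓘(ℝ, Cn n) ∞ X] {S : Set ℝ} {φ : ℝ → X → ℝ}
    (h : ContMDiffOn (𝓘(ℝ, Cn n).prod 𝓘(ℝ, ℝ)) 𝓘(ℝ, ℝ) ∞ (fun q : X × ℝ => φ q.2 q.1)
      (univ ×ˢ S)) : Fam n S φ := by
  intro p
  have h1 : ContMDiffOn 𝓘(ℝ, Cn n) 𝓘(ℝ, Cn n) ∞ (chartAt (Cn n) p).symm (chartAt (Cn n) p).target :=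
    contMDiffOn_chart_symm
  have h2 : ContMDiffOn 𝓘(ℝ, Cn n × ℝ) 𝓘(ℝ, Cn n) ∞
      (fun z : Cn n × ℝ => (chartAt (Cn n) p).symm z.1) ((chartAt (Cn n) p).target ×ˢ S) :=
    h1.comp (contDiff_fst.contMDiff.contMDiffOn) fun z hz => hz.1
  have h3 : ContMDiffOn 𝓘(ℝ, Cn n × ℝ) 𝓘(ℝ, ℝ) ∞
      (fun z : Cn n × ℝ => z.2) ((chartAt (Cn n) p).target ×ˢ S) :=
    contDiff_snd.contMDiff.contMDiffOn
  exact (h.comp (h2.prodMk h3) fun z hz => ⟨mem_univ _, hz.2⟩).contDiffOn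

variable [CompactSpace X] [MeasurableSpace X] [BorelSpace X] [IsManifold 𝓘(ℂ, Cn n) ω X]
  (ω₀ : KahlerForm n X)

theorem Fam.continuousOn_integral {P : Type*} [NormedAddCommGroup P] [NormedSpace ℝ P] {S : Set P}
    {G : Type*} [NormedAddCommGroup G] [NormedSpace ℝ G] {F : P → X → G} (h : Fam n S F) :
    ContinuousOn (fun s => ∫ x, F s x ∂(volX ω₀.toClosedRealForm11)) S :=
  continuousOn_integral_of_compact_support isCompact_univ h.continuousOn
    fun _ x _ hx => absurd (mem_univ x) hx

theorem Fam.hasDerivAt_integral {S : Set ℝ} (hS : IsOpen S) {G : Type*} [NormedAddCommGroup G]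
    [NormedSpace ℝ G] [SecondCountableTopology G] {F : ℝ → X → G} (h : Fam n S F) {s : ℝ}
    (hs : s ∈ S) : HasDerivAt (fun s => ∫ x, F s x ∂(volX ω₀.toClosedRealForm11))
      (∫ x, _root_.deriv (fun s => F s x) s ∂(volX ω₀.toClosedRealForm11)) s := by
  have := hasDerivAt_setIntegral (volX ω₀.toClosedRealForm11) isCompact_univ MeasurableSet.univ hS
    (f := F) (f' := fun s x => _root_.deriv (fun s => F s x) s)
    (fun s hs => (h.continuous hs).continuousOn) (fun s hs x _ => h.hasDerivAt hS hs x)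
    (h.deriv hS).continuousOn hs
  simpa using this

theorem Fam.integrable {P : Type*} [NormedAddCommGroup P] [NormedSpace ℝ P] {S : Set P}
    {G : Type*} [NormedAddCommGroup G] [NormedSpace ℝ G] {F : P → X → G} (h : Fam n S F) {s : P}
    (hs : s ∈ S) : Integrable (F s) (volX ω₀.toClosedRealForm11) :=
  integrable_volX ω₀ (h.continuous hs)

end Parametric

/-! ### The variation of the functionals -/

section Variation

open Topology

variable {n : ℕ} {X : Type*} [TopologicalSpace X] [ChartedSpace (Cn n) X]

theorem iddbar_const_mul {f : X → ℝ} (hf : IsSm (n := n) f) (c : ℝ) (x : X) (u v : Cn n) :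
    iddbar 𝓘(ℝ, Cn n) (fun x => c * f x) x u v = c * iddbar 𝓘(ℝ, Cn n) f x u v := by
  have h1 := hf.contDiffAt_self x
  have h3 : fderiv ℝ (fun y => c * (f ∘ (chartAt (Cn n) x).symm) y)
      =ᶠ[𝓝 (chartAt (Cn n) x x)] fun y => c • fderiv ℝ (f ∘ (chartAt (Cn n) x).symm) y := by
    filter_upwards [h1.eventually (by simp)] with z hz
    exact fderiv_const_mul (hz.differentiableAt (by simp)) c
  have d1 : DifferentiableAt ℝ (fderiv ℝ (f ∘ (chartAt (Cn n) x).symm)) (chartAt (Cn n) x x) :=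
    (h1.fderiv_right (m := 1) (by norm_num)).differentiableAt (by simp)
  change iddb (fun y => c * (f ∘ (chartAt (Cn n) x).symm) y) (chartAt (Cn n) x x) u v =
    c * iddb (f ∘ (chartAt (Cn n) x).symm) (chartAt (Cn n) x x) u v
  simp only [iddb, h3.fderiv_eq, fderiv_fun_const_smul d1, smul_apply, smul_eq_mul]
  ring

theorem hessAt_const_mul {f : X → ℝ} (hf : IsSm (n := n) f) (c : ℝ) (x : X) :
    (hessAt (fun x => c * f x) x : Matrix (Fin n) (Fin n) ℂ) = (c : ℂ) • hessAt f x := by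
  simp only [hessAt, iddbar_const_mul hf, Complex.ofReal_mul, sesqMat_const_mul]

theorem lin_const_mul (θ : ℝ) (ω₀ α : ClosedRealForm11 n X) (φ : X → ℝ) {f : X → ℝ}
    (hf : IsSm (n := n) f) (c : ℝ) (x : X) :
    lin θ ω₀ α φ (fun x => c * f x) x = c * lin θ ω₀ α φ f x := by
  simp only [lin, hessAt_const_mul hf, Matrix.mul_smul, Matrix.trace_smul, smul_eq_mul]
  ring

variable [CompactSpace X] [MeasurableSpace X] [BorelSpace X] [IsManifold 𝓘(ℂ, Cn n) ω X]

theorem phase_mul_integralX_topForm (θ : ℝ) (ω₀ : KahlerForm n X) (α : ClosedRealForm11 n X)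
    {f φ : X → ℝ} (hf : Continuous f) (hφ : IsSm (n := n) φ) :
    phase θ * integralX (fun (x : X) w => (f x : ℂ) * topForm ω₀ α φ x w) =
      ∫ x, (f x : ℂ) * ratio θ ω₀.toClosedRealForm11 α φ x ∂(volX ω₀.toClosedRealForm11) := by
  have hph : phase θ ≠ 0 := Complex.exp_ne_zero _
  have hc : Continuous fun x => (f x : ℂ) * ratio θ ω₀.toClosedRealForm11 α φ x :=
    (Complex.continuous_ofReal.comp hf).mul (continuous_ratio θ ω₀ α hφ)
  rw [integralX_eq ω₀ (G := fun x => (phase θ)⁻¹ * ((f x : ℂ) *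
    ratio θ ω₀.toClosedRealForm11 α φ x)) (continuous_const.mul hc), integral_const_mul,
    mul_inv_cancel_left₀ hph]
  intro p y hy
  have h1 := (formAt_posHerm ω₀ ((chartAt (Cn n) p).symm y)).det_ne_zero
  rw [topForm_eq ω₀ α hφ, Complex.real_smul, ← det_formAt_mul_frameFactor p hy, ratio]
  field_simp

/-- The phase times the functional `CY` as an iterated integral. -/
theorem phase_mul_CY (θ : ℝ) (ω₀ : KahlerForm n X) (α : ClosedRealForm11 n X) {φb φ : X → ℝ}
    (hφb : IsSm (n := n) φb) (hφ : IsSm (n := n) φ) :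
    phase θ * CY ω₀ α φb φ = ∫ τ in (0 : ℝ)..1, ∫ x, ((φ x - φb x : ℝ) : ℂ) *
      ratio θ ω₀.toClosedRealForm11 α (fun x => φb x + τ * (φ x - φb x)) x
        ∂(volX ω₀.toClosedRealForm11) := by
  have h1 : IsSm (n := n) fun x => φ x - φb x := fun p => (hφ p).sub (hφb p)
  rw [CY, ← intervalIntegral.integral_const_mul]
  congr 1
  funext τ
  refine phase_mul_integralX_topForm θ ω₀ α (f := fun x => φ x - φb x) h1.continuous ?_
  exact fun p => (hφb p).add (contDiffOn_const.mul (h1 p))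

variable {θ : ℝ} {ω₀ : KahlerForm n X} {α : ClosedRealForm11 n X} {φb : X → ℝ} {φ : ℝ → X → ℝ}

omit [CompactSpace X] [MeasurableSpace X] [BorelSpace X] [IsManifold 𝓘(ℂ, Cn n) ω X] in
theorem Fam.segment {S : Set ℝ} (hφb : IsSm (n := n) φb) (hφ : Fam n S φ) :
    Fam n (S ×ˢ (univ : Set ℝ)) fun (q : ℝ × ℝ) x => φb x + q.2 * (φ q.1 x - φb x) :=
  hφb.fam.add ((Fam.of_param contDiffOn_snd).mul
    ((hφ.comp contDiffOn_fst fun _ hq => hq.1).sub hφb.fam))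

theorem continuousOn_integral_segment {S : Set ℝ} (hφb : IsSm (n := n) φb) (hφ : Fam n S φ) :
    ContinuousOn (fun q : ℝ × ℝ => ∫ x, ((φ q.1 x - φb x : ℝ) : ℂ) *
      ratio θ ω₀.toClosedRealForm11 α (fun x => φb x + q.2 * (φ q.1 x - φb x)) x
        ∂(volX ω₀.toClosedRealForm11)) (S ×ˢ univ) :=
  Fam.continuousOn_integral ω₀ (((hφ.comp contDiffOn_fst fun _ hq => hq.1).sub
    hφb.fam).ofReal.mul ((hφ.segment hφb).ratio θ ω₀ α))

/-- Convexity on the closed interval requires continuity at the endpoints, where the curve is only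
smooth from one side. Precomposing with the projection onto `[0,1]` makes the integrand continuous
on all of `ℝ × ℝ`. -/
theorem continuousOn_phase_mul_CY (hφb : IsSm (n := n) φb) (hφ : Fam n (Icc 0 1) φ) :
    ContinuousOn (fun s => phase θ * CY ω₀ α φb (φ s)) (Icc 0 1) := by
  have h1 := continuousOn_integral_segment (θ := θ) (ω₀ := ω₀) (α := α) hφb hφ
  have h2 : Continuous (Function.uncurry fun (s τ : ℝ) => ∫ x,
      ((φ (projIcc (0 : ℝ) 1 zero_le_one s) x - φb x : ℝ) : ℂ) *
      ratio θ ω₀.toClosedRealForm11 α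
        (fun x => φb x + τ * (φ (projIcc (0 : ℝ) 1 zero_le_one s) x - φb x)) x
        ∂(volX ω₀.toClosedRealForm11)) := by
    rw [← continuousOn_univ]
    refine h1.comp (f := fun q : ℝ × ℝ => ((projIcc (0 : ℝ) 1 zero_le_one q.1 : ℝ), q.2)) ?_
      fun q _ => ⟨(projIcc (0 : ℝ) 1 zero_le_one q.1).2, mem_univ _⟩
    exact ((continuous_subtype_val.comp (continuous_projIcc.comp continuous_fst)).prodMk
      continuous_snd).continuousOn
  have h3 := intervalIntegral.continuous_parametric_intervalIntegral_of_continuous'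
    (μ := volume) h2 0 1
  refine h3.continuousOn.congr fun s hs => ?_
  rw [phase_mul_CY θ ω₀ α hφb (hφ.isSm hs)]
  simp only [projIcc_of_mem zero_le_one hs]

/-- The first variation of `CY`. -/
theorem hasDerivAt_phase_mul_CY [T2Space X] {S : Set ℝ} (hS : IsOpen S) (hφb : IsSm (n := n) φb)
    (hφ : Fam n S φ) {s : ℝ} (hs : s ∈ S) :
    HasDerivAt (fun s => phase θ * CY ω₀ α φb (φ s))
      (∫ x, ((deriv (fun s => φ s x) s : ℝ) : ℂ) * ratio θ ω₀.toClosedRealForm11 α (φ s) x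
        ∂(volX ω₀.toClosedRealForm11)) s := by
  set μ := volX ω₀.toClosedRealForm11
  set dφ : ℝ → X → ℝ := fun s x => deriv (fun s => φ s x) s with hdφ
  have hd : Fam n S dφ := hφ.deriv hS
  set χ : ℝ × ℝ → X → ℝ := fun q x => φb x + q.2 * (φ q.1 x - φb x) with hχ
  have hχf : Fam n (S ×ˢ univ) χ := hφ.segment hφb
  have hφ2 : Fam n (S ×ˢ (univ : Set ℝ)) fun q : ℝ × ℝ => φ q.1 :=
    hφ.comp contDiffOn_fst fun _ hq => hq.1
  have hd2 : Fam n (S ×ˢ (univ : Set ℝ)) fun q : ℝ × ℝ => dφ q.1 :=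
    hd.comp contDiffOn_fst fun _ hq => hq.1
  have hsub2 : Fam n (S ×ˢ (univ : Set ℝ)) fun (q : ℝ × ℝ) x => φ q.1 x - φb x := hφ2.sub hφb.fam
  have hr2 := hχf.ratio θ ω₀ α
  have hτ : ∀ τ : ℝ, Fam n S fun s => χ (s, τ) := fun τ =>
    hχf.comp (contDiffOn_id.prodMk contDiffOn_const) fun t ht => ⟨ht, mem_univ _⟩
  have dχ : ∀ t ∈ S, ∀ τ x, HasDerivAt (fun s => χ (s, τ) x) (τ * dφ t x) t := fun t ht τ x =>
    (((hφ.hasDerivAt hS ht x).sub_const _).const_mul τ).const_add _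
  -- the derivative in `s` of the inner integral
  have h1 : ∀ t ∈ S, ∀ τ : ℝ, HasDerivAt (fun s => ∫ x, ((φ s x - φb x : ℝ) : ℂ) *
      ratio θ ω₀.toClosedRealForm11 α (χ (s, τ)) x ∂μ)
      (∫ x, ((dφ t x : ℂ) * ratio θ ω₀.toClosedRealForm11 α (χ (t, τ)) x +
        ((φ t x - φb x : ℝ) : ℂ) *
          (Complex.I * (τ * lin θ ω₀.toClosedRealForm11 α (χ (t, τ)) (dφ t) x))) ∂μ) t := by
    intro t ht τ
    have hF : Fam n S fun s x => ((φ s x - φb x : ℝ) : ℂ) *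
        ratio θ ω₀.toClosedRealForm11 α (χ (s, τ)) x :=
      (hφ.sub hφb.fam).ofReal.mul ((hτ τ).ratio θ ω₀ α)
    refine (hF.hasDerivAt_integral ω₀ hS ht).congr_deriv (integral_congr_ae (.of_forall fun x => ?_))
    have e1 := hasDerivAt_ratio hS (hτ τ) ht θ ω₀.toClosedRealForm11 α x
    have e2 : (fun x => deriv (fun s => χ (s, τ) x) t) = fun x => τ * dφ t x :=
      funext fun x => (dχ t ht τ x).deriv
    rw [e2, lin_const_mul _ _ _ _ (hd.isSm ht)] at e1
    exact ((((hφ.hasDerivAt hS ht x).sub_const _).ofReal_comp).mul e1).deriv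
  have hcont : ContinuousOn (fun q : ℝ × ℝ => ∫ x, ((dφ q.1 x : ℂ) *
      ratio θ ω₀.toClosedRealForm11 α (χ q) x + ((φ q.1 x - φb x : ℝ) : ℂ) *
        (Complex.I * (q.2 * lin θ ω₀.toClosedRealForm11 α (χ q) (dφ q.1) x))) ∂μ)
      (S ×ˢ univ) :=
    Fam.continuousOn_integral ω₀ ((hd2.ofReal.mul hr2).add (hsub2.ofReal.mul ((Fam.const _).mul
      ((Fam.of_param (ofReal_contDiff.comp_contDiffOn contDiffOn_snd)).mul
        (hχf.lin hd2 θ ω₀ α)))))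
  have h2 := hasDerivAt_setIntegral (volume : Measure ℝ) (isCompact_Icc (a := (0 : ℝ)) (b := 1))
    measurableSet_Icc hS
    (f := fun s τ => ∫ x, ((φ s x - φb x : ℝ) : ℂ) *
      ratio θ ω₀.toClosedRealForm11 α (χ (s, τ)) x ∂μ)
    (fun t ht => (continuousOn_integral_segment hφb hφ).comp (f := fun τ => (t, τ)) (by fun_prop)
      fun τ _ => ⟨ht, mem_univ _⟩) (fun t ht τ _ => h1 t ht τ)
    (hcont.mono (prod_mono Subset.rfl (subset_univ _))) hs
  -- the derivative in `τ`
  have h3 : ∀ τ : ℝ, HasDerivAt (fun τ : ℝ => ∫ x, (dφ s x : ℂ) * ((τ : ℂ) *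
      ratio θ ω₀.toClosedRealForm11 α (χ (s, τ)) x) ∂μ)
      (∫ x, ((dφ s x : ℂ) * ratio θ ω₀.toClosedRealForm11 α (χ (s, τ)) x +
        ((φ s x - φb x : ℝ) : ℂ) *
          (Complex.I * (τ * lin θ ω₀.toClosedRealForm11 α (χ (s, τ)) (dφ s) x))) ∂μ) τ := by
    intro τ
    have hs' : Fam n univ fun τ => χ (s, τ) :=
      hχf.comp (contDiffOn_const.prodMk contDiffOn_id) fun t _ => ⟨hs, mem_univ _⟩
    have hds : IsSm (n := n) (dφ s) := hd.isSm hs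
    have hss : IsSm (n := n) fun x => φ s x - φb x := fun p => ((hφ.isSm hs) p).sub (hφb p)
    have hF : Fam n univ fun (τ : ℝ) x => (dφ s x : ℂ) * ((τ : ℂ) *
        ratio θ ω₀.toClosedRealForm11 α (χ (s, τ)) x) :=
      hds.fam.ofReal.mul ((Fam.of_param ofReal_contDiff.contDiffOn).mul (hs'.ratio θ ω₀ α))
    refine (hF.hasDerivAt_integral ω₀ isOpen_univ (mem_univ τ)).congr_deriv ?_
    have hl1 := continuous_lin θ ω₀ α (hs'.isSm (mem_univ τ)) hss
    have hl2 := continuous_lin θ ω₀ α (hs'.isSm (mem_univ τ)) hds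
    have hr := continuous_ratio θ ω₀ α (hs'.isSm (mem_univ τ))
    have e0 : ∀ x, deriv (fun τ : ℝ => (dφ s x : ℂ) * ((τ : ℂ) *
        ratio θ ω₀.toClosedRealForm11 α (χ (s, τ)) x)) τ =
        (dφ s x : ℂ) * ratio θ ω₀.toClosedRealForm11 α (χ (s, τ)) x + Complex.I * τ *
          ((dφ s x : ℂ) * lin θ ω₀.toClosedRealForm11 α (χ (s, τ)) (fun x => φ s x - φb x) x) := by
      intro x
      have e1 := hasDerivAt_ratio isOpen_univ hs' (mem_univ τ) θ ω₀.toClosedRealForm11 α x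
      have e2 : (fun x => deriv (fun τ => χ (s, τ) x) τ) = fun x => φ s x - φb x :=
        funext fun x => by
          have h := (((hasDerivAt_id τ).mul_const (φ s x - φb x)).const_add (φb x)).deriv
          rw [one_mul] at h
          exact h
      rw [e2] at e1
      refine (((HasDerivAt.ofReal_comp (hasDerivAt_id τ)).mul e1).const_mul _).deriv.trans ?_
      simp only [id, Complex.ofReal_one]
      ring
    have hint : ∀ {f g : X → ℂ}, Continuous f → Continuous g →
        Integrable (fun x => f x * g x) μ := fun hf hg => integrable_volX ω₀ (hf.mul hg)
    have co : ∀ {f : X → ℝ}, IsSm (n := n) f → Continuous fun x => (f x : ℂ) := fun hf =>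
      Complex.continuous_ofReal.comp hf.continuous
    simp only [e0]
    -- Here Green's formula moves `lin` from `φ - φb` to the velocity. It makes the `s`-derivative
    -- of the inner integral an exact `τ`-derivative, which expresses that the one-form `dCY` is
    -- closed.
    rw [integral_add (hint (co hds) hr) ((hint (co hds) hl1).const_mul _), integral_const_mul,
      green θ ω₀ α (hs'.isSm (mem_univ τ)) hds hss, ← integral_const_mul,
      ← integral_add (hint (co hds) hr) ((hint (co hss) hl2).const_mul _)]
    refine integral_congr_ae (.of_forall fun x => ?_)
    ring
  -- Only the endpoint `τ = 1` contributes: the primitive carries a factor `τ`, and at `τ = 1` the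
  -- segment has reached `φ s`.
  have h4 := intervalIntegral.integral_eq_sub_of_hasDerivAt (a := 0) (b := 1) (fun τ _ => h3 τ)
    (ContinuousOn.intervalIntegrable (hcont.comp (f := fun τ => (s, τ)) (by fun_prop)
      fun τ _ => ⟨hs, mem_univ _⟩))
  have hone : χ (s, 1) = φ s := by funext x; simp [hχ]
  simp only [Complex.ofReal_one, hone, one_mul, Complex.ofReal_zero, zero_mul, mul_zero,
    integral_zero, sub_zero] at h4
  rw [← h4, intervalIntegral.integral_of_le zero_le_one, ← integral_Icc_eq_integral_Ioc]
  refine h2.congr_of_eventuallyEq ?_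
  filter_upwards [hS.mem_nhds hs] with t ht
  rw [phase_mul_CY θ ω₀ α hφb (hφ.isSm ht), intervalIntegral.integral_of_le zero_le_one,
    ← integral_Icc_eq_integral_Ioc]

/-- The second variation of `CY`. -/
theorem hasDerivAt_integral_deriv_mul_ratio {S : Set ℝ} (hS : IsOpen S) (hφ : Fam n S φ) {s : ℝ}
    (hs : s ∈ S) :
    HasDerivAt (fun s => ∫ x, ((deriv (fun s => φ s x) s : ℝ) : ℂ) *
        ratio θ ω₀.toClosedRealForm11 α (φ s) x ∂(volX ω₀.toClosedRealForm11))
      (∫ x, (((deriv (fun s => deriv (fun s => φ s x) s) s : ℝ) : ℂ) *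
        ratio θ ω₀.toClosedRealForm11 α (φ s) x + Complex.I *
          (((deriv (fun s => φ s x) s : ℝ) : ℂ) * lin θ ω₀.toClosedRealForm11 α (φ s)
            (fun x => deriv (fun s => φ s x) s) x)) ∂(volX ω₀.toClosedRealForm11)) s := by
  have hd := hφ.deriv hS
  refine ((hd.ofReal.mul (hφ.ratio θ ω₀ α)).hasDerivAt_integral ω₀ hS hs).congr_deriv
    (integral_congr_ae (.of_forall fun x => ?_))
  refine (((hd.hasDerivAt hS hs x).ofReal_comp).mul
    (hasDerivAt_ratio hS hφ hs θ ω₀.toClosedRealForm11 α x)).deriv.trans ?_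
  ring

end Variation

/-! ### The carré du champ -/

section Gradient

open Topology

variable {n : ℕ}

/-- The complex gradient `∂F / ∂z_j` of a real function. -/
noncomputable def gradC (F : Cn n → ℝ) (y : Cn n) (j : Fin n) : ℂ := wz j (fun y => (F y : ℂ)) y

theorem conj_gradC {F : Cn n → ℝ} {y : Cn n} (hF : DifferentiableAt ℝ F y) (k : Fin n) :
    (starRingEnd ℂ) (gradC F y k) = wzb k (fun y => (F y : ℂ)) y := by
  have h : DifferentiableAt ℝ (fun y => (F y : ℂ)) y :=
    (ofReal_contDiff.differentiable (by simp)).differentiableAt.comp y hF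
  rw [wzb_eq_conj h, gradC]
  simp only [Complex.conj_ofReal]

theorem hessC_mul {F G : Cn n → ℝ} {y : Cn n} (hF : ContDiffAt ℝ 2 F y) (hG : ContDiffAt ℝ 2 G y)
    (j k : Fin n) : hessC (fun y => F y * G y) y j k =
      F y * hessC G y j k + G y * hessC F y j k +
        (gradC F y j * (starRingEnd ℂ) (gradC G y k) +
          gradC G y j * (starRingEnd ℂ) (gradC F y k)) := by
  have hof : ∀ {F : Cn n → ℝ} {y : Cn n}, ContDiffAt ℝ 2 F y →
      ContDiffAt ℝ 2 (fun y => (F y : ℂ)) y := fun hF =>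
    (ofReal_contDiff.of_le two_le_infty).contDiffAt.comp _ hF
  have hd : ∀ {F : Cn n → ℝ} {y : Cn n}, ContDiffAt ℝ 2 F y →
      DifferentiableAt ℝ (fun y => (F y : ℂ)) y := fun hF => (hof hF).differentiableAt (by simp)
  have hdb : ∀ {F : Cn n → ℝ} {y : Cn n} (k), ContDiffAt ℝ 2 F y →
      DifferentiableAt ℝ (wzb k (fun y => (F y : ℂ))) y := by
    intro F y k hF
    have h2 : DifferentiableAt ℝ (fderiv ℝ fun y => (F y : ℂ)) y :=
      ((hof hF).fderiv_right (m := 1) (by norm_num)).differentiableAt (by simp)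
    have h3 : ∀ v, DifferentiableAt ℝ (fun z => fderiv ℝ (fun y => (F y : ℂ)) z v) y := fun v =>
      h2.clm_apply (differentiableAt_const v)
    have h4 := ((h3 (stdB k)).fun_add ((h3 (Complex.I • stdB k)).const_mul Complex.I)).mul_const
      (2 : ℂ)⁻¹
    simp only [← div_eq_mul_inv] at h4
    exact h4
  rw [hessC_eq_wz (hF.mul hG), hessC_eq_wz hF, hessC_eq_wz hG,
    conj_gradC (hF.differentiableAt (by simp)), conj_gradC (hG.differentiableAt (by simp))]
  have h1 : wzb k (fun y => ((F y * G y : ℝ) : ℂ)) =ᶠ[𝓝 y] fun y =>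
      (F y : ℂ) * wzb k (fun y => (G y : ℂ)) y + wzb k (fun y => (F y : ℂ)) y * (G y : ℂ) := by
    filter_upwards [hF.eventually (by simp), hG.eventually (by simp)] with z hz hz'
    simp only [Complex.ofReal_mul]
    exact wzb_mul (hd hz) (hd hz')
  rw [wz_congr h1, wz_add ((hd hF).fun_mul (hdb k hG)) ((hdb k hF).fun_mul (hd hG)),
    wz_mul (hd hF) (hdb k hG), wz_mul (hdb k hF) (hd hG), gradC, gradC]
  ring

theorem Fam.gradC {P X : Type*} [NormedAddCommGroup P] [NormedSpace ℝ P] [TopologicalSpace X]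
    [ChartedSpace (Cn n) X] {S : Set P} {F : P → X → ℝ} (h : Fam n S F) (p : X) (j : Fin n) :
    ContDiffOn ℝ ∞ (fun z : Cn n × P => gradC (F z.2 ∘ (chartAt (Cn n) p).symm) z.1 j)
      ((chartAt (Cn n) p).target ×ˢ S) := by
  have h1 := contDiffOn_fderiv_fst (chartAt (Cn n) p).open_target (h.ofReal p)
  exact ((h1.clm_apply contDiffOn_const).sub (contDiffOn_const.mul
    (h1.clm_apply contDiffOn_const))).div_const _

/-- The sesquilinear form `∑ A_{kj} f_j ḡ_k`. -/
noncomputable def quad (A : Matrix (Fin n) (Fin n) ℂ) (f g : Fin n → ℂ) : ℂ :=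
  ∑ j, ∑ k, A k j * (f j * (starRingEnd ℂ) (g k))

theorem quad_eq_dotProduct (A : Matrix (Fin n) (Fin n) ℂ) (f g : Fin n → ℂ) :
    quad A f g = star g ⬝ᵥ A.mulVec f := by
  simp only [quad, dotProduct, Matrix.mulVec, Finset.mul_sum, Pi.star_apply, RCLike.star_def]
  rw [Finset.sum_comm]
  exact Finset.sum_congr rfl fun k _ => Finset.sum_congr rfl fun j _ => by ring

theorem quad_smul_matrix (c : ℂ) (A : Matrix (Fin n) (Fin n) ℂ) (f g : Fin n → ℂ) :
    quad (c • A) f g = c * quad A f g := by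
  simp only [quad, Matrix.smul_apply, smul_eq_mul, Finset.mul_sum, mul_assoc]

theorem quad_ofReal_smul (A : Matrix (Fin n) (Fin n) ℂ) (c : ℝ) (f g : Fin n → ℂ) :
    quad A (c • f) g = c * quad A f g ∧ quad A f (c • g) = c * quad A f g := by
  constructor <;>
  · simp only [quad, Finset.mul_sum, Pi.smul_apply, Complex.real_smul, map_mul, Complex.conj_ofReal]
    exact Finset.sum_congr rfl fun j _ => Finset.sum_congr rfl fun k _ => by ring

theorem trace_mul_hessC_mul (A : Matrix (Fin n) (Fin n) ℂ) {F G : Cn n → ℝ} {y : Cn n}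
    (hF : ContDiffAt ℝ 2 F y) (hG : ContDiffAt ℝ 2 G y) :
    (A * hessC (fun y => F y * G y) y).trace = F y * (A * hessC G y).trace +
      G y * (A * hessC F y).trace + (quad A (gradC F y) (gradC G y) +
        quad A (gradC G y) (gradC F y)) := by
  simp only [Matrix.trace, Matrix.diag_apply, Matrix.mul_apply, hessC_mul hF hG, quad]
  rw [Finset.sum_comm (f := fun j k => A k j * (gradC F y j * _)),
    Finset.sum_comm (f := fun j k => A k j * (gradC G y j * _))]
  simp only [Finset.mul_sum, ← Finset.sum_add_distrib]
  exact Finset.sum_congr rfl fun k _ => Finset.sum_congr rfl fun j _ => by ring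

end Gradient

/-! ### Positivity and integration by parts for the carré du champ -/

section CarreDuChamp

open Topology

variable {n : ℕ} {X : Type*} [TopologicalSpace X] [ChartedSpace (Cn n) X]

/-- The carré du champ of the operator `lin`. -/
noncomputable def gam (θ : ℝ) (ω₀ α : ClosedRealForm11 n X) (φ f g : X → ℝ) (x : X) : ℂ :=
  lin θ ω₀ α φ (fun x => f x * g x) x - f x * lin θ ω₀ α φ g x - g x * lin θ ω₀ α φ f x

variable [IsManifold 𝓘(ℂ, Cn n) ω X]

theorem Fam.gam {P : Type*} [NormedAddCommGroup P] [NormedSpace ℝ P] {S : Set P}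
    {φ f g : P → X → ℝ} (h : Fam n S φ) (hf : Fam n S f) (hg : Fam n S g) (θ : ℝ)
    (ω₀ : KahlerForm n X) (α : ClosedRealForm11 n X) :
    Fam n S fun s => gam θ ω₀.toClosedRealForm11 α (φ s) (f s) (g s) :=
  ((h.lin (hf.mul hg) θ ω₀ α).sub (hf.ofReal.mul (h.lin hg θ ω₀ α))).sub
    (hg.ofReal.mul (h.lin hf θ ω₀ α))

/-- In the product rule for the Hessian all terms with second derivatives cancel, so the carré du
champ depends on `f` and `g` only through their gradients. -/
theorem gam_chart (p : X) {y : Cn n} (hy : y ∈ (chartAt (Cn n) p).target) (θ : ℝ)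
    (ω₀ α : ClosedRealForm11 n X) {φ f g : X → ℝ} (hφ : IsSm (n := n) φ) (hf : IsSm (n := n) f)
    (hg : IsSm (n := n) g) :
    gam θ ω₀ α φ f g ((chartAt (Cn n) p).symm y) = phase θ / (formChart ω₀ p y).det *
      (quad (cplxChart ω₀ α (φ ∘ (chartAt (Cn n) p).symm) p y).adjugate
          (gradC (f ∘ (chartAt (Cn n) p).symm) y) (gradC (g ∘ (chartAt (Cn n) p).symm) y) +
        quad (cplxChart ω₀ α (φ ∘ (chartAt (Cn n) p).symm) p y).adjugate
          (gradC (g ∘ (chartAt (Cn n) p).symm) y) (gradC (f ∘ (chartAt (Cn n) p).symm) y)) := by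
  rw [gam, lin_chart p hy θ ω₀ α hφ (hf.mul hg), lin_chart p hy θ ω₀ α hφ hf,
    lin_chart p hy θ ω₀ α hφ hg]
  have h1 := trace_mul_hessC_mul (cplxChart ω₀ α (φ ∘ (chartAt (Cn n) p).symm) p y).adjugate
    ((hf.contDiffAt p hy).of_le two_le_infty) ((hg.contDiffAt p hy).of_le two_le_infty)
  have h2 : (fun x => f x * g x) ∘ (chartAt (Cn n) p).symm = fun y =>
    (f ∘ (chartAt (Cn n) p).symm) y * (g ∘ (chartAt (Cn n) p).symm) y := rfl
  rw [h2, h1]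
  simp only [Function.comp_apply]
  ring

theorem cplxChart_eq_add (p : X) {y : Cn n} (hy : y ∈ (chartAt (Cn n) p).target)
    (ω₀ : KahlerForm n X) (α : ClosedRealForm11 n X) {φ : X → ℝ} (hφ : IsSm (n := n) φ) :
    ∃ A : Matrix (Fin n) (Fin n) ℂ, A.IsHermitian ∧
      cplxChart ω₀.toClosedRealForm11 α (φ ∘ (chartAt (Cn n) p).symm) p y =
        formChart ω₀.toClosedRealForm11 p y + Complex.I • A :=
  ⟨_, (formChart_isHermitian p hy α).add (hessC_isHermitian p hy hφ), rfl⟩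

/-- Writing the adjugate as determinant times inverse extracts the factor `ratio` and leaves the
form of `h⁻¹`, whose real part is positive. -/
theorem gam_self_chart (p : X) {y : Cn n} (hy : y ∈ (chartAt (Cn n) p).target) (θ : ℝ)
    (ω₀ : KahlerForm n X) (α : ClosedRealForm11 n X) {φ f : X → ℝ} (hφ : IsSm (n := n) φ)
    (hf : IsSm (n := n) f) :
    gam θ ω₀.toClosedRealForm11 α φ f f ((chartAt (Cn n) p).symm y) =
      2 * ratio θ ω₀.toClosedRealForm11 α φ ((chartAt (Cn n) p).symm y) *
        quad (cplxChart ω₀.toClosedRealForm11 α (φ ∘ (chartAt (Cn n) p).symm) p y)⁻¹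
          (gradC (f ∘ (chartAt (Cn n) p).symm) y) (gradC (f ∘ (chartAt (Cn n) p).symm) y) := by
  rw [gam_chart p hy θ _ α hφ hf hf, ratio_chart p hy θ _ α hφ, Matrix.inv_def, quad_smul_matrix,
    Ring.inverse_eq_inv']
  have := det_cplxChart_ne_zero α p hy ω₀ hφ
  field_simp
  ring

theorem re_quad_inv_pos (p : X) {y : Cn n} (hy : y ∈ (chartAt (Cn n) p).target)
    (ω₀ : KahlerForm n X) (α : ClosedRealForm11 n X) {φ : X → ℝ} (hφ : IsSm (n := n) φ)
    {v : Fin n → ℂ} (hv : v ≠ 0) :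
    0 < (quad (cplxChart ω₀.toClosedRealForm11 α (φ ∘ (chartAt (Cn n) p).symm) p y)⁻¹ v v).re := by
  obtain ⟨A, hA, h⟩ := cplxChart_eq_add p hy ω₀ α hφ
  rw [h, quad_eq_dotProduct]
  exact re_inv_pos (formChart_posHerm p hy ω₀) hA hv

/-- After multiplication by `Re D` the left side is `Re (D̄ · 2DQ) = 2 |D|² Re Q`: the weight `Im D
/ Re D` is what cancels the phase of `D`. -/
theorem gam_self_comb {D Q : ℂ} (hD : D.re ≠ 0) :
    (2 * D * Q).re + D.im / D.re * (2 * D * Q).im = 2 * (Complex.normSq D / D.re) * Q.re := by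
  simp only [Complex.mul_re, Complex.mul_im, Complex.re_ofNat, Complex.im_ofNat,
    Complex.normSq_apply]
  field_simp
  ring

theorem eq_zero_or_gam_self_comb_pos (p : X) {y : Cn n} (hy : y ∈ (chartAt (Cn n) p).target) (θ : ℝ)
    (ω₀ : KahlerForm n X) (α : ClosedRealForm11 n X) {φ f : X → ℝ} (hφ : IsSm (n := n) φ)
    (hf : IsSm (n := n) f)
    (hD : 0 < (ratio θ ω₀.toClosedRealForm11 α φ ((chartAt (Cn n) p).symm y)).re)  :
    (gradC (f ∘ (chartAt (Cn n) p).symm) y = 0 ∧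
      gam θ ω₀.toClosedRealForm11 α φ f f ((chartAt (Cn n) p).symm y) = 0) ∨
    0 < (gam θ ω₀.toClosedRealForm11 α φ f f ((chartAt (Cn n) p).symm y)).re +
      (ratio θ ω₀.toClosedRealForm11 α φ ((chartAt (Cn n) p).symm y)).im /
        (ratio θ ω₀.toClosedRealForm11 α φ ((chartAt (Cn n) p).symm y)).re *
      (gam θ ω₀.toClosedRealForm11 α φ f f ((chartAt (Cn n) p).symm y)).im := by
  rw [gam_self_chart p hy θ ω₀ α hφ hf, gam_self_comb hD.ne']
  by_cases hv : gradC (f ∘ (chartAt (Cn n) p).symm) y = 0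
  · left
    exact ⟨hv, by simp [hv, quad]⟩
  · right
    have := re_quad_inv_pos p hy ω₀ α hφ hv
    have h2 : 0 < Complex.normSq (ratio θ ω₀.toClosedRealForm11 α φ ((chartAt (Cn n) p).symm y)) :=
      Complex.normSq_pos.2 fun h => hD.ne' (by rw [h]; rfl)
    positivity

variable [CompactSpace X] [MeasurableSpace X] [BorelSpace X] [T2Space X] {θ : ℝ}
  {ω₀ : KahlerForm n X} {α : ClosedRealForm11 n X}

omit [CompactSpace X] [MeasurableSpace X] [BorelSpace X] [T2Space X] in
theorem continuous_gam (θ : ℝ) (ω₀ : KahlerForm n X) (α : ClosedRealForm11 n X) {φ f g : X → ℝ}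
    (hφ : IsSm (n := n) φ) (hf : IsSm (n := n) f) (hg : IsSm (n := n) g) :
    Continuous (gam θ ω₀.toClosedRealForm11 α φ f g) :=
  (((hφ.fam (S := (univ : Set ℝ))).gam hf.fam hg.fam θ ω₀ α).continuous (mem_univ 0))

/-- Integration by parts. -/
theorem integral_mul_gam {φ r f g : X → ℝ} (hφ : IsSm (n := n) φ)
    (hr : IsSm (n := n) r) (hf : IsSm (n := n) f) (hg : IsSm (n := n) g) :
    ∫ x, (r x : ℂ) * gam θ ω₀.toClosedRealForm11 α φ f g x ∂(volX ω₀.toClosedRealForm11) =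
      -∫ x, (g x : ℂ) * (2 * r x * lin θ ω₀.toClosedRealForm11 α φ f x +
        gam θ ω₀.toClosedRealForm11 α φ r f x) ∂(volX ω₀.toClosedRealForm11) := by
  have hint : ∀ {f g : X → ℝ}, IsSm (n := n) f → IsSm (n := n) g → Integrable (fun x => (f x : ℂ) *
      lin θ ω₀.toClosedRealForm11 α φ g x) (volX ω₀.toClosedRealForm11) := fun hf hg =>
    integrable_volX ω₀ ((Complex.continuous_ofReal.comp hf.continuous).mul
      (continuous_lin θ ω₀ α hφ hg))
  have h1 := green θ ω₀ α hφ hr (hf.mul hg)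
  have h2 := green θ ω₀ α hφ (hr.mul hf) hg
  have e1 : (fun x => (r x : ℂ) * gam θ ω₀.toClosedRealForm11 α φ f g x) = fun x =>
      (r x : ℂ) * lin θ ω₀.toClosedRealForm11 α φ (fun x => f x * g x) x -
      ((r x * f x : ℝ) : ℂ) * lin θ ω₀.toClosedRealForm11 α φ g x -
      ((r x * g x : ℝ) : ℂ) * lin θ ω₀.toClosedRealForm11 α φ f x := by
    funext x; rw [gam]; push_cast; ring
  have e2 : (fun x => (g x : ℂ) * (2 * r x * lin θ ω₀.toClosedRealForm11 α φ f x +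
        gam θ ω₀.toClosedRealForm11 α φ r f x)) = fun x =>
      ((r x * g x : ℝ) : ℂ) * lin θ ω₀.toClosedRealForm11 α φ f x +
      (g x : ℂ) * lin θ ω₀.toClosedRealForm11 α φ (fun x => r x * f x) x -
      ((f x * g x : ℝ) : ℂ) * lin θ ω₀.toClosedRealForm11 α φ r x := by
    funext x; rw [gam]; push_cast; ring
  rw [e1, e2, integral_sub, integral_sub, integral_sub, integral_add, h1, h2]
  · ring
  · exact hint (hr.mul hg) hf
  · exact hint hg (hr.mul hf)
  · exact (hint (hr.mul hg) hf).add (hint hg (hr.mul hf))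
  · exact hint (hf.mul hg) hr
  · exact hint hr (hf.mul hg)
  · exact hint (hr.mul hf) hg
  · exact (hint hr (hf.mul hg)).sub (hint (hr.mul hf) hg)
  · exact hint (hr.mul hg) hf

omit [IsManifold 𝓘(ℂ, Cn n) ω X] [CompactSpace X] [MeasurableSpace X] [BorelSpace X]
  [T2Space X] in
theorem isSm_const (c : ℝ) : IsSm (n := n) fun _ : X => c := fun _ => contDiffOn_const

omit [IsManifold 𝓘(ℂ, Cn n) ω X] [CompactSpace X] [MeasurableSpace X] [BorelSpace X]
  [T2Space X] in
theorem lin_const (θ : ℝ) (ω₀ α : ClosedRealForm11 n X) (φ : X → ℝ) (c : ℝ) (x : X) :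
    lin θ ω₀ α φ (fun _ => c) x = 0 := by
  have h5 : (hessAt (fun _ : X => c) x : Matrix (Fin n) (Fin n) ℂ) = 0 := by
    have h2 : ∀ u v, iddbar 𝓘(ℝ, Cn n) (fun _ : X => c) x u v = 0 := by
      intro u v
      simp [iddbar, Function.comp_def]
    ext j k
    simp [hessAt, sesqMat, sesq, h2]
  rw [lin, h5]; simp

theorem integral_lin {φ f : X → ℝ} (hφ : IsSm (n := n) φ) (hf : IsSm (n := n) f) :
    ∫ x, lin θ ω₀.toClosedRealForm11 α φ f x ∂(volX ω₀.toClosedRealForm11) = 0 := by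
  have := green θ ω₀ α hφ (isSm_const 1) hf
  simpa [lin_const] using this

theorem integral_gam {φ f g : X → ℝ} (hφ : IsSm (n := n) φ) (hf : IsSm (n := n) f)
    (hg : IsSm (n := n) g) :
    ∫ x, gam θ ω₀.toClosedRealForm11 α φ f g x ∂(volX ω₀.toClosedRealForm11) =
      -(2 * ∫ x, (g x : ℂ) * lin θ ω₀.toClosedRealForm11 α φ f x
        ∂(volX ω₀.toClosedRealForm11)) := by
  have h := integral_mul_gam (θ := θ) (ω₀ := ω₀) (α := α) hφ (isSm_const 1) hf hg
  have h1 : ∀ x, gam θ ω₀.toClosedRealForm11 α φ (fun _ => 1) f x = 0 := fun x => by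
    simp [gam, lin_const]
  simp only [Complex.ofReal_one, one_mul, mul_one, h1, add_zero] at h
  rw [h, ← integral_const_mul]
  congr 2
  funext x; ring

/-- The case `r = f = g` of `integral_mul_gam`. It removes the cubic terms in the derivative of the
squared length of the velocity. -/
theorem integral_sq_mul_lin {φ f : X → ℝ} (hφ : IsSm (n := n) φ) (hf : IsSm (n := n) f) :
    ∫ x, ((f x ^ 2 : ℝ) : ℂ) * lin θ ω₀.toClosedRealForm11 α φ f x ∂(volX ω₀.toClosedRealForm11) =
      -∫ x, (f x : ℂ) * gam θ ω₀.toClosedRealForm11 α φ f f x ∂(volX ω₀.toClosedRealForm11) := by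
  have h := integral_mul_gam (θ := θ) (ω₀ := ω₀) (α := α) hφ hf hf hf
  have hco := Complex.continuous_ofReal.comp hf.continuous
  have h2 : ∫ x, (f x : ℂ) * (2 * f x * lin θ ω₀.toClosedRealForm11 α φ f x +
        gam θ ω₀.toClosedRealForm11 α φ f f x) ∂(volX ω₀.toClosedRealForm11) =
      2 * (∫ x, ((f x ^ 2 : ℝ) : ℂ) * lin θ ω₀.toClosedRealForm11 α φ f x
        ∂(volX ω₀.toClosedRealForm11)) +
      ∫ x, (f x : ℂ) * gam θ ω₀.toClosedRealForm11 α φ f f x ∂(volX ω₀.toClosedRealForm11) := by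
    rw [← integral_const_mul, ← integral_add]
    · congr 1; funext x; push_cast; ring
    · refine (integrable_volX ω₀ ?_).const_mul 2
      exact (Complex.continuous_ofReal.comp (hf.continuous.pow 2)).mul (continuous_lin θ ω₀ α hφ hf)
    · exact integrable_volX ω₀ (hco.mul (continuous_gam θ ω₀ α hφ hf hf))
  rw [h2] at h
  linear_combination (1 / 2 : ℂ) * h

end CarreDuChamp

/-! ### The complex Hessian on the product with the annulus -/

section Product

open Topology

variable {n : ℕ}

/-- The real linear map `(a, c) ↦ (a, Re c)`. -/
noncomputable def reSnd (n : ℕ) : (Cn n × ℂ) →L[ℝ] (Cn n × ℝ) :=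
  (ContinuousLinearMap.id ℝ (Cn n)).prodMap Complex.reCLM

theorem iddb_comp_reSnd {F : Cn n × ℝ → ℝ} {q : Cn n × ℂ}
    (hF : ContDiffAt ℝ 2 F (reSnd n q)) (a b : Cn n × ℂ) :
    iddb (F ∘ reSnd n) q a b =
      (fderiv ℝ (fderiv ℝ F) (reSnd n q) (reSnd n (Complex.I • a)) (reSnd n b) -
        fderiv ℝ (fderiv ℝ F) (reSnd n q) (reSnd n a) (reSnd n (Complex.I • b))) / 2 := by
  have h1 : fderiv ℝ (reSnd n) = fun _ => reSnd n := funext fun _ => (reSnd n).fderiv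
  rw [iddb_comp_pluriharmonic hF (reSnd n).contDiff.contDiffAt (fun u v => by rw [h1]; simp)]
  rw [h1]

/-- The Hessian of an `S¹`-invariant function in logarithmic coordinates. -/
theorem iddb_comp_neg_log {F : Cn n × ℝ → ℝ} {y : Cn n} {t : ℂ} (ht : t ≠ 0)
    (hF : ContDiffAt ℝ 2 F (y, -Real.log ‖t‖)) (a b : Cn n × ℂ) :
    iddb (fun q : Cn n × ℂ => F (q.1, -Real.log ‖q.2‖)) (y, t) a b =
      iddb (F ∘ reSnd n) (y, ((-Real.log ‖t‖ : ℝ) : ℂ)) (a.1, -t⁻¹ * a.2) (b.1, -t⁻¹ * b.2) := by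
  -- A holomorphic logarithmic coordinate near `t`. Dividing by `t` first keeps the argument of the
  -- logarithm near `1`, away from the branch cut; the real part of the second component at `(y,
  -- t')` is `-log ‖t'‖`.
  set H : Cn n × ℂ → Cn n × ℂ := fun q =>
    (q.1, ((-Real.log ‖t‖ : ℝ) : ℂ) - Complex.log (t⁻¹ * q.2)) with hH
  have hslit : t⁻¹ * t ∈ Complex.slitPlane := by simp [ht]
  have h0 : H (y, t) = (y, ((-Real.log ‖t‖ : ℝ) : ℂ)) := by simp [hH, ht]
  have hHc : ContDiffAt ℂ 2 H (y, t) := by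
    refine contDiffAt_fst.prodMk (contDiffAt_const.sub ?_)
    exact (Complex.contDiffAt_log hslit).comp (y, t) (contDiffAt_const.mul contDiffAt_snd)
  have heq : (fun q : Cn n × ℂ => F (q.1, -Real.log ‖q.2‖)) =ᶠ[𝓝 (y, t)] (F ∘ reSnd n) ∘ H := by
    have : ∀ᶠ q : Cn n × ℂ in 𝓝 (y, t), q.2 ≠ 0 := continuousAt_snd.eventually_ne ht
    filter_upwards [this] with q hq
    have h2 : (Complex.log (t⁻¹ * q.2)).re = -Real.log ‖t‖ + Real.log ‖q.2‖ := by
      rw [Complex.log_re, norm_mul, norm_inv, Real.log_mul (by simpa using ht) (by simpa using hq),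
        Real.log_inv]
    simp [hH, reSnd, h2]
  have hFR : ContDiffAt ℝ 2 (F ∘ reSnd n) (H (y, t)) := by
    refine ContDiffAt.comp _ ?_ (reSnd n).contDiff.contDiffAt
    rw [h0]
    simpa [reSnd] using hF
  have hd : ∀ a : Cn n × ℂ, fderiv ℝ H (y, t) a = (a.1, -t⁻¹ * a.2) := by
    intro a
    have e1 : HasFDerivAt (fun q : Cn n × ℂ => Complex.log (t⁻¹ * q.2))
        ((t⁻¹ * t)⁻¹ • (t⁻¹ • ContinuousLinearMap.snd ℂ (Cn n) ℂ)) (y, t) :=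
      ((hasFDerivAt_snd (𝕜 := ℂ) (p := (y, t))).const_mul t⁻¹).clog hslit
    have e2 : HasFDerivAt H ((ContinuousLinearMap.fst ℂ (Cn n) ℂ).prod
        (-((t⁻¹ * t)⁻¹ • (t⁻¹ • ContinuousLinearMap.snd ℂ (Cn n) ℂ)))) (y, t) :=
      (hasFDerivAt_fst (𝕜 := ℂ)).prodMk (e1.const_sub _)
    rw [(e2.restrictScalars ℝ).fderiv]
    simp [ht]
  rw [iddb_congr heq, iddb_comp_holomorphic hFR hHc, hd, hd, h0]

/-- The standard basis of `ℂⁿ × ℂ`. -/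
noncomputable def prodB (n : ℕ) (i : Fin (n + 1)) : Cn n × ℂ :=
  Fin.lastCases (motive := fun _ => Cn n × ℂ) (0, 1) (fun j => (stdB j, 0)) i

@[simp] theorem prodB_last : prodB n (Fin.last n) = (0, 1) := by simp [prodB]

@[simp] theorem prodB_castSucc (j : Fin n) : prodB n j.castSucc = (stdB j, 0) := by simp [prodB]

theorem eq_sum_prodB (a : Cn n × ℂ) :
    a = ∑ i, (Fin.snoc (α := fun _ => ℂ) a.1 a.2 : Fin (n + 1) → ℂ) i • prodB n i := by
  rw [Fin.sum_univ_castSucc]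
  ext
  · simp [Prod.fst_sum, stdB, Finset.sum_apply, Pi.single_apply]
  · simp [Prod.snd_sum]

theorem fderiv_fderiv_slice {F : Cn n × ℝ → ℝ} {y : Cn n} {s : ℝ} (hF : ContDiffAt ℝ 2 F (y, s))
    (u v : Cn n) : fderiv ℝ (fderiv ℝ F) (y, s) (u, 0) (v, 0) =
      fderiv ℝ (fderiv ℝ fun y => F (y, s)) y u v := by
  have h1 : fderiv ℝ (fun y : Cn n => (y, s)) = fun _ => ContinuousLinearMap.inl ℝ (Cn n) ℝ :=
    funext fun y => (hasFDerivAt_prodMk_left y s).fderiv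
  have h2 := fderiv_fderiv_comp (f := F) (g := fun y : Cn n => (y, s)) (y := y) hF
    (by fun_prop) u v
  simp only [h1] at h2
  simpa [Function.comp_def] using h2.symm

theorem fderiv_fderiv_mixed {F : Cn n × ℝ → ℝ} {y : Cn n} {s : ℝ} (hF : ContDiffAt ℝ 2 F (y, s))
    (v : Cn n) : fderiv ℝ (fderiv ℝ F) (y, s) (v, 0) (0, 1) =
      fderiv ℝ (fun y => deriv (fun s => F (y, s)) s) y v := by
  have h2 : DifferentiableAt ℝ (fderiv ℝ F) (y, s) :=
    (hF.fderiv_right (m := 1) (by norm_num)).differentiableAt (by simp)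
  have h3 : HasFDerivAt (fun y => fderiv ℝ F (y, s)) _ y :=
    HasFDerivAt.comp y h2.hasFDerivAt (hasFDerivAt_prodMk_left (𝕜 := ℝ) y s)
  have h4 := h3.clm_apply (hasFDerivAt_const ((0 : Cn n), (1 : ℝ)) y)
  have h5 : (fun y => deriv (fun s => F (y, s)) s) =ᶠ[𝓝 y] fun y => fderiv ℝ F (y, s) (0, 1) := by
    have h6 : ∀ᶠ q in 𝓝 (y, s), ContDiffAt ℝ 2 F q := hF.eventually (by simp)
    have h7 : Filter.Tendsto (fun y : Cn n => (y, s)) (𝓝 y) (𝓝 (y, s)) :=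
      (continuous_id.prodMk continuous_const).continuousAt
    filter_upwards [h7.eventually h6] with z hz
    exact deriv_snd_eq (hz.differentiableAt (by simp))
  rw [h5.fderiv_eq]
  have h6 := congrArg (fun T => T v) h4.fderiv
  refine Eq.trans ?_ h6.symm
  simp

theorem fderiv_fderiv_param {F : Cn n × ℝ → ℝ} {y : Cn n} {s : ℝ} (hF : ContDiffAt ℝ 2 F (y, s)) :
    fderiv ℝ (fderiv ℝ F) (y, s) (0, 1) (0, 1) = deriv (fun s => deriv (fun s => F (y, s)) s) s := by
  have h2 : DifferentiableAt ℝ (fderiv ℝ F) (y, s) :=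
    (hF.fderiv_right (m := 1) (by norm_num)).differentiableAt (by simp)
  have h3 : HasFDerivAt (fun s => fderiv ℝ F (y, s)) _ s :=
    HasFDerivAt.comp s h2.hasFDerivAt (hasFDerivAt_prodMk_right (𝕜 := ℝ) y s)
  have h4 := h3.clm_apply (hasFDerivAt_const ((0 : Cn n), (1 : ℝ)) s)
  have h5 : (fun s => deriv (fun s => F (y, s)) s) =ᶠ[𝓝 s] fun s => fderiv ℝ F (y, s) (0, 1) := by
    have h6 : ∀ᶠ q in 𝓝 (y, s), ContDiffAt ℝ 2 F q := hF.eventually (by simp)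
    have h7 : Filter.Tendsto (fun s : ℝ => (y, s)) (𝓝 s) (𝓝 (y, s)) :=
      (continuous_const.prodMk continuous_id).continuousAt
    filter_upwards [h7.eventually h6] with z hz
    exact deriv_snd_eq (hz.differentiableAt (by simp))
  rw [h5.deriv_eq, h4.hasDerivAt.deriv]
  simp

/-- The matrix of the complex Hessian of `F (y, Re τ)`. -/
theorem sesq_iddb_comp_reSnd {F : Cn n × ℝ → ℝ} {y : Cn n} {s : ℝ}
    (hF : ContDiffAt ℝ 2 F (y, s))
    (hF' : DifferentiableAt ℝ (fun y => deriv (fun s => F (y, s)) s) y) :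
    (∀ j k, sesq (fun u v => (iddb (F ∘ reSnd n) (y, (s : ℂ)) u v : ℂ)) (stdB j, 0) (stdB k, 0) =
      hessC (fun y => F (y, s)) y j k) ∧
    (∀ j, sesq (fun u v => (iddb (F ∘ reSnd n) (y, (s : ℂ)) u v : ℂ)) (stdB j, 0) (0, 1) =
      gradC (fun y => deriv (fun s => F (y, s)) s) y j / 2) ∧
    (∀ k, sesq (fun u v => (iddb (F ∘ reSnd n) (y, (s : ℂ)) u v : ℂ)) (0, 1) (stdB k, 0) =
      (starRingEnd ℂ) (gradC (fun y => deriv (fun s => F (y, s)) s) y k) / 2) ∧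
    sesq (fun u v => (iddb (F ∘ reSnd n) (y, (s : ℂ)) u v : ℂ)) (0, 1) (0, 1) =
      ((deriv (fun s => deriv (fun s => F (y, s)) s) s : ℝ) : ℂ) / 4 := by
  have hR : reSnd n (y, (s : ℂ)) = (y, s) := by simp [reSnd]
  have hsymm := hF.isSymmSndFDerivAt (by simp)
  have hmix : ∀ v : Cn n, fderiv ℝ (fderiv ℝ F) (y, s) (0, 1) (v, 0) =
      fderiv ℝ (fun y => deriv (fun s => F (y, s)) s) y v := fun v => by
    rw [hsymm.eq, fderiv_fderiv_mixed hF]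
  have hneg : ((0 : Cn n), (-1 : ℝ)) = -((0 : Cn n), (1 : ℝ)) := by simp
  have key := fun a b => iddb_comp_reSnd (q := (y, (s : ℂ))) (by rw [hR]; exact hF) a b
  simp only [hR] at key
  have r1 : ∀ v : Cn n, reSnd n (v, 0) = (v, 0) := fun v => by simp [reSnd]
  have r2 : reSnd n (0, 1) = (0, 1) := by simp [reSnd]
  have r3 : ∀ v : Cn n, reSnd n (Complex.I • (v, (0 : ℂ))) = (Complex.I • v, 0) := fun v => by
    simp [reSnd]
  have r4 : reSnd n (Complex.I • ((0 : Cn n), (1 : ℂ))) = 0 := by simp [reSnd]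
  have r5 : reSnd n (Complex.I • Complex.I • ((0 : Cn n), (1 : ℂ))) = -(0, 1) := by simp [reSnd]
  have r6 : ∀ v : Cn n, reSnd n (Complex.I • Complex.I • (v, (0 : ℂ))) =
      (Complex.I • Complex.I • v, 0) := fun v => by simp [reSnd]
  -- The parameter is the real part of the complex coordinate, on which `∂/∂τ` acts as `½ d/ds`;
  -- hence one factor `1/2` for each vertical index.
  refine ⟨fun j k => ?_, fun j => ?_, fun k => ?_, ?_⟩
  · simp only [hessC, sesqMat, sesq, Matrix.of_apply, key, r1, r3, r6]
    simp only [iddb, fderiv_fderiv_slice hF]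
  · simp only [sesq, key, r1, r2, r3, r4, r5, fderiv_fderiv_mixed hF, map_zero, map_neg,
      gradC, wz, fderiv_ofReal hF']
    push_cast
    ring
  · simp only [sesq, key, r1, r2, r3, r4, r6, map_zero,
      gradC, wz, fderiv_ofReal hF', hmix, zero_apply]
    simp only [map_sub, map_mul, map_div₀, Complex.conj_I, Complex.conj_ofReal, Complex.conj_ofNat]
    have h2 : Complex.I • Complex.I • (stdB k : Cn n) = -stdB k := by
      rw [smul_smul, Complex.I_mul_I, neg_one_smul]
    rw [h2, map_neg]
    push_cast
    ring
  · simp only [sesq, key, r2, r4, r5, map_zero, map_neg, fderiv_fderiv_param hF, zero_apply]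
    push_cast
    ring

end Product

/-! ### The top power on the product of `X` with the annulus -/

section SpaceTime

open Topology

variable {n : ℕ} {X : Type*} [TopologicalSpace X] [ChartedSpace (Cn n) X]

theorem isForm11_idtdtbar : IsForm11 fun u v : ℂ => (idtdtbar u v : ℂ) where
  add_left u v w := by simp only [idtdtbar, add_mul, Complex.add_im]; push_cast; ring
  smul_left r u w := by
    simp only [idtdtbar, smul_eq_mul, mul_assoc, Complex.im_ofReal_mul]
    push_cast; ring
  swap u w := by
    simp only [idtdtbar, Complex.mul_im, Complex.conj_re, Complex.conj_im]; push_cast; ring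
  type11 u w := by
    simp only [idtdtbar, smul_eq_mul, map_mul, Complex.conj_I]
    congr 2
    have : Complex.I * u * (-Complex.I * (starRingEnd ℂ) w) = u * (starRingEnd ℂ) w := by
      linear_combination (-u * (starRingEnd ℂ) w) * Complex.I_mul_I
    rw [this]

theorem gam_at (θ : ℝ) (ω₀ α : ClosedRealForm11 n X) (φ : X → ℝ) {f : X → ℝ}
    (hf : IsSm (n := n) f) (x : X) :
    gam θ ω₀ α φ f f x = 2 * (phase θ / (formAt ω₀ x).det *
      quad (cplxAt ω₀ α φ x).adjugate
        (gradC (f ∘ (chartAt (Cn n) x).symm) (chartAt (Cn n) x x))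
        (gradC (f ∘ (chartAt (Cn n) x).symm) (chartAt (Cn n) x x))) := by
  have h1 := trace_mul_hessC_mul (cplxAt ω₀ α φ x).adjugate (hf.contDiffAt_self x)
    (hf.contDiffAt_self x)
  have h2 : ∀ f : X → ℝ, (hessAt f x : Matrix (Fin n) (Fin n) ℂ) =
    hessC (f ∘ (chartAt (Cn n) x).symm) (chartAt (Cn n) x x) := fun _ => rfl
  have h3 : (fun x => f x * f x) ∘ (chartAt (Cn n) x).symm = fun y =>
    (f ∘ (chartAt (Cn n) x).symm) y * (f ∘ (chartAt (Cn n) x).symm) y := rfl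
  have h4 : (f ∘ (chartAt (Cn n) x).symm) (chartAt (Cn n) x x) = f x := by
    simp [(chartAt (Cn n) x).left_inv (mem_chart_source _ x)]
  rw [gam, lin, lin, h2, h2, h3, h1, h4]
  ring

theorem iddbar_lift (φ : ℝ → X → ℝ) (x : X) (t : ℂ) (a b : Cn n × ℂ) :
    iddbar (𝓘(ℝ, Cn n).prod 𝓘(ℝ, ℂ)) (lift φ) (x, t) a b =
      iddb (fun q : Cn n × ℂ => φ (-Real.log ‖q.2‖) ((chartAt (Cn n) x).symm q.1))
        (chartAt (Cn n) x x, t) a b := by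
  rfl

/-- The top power of the form on the product with the annulus. -/
theorem phase_mul_wedgePow_spaceTimeForm [IsManifold 𝓘(ℂ, Cn n) ω X] {S : Set ℝ} (hS : IsOpen S)
    {φ : ℝ → X → ℝ} (hφ : Fam n S φ) {t : ℂ} (ht : t ≠ 0) (hs : -Real.log ‖t‖ ∈ S) (θ ε : ℝ)
    (ω₀ : KahlerForm n X) (α : ClosedRealForm11 n X) (x : X) (w : Fin n × Fin 2 → Cn n) (u v : ℂ) :
    phase θ * wedgePow (spaceTimeForm ω₀ α ε φ (x, t)) (n + 1)
      (fun p : Fin (n + 1) × Fin 2 => Fin.lastCases (motive := fun _ => Cn n × ℂ)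
        ((0 : Cn n), ![u, v] p.2) (fun j => (w (j, p.2), (0 : ℂ))) p.1) =
    ((n : ℂ) + 1) * (idtdtbar u v : ℂ) * frameFactor w * (formAt ω₀.toClosedRealForm11 x).det *
      ((4 * ‖t‖ ^ 2 : ℝ) : ℂ)⁻¹ *
      (((4 * ‖t‖ ^ 2 * ε ^ 2 : ℝ) : ℂ) * ratio θ ω₀.toClosedRealForm11 α (φ (-Real.log ‖t‖)) x +
        Complex.I * ((deriv (fun s => deriv (fun s => φ s x) s) (-Real.log ‖t‖) : ℝ) : ℂ) *
          ratio θ ω₀.toClosedRealForm11 α (φ (-Real.log ‖t‖)) x +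
        gam θ ω₀.toClosedRealForm11 α (φ (-Real.log ‖t‖))
          (fun x => deriv (fun s => φ s x) (-Real.log ‖t‖))
          (fun x => deriv (fun s => φ s x) (-Real.log ‖t‖)) x / 2) := by
  set s := -Real.log ‖t‖ with hsdef
  set e := chartAt (Cn n) x with he
  set y := e x with hy
  have hyt : y ∈ e.target := mem_chart_target _ x
  have hex : e.symm y = x := e.left_inv (mem_chart_source _ x)
  set F : Cn n × ℝ → ℝ := fun z => φ z.2 (e.symm z.1) with hFdef
  have hF : ContDiffAt ℝ 2 F (y, s) :=
    ((hφ x).contDiffAt ((e.open_target.prod hS).mem_nhds ⟨hyt, hs⟩)).of_le two_le_infty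
  set dφ : X → ℝ := fun x => deriv (fun s => φ s x) s with hdφ
  have hd : IsSm (n := n) dφ := (hφ.deriv hS).isSm hs
  have hF' : DifferentiableAt ℝ (fun y => deriv (fun s => F (y, s)) s) y :=
    (hd.contDiffAt_self x).differentiableAt (by simp)
  have hφs := hφ.isSm hs
  obtain ⟨m1, m2, m3, m4⟩ := sesq_iddb_comp_reSnd hF hF'
  set η := fun u v => (iddb (F ∘ reSnd n) (y, (s : ℂ)) u v : ℂ) with hη
  have hη11 : IsForm11 η := isForm11_iddb (by
    refine ContDiffAt.comp _ ?_ (reSnd n).contDiff.contDiffAt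
    simpa [reSnd] using hF)
  -- The differential of the logarithmic coordinate of `iddb_comp_neg_log` at `t`.
  set T : (Cn n × ℂ) →ₗ[ℂ] (Cn n × ℂ) := LinearMap.prodMap LinearMap.id
    ((-t⁻¹) • LinearMap.id) with hT
  have hform : spaceTimeForm ω₀ α ε φ (x, t) = fun a b =>
      ((ω₀.toForm x ![a.1, b.1] : ℂ) + (ε ^ 2 : ℂ) * (idtdtbar a.2 b.2 : ℂ)) +
        Complex.I * ((α.toForm x ![a.1, b.1] : ℂ) + η (T a) (T b)) := by
    funext a b
    rw [spaceTimeForm, iddbar_lift, iddb_comp_neg_log (F := F) ht hF]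
    simp only [hη, hT, LinearMap.prodMap_apply, LinearMap.id_apply, LinearMap.smul_apply,
      smul_eq_mul]
    rw [← hsdef]
    push_cast
    rfl
  have i1 : ∀ α : ClosedRealForm11 n X, IsForm11 fun a b : Cn n × ℂ =>
      (α.toForm x ![a.1, b.1] : ℂ) := fun α =>
    isForm11_comp (isForm11_form α x) (LinearMap.fst ℂ (Cn n) ℂ)
  have i2 : IsForm11 fun a b : Cn n × ℂ => (idtdtbar a.2 b.2 : ℂ) :=
    isForm11_comp isForm11_idtdtbar (LinearMap.snd ℂ (Cn n) ℂ)
  have i3 := isForm11_comp hη11 T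
  have h11 : IsForm11 (spaceTimeForm ω₀ α ε φ (x, t)) := by
    rw [hform]
    exact isForm11_add (isForm11_add (i1 _) (isForm11_const_mul _ i2))
      (isForm11_const_mul _ (isForm11_add (i1 _) i3))
  set g := gradC (dφ ∘ e.symm) y with hg
  set M := sesqMat (prodB n) (spaceTimeForm ω₀ α ε φ (x, t)) with hM
  have hM' : M = (sesqMat (prodB n) (fun a b => (ω₀.toForm x ![a.1, b.1] : ℂ)) +
      (ε ^ 2 : ℂ) • sesqMat (prodB n) (fun a b => (idtdtbar a.2 b.2 : ℂ))) +
      Complex.I • (sesqMat (prodB n) (fun a b => (α.toForm x ![a.1, b.1] : ℂ)) +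
        sesqMat (prodB n) (fun a b => η (T a) (T b))) := by
    rw [hM, hform, sesqMat_add, sesqMat_add, sesqMat_const_mul, sesqMat_const_mul, sesqMat_add]
  have f1 : ∀ (α : ClosedRealForm11 n X) (j k : Fin n), sesqMat (prodB n)
      (fun a b => (α.toForm x ![a.1, b.1] : ℂ)) j.castSucc k.castSucc = formAt α x j k := by
    intro α j k
    simp [sesqMat, sesq, formAt]
  have f0 : ∀ (α : ClosedRealForm11 n X) (u : Cn n), (α.toForm x ![u, 0] : ℂ) = 0 ∧
      (α.toForm x ![0, u] : ℂ) = 0 := by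
    intro α u
    have h1 := (isForm11_form α x).smul_left 0 u u
    have h2 := (isForm11_form α x).swap 0 u
    simp only [Complex.ofReal_zero, zero_smul, zero_mul] at h1
    refine ⟨?_, h1⟩
    rw [h2]
    simp only [h1, neg_zero]
  have f2 : ∀ (α : ClosedRealForm11 n X) (j : Fin (n + 1)), sesqMat (prodB n)
      (fun a b => (α.toForm x ![a.1, b.1] : ℂ)) j (Fin.last n) = 0 ∧ sesqMat (prodB n)
      (fun a b => (α.toForm x ![a.1, b.1] : ℂ)) (Fin.last n) j = 0 := by
    intro α j
    simp [sesqMat, sesq, (f0 _ _).1, (f0 _ _).2]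
  have f3 : ∀ j k : Fin n, sesqMat (prodB n) (fun a b => (idtdtbar a.2 b.2 : ℂ))
      j.castSucc k.castSucc = 0 := by
    intro j k; simp [sesqMat, sesq, idtdtbar]
  have f4 : ∀ j : Fin n, sesqMat (prodB n) (fun a b => (idtdtbar a.2 b.2 : ℂ))
      j.castSucc (Fin.last n) = 0 ∧ sesqMat (prodB n) (fun a b => (idtdtbar a.2 b.2 : ℂ))
      (Fin.last n) j.castSucc = 0 := by
    intro j; simp [sesqMat, sesq, idtdtbar]
  have f5 : sesqMat (prodB n) (fun a b => (idtdtbar a.2 b.2 : ℂ)) (Fin.last n) (Fin.last n) = 1 := by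
    simp [sesqMat, sesq, idtdtbar]
  have tb : ∀ j : Fin n, T (prodB n j.castSucc) = (stdB j, 0) := fun j => by simp [hT]
  have tl : T (prodB n (Fin.last n)) = (-t⁻¹) • ((0 : Cn n), (1 : ℂ)) := by simp [hT]
  have sT : ∀ j k, sesqMat (prodB n) (fun a b => η (T a) (T b)) j k =
      sesq η (T (prodB n j)) (T (prodB n k)) := fun j k => by simp [sesqMat, sesq]
  -- The four computations `g1` to `g4` give a bordered matrix: the block `h`, the borders `√-1
  -- (-t̄⁻¹) ∂φ̇/2` and `√-1 (-t⁻¹) ∂̄φ̇/2`, and the corner `ε² + √-1 φ̈/(4‖t‖²)`.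
  have g1 : ∀ j k : Fin n, M j.castSucc k.castSucc =
      cplxAt ω₀.toClosedRealForm11 α (φ s) x j k := by
    intro j k
    rw [hM']
    simp only [Matrix.add_apply, Matrix.smul_apply, f1, f3, sT, tb, m1, cplxAt]
    simp only [smul_eq_mul, mul_zero, add_zero]
    rfl
  have g2 : ∀ j : Fin n, M j.castSucc (Fin.last n) =
      Complex.I * ((starRingEnd ℂ) (-t⁻¹) * (g j / 2)) := by
    intro j
    rw [hM']
    simp only [Matrix.add_apply, Matrix.smul_apply, (f2 _ _).1, (f4 j).1, sT, tb, tl,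
      hη11.sesq_smul_right, m2, smul_eq_mul, mul_zero, zero_add]
    rfl
  have g3 : ∀ k : Fin n, M (Fin.last n) k.castSucc =
      Complex.I * (-t⁻¹ * ((starRingEnd ℂ) (g k) / 2)) := by
    intro k
    rw [hM']
    simp only [Matrix.add_apply, Matrix.smul_apply, (f2 _ _).2, (f4 k).2, sT, tb, tl,
      hη11.sesq_smul_left, m3, smul_eq_mul, mul_zero, zero_add]
    rfl
  have g4 : M (Fin.last n) (Fin.last n) = (ε ^ 2 : ℂ) + Complex.I * (-t⁻¹ *
      ((starRingEnd ℂ) (-t⁻¹) *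
        (((deriv (fun s => deriv (fun s => φ s x) s) s : ℝ) : ℂ) / 4))) := by
    rw [hM']
    simp only [Matrix.add_apply, Matrix.smul_apply, (f2 _ _).2, f5, sT, tl,
      hη11.sesq_smul_left, hη11.sesq_smul_right, m4, smul_eq_mul, mul_one, zero_add]
    simp only [hFdef, hex]
  have hdet : (cplxAt ω₀.toClosedRealForm11 α (φ s) x).det ≠ 0 := by
    rw [cplxAt]
    exact det_add_I_smul_ne_zero (formAt_posHerm ω₀ x)
      ((formAt_isHermitian α x).add (hessAt_isHermitian hφs x))
  have hnorm : t⁻¹ * (starRingEnd ℂ) t⁻¹ = ((‖t‖ ^ 2 : ℝ) : ℂ)⁻¹ := by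
    rw [Complex.mul_conj, Complex.normSq_eq_norm_sq, norm_inv]
    push_cast
    rw [inv_pow]
  have hsum : ∑ j, ∑ k, M (Fin.last n) (Fin.castSucc k) *
      (cplxAt ω₀.toClosedRealForm11 α (φ s) x).adjugate k j * M (Fin.castSucc j) (Fin.last n) =
      -(((‖t‖ ^ 2 : ℝ) : ℂ)⁻¹ / 4 *
        quad (cplxAt ω₀.toClosedRealForm11 α (φ s) x).adjugate g g) := by
    rw [← hnorm, quad, Finset.mul_sum, ← Finset.sum_neg_distrib]
    refine Finset.sum_congr rfl fun j _ => ?_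
    rw [Finset.mul_sum, ← Finset.sum_neg_distrib]
    refine Finset.sum_congr rfl fun k _ => ?_
    rw [g2, g3, map_neg]
    linear_combination (t⁻¹ * (starRingEnd ℂ) t⁻¹ / 4 * (starRingEnd ℂ) (g k) * g j *
      (cplxAt ω₀.toClosedRealForm11 α (φ s) x).adjugate k j) * Complex.I_mul_I
  have hfac : (((n + 1).factorial : ℕ) : ℂ) = ((n : ℂ) + 1) * (n.factorial : ℂ) := by
    rw [Nat.factorial_succ]; push_cast; ring
  have hco := det_coordMat_snoc w u v
  -- The determinant of the bordered matrix is `h.det` times the corner, plus `quad` of the adjugate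
  -- over `4‖t‖²`: the two factors `√-1` of the borders turn the minus sign of the Schur complement
  -- into a plus. The factor `n + 1` is `(n+1)!/n!`.
  rw [wedgePow_eq_det h11 (prodB n) (fun a : Cn n × ℂ => Fin.snoc (α := fun _ => ℂ) a.1 a.2)
    eq_sum_prodB, ← hM, det_snoc g1 hdet, hsum, g4, gam_at θ _ α (φ s) hd, ratio, frameFactor, hfac,
    pow_succ]
  rw [map_neg]
  have hW := (formAt_posHerm ω₀ x).det_ne_zero
  have htn : ((‖t‖ : ℝ) : ℂ) ≠ 0 := by simpa using ht
  set C1 := (coordMat (fun a : Cn n × ℂ => Fin.snoc (α := fun _ => ℂ) a.1 a.2)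
      (fun p : Fin (n + 1) × Fin 2 => Fin.lastCases (motive := fun _ => Cn n × ℂ)
        ((0 : Cn n), ![u, v] p.2) (fun j => (w (j, p.2), (0 : ℂ))) p.1)).det
  set C0 := (coordMat (fun a : Cn n => a) w).det
  set φ2 := deriv (fun s => deriv (fun s => φ s x) s) s
  set dh := (cplxAt ω₀.toClosedRealForm11 α (φ s) x).det
  set q := quad (cplxAt ω₀.toClosedRealForm11 α (φ s) x).adjugate g g
  set W := (formAt ω₀.toClosedRealForm11 x).det
  have e1 : dh * ((ε ^ 2 : ℂ) + Complex.I * (-t⁻¹ * (-(starRingEnd ℂ) t⁻¹ * ((φ2 : ℂ) / 4)))) -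
      -(((‖t‖ ^ 2 : ℝ) : ℂ)⁻¹ / 4 * q) =
      ((4 * ‖t‖ ^ 2 : ℝ) : ℂ)⁻¹ * (((4 * ‖t‖ ^ 2 * ε ^ 2 : ℝ) : ℂ) * dh + Complex.I * φ2 * dh + q) := by
    have e2 : dh * ((ε ^ 2 : ℂ) + Complex.I * (-t⁻¹ * (-(starRingEnd ℂ) t⁻¹ * ((φ2 : ℂ) / 4)))) =
        dh * ((ε ^ 2 : ℂ) + Complex.I * ((t⁻¹ * (starRingEnd ℂ) t⁻¹) * ((φ2 : ℂ) / 4))) := by ring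
    rw [e2, hnorm]
    push_cast
    field_simp
    ring
  rw [e1]
  calc _ = ((n : ℂ) + 1) * (n.factorial : ℂ) * Complex.I ^ n * (Complex.I * C1) * phase θ *
      (((4 * ‖t‖ ^ 2 : ℝ) : ℂ)⁻¹ * (((4 * ‖t‖ ^ 2 * ε ^ 2 : ℝ) : ℂ) * dh + Complex.I * φ2 * dh + q))
      := by ring
    _ = _ := by
      rw [hco]
      field_simp

end SpaceTime

/-! ### The Hessian of the functionals along a curve -/

section HessianAnnulus

open Topology

theorem contDiffOn_two_of_hasDerivAt {G : Type*} [NormedAddCommGroup G] [NormedSpace ℝ G]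
    {f f1 f2 : ℝ → G} {S : Set ℝ} (hS : IsOpen S) (h1 : ∀ s ∈ S, HasDerivAt f (f1 s) s)
    (h2 : ∀ s ∈ S, HasDerivAt f1 (f2 s) s) (h3 : ContinuousOn f2 S) : ContDiffOn ℝ 2 f S := by
  have key : ∀ {f g : ℝ → G} {m : ℕ}, (∀ s ∈ S, HasDerivAt f (g s) s) → ContDiffOn ℝ m g S →
      ContDiffOn ℝ ((m : WithTop ℕ∞) + 1) f S := by
    intro f g m hf hg
    rw [contDiffOn_succ_iff_deriv_of_isOpen hS]
    refine ⟨fun s hs => (hf s hs).differentiableAt.differentiableWithinAt, fun h => ?_,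
      hg.congr fun s hs => (hf s hs).deriv⟩
    exact absurd h (by simp)
  have h4 : ContDiffOn ℝ ((0 : ℕ) : WithTop ℕ∞) f2 S := by
    rw [Nat.cast_zero]
    exact contDiffOn_zero.2 h3
  have h6 := key h1 (m := 1) (by simpa using key h2 h4)
  have h7 : (((1 : ℕ) : WithTop ℕ∞) + 1) = 2 := by norm_num
  rwa [h7] at h6

/-- The form `√-1 ∂∂̄` of a radial function on `ℂ`. -/
theorem iddbar_radial {j : ℝ → ℝ} {t : ℂ} (ht : t ≠ 0) (hj : ContDiffAt ℝ 2 j (-Real.log ‖t‖))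
    (u v : ℂ) : iddbar 𝓘(ℝ, ℂ) (fun t : ℂ => j (-Real.log ‖t‖)) t u v =
      deriv (deriv j) (-Real.log ‖t‖) * (idtdtbar u v / (4 * ‖t‖ ^ 2)) := by
  -- The computation on the product is reused with a point as first factor.
  set F : Cn 0 × ℝ → ℝ := fun z => j z.2 with hFdef
  have hF : ContDiffAt ℝ 2 F ((0 : Cn 0), -Real.log ‖t‖) :=
    ContDiffAt.comp (g := j) (f := Prod.snd) ((0 : Cn 0), -Real.log ‖t‖) hj contDiffAt_snd
  have h1 : iddbar 𝓘(ℝ, ℂ) (fun t : ℂ => j (-Real.log ‖t‖)) t u v =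
      iddb ((fun q : Cn 0 × ℂ => F (q.1, -Real.log ‖q.2‖)) ∘ fun t : ℂ => ((0 : Cn 0), t)) t u v :=
    rfl
  have hlog : ContDiffAt ℝ 2 (fun q : Cn 0 × ℂ => (q.1, -Real.log ‖q.2‖)) ((0 : Cn 0), t) := by
    refine contDiffAt_fst.prodMk (ContDiffAt.neg (ContDiffAt.log ?_ (by simpa using ht)))
    exact contDiffAt_snd.norm ℝ ht
  have hG : ContDiffAt ℝ 2 (fun q : Cn 0 × ℂ => F (q.1, -Real.log ‖q.2‖)) ((0 : Cn 0), t) :=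
    ContDiffAt.comp (g := F) ((0 : Cn 0), t) hF hlog
  have hd : ∀ u, fderiv ℝ (fun t : ℂ => ((0 : Cn 0), t)) t u = (0, u) := by
    intro u
    have h2 : HasFDerivAt (fun t : ℂ => ((0 : Cn 0), t)) (ContinuousLinearMap.inr ℝ (Cn 0) ℂ) t :=
      hasFDerivAt_prodMk_right (0 : Cn 0) t
    rw [h2.fderiv]; simp
  have hR : reSnd 0 ((0 : Cn 0), ((-Real.log ‖t‖ : ℝ) : ℂ)) = ((0 : Cn 0), -Real.log ‖t‖) := by
    simp [reSnd]
  rw [h1, iddb_comp_holomorphic hG (by fun_prop), hd, hd, iddb_comp_neg_log ht hF,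
    iddb_comp_reSnd (by rw [hR]; exact hF), hR]
  have h5 : ∀ c d : ℝ, fderiv ℝ (fderiv ℝ F) ((0 : Cn 0), -Real.log ‖t‖) (0, c) (0, d) =
      c * d * deriv (deriv j) (-Real.log ‖t‖) := by
    intro c d
    have e1 : ((0 : Cn 0), c) = c • ((0 : Cn 0), (1 : ℝ)) := by simp
    have e2 : ((0 : Cn 0), d) = d • ((0 : Cn 0), (1 : ℝ)) := by simp
    rw [e1, e2, map_smul, map_smul, smul_apply, fderiv_fderiv_param hF]
    simp only [smul_eq_mul]
    ring
  have h6 : ∀ c : ℂ, reSnd 0 ((0 : Cn 0), c) = (0, c.re) := fun c => by simp [reSnd]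
  simp only [Prod.smul_mk, smul_zero, h6, h5, smul_eq_mul]
  have h7 : (-t⁻¹ * u * (starRingEnd ℂ) (-t⁻¹ * v)).im = (u * (starRingEnd ℂ) v).im / ‖t‖ ^ 2 := by
    have : -t⁻¹ * u * (starRingEnd ℂ) (-t⁻¹ * v) =
        ((‖t‖ ^ 2)⁻¹ : ℝ) * (u * (starRingEnd ℂ) v) := by
      have h8 : t⁻¹ * (starRingEnd ℂ) t⁻¹ = (((‖t‖ ^ 2)⁻¹ : ℝ) : ℂ) := by
        rw [Complex.mul_conj, Complex.normSq_eq_norm_sq, norm_inv, inv_pow]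
      rw [← h8, map_mul, map_neg]; ring
    rw [this, Complex.im_ofReal_mul]; ring
  have h9 : idtdtbar u v / (4 * ‖t‖ ^ 2) = -(-t⁻¹ * u * (starRingEnd ℂ) (-t⁻¹ * v)).im / 2 := by
    rw [h7, idtdtbar]; ring
  rw [h9]
  simp only [Complex.mul_im, Complex.mul_re, Complex.conj_re, Complex.conj_im, Complex.I_re,
    Complex.I_im]
  ring

end HessianAnnulus

/-! ### The Hessian of the functionals as a fibre integral -/

section PartOne

open Topology

variable {n : ℕ} {X : Type*} [TopologicalSpace X] [ChartedSpace (Cn n) X]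

/-- The density of the fibre integral of the top form on the product with the annulus. -/
noncomputable def hessDensity (θ : ℝ) (ω₀ α : ClosedRealForm11 n X) (φ : ℝ → X → ℝ) (s : ℝ)
    (x : X) : ℂ :=
  Complex.I * ((deriv (fun s => deriv (fun s => φ s x) s) s : ℝ) : ℂ) * ratio θ ω₀ α (φ s) x +
    gam θ ω₀ α (φ s) (fun x => deriv (fun s => φ s x) s) (fun x => deriv (fun s => φ s x) s) x / 2

variable [IsManifold 𝓘(ℂ, Cn n) ω X]

theorem Fam.hessDensity {S : Set ℝ} (hS : IsOpen S) {φ : ℝ → X → ℝ} (h : Fam n S φ) (θ : ℝ)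
    (ω₀ : KahlerForm n X) (α : ClosedRealForm11 n X) :
    Fam n S (hessDensity θ ω₀.toClosedRealForm11 α φ) :=
  (((Fam.const _).mul ((h.deriv hS).deriv hS).ofReal).mul (h.ratio θ ω₀ α)).add
    ((h.gam (h.deriv hS) (h.deriv hS) θ ω₀ α).div (Fam.const _) fun _ _ _ => two_ne_zero)

variable [CompactSpace X] [MeasurableSpace X] [BorelSpace X] [T2Space X] {θ : ℝ}
  {ω₀ : KahlerForm n X} {α : ClosedRealForm11 n X} {φb : X → ℝ} {φ : ℝ → X → ℝ} {S : Set ℝ}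

/-- The second variation of `CY`, after integration by parts. -/
theorem hasDerivAt_deriv_phase_mul_CY (hS : IsOpen S) (hφ : Fam n S φ) {s : ℝ} (hs : s ∈ S) :
    HasDerivAt (fun s => ∫ x, ((deriv (fun s => φ s x) s : ℝ) : ℂ) *
        ratio θ ω₀.toClosedRealForm11 α (φ s) x ∂(volX ω₀.toClosedRealForm11))
      (-Complex.I * ∫ x, hessDensity θ ω₀.toClosedRealForm11 α φ s x
        ∂(volX ω₀.toClosedRealForm11)) s := by
  refine (hasDerivAt_integral_deriv_mul_ratio hS hφ hs).congr_deriv ?_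
  have hd := hφ.deriv hS
  have hdd := hd.deriv hS
  -- Integration by parts replaces the term `φ̇ Lφ̇` of the second variation by `-Γ(φ̇,φ̇)/2`, the
  -- expression that occurs in the form on the product.
  have h1 := integral_gam (θ := θ) (ω₀ := ω₀) (α := α) (hφ.isSm hs) (hd.isSm hs) (hd.isSm hs)
  have f1 := (hdd.ofReal.mul (hφ.ratio θ ω₀ α)).integrable ω₀ hs
  have f2 := (hd.ofReal.mul (hφ.lin hd θ ω₀ α)).integrable ω₀ hs
  have f3 := (hφ.gam hd hd θ ω₀ α).integrable ω₀ hs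
  have e1 : (fun x => hessDensity θ ω₀.toClosedRealForm11 α φ s x) = fun x =>
      Complex.I * (((deriv (fun s => deriv (fun s => φ s x) s) s : ℝ) : ℂ) *
        ratio θ ω₀.toClosedRealForm11 α (φ s) x) + (1 / 2 : ℂ) *
      gam θ ω₀.toClosedRealForm11 α (φ s) (fun x => deriv (fun s => φ s x) s)
        (fun x => deriv (fun s => φ s x) s) x := by
    funext x; rw [DHYM.hessDensity]; ring
  rw [e1, integral_add f1 (f2.const_mul _), integral_add (f1.const_mul _) (f3.const_mul _),
    integral_const_mul, integral_const_mul, integral_const_mul, h1]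
  linear_combination (∫ x, ((deriv (fun s => deriv (fun s => φ s x) s) s : ℝ) : ℂ) *
        ratio θ ω₀.toClosedRealForm11 α (φ s) x ∂(volX ω₀.toClosedRealForm11)) * Complex.I_mul_I

omit [T2Space X] in
theorem continuousOn_integral_hessDensity (hS : IsOpen S) (hφ : Fam n S φ) :
    ContinuousOn (fun s => ∫ x, hessDensity θ ω₀.toClosedRealForm11 α φ s x
        ∂(volX ω₀.toClosedRealForm11)) S :=
  (hφ.hessDensity hS θ ω₀ α).continuousOn_integral ω₀

theorem hasDerivAt_funcJ (hS : IsOpen S) (hφb : IsSm (n := n) φb) (hφ : Fam n S φ) {s : ℝ}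
    (hs : s ∈ S) : HasDerivAt (fun s => funcJ ω₀ α θ φb (φ s))
      (-(∫ x, ((deriv (fun s => φ s x) s : ℝ) : ℂ) *
        ratio θ ω₀.toClosedRealForm11 α (φ s) x ∂(volX ω₀.toClosedRealForm11)).im) s :=
  (Complex.imCLM.hasFDerivAt.comp_hasDerivAt s (hasDerivAt_phase_mul_CY hS hφb hφ hs)).neg

theorem hasDerivAt_funcC (hS : IsOpen S) (hφb : IsSm (n := n) φb) (hφ : Fam n S φ) {s : ℝ}
    (hs : s ∈ S) : HasDerivAt (fun s => funcC ω₀ α θ φb (φ s))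
      (∫ x, ((deriv (fun s => φ s x) s : ℝ) : ℂ) *
        ratio θ ω₀.toClosedRealForm11 α (φ s) x ∂(volX ω₀.toClosedRealForm11)).re s :=
  Complex.reCLM.hasFDerivAt.comp_hasDerivAt s (hasDerivAt_phase_mul_CY hS hφb hφ hs)

theorem hasDerivAt_deriv_funcJ (hS : IsOpen S) (hφ : Fam n S φ) {s : ℝ} (hs : s ∈ S) :
    HasDerivAt (fun s => -(∫ x, ((deriv (fun s => φ s x) s : ℝ) : ℂ) *
        ratio θ ω₀.toClosedRealForm11 α (φ s) x ∂(volX ω₀.toClosedRealForm11)).im)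
      (∫ x, hessDensity θ ω₀.toClosedRealForm11 α φ s x ∂(volX ω₀.toClosedRealForm11)).re s := by
  have h := (Complex.imCLM.hasFDerivAt.comp_hasDerivAt s
    (hasDerivAt_deriv_phase_mul_CY (θ := θ) (ω₀ := ω₀) (α := α) hS hφ hs)).neg
  refine h.congr_deriv ?_
  simp

theorem hasDerivAt_deriv_funcC (hS : IsOpen S) (hφ : Fam n S φ) {s : ℝ} (hs : s ∈ S) :
    HasDerivAt (fun s => (∫ x, ((deriv (fun s => φ s x) s : ℝ) : ℂ) *
        ratio θ ω₀.toClosedRealForm11 α (φ s) x ∂(volX ω₀.toClosedRealForm11)).re)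
      (∫ x, hessDensity θ ω₀.toClosedRealForm11 α φ s x ∂(volX ω₀.toClosedRealForm11)).im s := by
  have h := Complex.reCLM.hasFDerivAt.comp_hasDerivAt s
    (hasDerivAt_deriv_phase_mul_CY (θ := θ) (ω₀ := ω₀) (α := α) hS hφ hs)
  refine h.congr_deriv ?_
  simp

theorem contDiffOn_funcJ (hS : IsOpen S) (hφb : IsSm (n := n) φb) (hφ : Fam n S φ) :
    ContDiffOn ℝ 2 (fun s => funcJ ω₀ α θ φb (φ s)) S :=
  contDiffOn_two_of_hasDerivAt hS (fun _ hs => hasDerivAt_funcJ hS hφb hφ hs)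
    (fun _ hs => hasDerivAt_deriv_funcJ hS hφ hs)
    (Complex.continuous_re.comp_continuousOn (continuousOn_integral_hessDensity hS hφ))

theorem contDiffOn_funcC (hS : IsOpen S) (hφb : IsSm (n := n) φb) (hφ : Fam n S φ) :
    ContDiffOn ℝ 2 (fun s => funcC ω₀ α θ φb (φ s)) S :=
  contDiffOn_two_of_hasDerivAt hS (fun _ hs => hasDerivAt_funcC hS hφb hφ hs)
    (fun _ hs => hasDerivAt_deriv_funcC hS hφ hs)
    (Complex.continuous_im.comp_continuousOn (continuousOn_integral_hessDensity hS hφ))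

theorem deriv_deriv_eq_of_hasDerivAt {G : Type*} [NormedAddCommGroup G] [NormedSpace ℝ G]
    {f f1 f2 : ℝ → G} {S : Set ℝ} (hS : IsOpen S) (h1 : ∀ s ∈ S, HasDerivAt f (f1 s) s)
    (h2 : ∀ s ∈ S, HasDerivAt f1 (f2 s) s) {s : ℝ} (hs : s ∈ S) : deriv (deriv f) s = f2 s := by
  have : deriv f =ᶠ[𝓝 s] f1 := by
    filter_upwards [hS.mem_nhds hs] with t ht using (h1 t ht).deriv
  rw [this.deriv_eq, (h2 s hs).deriv]

-- The functional `ℓ` stands for the real or the imaginary part, so one computation yields both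
-- formulas. For `ε = 0` the bracket in `phase_mul_wedgePow_spaceTimeForm` is exactly `hessDensity`.
omit [T2Space X] in
theorem fibreIntegral_spaceTimeForm (hS : IsOpen S) (hφ : Fam n S φ) {t : ℂ} (ht : t ≠ 0)
    (hs : -Real.log ‖t‖ ∈ S) (ℓ : ℂ →L[ℝ] ℝ) (u v : ℂ) :
    fibreIntegral (fun (q : X × ℂ) w =>
      ℓ (phase θ * wedgePow (spaceTimeForm ω₀ α 0 φ q) (n + 1) w)) t u v =
    ((n : ℝ) + 1) * (idtdtbar u v / (4 * ‖t‖ ^ 2)) *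
      ℓ (∫ x, hessDensity θ ω₀.toClosedRealForm11 α φ (-Real.log ‖t‖) x
        ∂(volX ω₀.toClosedRealForm11)) := by
  have hc := (hφ.hessDensity hS θ ω₀ α).continuous hs
  rw [fibreIntegral, integralX_eq ω₀ (G := fun x => ((n : ℝ) + 1) *
    (idtdtbar u v / (4 * ‖t‖ ^ 2)) * ℓ (hessDensity θ ω₀.toClosedRealForm11 α φ (-Real.log ‖t‖) x))
    (continuous_const.mul (ℓ.continuous.comp hc)), integral_const_mul,
    ℓ.integral_comp_comm (integrable_volX ω₀ hc)]
  intro p y hy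
  refine (congrArg ℓ (phase_mul_wedgePow_spaceTimeForm hS hφ ht hs θ 0 ω₀ α _
    (fun q => dChartSymm (chartAt (Cn n) p) y (stdFrame n q)) u v)).trans ?_
  have h1 := det_formAt_mul_frameFactor p hy ω₀
  have h2 : ∀ (c : ℝ) (z : ℂ), ℓ ((c : ℂ) * z) = c * ℓ z := fun c z => by
    rw [← Complex.real_smul, map_smul, smul_eq_mul]
  rw [smul_eq_mul, ← mul_assoc, ← h2]
  congr 1
  set Df := (formAt ω₀.toClosedRealForm11 ((chartAt (Cn n) p).symm y)).det
  rw [DHYM.hessDensity, Complex.ofReal_mul (dens _ _ _), ← h1]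
  push_cast
  ring

theorem iddbar_functionals (hφb : IsSm (n := n) φb) (hS : IsOpen S) (hφ : Fam n S φ) {t : ℂ}
    (ht : t ≠ 0) (hs : -Real.log ‖t‖ ∈ S) (u v : ℂ) :
    iddbar 𝓘(ℝ, ℂ) (fun t' : ℂ => funcJ ω₀ α θ φb (φ (-Real.log ‖t'‖))) t u v =
      ((n : ℝ) + 1)⁻¹ * fibreIntegral (fun (q : X × ℂ) w =>
        (phase θ * wedgePow (spaceTimeForm ω₀ α 0 φ q) (n + 1) w).re) t u v ∧
    iddbar 𝓘(ℝ, ℂ) (fun t' : ℂ => funcC ω₀ α θ φb (φ (-Real.log ‖t'‖))) t u v =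
      ((n : ℝ) + 1)⁻¹ * fibreIntegral (fun (q : X × ℂ) w =>
        (phase θ * wedgePow (spaceTimeForm ω₀ α 0 φ q) (n + 1) w).im) t u v := by
  have hn : (n : ℝ) + 1 ≠ 0 := by positivity
  have hJ := (contDiffOn_funcJ (θ := θ) (ω₀ := ω₀) (α := α) hS hφb hφ).contDiffAt (hS.mem_nhds hs)
  have hC := (contDiffOn_funcC (θ := θ) (ω₀ := ω₀) (α := α) hS hφb hφ).contDiffAt (hS.mem_nhds hs)
  have h1 := fibreIntegral_spaceTimeForm (θ := θ) (ω₀ := ω₀) (α := α) hS hφ ht hs Complex.reCLM u v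
  have h2 := fibreIntegral_spaceTimeForm (θ := θ) (ω₀ := ω₀) (α := α) hS hφ ht hs Complex.imCLM u v
  simp only [Complex.reCLM_apply, Complex.imCLM_apply] at h1 h2
  constructor
  · rw [iddbar_radial (j := fun s => funcJ ω₀ α θ φb (φ s)) ht hJ, h1,
      deriv_deriv_eq_of_hasDerivAt hS (fun _ hs => hasDerivAt_funcJ hS hφb hφ hs)
        (fun _ hs => hasDerivAt_deriv_funcJ hS hφ hs) hs]
    field_simp
  · rw [iddbar_radial (j := fun s => funcC ω₀ α θ φb (φ s)) ht hC, h2,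
      deriv_deriv_eq_of_hasDerivAt hS (fun _ hs => hasDerivAt_funcC hS hφb hφ hs)
        (fun _ hs => hasDerivAt_deriv_funcC hS hφ hs) hs]
    field_simp

end PartOne

theorem ne_zero_and_neg_log_mem_of_mem_annulus {t : ℂ} (ht : t ∈ annulus) :
    t ≠ 0 ∧ -Real.log ‖t‖ ∈ Ioo (0 : ℝ) 1 := by
  have h0 : 0 < ‖t‖ := (Real.exp_pos _).trans ht.1
  refine ⟨norm_pos_iff.1 h0, ?_, ?_⟩
  · have := Real.log_neg h0 ht.2
    linarith
  · have := (Real.lt_log_iff_exp_lt h0).2 ht.1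
    linarith

/-! ### Geodesics -/

section Geodesic

open Topology

variable {n : ℕ} {X : Type*} [TopologicalSpace X] [ChartedSpace (Cn n) X]

/-- The velocity of a curve of functions. -/
noncomputable def vel (φ : ℝ → X → ℝ) (s : ℝ) (x : X) : ℝ := deriv (fun s => φ s x) s

/-- The geodesic equation, as an equation on `X`, for a curve parametrized by the open set `S`. -/
structure IsGeod (θ : ℝ) (ω₀ : KahlerForm n X) (α : ClosedRealForm11 n X) (S : Set ℝ) (E : ℝ → ℝ)
    (φ : ℝ → X → ℝ) : Prop where
  isOpen : IsOpen S
  fam : Fam n S φ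
  pos : ∀ s ∈ S, ∀ x, 0 < (ratio θ ω₀.toClosedRealForm11 α (φ s) x).re
  nonneg : ∀ s ∈ S, 0 ≤ E s
  eqn : ∀ s ∈ S, ∀ x, vel (vel φ) s x * (ratio θ ω₀.toClosedRealForm11 α (φ s) x).re +
    (gam θ ω₀.toClosedRealForm11 α (φ s) (vel φ s) (vel φ s) x).im / 2 +
      E s * (ratio θ ω₀.toClosedRealForm11 α (φ s) x).im = 0

/-- The tangent of the excess of the Lagrangian phase. -/
noncomputable def slope (θ : ℝ) (ω₀ α : ClosedRealForm11 n X) (φ : X → ℝ) (x : X) : ℝ :=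
  (ratio θ ω₀ α φ x).im / (ratio θ ω₀ α φ x).re

/-- The gradient part of the second derivative of `𝒥`. -/
noncomputable def energy (θ : ℝ) (ω₀ α : ClosedRealForm11 n X) (φ f : X → ℝ) (x : X) : ℝ :=
  ((gam θ ω₀ α φ f f x).re + slope θ ω₀ α φ x * (gam θ ω₀ α φ f f x).im) / 2

namespace IsGeod

variable {θ : ℝ} {ω₀ : KahlerForm n X} {α : ClosedRealForm11 n X} {S : Set ℝ} {E : ℝ → ℝ}
  {φ : ℝ → X → ℝ} (h : IsGeod θ ω₀ α S E φ)
include h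

theorem famVel : Fam n S (vel φ) := h.fam.deriv h.isOpen

theorem famVel2 : Fam n S (vel (vel φ)) := h.famVel.deriv h.isOpen

theorem im_ratio {s : ℝ} (hs : s ∈ S) (x : X) : (ratio θ ω₀.toClosedRealForm11 α (φ s) x).im =
    slope θ ω₀.toClosedRealForm11 α (φ s) x * (ratio θ ω₀.toClosedRealForm11 α (φ s) x).re := by
  rw [slope, div_mul_cancel₀ _ (h.pos s hs x).ne']

theorem vel2_eq {s : ℝ} (hs : s ∈ S) (x : X) : vel (vel φ) s x =
    -((gam θ ω₀.toClosedRealForm11 α (φ s) (vel φ s) (vel φ s) x).im / 2 /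
      (ratio θ ω₀.toClosedRealForm11 α (φ s) x).re) -
      E s * slope θ ω₀.toClosedRealForm11 α (φ s) x := by
  have h1 := h.eqn s hs x
  have h2 := (h.pos s hs x).ne'
  rw [h.im_ratio hs] at h1
  field_simp
  linear_combination 2 * h1

/-- Eliminating `φ̈` by the geodesic equation writes the density of `𝒥''` as a sum of two
nonnegative terms: a multiple of the squared slope, and a quadratic form in the gradient of the
velocity. -/
theorem hessDensity_re {s : ℝ} (hs : s ∈ S) (x : X) :
    (hessDensity θ ω₀.toClosedRealForm11 α φ s x).re =
      E s * slope θ ω₀.toClosedRealForm11 α (φ s) x ^ 2 *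
        (ratio θ ω₀.toClosedRealForm11 α (φ s) x).re +
      energy θ ω₀.toClosedRealForm11 α (φ s) (vel φ s) x := by
  have h1 : (hessDensity θ ω₀.toClosedRealForm11 α φ s x).re =
      -(vel (vel φ) s x * (ratio θ ω₀.toClosedRealForm11 α (φ s) x).im) +
      (gam θ ω₀.toClosedRealForm11 α (φ s) (vel φ s) (vel φ s) x).re / 2 := by
    rw [hessDensity, Complex.add_re, Complex.div_ofNat_re]
    simp only [Complex.mul_re, Complex.mul_im, Complex.I_re, Complex.I_im, Complex.ofReal_re,
      Complex.ofReal_im]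
    change _ = -(deriv (fun s => deriv (fun s => φ s x) s) s * _) +
      (gam θ ω₀.toClosedRealForm11 α (φ s) (fun x => deriv (fun s => φ s x) s)
        (fun x => deriv (fun s => φ s x) s) x).re / 2
    ring
  rw [h1, h.vel2_eq hs, energy, h.im_ratio hs]
  have h2 := (h.pos s hs x).ne'
  field_simp
  ring

/-- The geodesic equation makes the density of `𝒞''` a multiple of `Im D`, constant on `X` at each
time; its integral vanishes by `integral_ratio_im`. -/
theorem hessDensity_im {s : ℝ} (hs : s ∈ S) (x : X) :
    (hessDensity θ ω₀.toClosedRealForm11 α φ s x).im =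
      -(E s * (ratio θ ω₀.toClosedRealForm11 α (φ s) x).im) := by
  have h1 : (hessDensity θ ω₀.toClosedRealForm11 α φ s x).im =
      vel (vel φ) s x * (ratio θ ω₀.toClosedRealForm11 α (φ s) x).re +
      (gam θ ω₀.toClosedRealForm11 α (φ s) (vel φ s) (vel φ s) x).im / 2 := by
    rw [hessDensity, Complex.add_im, Complex.div_ofNat_im]
    simp only [Complex.mul_re, Complex.mul_im, Complex.I_re, Complex.I_im, Complex.ofReal_re,
      Complex.ofReal_im]
    change _ = deriv (fun s => deriv (fun s => φ s x) s) s * _ +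
      (gam θ ω₀.toClosedRealForm11 α (φ s) (fun x => deriv (fun s => φ s x) s)
        (fun x => deriv (fun s => φ s x) s) x).im / 2
    ring
  rw [h1]
  linear_combination h.eqn s hs x

variable [IsManifold 𝓘(ℂ, Cn n) ω X]

theorem famRatio : Fam n S fun s => ratio θ ω₀.toClosedRealForm11 α (φ s) := h.fam.ratio θ ω₀ α

theorem famSlope : Fam n S fun s => slope θ ω₀.toClosedRealForm11 α (φ s) :=
  h.famRatio.im.div h.famRatio.re fun s hs x => (h.pos s hs x).ne'

theorem famGam : Fam n S fun s => gam θ ω₀.toClosedRealForm11 α (φ s) (vel φ s) (vel φ s) :=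
  h.fam.gam h.famVel h.famVel θ ω₀ α

theorem famEnergy : Fam n S fun s => energy θ ω₀.toClosedRealForm11 α (φ s) (vel φ s) :=
  (h.famGam.re.add (h.famSlope.mul h.famGam.im)).div (Fam.const 2) fun _ _ _ => two_ne_zero

/-- The gradient part of the second derivative of `𝒥` is nonnegative. -/
theorem grad_eq_zero_or_energy_pos (p : X) {y : Cn n} (hy : y ∈ (chartAt (Cn n) p).target) {s : ℝ}
    (hs : s ∈ S) :
    (gradC (vel φ s ∘ (chartAt (Cn n) p).symm) y = 0 ∧
      energy θ ω₀.toClosedRealForm11 α (φ s) (vel φ s) ((chartAt (Cn n) p).symm y) = 0) ∨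
    0 < energy θ ω₀.toClosedRealForm11 α (φ s) (vel φ s) ((chartAt (Cn n) p).symm y) := by
  rcases eq_zero_or_gam_self_comb_pos p hy θ ω₀ α (h.fam.isSm hs) (h.famVel.isSm hs)
    (h.pos s hs _) with h1 | h1
  · exact .inl ⟨h1.1, by simp [energy, h1.2]⟩
  · exact .inr (half_pos h1)

theorem energy_nonneg {s : ℝ} (hs : s ∈ S) (x : X) :
    0 ≤ energy θ ω₀.toClosedRealForm11 α (φ s) (vel φ s) x := by
  have h1 := h.grad_eq_zero_or_energy_pos x (mem_chart_target _ x) hs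
  rw [(chartAt (Cn n) x).left_inv (mem_chart_source _ x)] at h1
  rcases h1 with h1 | h1
  · exact h1.2.ge
  · exact h1.le

omit [IsManifold 𝓘(ℂ, Cn n) ω X] in
theorem phase_energy_nonneg {s : ℝ} (hs : s ∈ S) (x : X) :
    0 ≤ E s * slope θ ω₀.toClosedRealForm11 α (φ s) x ^ 2 *
        (ratio θ ω₀.toClosedRealForm11 α (φ s) x).re :=
  mul_nonneg (mul_nonneg (h.nonneg s hs) (sq_nonneg _)) (h.pos s hs x).le

variable [CompactSpace X] [MeasurableSpace X] [BorelSpace X]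

theorem integrable_phase_energy {s : ℝ} (hs : s ∈ S) :
    Integrable (fun x => E s * slope θ ω₀.toClosedRealForm11 α (φ s) x ^ 2 *
        (ratio θ ω₀.toClosedRealForm11 α (φ s) x).re) (volX ω₀.toClosedRealForm11) :=
  integrable_volX ω₀ ((continuous_const.mul ((h.famSlope.continuous hs).pow 2)).mul
    (h.famRatio.re.continuous hs))

theorem re_integral_hessDensity {s : ℝ} (hs : s ∈ S) :
    (∫ x, hessDensity θ ω₀.toClosedRealForm11 α φ s x ∂(volX ω₀.toClosedRealForm11)).re =
      (∫ x, E s * slope θ ω₀.toClosedRealForm11 α (φ s) x ^ 2 *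
        (ratio θ ω₀.toClosedRealForm11 α (φ s) x).re ∂(volX ω₀.toClosedRealForm11)) +
      ∫ x, energy θ ω₀.toClosedRealForm11 α (φ s) (vel φ s) x ∂(volX ω₀.toClosedRealForm11) := by
  have h1 := Complex.reCLM.integral_comp_comm
    ((h.fam.hessDensity h.isOpen θ ω₀ α).integrable ω₀ hs)
  simp only [Complex.reCLM_apply] at h1
  rw [← h1, ← integral_add (h.integrable_phase_energy hs) (h.famEnergy.integrable ω₀ hs)]
  exact integral_congr_ae (.of_forall fun x => h.hessDensity_re hs x)

omit [BorelSpace X] in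
theorem integral_energy_nonneg {s : ℝ} (hs : s ∈ S) :
    0 ≤ ∫ x, energy θ ω₀.toClosedRealForm11 α (φ s) (vel φ s) x ∂(volX ω₀.toClosedRealForm11) :=
  integral_nonneg fun x => h.energy_nonneg hs x

omit [IsManifold 𝓘(ℂ, Cn n) ω X] [BorelSpace X] in
theorem integral_phase_energy_nonneg {s : ℝ} (hs : s ∈ S) :
    0 ≤ ∫ x, E s * slope θ ω₀.toClosedRealForm11 α (φ s) x ^ 2 *
        (ratio θ ω₀.toClosedRealForm11 α (φ s) x).re ∂(volX ω₀.toClosedRealForm11) :=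
  integral_nonneg fun x => h.phase_energy_nonneg hs x

end IsGeod

variable [IsManifold 𝓘(ℂ, Cn n) ω X] [CompactSpace X] [MeasurableSpace X] [BorelSpace X]
  {θ : ℝ} {ω₀ : KahlerForm n X} {α : ClosedRealForm11 n X}

/-- The integral of `e^{-√-1 θ} (ω + √-1 α_φ)ⁿ` does not depend on `φ`. -/
theorem integral_ratio_im [T2Space X] (hθ : IsPhaseAngle ω₀ α θ) {φ : X → ℝ}
    (hφ : IsSm (n := n) φ) :
    ∫ x, (ratio θ ω₀.toClosedRealForm11 α φ x).im ∂(volX ω₀.toClosedRealForm11) = 0 := by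
  set P : ℝ → X → ℝ := fun τ x => τ * φ x with hP
  have hPf : Fam n univ P := (Fam.of_param contDiffOn_id).mul hφ.fam
  have hd : ∀ τ, (fun x => deriv (fun τ => P τ x) τ) = φ := by
    intro τ; funext x
    have := ((hasDerivAt_id τ).mul_const (φ x)).deriv
    rw [one_mul] at this
    exact this
  -- Along `τ φ` the derivative is `√-1` times the integral of `lin`, which is zero by Green's
  -- formula. At `τ = 0` the defining property of `θ` makes the integral real.
  have h1 : ∀ τ, HasDerivAt (fun τ => ∫ x, ratio θ ω₀.toClosedRealForm11 α (P τ) x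
      ∂(volX ω₀.toClosedRealForm11)) 0 τ := by
    intro τ
    refine ((hPf.ratio θ ω₀ α).hasDerivAt_integral ω₀ isOpen_univ (mem_univ τ)).congr_deriv ?_
    have h2 : ∀ x, deriv (fun τ => ratio θ ω₀.toClosedRealForm11 α (P τ) x) τ =
        Complex.I * lin θ ω₀.toClosedRealForm11 α (P τ) φ x := fun x => by
      have := hasDerivAt_ratio isOpen_univ hPf (mem_univ τ) θ ω₀.toClosedRealForm11 α x
      rw [hd τ] at this
      exact this.deriv
    simp only [h2]
    rw [integral_const_mul, integral_lin (hPf.isSm (mem_univ τ)) hφ, mul_zero]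
  have h2 := is_const_of_deriv_eq_zero (fun τ => (h1 τ).differentiableAt)
    (fun τ => (h1 τ).deriv) 1 0
  have hP1 : P 1 = φ := by funext x; simp [hP]
  have hP0 : P 0 = fun _ => 0 := by funext x; simp [hP]
  rw [hP1, hP0] at h2
  have h3 := phase_mul_integralX_topForm θ ω₀ α (f := fun _ => 1) continuous_const
    (isSm_const (n := n) (X := X) 0)
  have h4 : ∀ u v x, alphaPhi α (fun _ => (0 : ℝ)) x u v = α.toForm x ![u, v] := by
    intro u v x
    simp [alphaPhi, iddbar, Function.comp_def]
  simp only [Complex.ofReal_one, one_mul, topForm, h4] at h3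
  obtain ⟨c, -, hc⟩ := hθ
  rw [hc] at h3
  have h5 : phase θ * ((c : ℂ) * Complex.exp (Complex.I * (θ : ℂ))) = c := by
    rw [phase, mul_left_comm, ← Complex.exp_add]; simp
  have h6 := Complex.imCLM.integral_comp_comm (integrable_volX ω₀ (continuous_ratio θ ω₀ α hφ))
  simp only [Complex.imCLM_apply] at h6
  rw [h6, h2, ← h3, h5, Complex.ofReal_im]

theorem IsGeod.im_integral_hessDensity [T2Space X] {S : Set ℝ} {E : ℝ → ℝ} {φ : ℝ → X → ℝ}
    (h : IsGeod θ ω₀ α S E φ) (hθ : IsPhaseAngle ω₀ α θ) {s : ℝ} (hs : s ∈ S) :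
    (∫ x, hessDensity θ ω₀.toClosedRealForm11 α φ s x ∂(volX ω₀.toClosedRealForm11)).im = 0 := by
  have h1 := Complex.imCLM.integral_comp_comm
    ((h.fam.hessDensity h.isOpen θ ω₀ α).integrable ω₀ hs)
  simp only [Complex.imCLM_apply] at h1
  rw [← h1]
  simp only [h.hessDensity_im hs]
  rw [integral_neg, integral_const_mul, integral_ratio_im hθ (h.fam.isSm hs)]
  simp

omit [CompactSpace X] [MeasurableSpace X] [BorelSpace X] in
theorem re_ratio_pos_of_mem_spaceH {φ : X → ℝ} (h : φ ∈ spaceH ω₀ α θ) (x : X) :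
    0 < (ratio θ ω₀.toClosedRealForm11 α φ x).re := by
  have := isManifold_real n X
  have h1 := h.2 x
  rw [phase_mul_topForm_stdFrame θ ω₀ α (isSm_of_contMDiff h.1), Complex.re_ofReal_mul] at h1
  have h2 := (formAt_posHerm ω₀ x).det_pos.1
  have h3 : 0 < (n.factorial : ℝ) * 2 ^ n * (formAt ω₀.toClosedRealForm11 x).det.re := by positivity
  exact pos_of_mul_pos_right h1 h3.le

omit [CompactSpace X] [MeasurableSpace X] [BorelSpace X] in
/-- An `ε`-geodesic satisfies the geodesic equation on `X`. -/
theorem IsEpsGeodesic.isGeod {ε : ℝ} {φ : ℝ → X → ℝ}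
    (h : IsEpsGeodesic ω₀ α θ ε φ) :
    IsGeod θ ω₀ α (Ioo 0 1) (fun s => 4 * ε ^ 2 * Real.exp (-2 * s)) φ := by
  have := isManifold_real n X
  have hf : Fam n (Ioo 0 1) φ := (Fam.of_contMDiffOn h.smooth).mono Ioo_subset_Icc_self
  refine ⟨isOpen_Ioo, hf, fun s hs => re_ratio_pos_of_mem_spaceH (h.mem s (Ioo_subset_Icc_self hs)),
    fun s _ => by positivity, fun s hs x => ?_⟩
  -- The point of the circle over `s` on the positive real axis; by rotational invariance it carries
  -- the full information.
  set t : ℂ := ((Real.exp (-s) : ℝ) : ℂ) with ht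
  have hnorm : ‖t‖ = Real.exp (-s) := by
    rw [ht, Complex.norm_real, Real.norm_of_nonneg (Real.exp_pos _).le]
  have hlog : -Real.log ‖t‖ = s := by rw [hnorm, Real.log_exp, neg_neg]
  have ht0 : t ≠ 0 := by
    rw [← norm_pos_iff, hnorm]; exact Real.exp_pos _
  have hta : t ∈ annulus := by
    refine ⟨?_, ?_⟩
    · rw [hnorm]; exact Real.exp_lt_exp.2 (by linarith [hs.2])
    · rw [hnorm]; rw [Real.exp_lt_one_iff]; linarith [hs.1]
  -- One test frame is enough: on the standard horizontal frame together with `1, √-1` the prefactor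
  -- is a positive real number, so it can be divided out before taking the imaginary part.
  have h1 := h.eqn x t hta
    (fun p : Fin (n + 1) × Fin 2 => Fin.lastCases (motive := fun _ => Cn n × ℂ)
        ((0 : Cn n), ![(1 : ℂ), Complex.I] p.2) (fun j => (stdFrame n (j, p.2), (0 : ℂ))) p.1)
  rw [phase_mul_wedgePow_spaceTimeForm isOpen_Ioo hf ht0 (by rw [hlog]; exact hs),
    frameFactor_stdFrame, hlog] at h1
  have h2 := formAt_posHerm ω₀ x
  have h3 : ((formAt ω₀.toClosedRealForm11 x).det.re : ℂ) =
      (formAt ω₀.toClosedRealForm11 x).det := by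
    apply Complex.ext <;> simp [h2.det_pos.2]
  have h4 : (idtdtbar 1 Complex.I : ℂ) = (2 : ℝ) := by simp [idtdtbar]
  have h5 : ((n : ℂ) + 1) = ((n + 1 : ℝ) : ℂ) := by push_cast; ring
  rw [← h3, h4, h5, ← Complex.ofReal_inv] at h1
  simp only [← Complex.ofReal_mul] at h1
  rw [Complex.im_ofReal_mul] at h1
  have hdp := h2.det_pos.1
  have hnp : 0 < ‖t‖ := norm_pos_iff.2 ht0
  have h6 := (mul_eq_zero.1 h1).resolve_left (by positivity)
  have h7 : 4 * ‖t‖ ^ 2 * ε ^ 2 = 4 * ε ^ 2 * Real.exp (-2 * s) := by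
    rw [hnorm, ← Real.exp_nat_mul]
    have : ((2 : ℕ) : ℝ) * -s = -2 * s := by push_cast; ring
    rw [this]; ring
  rw [h7] at h6
  rw [Complex.add_im, Complex.add_im, Complex.im_ofReal_mul, Complex.div_ofNat_im] at h6
  simp only [Complex.mul_re, Complex.mul_im, Complex.I_re, Complex.I_im, Complex.ofReal_re,
      Complex.ofReal_im] at h6
  change deriv (fun s => deriv (fun s => φ s x) s) s * _ +
      (gam θ ω₀.toClosedRealForm11 α (φ s) (fun x => deriv (fun s => φ s x) s)
        (fun x => deriv (fun s => φ s x) s) x).im / 2 + _ = 0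
  linear_combination h6

end Geodesic

/-! ### Uniform bounds by the energy density -/

section Bounds

open Topology

/-- A homogeneous function of degree two is bounded by a positive one, uniformly on compact sets. -/
theorem exists_le_mul_of_homogeneous {Y V : Type*} [TopologicalSpace Y] [NormedAddCommGroup V]
    [NormedSpace ℝ V] [ProperSpace V] {K : Set Y} (hK : IsCompact K) {T Z : Y × V → ℝ}
    (hT : ContinuousOn T (K ×ˢ univ)) (hZ : ContinuousOn Z (K ×ˢ univ))
    (hT2 : ∀ q (c : ℝ) v, T (q, c • v) = c ^ 2 * T (q, v))
    (hZ2 : ∀ q (c : ℝ) v, Z (q, c • v) = c ^ 2 * Z (q, v))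
    (hpos : ∀ q ∈ K, ∀ v, v ≠ 0 → 0 < Z (q, v)) :
    ∃ C : ℝ, 0 ≤ C ∧ ∀ q ∈ K, ∀ v, T (q, v) ≤ C * Z (q, v) := by
  have hsub : K ×ˢ Metric.sphere (0 : V) 1 ⊆ K ×ˢ univ := prod_mono Subset.rfl (subset_univ _)
  have hne : ∀ v ∈ Metric.sphere (0 : V) 1, v ≠ 0 := fun v hv h => by simp [h] at hv
  obtain ⟨C, hC⟩ := (hK.prod (isCompact_sphere (0 : V) 1)).exists_bound_of_continuousOn
    ((hT.mono hsub).div (hZ.mono hsub) fun q hq => (hpos q.1 hq.1 q.2 (hne _ hq.2)).ne')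
  refine ⟨max C 0, le_max_right _ _, fun q hq v => ?_⟩
  by_cases hv : v = 0
  · have h1 := hT2 q 0 0
    have h2 := hZ2 q 0 0
    simp only [smul_zero, ne_eq, OfNat.ofNat_ne_zero, not_false_eq_true, zero_pow, zero_mul] at h1 h2
    rw [hv, h1, h2, mul_zero]
  · have hv0 : ‖v‖ ≠ 0 := norm_ne_zero_iff.2 hv
    have hmem : ‖v‖⁻¹ • v ∈ Metric.sphere (0 : V) 1 := by
      simp [norm_smul, hv0]
    have h1 := (le_abs_self _).trans (hC (q, ‖v‖⁻¹ • v) ⟨hq, hmem⟩)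
    have hp := hpos q hq _ (hne _ hmem)
    rw [Pi.div_apply, div_le_iff₀ hp] at h1
    have h2 : v = ‖v‖ • (‖v‖⁻¹ • v) := by rw [smul_smul, mul_inv_cancel₀ hv0, one_smul]
    rw [h2, hT2, hZ2, mul_left_comm]
    exact mul_le_mul_of_nonneg_left
      (h1.trans (mul_le_mul_of_nonneg_right (le_max_left _ _) hp.le)) (sq_nonneg _)

variable {n : ℕ}

theorem continuousOn_quad {Z : Type*} [TopologicalSpace Z] {s : Set Z}
    {A : Z → Matrix (Fin n) (Fin n) ℂ} {f g : Z → Fin n → ℂ}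
    (hA : ∀ j k, ContinuousOn (fun z => A z j k) s) (hf : ∀ j, ContinuousOn (fun z => f z j) s)
    (hg : ∀ j, ContinuousOn (fun z => g z j) s) : ContinuousOn (fun z => quad (A z) (f z) (g z)) s :=
  continuousOn_finsetSum _ fun j _ => continuousOn_finsetSum _ fun k _ =>
    (hA k j).mul ((hf j).mul (Complex.continuous_conj.comp_continuousOn (hg k)))

theorem quad_smul_smul (A : Matrix (Fin n) (Fin n) ℂ) (c : ℝ) (f g : Fin n → ℂ) :
    quad A (c • f) (c • g) = (c : ℂ) ^ 2 * quad A f g := by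
  rw [(quad_ofReal_smul A c f _).1, (quad_ofReal_smul A c f g).2]; ring

theorem hasDerivAt_quad {A : ℝ → Matrix (Fin n) (Fin n) ℂ} {A' : Matrix (Fin n) (Fin n) ℂ}
    {f : ℝ → Fin n → ℂ} {f' : Fin n → ℂ} {s : ℝ} (hA : ∀ j k, HasDerivAt (fun s => A s j k) (A' j k) s)
    (hf : ∀ j, HasDerivAt (fun s => f s j) (f' j) s) :
    HasDerivAt (fun s => quad (A s) (f s) (f s))
      (quad A' (f s) (f s) + quad (A s) f' (f s) + quad (A s) (f s) f') s := by
  have hc : ∀ j, HasDerivAt (fun s => (starRingEnd ℂ) (f s j)) ((starRingEnd ℂ) (f' j)) s :=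
    fun j => Complex.conjCLE.toContinuousLinearMap.hasFDerivAt.comp_hasDerivAt s (hf j)
  have h1 := HasDerivAt.fun_sum (u := Finset.univ) fun (j : Fin n) _ =>
    HasDerivAt.fun_sum (u := Finset.univ) fun (k : Fin n) _ => (hA k j).fun_mul ((hf j).fun_mul (hc k))
  refine h1.congr_deriv ?_
  simp only [quad, ← Finset.sum_add_distrib]
  exact Finset.sum_congr rfl fun j _ => Finset.sum_congr rfl fun k _ => by ring

variable {X : Type*} [TopologicalSpace X] [ChartedSpace (Cn n) X]

theorem hasDerivAt_gradC {S : Set ℝ} {f : ℝ → X → ℝ} (hS : IsOpen S) (h : Fam n S f) {s : ℝ}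
    (hs : s ∈ S) (p : X) {y : Cn n} (hy : y ∈ (chartAt (Cn n) p).target) (j : Fin n) :
    HasDerivAt (fun s => gradC (f s ∘ (chartAt (Cn n) p).symm) y j)
      (gradC (vel f s ∘ (chartAt (Cn n) p).symm) y j) s := by
  have h1 := hasDerivAt_fderiv_fst (chartAt (Cn n) p).open_target hS (h.ofReal p) hy hs
  have h2 : ∀ v : Cn n, HasDerivAt (fun s =>
      fderiv ℝ (fun y => ((f s ∘ (chartAt (Cn n) p).symm) y : ℂ)) y v)
      (fderiv ℝ (fun y => ((vel f s ∘ (chartAt (Cn n) p).symm) y : ℂ)) y v) s := by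
    intro v
    have h3 := h1.clm_apply (hasDerivAt_const s v)
    rw [map_zero, add_zero] at h3
    have h4 : (fun y => deriv (fun s => ((f s ((chartAt (Cn n) p).symm y) : ℝ) : ℂ)) s) =
        fun y => ((vel f s ∘ (chartAt (Cn n) p).symm) y : ℂ) := by
      funext y
      exact ((h.hasDerivAt hS hs _).ofReal_comp).deriv
    have h5 : fderiv ℝ (fun y => deriv (fun s => ((f s ((chartAt (Cn n) p).symm y) : ℝ) : ℂ)) s) y v
      = fderiv ℝ (fun y => ((vel f s ∘ (chartAt (Cn n) p).symm) y : ℂ)) y v := by rw [h4]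
    exact h3.congr_deriv h5
  exact ((h2 _).sub ((h2 _).const_mul Complex.I)).div_const 2

variable [IsManifold 𝓘(ℂ, Cn n) ω X] {θ : ℝ} {ω₀ : KahlerForm n X} {α : ClosedRealForm11 n X}
  {S : Set ℝ} {E : ℝ → ℝ} {φ : ℝ → X → ℝ}

omit [IsManifold 𝓘(ℂ, Cn n) ω X] in
theorem Fam.adjugate_cplxChart {P : Type*} [NormedAddCommGroup P] [NormedSpace ℝ P] {S : Set P}
    {φ : P → X → ℝ} (h : Fam n S φ) (ω₀ α : ClosedRealForm11 n X) (p : X) (j k : Fin n) :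
    ContDiffOn ℝ ∞ (fun z : Cn n × P =>
      (DHYM.cplxChart ω₀ α (φ z.2 ∘ (chartAt (Cn n) p).symm) p z.1).adjugate j k)
      ((chartAt (Cn n) p).target ×ˢ S) :=
  contDiffOn_adjugate (fun j k => h.cplxChart ω₀ α p j k) j k

/-- The derivative of the coefficients of the carré du champ. -/
noncomputable def gamDot (θ : ℝ) (ω₀ : KahlerForm n X) (α : ClosedRealForm11 n X) (φ : ℝ → X → ℝ)
    (s : ℝ) (x : X) : ℂ :=
  deriv (fun s => gam θ ω₀.toClosedRealForm11 α (φ s) (vel φ s) (vel φ s) x) s -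
    2 * gam θ ω₀.toClosedRealForm11 α (φ s) (vel φ s) (vel (vel φ) s) x

/-- The derivatives that fall on the gradient of the velocity are those subtracted in `gamDot`. Only
the derivative of the adjugate remains, so the expression is again quadratic in that gradient,
without higher derivatives of the velocity. -/
theorem gamDot_chart (h : IsGeod θ ω₀ α S E φ) (p : X) {y : Cn n}
    (hy : y ∈ (chartAt (Cn n) p).target) {s : ℝ} (hs : s ∈ S) :
    gamDot θ ω₀ α φ s ((chartAt (Cn n) p).symm y) =
      2 * (phase θ / (formChart ω₀.toClosedRealForm11 p y).det * quad (Matrix.of fun j k =>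
        deriv (fun s => (cplxChart ω₀.toClosedRealForm11 α (φ s ∘ (chartAt (Cn n) p).symm) p
          y).adjugate j k) s) (gradC (vel φ s ∘ (chartAt (Cn n) p).symm) y)
          (gradC (vel φ s ∘ (chartAt (Cn n) p).symm) y)) := by
  have hA : ∀ j k, HasDerivAt (fun s => (cplxChart ω₀.toClosedRealForm11 α
      (φ s ∘ (chartAt (Cn n) p).symm) p y).adjugate j k) (Matrix.of (fun j k =>
        deriv (fun s => (cplxChart ω₀.toClosedRealForm11 α (φ s ∘ (chartAt (Cn n) p).symm) p
          y).adjugate j k) s) j k) s := by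
    intro j k
    have h0 := h.fam.adjugate_cplxChart ω₀.toClosedRealForm11 α p j k
    have h1 : DifferentiableAt ℝ (fun z : Cn n × ℝ => (cplxChart ω₀.toClosedRealForm11 α
        (φ z.2 ∘ (chartAt (Cn n) p).symm) p z.1).adjugate j k) (y, s) :=
      (h0.contDiffAt (((chartAt (Cn n) p).open_target.prod h.isOpen).mem_nhds
        ⟨hy, hs⟩)).differentiableAt (by simp)
    have h2 := h1.hasFDerivAt.comp s (hasFDerivAt_prodMk_right (𝕜 := ℝ) y s)
    exact h2.differentiableAt.hasDerivAt
  have h2 := ((hasDerivAt_quad hA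
    (fun j => hasDerivAt_gradC h.isOpen h.famVel hs p hy j)).const_mul
      (phase θ / (formChart ω₀.toClosedRealForm11 p y).det)).const_mul 2
  have h3 : (fun s => gam θ ω₀.toClosedRealForm11 α (φ s) (vel φ s) (vel φ s)
      ((chartAt (Cn n) p).symm y)) =ᶠ[𝓝 s] fun s => 2 * (phase θ /
        (formChart ω₀.toClosedRealForm11 p y).det * quad (cplxChart ω₀.toClosedRealForm11 α
          (φ s ∘ (chartAt (Cn n) p).symm) p y).adjugate
          (gradC (vel φ s ∘ (chartAt (Cn n) p).symm) y)
          (gradC (vel φ s ∘ (chartAt (Cn n) p).symm) y)) := by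
    filter_upwards [h.isOpen.mem_nhds hs] with t ht
    rw [gam_chart p hy θ _ α (h.fam.isSm ht) (h.famVel.isSm ht) (h.famVel.isSm ht)]
    ring
  rw [gamDot, h3.deriv_eq, h2.deriv, gam_chart p hy θ _ α (h.fam.isSm hs) (h.famVel.isSm hs)
    (h.famVel2.isSm hs)]
  ring

/-- Near a point, quadratic expressions in the gradient are bounded by the energy density. -/
theorem exists_nhds_bound (h : IsGeod θ ω₀ α S E φ) {I : Set ℝ} (hI : IsCompact I) (hIS : I ⊆ S)
    (x : X) : ∃ W ∈ 𝓝 x, ∃ C : ℝ, 0 ≤ C ∧ ∀ s ∈ I, ∀ z ∈ W,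
      ‖gam θ ω₀.toClosedRealForm11 α (φ s) (vel φ s) (vel φ s) z‖ + ‖gamDot θ ω₀ α φ s z‖ +
        ‖gam θ ω₀.toClosedRealForm11 α (φ s) (slope θ ω₀.toClosedRealForm11 α (φ s)) (vel φ s) z‖ ^ 2
      ≤ C * energy θ ω₀.toClosedRealForm11 α (φ s) (vel φ s) z := by
  set e := chartAt (Cn n) x with he
  obtain ⟨K, hKn, hKt, hK⟩ := local_compact_nhds (e.open_target.mem_nhds (mem_chart_target _ x))
  set c0 : Cn n → ℂ := fun y => phase θ / (formChart ω₀.toClosedRealForm11 x y).det with hc0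
  set A : Cn n × ℝ → Matrix (Fin n) (Fin n) ℂ := fun q =>
    (cplxChart ω₀.toClosedRealForm11 α (φ q.2 ∘ e.symm) x q.1).adjugate with hA
  set A' : Cn n × ℝ → Matrix (Fin n) (Fin n) ℂ := fun q => Matrix.of fun j k =>
    deriv (fun s => A (q.1, s) j k) q.2 with hA'
  set R : Cn n × ℝ → Fin n → ℂ := fun q =>
    gradC (slope θ ω₀.toClosedRealForm11 α (φ q.2) ∘ e.symm) q.1 with hR
  set ρ : Cn n × ℝ → ℝ := fun q => slope θ ω₀.toClosedRealForm11 α (φ q.2) (e.symm q.1) with hρ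
  -- The gradient of the velocity is replaced by a free vector of `ℂⁿ`. `G` and `G1` are then
  -- homogeneous of degree two; `G2` has degree one and enters squared. Compactness of the unit
  -- sphere gives the constant.
  set G : (Cn n × ℝ) × (Fin n → ℂ) → ℂ := fun q => 2 * (c0 q.1.1 * quad (A q.1) q.2 q.2) with hG
  set G1 : (Cn n × ℝ) × (Fin n → ℂ) → ℂ := fun q => 2 * (c0 q.1.1 * quad (A' q.1) q.2 q.2) with hG1
  set G2 : (Cn n × ℝ) × (Fin n → ℂ) → ℂ := fun q =>
    c0 q.1.1 * (quad (A q.1) (R q.1) q.2 + quad (A q.1) q.2 (R q.1)) with hG2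
  have cA' : ∀ j k, ContDiffOn ℝ ∞ (fun q => A q j k) (e.target ×ˢ S) := fun j k =>
    h.fam.adjugate_cplxChart ω₀.toClosedRealForm11 α x j k
  have lift1 : ∀ {f : Cn n × ℝ → ℂ}, ContinuousOn f (e.target ×ˢ S) →
      ContinuousOn (fun q : (Cn n × ℝ) × (Fin n → ℂ) => f q.1) ((K ×ˢ I) ×ˢ univ) := fun hf =>
    hf.comp continuousOn_fst fun q hq => ⟨hKt hq.1.1, hIS hq.1.2⟩
  have kc0 : ContinuousOn (fun q : (Cn n × ℝ) × (Fin n → ℂ) => c0 q.1.1) ((K ×ˢ I) ×ˢ univ) :=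
    lift1 (f := fun q => c0 q.1) (continuousOn_const.div
      (contDiffOn_det_formChart ω₀ x).continuousOn fun q hq =>
        (formChart_posHerm x hq.1 ω₀).det_ne_zero)
  have kA : ∀ j k, ContinuousOn (fun q : (Cn n × ℝ) × (Fin n → ℂ) => A q.1 j k)
      ((K ×ˢ I) ×ˢ univ) := fun j k => lift1 (f := fun q => A q j k) (cA' j k).continuousOn
  have kA' : ∀ j k, ContinuousOn (fun q : (Cn n × ℝ) × (Fin n → ℂ) => A' q.1 j k)
      ((K ×ˢ I) ×ˢ univ) := fun j k =>
    lift1 (f := fun q => A' q j k) (contDiffOn_deriv_snd h.isOpen (cA' j k)).continuousOn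
  have kR : ∀ j, ContinuousOn (fun q : (Cn n × ℝ) × (Fin n → ℂ) => R q.1 j)
      ((K ×ˢ I) ×ˢ univ) := fun j =>
    lift1 (f := fun q => R q j) (h.famSlope.gradC x j).continuousOn
  have kv : ∀ j, ContinuousOn (fun q : (Cn n × ℝ) × (Fin n → ℂ) => q.2 j)
      ((K ×ˢ I) ×ˢ univ) := fun j => by fun_prop
  have kρ : ContinuousOn (fun q : (Cn n × ℝ) × (Fin n → ℂ) => ρ q.1) ((K ×ˢ I) ×ˢ univ) :=
    (h.famSlope x).continuousOn.comp continuousOn_fst fun q hq => ⟨hKt hq.1.1, hIS hq.1.2⟩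
  have kG : ContinuousOn G ((K ×ˢ I) ×ˢ univ) :=
    continuousOn_const.mul (kc0.mul (continuousOn_quad kA kv kv))
  have kG1 : ContinuousOn G1 ((K ×ˢ I) ×ˢ univ) :=
    continuousOn_const.mul (kc0.mul (continuousOn_quad kA' kv kv))
  have kG2 : ContinuousOn G2 ((K ×ˢ I) ×ˢ univ) :=
    kc0.mul ((continuousOn_quad kA kR kv).add (continuousOn_quad kA kv kR))
  have sG : ∀ q (c : ℝ) v, G (q, c • v) = ((c ^ 2 : ℝ) : ℂ) * G (q, v) := fun q c v => by
    simp only [hG, quad_smul_smul]; push_cast; ring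
  have sG1 : ∀ q (c : ℝ) v, G1 (q, c • v) = ((c ^ 2 : ℝ) : ℂ) * G1 (q, v) := fun q c v => by
    simp only [hG1, quad_smul_smul]; push_cast; ring
  have sG2 : ∀ q (c : ℝ) v, G2 (q, c • v) = (c : ℂ) * G2 (q, v) := fun q c v => by
    simp only [hG2]
    rw [(quad_ofReal_smul (A q) c v (R q)).1, (quad_ofReal_smul (A q) c (R q) v).2]; ring
  obtain ⟨C, hC0, hC⟩ := exists_le_mul_of_homogeneous (hK.prod hI)
    (T := fun q => ‖G q‖ + ‖G1 q‖ + ‖G2 q‖ ^ 2)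
    (Z := fun q => ((G q).re + ρ q.1 * (G q).im) / 2)
    ((kG.norm.add kG1.norm).add (kG2.norm.pow 2))
    (((Complex.continuous_re.comp_continuousOn kG).add
      (kρ.mul (Complex.continuous_im.comp_continuousOn kG))).div_const 2)
    (fun q c v => by
      simp only [sG, sG1, sG2, norm_mul, Complex.norm_real, Real.norm_eq_abs, abs_of_nonneg
        (sq_nonneg c), mul_pow, sq_abs]
      ring)
    (fun q c v => by
      simp only [sG, Complex.re_ofReal_mul, Complex.im_ofReal_mul]
      ring)
    (fun q hq v hv => by
      have hy : q.1 ∈ e.target := hKt hq.1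
      have hs := hIS hq.2
      have h1 := re_quad_inv_pos x hy ω₀ α (h.fam.isSm hs) hv
      have h2 : G (q, v) = 2 * ratio θ ω₀.toClosedRealForm11 α (φ q.2) (e.symm q.1) *
          quad (cplxChart ω₀.toClosedRealForm11 α (φ q.2 ∘ e.symm) x q.1)⁻¹ v v := by
        rw [ratio_chart x hy θ _ α (h.fam.isSm hs), Matrix.inv_def, quad_smul_matrix,
          Ring.inverse_eq_inv']
        have := det_cplxChart_ne_zero α x hy ω₀ (h.fam.isSm hs)
        simp only [hG, hc0, hA]
        rw [← he] at this ⊢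
        field_simp
      have hpos := h.pos q.2 hs (e.symm q.1)
      have h3 : 0 < Complex.normSq (ratio θ ω₀.toClosedRealForm11 α (φ q.2) (e.symm q.1)) :=
        Complex.normSq_pos.2 fun h0 => hpos.ne' (by rw [h0]; rfl)
      change 0 < ((G (q, v)).re + slope θ ω₀.toClosedRealForm11 α (φ q.2) (e.symm q.1) *
        (G (q, v)).im) / 2
      rw [h2, slope, gam_self_comb hpos.ne']
      exact half_pos (mul_pos (mul_pos two_pos (div_pos h3 hpos)) h1))
  refine ⟨e.source ∩ e ⁻¹' K, ?_, C, hC0, fun s hs z hz => ?_⟩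
  · exact Filter.inter_mem (e.open_source.mem_nhds (mem_chart_source _ x))
      ((e.continuousAt (mem_chart_source _ x)).preimage_mem_nhds hKn)
  · have hz1 : e.symm (e z) = z := e.left_inv hz.1
    have hy : e z ∈ e.target := e.map_source hz.1
    have hss := hIS hs
    have h1 := hC (e z, s) ⟨hz.2, hs⟩ (gradC (vel φ s ∘ e.symm) (e z))
    have g1 := gam_chart x hy θ ω₀.toClosedRealForm11 α (h.fam.isSm hss) (h.famVel.isSm hss)
      (h.famVel.isSm hss)
    have g2 := gamDot_chart h x hy hss
    have g3 := gam_chart x hy θ ω₀.toClosedRealForm11 α (h.fam.isSm hss) (h.famSlope.isSm hss)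
      (h.famVel.isSm hss)
    rw [← he, hz1] at g1 g2 g3
    have e1 : G ((e z, s), gradC (vel φ s ∘ e.symm) (e z)) =
        gam θ ω₀.toClosedRealForm11 α (φ s) (vel φ s) (vel φ s) z := by
      rw [g1]; simp only [hG, hc0, hA]; ring
    have e2 : G1 ((e z, s), gradC (vel φ s ∘ e.symm) (e z)) = gamDot θ ω₀ α φ s z := g2.symm
    have e3 : G2 ((e z, s), gradC (vel φ s ∘ e.symm) (e z)) =
        gam θ ω₀.toClosedRealForm11 α (φ s) (slope θ ω₀.toClosedRealForm11 α (φ s)) (vel φ s) z :=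
      g3.symm
    simp only [e1, e2, e3, hρ, hz1] at h1
    exact h1

theorem exists_bound_energy [CompactSpace X] (h : IsGeod θ ω₀ α S E φ) {I : Set ℝ}
    (hI : IsCompact I) (hIS : I ⊆ S) : ∃ C : ℝ, 0 ≤ C ∧ ∀ s ∈ I, ∀ z,
      ‖gam θ ω₀.toClosedRealForm11 α (φ s) (vel φ s) (vel φ s) z‖ + ‖gamDot θ ω₀ α φ s z‖ +
        ‖gam θ ω₀.toClosedRealForm11 α (φ s) (slope θ ω₀.toClosedRealForm11 α (φ s)) (vel φ s) z‖ ^ 2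
      ≤ C * energy θ ω₀.toClosedRealForm11 α (φ s) (vel φ s) z := by
  choose W hW C hC0 hC using exists_nhds_bound h hI hIS
  obtain ⟨t, -, ht⟩ := isCompact_univ.elim_nhds_subcover W fun x _ => hW x
  refine ⟨∑ x ∈ t, C x, Finset.sum_nonneg fun x _ => hC0 x, fun s hs z => ?_⟩
  obtain ⟨x, hx, hz⟩ := mem_iUnion₂.1 (ht (mem_univ z))
  exact (hC x s hs z hz).trans (mul_le_mul_of_nonneg_right
    (Finset.single_le_sum (f := C) (fun x _ => hC0 x) hx) (h.energy_nonneg (hIS hs) z))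

omit [IsManifold 𝓘(ℂ, Cn n) ω X] in
theorem Fam.exists_bound [CompactSpace X] {F : ℝ → X → ℝ} (h : Fam n S F) {I : Set ℝ}
    (hI : IsCompact I) (hIS : I ⊆ S) : ∃ C : ℝ, ∀ s ∈ I, ∀ z, |F s z| ≤ C := by
  obtain ⟨C, hC⟩ := (hI.prod isCompact_univ).exists_bound_of_continuousOn
    (h.continuousOn.mono (prod_mono hIS Subset.rfl))
  exact ⟨C, fun s hs z => hC (s, z) ⟨hs, mem_univ _⟩⟩

end Bounds

/-! ### A differential inequality -/

/-- Uniqueness for a degenerate second order system of differential inequalities. -/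
theorem eq_zero_of_differential_inequality {a p Y Z E κ' : ℝ → ℝ} {s0 s1 C E1 : ℝ} (h01 : s0 ≤ s1)
    (ha : ∀ s ∈ Icc s0 s1, HasDerivAt a (2 * E s * p s) s)
    (hp : ∀ s ∈ Icc s0 s1, HasDerivAt p (Y s + Z s) s)
    (hκ : ∀ s ∈ Icc s0 s1, HasDerivAt (fun s => Y s - Z s) (κ' s) s)
    (hκ' : ∀ s ∈ Icc s0 s1, |κ' s| ≤ C * (Y s + Z s))
    (hcs : ∀ s ∈ Icc s0 s1, E s * p s ^ 2 ≤ a s * Y s)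
    (ha0 : ∀ s ∈ Icc s0 s1, 0 ≤ a s) (hY0 : ∀ s ∈ Icc s0 s1, 0 ≤ Y s)
    (hZ0 : ∀ s ∈ Icc s0 s1, 0 ≤ Z s) (hE0 : ∀ s ∈ Icc s0 s1, 0 ≤ E s)
    (hE1 : ∀ s ∈ Icc s0 s1, E s ≤ E1) (ia : a s0 = 0) (ip : p s0 = 0) (iκ : Y s0 - Z s0 = 0) :
    a s1 = 0 := by
  have hm0 : s0 ∈ Icc s0 s1 := left_mem_Icc.2 h01
  have hm1 : s1 ∈ Icc s0 s1 := right_mem_Icc.2 h01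
  have mono : ∀ {f f' : ℝ → ℝ}, (∀ s ∈ Icc s0 s1, HasDerivAt f (f' s) s) →
      (∀ s ∈ Icc s0 s1, 0 ≤ f' s) → MonotoneOn f (Icc s0 s1) := fun hf hf' =>
    monotoneOn_of_hasDerivWithinAt_nonneg (convex_Icc _ _)
      (fun s hs => (hf s hs).continuousAt.continuousWithinAt)
      (fun s hs => (hf s (interior_subset hs)).hasDerivWithinAt)
      fun s hs => hf' s (interior_subset hs)
  have p0 : ∀ s ∈ Icc s0 s1, 0 ≤ p s := fun s hs => by
    have := mono hp (fun s hs => add_nonneg (hY0 s hs) (hZ0 s hs)) hm0 hs hs.1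
    rwa [ip] at this
  -- Both `Y - Z` and `p` vanish at `s0`, and `C (Y + Z)` is the derivative of `C p`.
  have κp : ∀ s ∈ Icc s0 s1, Y s - Z s ≤ C * p s := fun s hs => by
    have := mono (fun s hs => ((hp s hs).const_mul C).sub (hκ s hs))
      (fun s hs => sub_nonneg.2 ((le_abs_self _).trans (hκ' s hs))) hm0 hs hs.1
    simp only [Pi.sub_apply, ip, iκ] at this
    linarith
  by_contra hne
  have hpos1 : 0 < a s1 := lt_of_le_of_ne (ha0 s1 hm1) (Ne.symm hne)
  have hac : ContinuousOn a (Icc s0 s1) := fun s hs => (ha s hs).continuousAt.continuousWithinAt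
  -- The last zero `r` of `a`; after it, division by `a` is allowed.
  obtain ⟨r, ⟨hrI, hr0⟩, hrmax⟩ := (isCompact_Icc.of_isClosed_subset
    (hac.preimage_isClosed_of_isClosed isClosed_Icc isClosed_singleton)
      inter_subset_left : IsCompact (Icc s0 s1 ∩ a ⁻¹' {0})).exists_isGreatest ⟨s0, hm0, ia⟩
  rw [mem_preimage, mem_singleton_iff] at hr0
  have apos : ∀ s ∈ Ioc r s1, 0 < a s := fun s hs => by
    have hsI : s ∈ Icc s0 s1 := ⟨hrI.1.trans hs.1.le, hs.2⟩
    refine lt_of_le_of_ne (ha0 s hsI) fun h => ?_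
    exact absurd (hrmax ⟨hsI, h.symm⟩) (not_le.2 hs.1)
  have hsub : Icc r s1 ⊆ Icc s0 s1 := Icc_subset_Icc_left hrI.1
  have hq : ∀ s ∈ Ioc r s1, HasDerivAt (fun s => Real.exp (C * s) * (p s / a s))
      (Real.exp (C * s) * (C * (p s / a s)) +
        Real.exp (C * s) * (((Y s + Z s) * a s - p s * (2 * E s * p s)) / a s ^ 2)) s := by
    intro s hs
    have hsI := hsub (Ioc_subset_Icc_self hs)
    have h1 := ((hasDerivAt_id s).const_mul C).exp
    refine (h1.mul ((hp s hsI).div (ha s hsI) (apos s hs).ne')).congr_deriv ?_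
    simp only [id, Pi.div_apply]
    ring
  -- By `hcs`, `(p/a)' = (Y + Z)/a - 2Ep²/a² ≥ (Z - Y)/a ≥ -C p/a`, so the exponential weight makes
  -- the quotient nondecreasing.
  have hqm : MonotoneOn (fun s => Real.exp (C * s) * (p s / a s)) (Ioc r s1) := by
    refine monotoneOn_of_hasDerivWithinAt_nonneg (convex_Ioc _ _)
      (fun s hs => (hq s hs).continuousAt.continuousWithinAt)
      (fun s hs => (hq s (interior_subset hs)).hasDerivWithinAt) fun s hs => ?_
    have hs' := interior_subset hs
    have hsI := hsub (Ioc_subset_Icc_self hs')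
    have h1 := apos s hs'
    rw [← mul_add]
    refine mul_nonneg (Real.exp_pos _).le ?_
    have h2 : C * (p s / a s) + ((Y s + Z s) * a s - p s * (2 * E s * p s)) / a s ^ 2 =
        (C * p s * a s + ((Y s + Z s) * a s - 2 * (E s * p s ^ 2))) / a s ^ 2 := by
      field_simp
    rw [h2]
    refine div_nonneg ?_ (sq_nonneg _)
    have h3 := mul_le_mul_of_nonneg_right (κp s hsI) h1.le
    have h4 := hcs s hsI
    linarith
  have hrs1 : r < s1 := lt_of_le_of_ne hrI.2 fun h => hne (h ▸ hr0)
  -- Monotonicity bounds `p / a` on all of `(r, s1]` by its value at `s1`, up to exponential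
  -- factors; in particular the quotient stays bounded as `s` decreases to `r`.
  obtain ⟨K, hK0, hK⟩ : ∃ K, 0 ≤ K ∧ ∀ s ∈ Ioc r s1, p s ≤ K * a s := by
    obtain ⟨B, hB⟩ := (isCompact_Icc (a := r) (b := s1)).exists_bound_of_continuousOn
      (f := fun s => Real.exp (-(C * s))) (by fun_prop)
    have hk0 : 0 ≤ Real.exp (C * s1) * (p s1 / a s1) :=
      mul_nonneg (Real.exp_pos _).le (div_nonneg (p0 s1 hm1) hpos1.le)
    have hB0 : 0 ≤ B := (norm_nonneg _).trans (hB r (left_mem_Icc.2 hrs1.le))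
    refine ⟨B * (Real.exp (C * s1) * (p s1 / a s1)), mul_nonneg hB0 hk0, fun s hs => ?_⟩
    have h1 := hqm hs ⟨hrs1, le_rfl⟩ hs.2
    have h2 := hB s (Ioc_subset_Icc_self hs)
    rw [Real.norm_of_nonneg (Real.exp_pos _).le] at h2
    have h3 : p s = Real.exp (-(C * s)) * (Real.exp (C * s) * (p s / a s)) * a s := by
      rw [← mul_assoc, ← Real.exp_add, neg_add_cancel, Real.exp_zero, one_mul,
        div_mul_cancel₀ _ (apos s hs).ne']
    rw [h3]
    refine mul_le_mul_of_nonneg_right ?_ (apos s hs).le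
    exact (mul_le_mul_of_nonneg_left h1 (Real.exp_pos _).le).trans (mul_le_mul_of_nonneg_right h2 hk0)
  -- Grönwall: `a' = 2Ep ≤ 2 E1 K a` starting from `a r = 0`, which contradicts `a s1 > 0`.
  have hanti : AntitoneOn (fun s => Real.exp (-(2 * E1 * K * s)) * a s) (Icc r s1) := by
    have hd : ∀ s ∈ Icc r s1, HasDerivAt (fun s => Real.exp (-(2 * E1 * K * s)) * a s)
        (Real.exp (-(2 * E1 * K * s)) * (2 * (E s * p s - E1 * (K * a s)))) s := by
      intro s hs
      refine ((((hasDerivAt_id s).const_mul (2 * E1 * K)).neg.exp).mul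
        (ha s (hsub hs))).congr_deriv ?_
      simp only [id, Pi.neg_apply]
      ring
    refine antitoneOn_of_hasDerivWithinAt_nonpos (convex_Icc _ _)
      (fun s hs => (hd s hs).continuousAt.continuousWithinAt)
      (fun s hs => (hd s (interior_subset hs)).hasDerivWithinAt) fun s hs => ?_
    rw [interior_Icc] at hs
    have hsI := hsub (Ioo_subset_Icc_self hs)
    refine mul_nonpos_of_nonneg_of_nonpos (Real.exp_pos _).le ?_
    have := mul_le_mul (hE1 s hsI) (hK s (Ioo_subset_Ioc_self hs)) (p0 s hsI)
      ((hE0 s hsI).trans (hE1 s hsI))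
    linarith
  have := hanti (left_mem_Icc.2 hrs1.le) (right_mem_Icc.2 hrs1.le) hrs1.le
  simp only [hr0, mul_zero] at this
  exact absurd this (not_le.2 (mul_pos (Real.exp_pos _) hpos1))

/-! ### Unique continuation for geodesics -/

section Continuation

open Topology

variable {n : ℕ} {X : Type*} [TopologicalSpace X] [ChartedSpace (Cn n) X]
  [IsManifold 𝓘(ℂ, Cn n) ω X] {θ : ℝ} {ω₀ : KahlerForm n X} {α : ClosedRealForm11 n X}
  {S : Set ℝ} {E : ℝ → ℝ} {φ : ℝ → X → ℝ}

section

variable [CompactSpace X] [MeasurableSpace X] [BorelSpace X]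

theorem im_integral_ofReal_mul (ω₀ : KahlerForm n X) {f : X → ℝ} {g : X → ℂ} (hf : Continuous f)
    (hg : Continuous g) : (∫ x, (f x : ℂ) * g x ∂(volX ω₀.toClosedRealForm11)).im =
      ∫ x, f x * (g x).im ∂(volX ω₀.toClosedRealForm11) := by
  have h6 := Complex.imCLM.integral_comp_comm (integrable_volX ω₀
    ((Complex.continuous_ofReal.comp hf).mul hg))
  exact h6.symm.trans (integral_congr_ae (.of_forall fun x => Complex.im_ofReal_mul _ _))

theorem re_integral_ofReal_mul (ω₀ : KahlerForm n X) {f : X → ℝ} {g : X → ℂ} (hf : Continuous f)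
    (hg : Continuous g) : (∫ x, (f x : ℂ) * g x ∂(volX ω₀.toClosedRealForm11)).re =
      ∫ x, f x * (g x).re ∂(volX ω₀.toClosedRealForm11) := by
  have h6 := Complex.reCLM.integral_comp_comm (integrable_volX ω₀
    ((Complex.continuous_ofReal.comp hf).mul hg))
  exact h6.symm.trans (integral_congr_ae (.of_forall fun x => Complex.re_ofReal_mul _ _))

end

namespace IsGeod

theorem famLin (h : IsGeod θ ω₀ α S E φ) :
    Fam n S fun s => lin θ ω₀.toClosedRealForm11 α (φ s) (vel φ s) :=
  h.fam.lin h.famVel θ ω₀ α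

theorem hasDerivAt_re_ratio (h : IsGeod θ ω₀ α S E φ) {s : ℝ} (hs : s ∈ S) (x : X) :
    HasDerivAt (fun s => (ratio θ ω₀.toClosedRealForm11 α (φ s) x).re)
      (-(lin θ ω₀.toClosedRealForm11 α (φ s) (vel φ s) x).im) s := by
  refine (Complex.reCLM.hasFDerivAt.comp_hasDerivAt s
    (hasDerivAt_ratio h.isOpen h.fam hs θ ω₀.toClosedRealForm11 α x)).congr_deriv ?_
  simp only [Complex.reCLM_apply, Complex.mul_re, Complex.I_re, Complex.I_im, zero_mul, zero_sub,
    one_mul]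
  rfl

theorem hasDerivAt_im_ratio (h : IsGeod θ ω₀ α S E φ) {s : ℝ} (hs : s ∈ S) (x : X) :
    HasDerivAt (fun s => (ratio θ ω₀.toClosedRealForm11 α (φ s) x).im)
      (lin θ ω₀.toClosedRealForm11 α (φ s) (vel φ s) x).re s := by
  refine (Complex.imCLM.hasFDerivAt.comp_hasDerivAt s
    (hasDerivAt_ratio h.isOpen h.fam hs θ ω₀.toClosedRealForm11 α x)).congr_deriv ?_
  simp only [Complex.imCLM_apply, Complex.mul_im, Complex.I_re, Complex.I_im, zero_mul, zero_add,
    one_mul]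
  rfl

/-- The derivative of the slope along a curve. -/
noncomputable def slopeDot (θ : ℝ) (ω₀ α : ClosedRealForm11 n X) (φ : ℝ → X → ℝ) (s : ℝ) (x : X) :
    ℝ :=
  ((lin θ ω₀ α (φ s) (vel φ s) x).re +
    slope θ ω₀ α (φ s) x * (lin θ ω₀ α (φ s) (vel φ s) x).im) / (ratio θ ω₀ α (φ s) x).re

theorem hasDerivAt_slope (h : IsGeod θ ω₀ α S E φ) {s : ℝ} (hs : s ∈ S) (x : X) :
    HasDerivAt (fun s => slope θ ω₀.toClosedRealForm11 α (φ s) x)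
      (slopeDot θ ω₀.toClosedRealForm11 α φ s x) s := by
  have h0 := (h.pos s hs x).ne'
  refine ((h.hasDerivAt_im_ratio hs x).div (h.hasDerivAt_re_ratio hs x) h0).congr_deriv ?_
  rw [slopeDot, h.im_ratio hs]
  field_simp
  ring

theorem hasDerivAt_gam (h : IsGeod θ ω₀ α S E φ) {s : ℝ} (hs : s ∈ S) (x : X) :
    HasDerivAt (fun s => gam θ ω₀.toClosedRealForm11 α (φ s) (vel φ s) (vel φ s) x)
      (gamDot θ ω₀ α φ s x +
        2 * gam θ ω₀.toClosedRealForm11 α (φ s) (vel φ s) (vel (vel φ) s) x) s := by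
  refine (h.famGam.hasDerivAt h.isOpen hs x).congr_deriv ?_
  rw [gamDot]; ring

theorem hasDerivAt_energy (h : IsGeod θ ω₀ α S E φ) {s : ℝ} (hs : s ∈ S) (x : X) :
    HasDerivAt (fun s => energy θ ω₀.toClosedRealForm11 α (φ s) (vel φ s) x)
      (((gamDot θ ω₀ α φ s x).re +
          slope θ ω₀.toClosedRealForm11 α (φ s) x * (gamDot θ ω₀ α φ s x).im) / 2 +
        slopeDot θ ω₀.toClosedRealForm11 α φ s x *
          (gam θ ω₀.toClosedRealForm11 α (φ s) (vel φ s) (vel φ s) x).im / 2 +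
        ((gam θ ω₀.toClosedRealForm11 α (φ s) (vel φ s) (vel (vel φ) s) x).re +
          slope θ ω₀.toClosedRealForm11 α (φ s) x *
            (gam θ ω₀.toClosedRealForm11 α (φ s) (vel φ s) (vel (vel φ) s) x).im)) s := by
  have h1 := h.hasDerivAt_gam hs x
  have hre := Complex.reCLM.hasFDerivAt.comp_hasDerivAt s h1
  have him := Complex.imCLM.hasFDerivAt.comp_hasDerivAt s h1
  refine ((hre.add ((h.hasDerivAt_slope hs x).mul him)).div_const 2).congr_deriv ?_
  simp only [Complex.reCLM_apply, Complex.imCLM_apply, Complex.add_re, Complex.add_im,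
    Complex.mul_re, Complex.mul_im, Complex.re_ofNat, Complex.im_ofNat, Function.comp_apply]
  ring

theorem famGam2 (h : IsGeod θ ω₀ α S E φ) :
    Fam n S fun s => gam θ ω₀.toClosedRealForm11 α (φ s) (vel φ s) (vel (vel φ) s) :=
  h.fam.gam h.famVel h.famVel2 θ ω₀ α

theorem famGamSlope (h : IsGeod θ ω₀ α S E φ) : Fam n S fun s =>
    gam θ ω₀.toClosedRealForm11 α (φ s) (slope θ ω₀.toClosedRealForm11 α (φ s)) (vel φ s) :=
  h.fam.gam h.famSlope h.famVel θ ω₀ α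

theorem famGamDot (h : IsGeod θ ω₀ α S E φ) : Fam n S (gamDot θ ω₀ α φ) :=
  (h.famGam.deriv h.isOpen).sub ((Fam.const 2).mul h.famGam2)

theorem famSlopeDot (h : IsGeod θ ω₀ α S E φ) : Fam n S (slopeDot θ ω₀.toClosedRealForm11 α φ) :=
  (h.famLin.re.add (h.famSlope.mul h.famLin.im)).div h.famRatio.re fun s hs x => (h.pos s hs x).ne'

/-- The density of the derivative of the difference of the two parts of the second derivative of
`𝒥`, after integrations by parts. -/
noncomputable def gapDot (θ : ℝ) (ω₀ : KahlerForm n X) (α : ClosedRealForm11 n X) (k : ℝ)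
    (E : ℝ → ℝ) (φ : ℝ → X → ℝ) (s : ℝ) (x : X) : ℝ :=
  (k - (lin θ ω₀.toClosedRealForm11 α (φ s) (vel φ s) x).im /
      (ratio θ ω₀.toClosedRealForm11 α (φ s) x).re) *
    (E s * slope θ ω₀.toClosedRealForm11 α (φ s) x ^ 2 *
      (ratio θ ω₀.toClosedRealForm11 α (φ s) x).re) -
  E s * slope θ ω₀.toClosedRealForm11 α (φ s) x *
    (gam θ ω₀.toClosedRealForm11 α (φ s) (slope θ ω₀.toClosedRealForm11 α (φ s)) (vel φ s) x).im -
  ((gamDot θ ω₀ α φ s x).re +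
    slope θ ω₀.toClosedRealForm11 α (φ s) x * (gamDot θ ω₀ α φ s x).im) / 2 -
  (3 * slopeDot θ ω₀.toClosedRealForm11 α φ s x +
    (gam θ ω₀.toClosedRealForm11 α (φ s) (slope θ ω₀.toClosedRealForm11 α (φ s)) (vel φ s) x).im /
      (ratio θ ω₀.toClosedRealForm11 α (φ s) x).re) *
    (gam θ ω₀.toClosedRealForm11 α (φ s) (vel φ s) (vel φ s) x).im / 2

variable [CompactSpace X] [MeasurableSpace X] [BorelSpace X] [T2Space X]

/-- The derivative of the `L²`-norm of the velocity. -/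
theorem hasDerivAt_integral_sq (h : IsGeod θ ω₀ α S E φ) {s : ℝ} (hs : s ∈ S) :
    HasDerivAt (fun s => ∫ x, vel φ s x ^ 2 * (ratio θ ω₀.toClosedRealForm11 α (φ s) x).re
        ∂(volX ω₀.toClosedRealForm11))
      (2 * E s * -(∫ x, (vel φ s x : ℂ) * ratio θ ω₀.toClosedRealForm11 α (φ s) x
        ∂(volX ω₀.toClosedRealForm11)).im) s := by
  set μ := volX ω₀.toClosedRealForm11
  have hF : Fam n S fun s x => vel φ s x ^ 2 * (ratio θ ω₀.toClosedRealForm11 α (φ s) x).re := by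
    simp only [sq]
    exact (h.famVel.mul h.famVel).mul h.famRatio.re
  refine (hF.hasDerivAt_integral ω₀ h.isOpen hs).congr_deriv ?_
  have hd : ∀ x, deriv (fun s => vel φ s x ^ 2 * (ratio θ ω₀.toClosedRealForm11 α (φ s) x).re) s =
      -(vel φ s x ^ 2 * (lin θ ω₀.toClosedRealForm11 α (φ s) (vel φ s) x).im) +
      (-(vel φ s x * (gam θ ω₀.toClosedRealForm11 α (φ s) (vel φ s) (vel φ s) x).im) -
        2 * E s * (vel φ s x * (ratio θ ω₀.toClosedRealForm11 α (φ s) x).im)) := fun x => by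
    rw [(((h.famVel.hasDerivAt h.isOpen hs x).fun_pow 2).fun_mul (h.hasDerivAt_re_ratio hs x)).deriv]
    have h1 := h.eqn s hs x
    simp only [Nat.cast_ofNat, Nat.add_one_sub_one, pow_one]
    change 2 * vel φ s x * vel (vel φ) s x * _ + _ = _
    linear_combination 2 * vel φ s x * h1
  simp only [hd]
  have i1 : Integrable (fun x => vel φ s x ^ 2 *
      (lin θ ω₀.toClosedRealForm11 α (φ s) (vel φ s) x).im) μ :=
    integrable_volX ω₀ (((h.famVel.continuous hs).pow 2).mul (h.famLin.im.continuous hs))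
  have i2 : Integrable (fun x => vel φ s x *
      (gam θ ω₀.toClosedRealForm11 α (φ s) (vel φ s) (vel φ s) x).im) μ :=
    integrable_volX ω₀ ((h.famVel.continuous hs).mul (h.famGam.im.continuous hs))
  have i3 : Integrable (fun x => vel φ s x * (ratio θ ω₀.toClosedRealForm11 α (φ s) x).im) μ :=
    integrable_volX ω₀ ((h.famVel.continuous hs).mul (h.famRatio.im.continuous hs))
  -- After `φ̈` is eliminated, the terms cubic in the velocity cancel in the integral, and only the
  -- term with `E` is left. For `E = 0` this is conservation of the length of the velocity.
  have h1 := congrArg Complex.im (integral_sq_mul_lin (θ := θ) (ω₀ := ω₀) (α := α)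
    (h.fam.isSm hs) (h.famVel.isSm hs))
  rw [Complex.neg_im, im_integral_ofReal_mul ω₀ (f := fun x => vel φ s x ^ 2) ((h.famVel.continuous hs).pow 2)
    (h.famLin.continuous hs), im_integral_ofReal_mul ω₀ (h.famVel.continuous hs) (h.famGam.continuous hs)] at h1
  rw [im_integral_ofReal_mul ω₀ (h.famVel.continuous hs) (h.famRatio.continuous hs), integral_add
    (by exact i1.neg) (by exact i2.neg.sub (i3.const_mul _)),
    integral_sub (by exact i2.neg) (by exact i3.const_mul _), integral_neg, integral_neg,
    integral_const_mul, h1]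
  ring

/-- The derivative of `Y` contains `2 E ρ ρ̇ Re D`, where `ρ̇` involves second derivatives of `φ̇`
and is only multiplied by one power of `ρ`. In the derivative of `Z`, integrating the terms `Γ(φ̇,
φ̈)` by parts gives `-2 φ̈ ρ̇ Re D` and a gradient term; inserting `φ̈ = -Im Γ/(2 Re D) - E ρ`
produces the same expression `2 E ρ ρ̇ Re D`. It cancels in `Y - Z`, and every term left in `gapDot`
is quadratically small. -/
theorem hasDerivAt_gap (h : IsGeod θ ω₀ α S E φ) {k s : ℝ} (hE : HasDerivAt E (k * E s) s)
    (hs : s ∈ S) :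
    HasDerivAt (fun s => (∫ x, E s * slope θ ω₀.toClosedRealForm11 α (φ s) x ^ 2 *
        (ratio θ ω₀.toClosedRealForm11 α (φ s) x).re ∂(volX ω₀.toClosedRealForm11)) -
      ∫ x, energy θ ω₀.toClosedRealForm11 α (φ s) (vel φ s) x ∂(volX ω₀.toClosedRealForm11))
      (∫ x, gapDot θ ω₀ α k E φ s x ∂(volX ω₀.toClosedRealForm11)) s := by
  have hF : Fam n S fun s x => slope θ ω₀.toClosedRealForm11 α (φ s) x ^ 2 *
      (ratio θ ω₀.toClosedRealForm11 α (φ s) x).re := by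
    simp only [sq]
    exact (h.famSlope.mul h.famSlope).mul h.famRatio.re
  simp only [mul_assoc, integral_const_mul]
  refine ((hE.fun_mul (hF.hasDerivAt_integral ω₀ h.isOpen hs)).fun_sub
    (h.famEnergy.hasDerivAt_integral ω₀ h.isOpen hs)).congr_deriv ?_
  have hd : ∀ x, deriv (fun s => slope θ ω₀.toClosedRealForm11 α (φ s) x ^ 2 *
      (ratio θ ω₀.toClosedRealForm11 α (φ s) x).re) s =
      2 * slope θ ω₀.toClosedRealForm11 α (φ s) x * slopeDot θ ω₀.toClosedRealForm11 α φ s x *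
        (ratio θ ω₀.toClosedRealForm11 α (φ s) x).re +
      slope θ ω₀.toClosedRealForm11 α (φ s) x ^ 2 *
        -(lin θ ω₀.toClosedRealForm11 α (φ s) (vel φ s) x).im := fun x => by
    rw [(((h.hasDerivAt_slope hs x).fun_pow 2).fun_mul (h.hasDerivAt_re_ratio hs x)).deriv]
    simp only [Nat.cast_ofNat, Nat.add_one_sub_one, pow_one]
  simp only [hd, fun x => (h.hasDerivAt_energy hs x).deriv]
  -- These two integrations by parts move all derivatives off `φ̈`, so that the geodesic equation
  -- can be substituted without differentiating it.
  have p1 := congrArg Complex.re (integral_gam (θ := θ) (ω₀ := ω₀) (α := α)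
    (h.fam.isSm hs) (h.famVel.isSm hs) (h.famVel2.isSm hs))
  have p2 := congrArg Complex.im (integral_mul_gam (θ := θ) (ω₀ := ω₀) (α := α)
    (h.fam.isSm hs) (h.famSlope.isSm hs) (h.famVel.isSm hs) (h.famVel2.isSm hs))
  have cr := h.famSlope.continuous hs
  have cL := h.famLin.continuous hs
  have cg := h.famGamSlope.continuous hs
  have cv := h.famVel2.continuous hs
  have p3 := Complex.reCLM.integral_comp_comm (h.famGam2.integrable ω₀ hs)
  simp only [Complex.reCLM_apply] at p3
  rw [← p3, Complex.neg_re, show ∀ z : ℂ, (2 * z).re = 2 * z.re from fun z => by simp, re_integral_ofReal_mul ω₀ cv cL] at p1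
  rw [im_integral_ofReal_mul ω₀ cr (h.famGam2.continuous hs), Complex.neg_im,
    im_integral_ofReal_mul ω₀ cv (by exact ((continuous_const.mul
      (Complex.continuous_ofReal.comp cr)).mul cL).add cg)] at p2
  have him : ∀ x, (2 * (slope θ ω₀.toClosedRealForm11 α (φ s) x : ℂ) *
      lin θ ω₀.toClosedRealForm11 α (φ s) (vel φ s) x + gam θ ω₀.toClosedRealForm11 α (φ s)
        (slope θ ω₀.toClosedRealForm11 α (φ s)) (vel φ s) x).im =
      2 * slope θ ω₀.toClosedRealForm11 α (φ s) x *
        (lin θ ω₀.toClosedRealForm11 α (φ s) (vel φ s) x).im + (gam θ ω₀.toClosedRealForm11 α (φ s)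
        (slope θ ω₀.toClosedRealForm11 α (φ s)) (vel φ s) x).im := fun x => by
    simp [mul_assoc]
  simp only [him] at p2
  have hpt : ∀ x, gapDot θ ω₀ α k E φ s x =
      k * E s * (slope θ ω₀.toClosedRealForm11 α (φ s) x ^ 2 *
        (ratio θ ω₀.toClosedRealForm11 α (φ s) x).re) +
      E s * (2 * slope θ ω₀.toClosedRealForm11 α (φ s) x * slopeDot θ ω₀.toClosedRealForm11 α φ s x *
        (ratio θ ω₀.toClosedRealForm11 α (φ s) x).re + slope θ ω₀.toClosedRealForm11 α (φ s) x ^ 2 *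
        -(lin θ ω₀.toClosedRealForm11 α (φ s) (vel φ s) x).im) -
      (((gamDot θ ω₀ α φ s x).re +
          slope θ ω₀.toClosedRealForm11 α (φ s) x * (gamDot θ ω₀ α φ s x).im) / 2 +
        slopeDot θ ω₀.toClosedRealForm11 α φ s x *
          (gam θ ω₀.toClosedRealForm11 α (φ s) (vel φ s) (vel φ s) x).im / 2) +
      2 * (vel (vel φ) s x * (lin θ ω₀.toClosedRealForm11 α (φ s) (vel φ s) x).re) +
      vel (vel φ) s x * (2 * slope θ ω₀.toClosedRealForm11 α (φ s) x *
        (lin θ ω₀.toClosedRealForm11 α (φ s) (vel φ s) x).im + (gam θ ω₀.toClosedRealForm11 α (φ s)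
        (slope θ ω₀.toClosedRealForm11 α (φ s)) (vel φ s) x).im) := fun x => by
    have h0 := (h.pos s hs x).ne'
    rw [gapDot, h.vel2_eq hs, slopeDot]
    field_simp
    ring
  simp only [hpt]
  have cΓ := h.famGam.continuous hs
  have cD := h.famRatio.continuous hs
  have cd := h.famGamDot.continuous hs
  have c2 := h.famGam2.continuous hs
  have cs := h.famSlopeDot.continuous hs
  generalize slope θ ω₀.toClosedRealForm11 α (φ s) = r at *
  generalize ratio θ ω₀.toClosedRealForm11 α (φ s) = D at *
  generalize lin θ ω₀.toClosedRealForm11 α (φ s) (vel φ s) = L at *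
  generalize gam θ ω₀.toClosedRealForm11 α (φ s) (vel φ s) (vel φ s) = Γ at *
  generalize gam θ ω₀.toClosedRealForm11 α (φ s) (vel φ s) (vel (vel φ) s) = G at *
  generalize gam θ ω₀.toClosedRealForm11 α (φ s) r (vel φ s) = g at *
  generalize slopeDot θ ω₀.toClosedRealForm11 α φ s = r' at *
  generalize gamDot θ ω₀ α φ s = d at *
  generalize vel (vel φ) s = v at *
  have hI : ∀ {f : X → ℝ}, Continuous f → Integrable f (volX ω₀.toClosedRealForm11) :=
    fun hf => integrable_volX ω₀ hf
  symm
  rw [integral_add (hI (by fun_prop)) (hI (by fun_prop)),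
    integral_add (hI (by fun_prop)) (hI (by fun_prop)),
    integral_sub (hI (by fun_prop)) (hI (by fun_prop)),
    integral_add (hI (by fun_prop)) (hI (by fun_prop)), integral_const_mul, integral_const_mul,
    integral_const_mul, integral_add (μ := volX ω₀.toClosedRealForm11)
      (g := fun x => (G x).re + r x * (G x).im) (hI (by fun_prop)) (hI (by fun_prop)),
    integral_add (μ := volX ω₀.toClosedRealForm11) (f := fun x => (G x).re)
      (hI (by fun_prop)) (hI (by fun_prop)), p1, p2]
  ring

-- Each term of `gapDot` is a bounded coefficient times `E ρ² Re D`, times a quadratic expression in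
-- the gradient of `φ̇`, or a product of one factor of each kind. The energy density controls the
-- gradient terms uniformly on compact time intervals by `exists_bound_energy`.
omit [MeasurableSpace X] [BorelSpace X] [T2Space X] in
theorem abs_gapDot_le (h : IsGeod θ ω₀ α S E φ) (k : ℝ) {I : Set ℝ} (hI : IsCompact I)
    (hIS : I ⊆ S) {E1 : ℝ} (hE1 : ∀ s ∈ I, E s ≤ E1) : ∃ C : ℝ, ∀ s ∈ I, ∀ x,
      |gapDot θ ω₀ α k E φ s x| ≤ C * (E s * slope θ ω₀.toClosedRealForm11 α (φ s) x ^ 2 *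
        (ratio θ ω₀.toClosedRealForm11 α (φ s) x).re +
        energy θ ω₀.toClosedRealForm11 α (φ s) (vel φ s) x) := by
  obtain ⟨C, hC0, hC⟩ := exists_bound_energy h hI hIS
  have hne : ∀ s ∈ S, ∀ x, (ratio θ ω₀.toClosedRealForm11 α (φ s) x).re ≠ 0 :=
    fun s hs x => (h.pos s hs x).ne'
  obtain ⟨M1, h1⟩ := ((Fam.const k).sub (h.famLin.im.div h.famRatio.re hne)).exists_bound hI hIS
  obtain ⟨M2, h2⟩ := ((Fam.const (1 : ℝ)).div h.famRatio.re hne).exists_bound hI hIS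
  obtain ⟨M3, h3⟩ := h.famSlope.exists_bound hI hIS
  obtain ⟨M4, h4⟩ := (((Fam.const (3 : ℝ)).mul h.famSlopeDot).add
    (h.famGamSlope.im.div h.famRatio.re hne)).exists_bound hI hIS
  refine ⟨|M1| + |M2| + (|E1| + 1 + |M3| + |M4|) * C, fun s hs x => ?_⟩
  have hss := hIS hs
  replace hC := hC s hs x
  replace h1 := (h1 s hs x).trans (le_abs_self _)
  replace h2 := (h2 s hs x).trans (le_abs_self _)
  replace h3 := (h3 s hs x).trans (le_abs_self _)
  replace h4 := (h4 s hs x).trans (le_abs_self _)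
  have hE := (hE1 s hs).trans (le_abs_self _)
  have hP := h.phase_energy_nonneg hss x
  have he := h.energy_nonneg hss x
  have hD := h.pos s hss x
  have hEn := h.nonneg s hss
  rw [gapDot]
  generalize slope θ ω₀.toClosedRealForm11 α (φ s) = r at *
  generalize ratio θ ω₀.toClosedRealForm11 α (φ s) x = D at *
  generalize lin θ ω₀.toClosedRealForm11 α (φ s) (vel φ s) x = L at *
  generalize gam θ ω₀.toClosedRealForm11 α (φ s) (vel φ s) (vel φ s) x = Γ at *
  generalize gam θ ω₀.toClosedRealForm11 α (φ s) r (vel φ s) x = g at *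
  generalize slopeDot θ ω₀.toClosedRealForm11 α φ s x = r' at *
  generalize gamDot θ ω₀ α φ s x = d at *
  generalize energy θ ω₀.toClosedRealForm11 α (φ s) (vel φ s) x = e at *
  set P := E s * r x ^ 2 * D.re with hPdef
  have a1 := Complex.abs_im_le_norm Γ
  have a2 := Complex.abs_im_le_norm d
  have a3 := Complex.abs_re_le_norm d
  have a4 : g.im ^ 2 ≤ ‖g‖ ^ 2 := sq_le_sq.2 (by rw [abs_norm]; exact Complex.abs_im_le_norm g)
  have n1 := norm_nonneg Γ
  have n2 := norm_nonneg d
  have n3 := sq_nonneg ‖g‖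
  have t1 : |(k - L.im / D.re) * P| ≤ |M1| * P := by
    rw [abs_mul, abs_of_nonneg hP]
    exact mul_le_mul_of_nonneg_right h1 hP
  -- Young's inequality: `M2` bounds `1 / Re D`, which compares `E ρ²` with `P`, while `g` is linear
  -- in the gradient of the velocity, so its square is bounded by the energy density.
  have t2 : |E s * r x * g.im| ≤ |M2| * P + |E1| * (C * e) := by
    have u1 : E s * r x ^ 2 ≤ |M2| * P := by
      rw [abs_of_nonneg (by positivity)] at h2
      have := mul_le_mul_of_nonneg_right h2 hP
      have u2 : 1 / D.re * P = E s * r x ^ 2 := by rw [hPdef]; field_simp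
      linarith
    have u3 : E s * g.im ^ 2 ≤ |E1| * (C * e) :=
      mul_le_mul hE (by linarith) (sq_nonneg _) (abs_nonneg _)
    have u4 : 0 ≤ E s * (|r x| - |g.im|) ^ 2 := mul_nonneg hEn (sq_nonneg _)
    rw [sub_sq, sq_abs, sq_abs] at u4
    have u5 : |E s * r x * g.im| = E s * (|r x| * |g.im|) := by
      rw [abs_mul, abs_mul, abs_of_nonneg hEn, mul_assoc]
    have u6 : 0 ≤ E s * r x ^ 2 := mul_nonneg hEn (sq_nonneg _)
    have u7 : 0 ≤ E s * g.im ^ 2 := mul_nonneg hEn (sq_nonneg _)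
    rw [u5]
    linarith
  have t3 : |(d.re + r x * d.im) / 2| ≤ (1 + |M3|) * (C * e) := by
    have u1 : |r x * d.im| ≤ |M3| * (C * e) := by
      rw [abs_mul]
      exact mul_le_mul h3 (by linarith) (abs_nonneg _) (abs_nonneg _)
    have u2 := abs_add_le d.re (r x * d.im)
    have u3 := abs_nonneg (d.re + r x * d.im)
    rw [abs_div, abs_two]
    linarith
  have t4 : |(3 * r' + g.im / D.re) * Γ.im / 2| ≤ |M4| * (C * e) := by
    rw [abs_div, abs_two, abs_mul]
    have := mul_le_mul h4 (show |Γ.im| ≤ C * e by linarith) (abs_nonneg _) (abs_nonneg _)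
    have u3 := mul_nonneg (abs_nonneg (3 * r' + g.im / D.re)) (abs_nonneg Γ.im)
    linarith
  have v1 := abs_sub ((k - L.im / D.re) * P - E s * r x * g.im - (d.re + r x * d.im) / 2)
    ((3 * r' + g.im / D.re) * Γ.im / 2)
  have v2 := abs_sub ((k - L.im / D.re) * P - E s * r x * g.im) ((d.re + r x * d.im) / 2)
  have v3 := abs_sub ((k - L.im / D.re) * P) (E s * r x * g.im)
  have v4 : 0 ≤ (|M1| + |M2|) * e := by positivity
  have v5 : 0 ≤ (|E1| + 1 + |M3| + |M4|) * C * P := by positivity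
  linarith

-- Cauchy-Schwarz for the weight `Re D`, since `Im D = ρ Re D`. The proof uses the discriminant of
-- `∫ (c φ̇ + ρ)² Re D ≥ 0` as a quadratic in `c`, multiplied by `E`.
omit [T2Space X] in
theorem mul_sq_integral_le (h : IsGeod θ ω₀ α S E φ) {s : ℝ} (hs : s ∈ S) :
    E s * (-(∫ x, (vel φ s x : ℂ) * ratio θ ω₀.toClosedRealForm11 α (φ s) x
        ∂(volX ω₀.toClosedRealForm11)).im) ^ 2 ≤
      (∫ x, vel φ s x ^ 2 * (ratio θ ω₀.toClosedRealForm11 α (φ s) x).re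
        ∂(volX ω₀.toClosedRealForm11)) *
      ∫ x, E s * slope θ ω₀.toClosedRealForm11 α (φ s) x ^ 2 *
        (ratio θ ω₀.toClosedRealForm11 α (φ s) x).re ∂(volX ω₀.toClosedRealForm11) := by
  have cr := h.famSlope.continuous hs
  have cD := h.famRatio.continuous hs
  have cv := h.famVel.continuous hs
  have hI : ∀ {f : X → ℝ}, Continuous f → Integrable f (volX ω₀.toClosedRealForm11) :=
    fun hf => integrable_volX ω₀ hf
  rw [im_integral_ofReal_mul ω₀ cv cD, neg_sq]
  simp only [mul_assoc (E s), integral_const_mul]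
  rw [mul_left_comm]
  refine mul_le_mul_of_nonneg_left ?_ (h.nonneg s hs)
  have hq : ∀ c : ℝ, 0 ≤ (∫ x, vel φ s x ^ 2 * (ratio θ ω₀.toClosedRealForm11 α (φ s) x).re
        ∂(volX ω₀.toClosedRealForm11)) * (c * c) +
      (2 * ∫ x, vel φ s x * (ratio θ ω₀.toClosedRealForm11 α (φ s) x).im
        ∂(volX ω₀.toClosedRealForm11)) * c +
      ∫ x, slope θ ω₀.toClosedRealForm11 α (φ s) x ^ 2 *
        (ratio θ ω₀.toClosedRealForm11 α (φ s) x).re ∂(volX ω₀.toClosedRealForm11) := fun c => by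
    rw [← integral_mul_const, ← integral_const_mul, ← integral_mul_const,
      ← integral_add (hI (by fun_prop)) (hI (by fun_prop)),
      ← integral_add (hI (by fun_prop)) (hI (by fun_prop))]
    refine integral_nonneg fun x => ?_
    have : vel φ s x ^ 2 * (ratio θ ω₀.toClosedRealForm11 α (φ s) x).re * (c * c) +
        2 * (vel φ s x * (ratio θ ω₀.toClosedRealForm11 α (φ s) x).im) * c +
        slope θ ω₀.toClosedRealForm11 α (φ s) x ^ 2 *
          (ratio θ ω₀.toClosedRealForm11 α (φ s) x).re =
        (vel φ s x * c + slope θ ω₀.toClosedRealForm11 α (φ s) x) ^ 2 *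
          (ratio θ ω₀.toClosedRealForm11 α (φ s) x).re := by
      rw [h.im_ratio hs]; ring
    exact this.ge.trans' (mul_nonneg (sq_nonneg _) (h.pos s hs x).le)
  have := discrim_le_zero hq
  rw [discrim] at this
  linarith

/-- A geodesic whose velocity vanishes at one time, where it is infinitesimally stationary, has
vanishing velocity at all later times. -/
theorem vel_eq_zero_of_le (h : IsGeod θ ω₀ α S E φ) {k : ℝ}
    (hE : ∀ s ∈ S, HasDerivAt E (k * E s) s) {s0 s1 : ℝ} (h01 : s0 ≤ s1) (hS : Icc s0 s1 ⊆ S)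
    (hv : ∀ x, vel φ s0 x = 0)
    (hr : ∀ x, E s0 * slope θ ω₀.toClosedRealForm11 α (φ s0) x ^ 2 *
        (ratio θ ω₀.toClosedRealForm11 α (φ s0) x).re = 0)
    (he : ∀ x, energy θ ω₀.toClosedRealForm11 α (φ s0) (vel φ s0) x = 0) (x : X) :
    vel φ s1 x = 0 := by
  have hEc : ContinuousOn E (Icc s0 s1) := fun s hs =>
    (hE s (hS hs)).continuousAt.continuousWithinAt
  obtain ⟨E1, hE1⟩ := isCompact_Icc.exists_bound_of_continuousOn hEc
  have hE1' : ∀ s ∈ Icc s0 s1, E s ≤ E1 := fun s hs => (le_abs_self _).trans (hE1 s hs)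
  obtain ⟨C, hC⟩ := h.abs_gapDot_le k isCompact_Icc hS hE1'
  -- Here `a` is the squared length of the velocity, `p` the derivative of `𝒥`, and `Y`, `Z` are the
  -- phase part and the gradient part of its second derivative.
  have key := eq_zero_of_differential_inequality h01
    (fun s hs => h.hasDerivAt_integral_sq (hS hs))
    (fun s hs => (hasDerivAt_deriv_funcJ (θ := θ) (ω₀ := ω₀) (α := α) h.isOpen h.fam
      (hS hs)).congr_deriv (h.re_integral_hessDensity (hS hs)))
    (fun s hs => h.hasDerivAt_gap (hE s (hS hs)) (hS hs)) (C := C)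
    (fun s hs => ?_) (fun s hs => h.mul_sq_integral_le (hS hs))
    (fun s hs => integral_nonneg fun x => mul_nonneg (sq_nonneg _) (h.pos s (hS hs) x).le)
    (fun s hs => h.integral_phase_energy_nonneg (hS hs))
    (fun s hs => h.integral_energy_nonneg (hS hs)) (fun s hs => h.nonneg s (hS hs)) hE1'
    (by simp [hv]) (by simp [hv]) (by simp only [hr, he, sub_self])
  · have hs1 : s1 ∈ S := hS (right_mem_Icc.2 h01)
    have hc : Continuous fun x => vel φ s1 x ^ 2 * (ratio θ ω₀.toClosedRealForm11 α (φ s1) x).re :=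
      ((h.famVel.continuous hs1).pow 2).mul (h.famRatio.re.continuous hs1)
    have := isOpenPosMeasure_volX ω₀
    rw [integral_eq_zero_iff_of_nonneg (fun x => mul_nonneg (sq_nonneg _) (h.pos s1 hs1 x).le)
      (integrable_volX ω₀ hc), hc.ae_eq_iff_eq _ continuous_zero] at key
    have h2 := congrFun key x
    simpa [(h.pos s1 hs1 x).ne'] using h2
  · have i2 := (h.integrable_phase_energy (hS hs)).add (h.famEnergy.integrable ω₀ (hS hs))
    rw [← integral_add (h.integrable_phase_energy (hS hs)) (h.famEnergy.integrable ω₀ (hS hs)),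
      ← integral_const_mul, ← Real.norm_eq_abs]
    exact norm_integral_le_of_norm_le (i2.const_mul C) (.of_forall fun x => hC s hs x)

end IsGeod

end Continuation

/-! ### Locally constant functions -/

section LocallyConstant

open Topology

variable {n : ℕ}

theorem fderiv_eq_zero_of_gradC_eq_zero {F : Cn n → ℝ} {y : Cn n} (hF : DifferentiableAt ℝ F y)
    (h : gradC F y = 0) : fderiv ℝ F y = 0 := by
  have h1 : fderiv ℝ (fun y => (F y : ℂ)) y = Complex.ofRealCLM.comp (fderiv ℝ F y) :=
    (Complex.ofRealCLM.hasFDerivAt.comp y hF.hasFDerivAt).fderiv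
  have h2 : ∀ j, fderiv ℝ F y (stdB j) = 0 ∧ fderiv ℝ F y (Complex.I • stdB j) = 0 := fun j => by
    have h3 := congrFun h j
    rw [gradC, wz, h1, Pi.zero_apply, div_eq_zero_iff, or_iff_left two_ne_zero] at h3
    simp only [ContinuousLinearMap.comp_apply, Complex.ofRealCLM_apply] at h3
    have h4 := congrArg Complex.re h3
    have h5 := congrArg Complex.im h3
    simp only [Complex.sub_re, Complex.sub_im, Complex.mul_re, Complex.mul_im, Complex.I_re,
      Complex.I_im, Complex.ofReal_re, Complex.ofReal_im, Complex.zero_re, Complex.zero_im] at h4 h5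
    exact ⟨by linarith, by linarith⟩
  ext v
  have h6 : v = ∑ k, ((v k).re • (stdB k : Cn n) + (v k).im • (Complex.I • (stdB k : Cn n))) := by
    refine (eq_sum_stdB v).trans (Finset.sum_congr rfl fun k _ => ?_)
    rw [← Complex.coe_smul, ← Complex.coe_smul, smul_smul, ← add_smul, Complex.re_add_im]
  rw [h6]
  simp [h2]

variable {X : Type*} [TopologicalSpace X] [ChartedSpace (Cn n) X]

theorem isLocallyConstant_of_gradC_eq_zero {c : X → ℝ} (hc : IsSm (n := n) c)
    (h : ∀ p : X, ∀ y ∈ (chartAt (Cn n) p).target, gradC (c ∘ (chartAt (Cn n) p).symm) y = 0) :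
    IsLocallyConstant c := by
  refine (IsLocallyConstant.iff_eventually_eq c).2 fun x => ?_
  set e := chartAt (Cn n) x with he
  have hd : DifferentiableOn ℝ (c ∘ e.symm) e.target := (hc x).differentiableOn (by simp)
  have h1 := e.open_target.isOpen_inter_preimage_of_fderiv_eq_zero hd (fun y hy =>
    fderiv_eq_zero_of_gradC_eq_zero (hd.differentiableAt (e.open_target.mem_nhds hy)) (h x y hy))
    {c x}
  have hx := mem_chart_source (Cn n) x
  have h2 := (e.continuousAt hx).preimage_mem_nhds (h1.mem_nhds
    ⟨e.map_source hx, by simp [e.left_inv hx]⟩)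
  filter_upwards [h2, e.open_source.mem_nhds hx] with z hz hz'
  simpa [e.left_inv hz'] using hz.2

variable {c : X → ℝ} (hl : IsLocallyConstant c)
include hl

/-- `X` is not assumed connected, so a function with vanishing gradient is only locally constant;
near each point it still acts as an additive constant and does not affect derivatives. -/
theorem iddbar_add_mul_of_isLocallyConstant {f : X → ℝ} (hf : IsSm (n := n) f) (a : ℝ) (x : X)
    (u v : Cn n) : iddbar 𝓘(ℝ, Cn n) (fun y => f y + a * c y) x u v =
      iddbar 𝓘(ℝ, Cn n) f x u v := by
  have h1 : (fun y => f y + a * c y) ∘ (chartAt (Cn n) x).symm =ᶠ[𝓝 (chartAt (Cn n) x x)]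
      (fun y => f y + a * c x) ∘ (chartAt (Cn n) x).symm := by
    have hc := (chartAt (Cn n) x).continuousAt_symm (mem_chart_target _ x)
    rw [ContinuousAt, (chartAt (Cn n) x).left_inv (mem_chart_source _ x)] at hc
    filter_upwards [hc.eventually ((IsLocallyConstant.iff_eventually_eq c).1 hl x)] with z hz
    simp only [Function.comp_apply, hz]
  have h2 : iddbar 𝓘(ℝ, Cn n) (fun y => f y + a * c y) x u v =
    iddbar 𝓘(ℝ, Cn n) (fun y => f y + a * c x) x u v := iddb_congr h1 u v
  rw [h2, iddbar_add hf (isSm_const _)]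
  simp [iddbar, Function.comp_def]

theorem hessAt_add_mul_of_isLocallyConstant {f : X → ℝ} (hf : IsSm (n := n) f) (a : ℝ) (x : X) :
    (hessAt (fun y => f y + a * c y) x : Matrix (Fin n) (Fin n) ℂ) = hessAt f x := by
  simp only [hessAt, iddbar_add_mul_of_isLocallyConstant hl hf]

theorem ratio_add_mul_of_isLocallyConstant {φ : X → ℝ} (hφ : IsSm (n := n) φ) (a : ℝ) (θ : ℝ)
    (ω₀ α : ClosedRealForm11 n X) (x : X) :
    ratio θ ω₀ α (fun y => φ y + a * c y) x = ratio θ ω₀ α φ x := by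
  simp only [ratio, cplxAt, hessAt_add_mul_of_isLocallyConstant hl hφ]

theorem gam_add_of_isLocallyConstant {φ f : X → ℝ} (hφ : IsSm (n := n) φ)
    (hf : IsSm (n := n) f) (a : ℝ) (θ : ℝ) (ω₀ α : ClosedRealForm11 n X) (x : X) :
    gam θ ω₀ α (fun y => φ y + a * c y) (fun y => f y + c y) (fun y => f y + c y) x =
      gam θ ω₀ α φ f f x := by
  have h1 : ∀ g, lin θ ω₀ α (fun y => φ y + a * c y) g x = lin θ ω₀ α φ g x := fun g => by
    simp only [lin, cplxAt, hessAt_add_mul_of_isLocallyConstant hl hφ]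
  have h2 : lin θ ω₀ α φ (fun y => f y + c y) x = lin θ ω₀ α φ f x := by
    have := hessAt_add_mul_of_isLocallyConstant hl hf 1 x
    simp only [one_mul] at this
    simp only [lin, this]
  have h3 : lin θ ω₀ α φ (fun y => (f y + c y) * (f y + c y)) x =
      lin θ ω₀ α φ (fun y => f y * f y) x + ((2 * c x : ℝ) : ℂ) * lin θ ω₀ α φ f x := by
    rw [← lin_const_mul θ ω₀ α φ hf, ← lin_add θ ω₀ α φ (hf.mul hf) ((isSm_const _).mul hf)]
    have h4 : (fun y => (f y + c y) * (f y + c y)) =ᶠ[𝓝 x]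
        fun y => f y * f y + 2 * c x * f y + c x * c x := by
      filter_upwards [(IsLocallyConstant.iff_eventually_eq c).1 hl x] with z hz
      rw [hz]; ring
    have h5 := lin_add θ ω₀ α φ ((hf.mul hf).add ((isSm_const (2 * c x)).mul hf))
      (isSm_const (c x * c x)) x
    rw [lin_const, add_zero] at h5
    rw [← h5]
    simp only [lin, hessAt_congr h4]
  simp only [gam, h1, h2, h3]
  push_cast
  ring

end LocallyConstant

/-! ### Rigidity of geodesics -/

section Rigidity

open Topology

variable {n : ℕ} {X : Type*} [TopologicalSpace X] [ChartedSpace (Cn n) X] {θ : ℝ}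
  {ω₀ : KahlerForm n X} {α : ClosedRealForm11 n X} {S : Set ℝ} {E : ℝ → ℝ} {φ : ℝ → X → ℝ}

theorem gam_neg_neg {f : X → ℝ} (hf : IsSm (n := n) f) (θ : ℝ) (ω₀ α : ClosedRealForm11 n X)
    (φ : X → ℝ) (x : X) :
    gam θ ω₀ α φ (fun y => -f y) (fun y => -f y) x = gam θ ω₀ α φ f f x := by
  have h1 := lin_const_mul θ ω₀ α φ hf (-1) x
  simp only [neg_mul, one_mul, Complex.ofReal_neg, Complex.ofReal_one] at h1
  simp only [gam, neg_mul_neg, h1, Complex.ofReal_neg]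

omit [TopologicalSpace X] [ChartedSpace (Cn n) X] in
theorem vel_comp_neg (φ : ℝ → X → ℝ) (s : ℝ) :
    vel (fun s => φ (-s)) s = fun x => -vel φ (-s) x :=
  funext fun x => deriv_comp_neg (fun s => φ s x) s

omit [TopologicalSpace X] [ChartedSpace (Cn n) X] in
theorem vel_vel_comp_neg (φ : ℝ → X → ℝ) (s : ℝ) :
    vel (vel fun s => φ (-s)) s = vel (vel φ) (-s) := by
  funext x
  have h1 : (fun s => vel (fun s => φ (-s)) s x) = fun s => -vel φ (-s) x :=
    funext fun s => by rw [vel_comp_neg]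
  rw [vel, h1, deriv.fun_neg, deriv_comp_neg (fun s => vel φ s x), neg_neg]
  rfl

namespace IsGeod

/-- The equation contains the velocity only quadratically and the acceleration linearly, so it is
invariant under time reversal. This extends uniqueness forward in time to earlier times. -/
theorem comp_neg (h : IsGeod θ ω₀ α S E φ) :
    IsGeod θ ω₀ α (Neg.neg ⁻¹' S) (fun s => E (-s)) fun s => φ (-s) := by
  refine ⟨h.isOpen.preimage continuous_neg, h.fam.comp contDiff_neg.contDiffOn fun s hs => hs,
    fun s hs => h.pos _ hs, fun s hs => h.nonneg _ hs, fun s hs x => ?_⟩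
  rw [vel_vel_comp_neg, vel_comp_neg, gam_neg_neg (h.famVel.isSm hs)]
  exact h.eqn (-s) hs x

theorem vel_add_mul (h : IsGeod θ ω₀ α S E φ) (c : X → ℝ) {s : ℝ} (hs : s ∈ S) :
    vel (fun s x => φ s x + s * c x) s = fun x => vel φ s x + c x := by
  funext x
  have h1 := (h.fam.hasDerivAt h.isOpen hs x).fun_add ((hasDerivAt_id s).mul_const (c x))
  rw [one_mul] at h1
  exact h1.deriv

theorem vel_vel_add_mul (h : IsGeod θ ω₀ α S E φ) (c : X → ℝ) {s : ℝ} (hs : s ∈ S) :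
    vel (vel fun s x => φ s x + s * c x) s = vel (vel φ) s := by
  funext x
  have h1 : (fun s => vel (fun s x => φ s x + s * c x) s x) =ᶠ[𝓝 s] fun s => vel φ s x + c x := by
    filter_upwards [h.isOpen.mem_nhds hs] with t ht
    rw [h.vel_add_mul c ht]
  rw [vel, h1.deriv_eq, deriv_add_const]
  rfl

/-- Adding `s c` changes neither the Hessian of `φ`, nor the acceleration, nor the gradient of the
velocity. It allows a locally constant velocity to be normalized to zero. -/
theorem add_mul (h : IsGeod θ ω₀ α S E φ) {c : X → ℝ} (hc : IsSm (n := n) c)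
    (hl : IsLocallyConstant c) : IsGeod θ ω₀ α S E fun s x => φ s x + s * c x := by
  refine ⟨h.isOpen, h.fam.add ((Fam.of_param contDiffOn_id).mul hc.fam), fun s hs x => ?_,
    h.nonneg, fun s hs x => ?_⟩
  · rw [ratio_add_mul_of_isLocallyConstant hl (h.fam.isSm hs)]
    exact h.pos s hs x
  · rw [h.vel_vel_add_mul c hs, h.vel_add_mul c hs,
      ratio_add_mul_of_isLocallyConstant hl (h.fam.isSm hs),
      gam_add_of_isLocallyConstant hl (h.fam.isSm hs) (h.famVel.isSm hs)]
    exact h.eqn s hs x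

variable [IsManifold 𝓘(ℂ, Cn n) ω X] [CompactSpace X] [MeasurableSpace X] [BorelSpace X] [T2Space X]

/-- A geodesic whose velocity vanishes at one time, where it is infinitesimally stationary, has
vanishing velocity at all times. -/
theorem vel_eq_zero (h : IsGeod θ ω₀ α S E φ) {k : ℝ} (hE : ∀ s ∈ S, HasDerivAt E (k * E s) s)
    (hS : S.OrdConnected) {s0 s1 : ℝ} (h0 : s0 ∈ S) (h1 : s1 ∈ S) (hv : ∀ x, vel φ s0 x = 0)
    (hr : ∀ x, E s0 * slope θ ω₀.toClosedRealForm11 α (φ s0) x ^ 2 *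
        (ratio θ ω₀.toClosedRealForm11 α (φ s0) x).re = 0)
    (he : ∀ x, energy θ ω₀.toClosedRealForm11 α (φ s0) (vel φ s0) x = 0) (x : X) :
    vel φ s1 x = 0 := by
  rcases le_total s0 s1 with h01 | h01
  · exact h.vel_eq_zero_of_le hE h01 (hS.out h0 h1) hv hr he x
  · have key := h.comp_neg.vel_eq_zero_of_le (k := -k) (s0 := -s0) (s1 := -s1)
      (fun s hs => ((hE _ hs).comp s (hasDerivAt_neg s)).congr_deriv (by ring)) (neg_le_neg h01)
      (fun s hs => hS.out h1 h0 ⟨le_neg.1 hs.2, neg_le.1 hs.1⟩)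
      (fun x => by simp only [vel_comp_neg, neg_neg, hv, neg_zero])
      (fun x => by simpa only [neg_neg] using hr x)
      (fun x => by
        simp only [energy, vel_comp_neg, neg_neg, gam_neg_neg (h.famVel.isSm h0)]
        exact he x) x
    rwa [vel_comp_neg, neg_neg, neg_eq_zero] at key

/-- If the second derivative of `𝒥` vanishes at one time of a geodesic, its velocity is locally
constant on `X` and independent of time. -/
theorem exists_vel_eq (h : IsGeod θ ω₀ α S E φ) {k : ℝ} (hE : ∀ s ∈ S, HasDerivAt E (k * E s) s)
    (hS : S.OrdConnected) {s0 : ℝ} (h0 : s0 ∈ S)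
    (hJ : (∫ x, hessDensity θ ω₀.toClosedRealForm11 α φ s0 x
      ∂(volX ω₀.toClosedRealForm11)).re = 0) :
    ∃ c : X → ℝ, IsLocallyConstant c ∧ ∀ s ∈ S, ∀ x, vel φ s x = c x := by
  have := isOpenPosMeasure_volX ω₀
  rw [h.re_integral_hessDensity h0] at hJ
  have hY := h.integral_phase_energy_nonneg h0
  have hZ := h.integral_energy_nonneg h0
  have hzero : ∀ {f : X → ℝ}, Continuous f → (∀ x, 0 ≤ f x) →
      ∫ x, f x ∂(volX ω₀.toClosedRealForm11) = 0 → ∀ x, f x = 0 := fun {f} hf hf0 hi x => by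
    rw [integral_eq_zero_iff_of_nonneg hf0 (integrable_volX ω₀ hf),
      hf.ae_eq_iff_eq _ continuous_zero] at hi
    exact congrFun hi x
  -- `𝒥''` is the sum of two nonnegative integrals of continuous nonnegative densities, so both
  -- densities vanish everywhere.
  have hr := hzero (f := fun x => E s0 * slope θ ω₀.toClosedRealForm11 α (φ s0) x ^ 2 *
    (ratio θ ω₀.toClosedRealForm11 α (φ s0) x).re) ((continuous_const.mul ((h.famSlope.continuous h0).pow 2)).mul
    (h.famRatio.re.continuous h0)) (fun x => h.phase_energy_nonneg h0 x) (by linarith)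
  have he := hzero (h.famEnergy.continuous h0) (fun x => h.energy_nonneg h0 x) (by linarith)
  have hsm := h.famVel.isSm h0
  have hl : IsLocallyConstant (vel φ s0) := by
    refine isLocallyConstant_of_gradC_eq_zero hsm fun p y hy => ?_
    rcases h.grad_eq_zero_or_energy_pos p hy h0 with h1 | h1
    · exact h1.1
    · exact absurd (he _) h1.ne'
  refine ⟨vel φ s0, hl, fun s hs x => ?_⟩
  have hsm' : IsSm (n := n) fun x => -vel φ s0 x := fun p => (hsm p).neg
  have hl' : IsLocallyConstant fun x => -vel φ s0 x := hl.comp fun r => -r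
  -- Uniqueness is applied to `φ s - s φ̇(s0)`, whose velocity vanishes at `s0`.
  have key := (h.add_mul hsm' hl').vel_eq_zero hE hS h0 hs
    (fun x => by simp only [h.vel_add_mul _ h0, add_neg_cancel])
    (fun x => by
      simp only [slope, ratio_add_mul_of_isLocallyConstant hl' (h.fam.isSm h0)]
      exact hr x)
    (fun x => by
      rw [h.vel_add_mul _ h0]
      simp only [energy, slope, ratio_add_mul_of_isLocallyConstant hl' (h.fam.isSm h0),
        gam_add_of_isLocallyConstant hl' (h.fam.isSm h0) hsm]
      exact he x) x
  rw [h.vel_add_mul _ hs] at key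
  linarith

end IsGeod

end Rigidity

/-! ### Convexity along geodesics -/

section Convexity

variable {n : ℕ} {X : Type*} [TopologicalSpace X] [T2Space X] [CompactSpace X]
  [ChartedSpace (Cn n) X] [IsManifold 𝓘(ℂ, Cn n) ω X] [MeasurableSpace X] [BorelSpace X] {θ : ℝ}
  {ω₀ : KahlerForm n X} {α : ClosedRealForm11 n X} {φ : ℝ → X → ℝ} {φb : X → ℝ} {ε : ℝ}

omit [T2Space X] [CompactSpace X] [MeasurableSpace X] [BorelSpace X] in
theorem fam_of_isEpsGeodesic (h : IsEpsGeodesic ω₀ α θ ε φ) : Fam n (Icc 0 1) φ :=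
  have := isManifold_real n X
  Fam.of_contMDiffOn h.smooth

theorem convexOn_funcJ (hb : IsSm (n := n) φb) (h : IsEpsGeodesic ω₀ α θ ε φ) :
    ConvexOn ℝ (Icc 0 1) fun s => funcJ ω₀ α θ φb (φ s) := by
  have hg := h.isGeod
  have hc : ContinuousOn (fun s => funcJ ω₀ α θ φb (φ s)) (Icc 0 1) :=
    (Complex.continuous_im.comp_continuousOn
      (continuousOn_phase_mul_CY hb (fam_of_isEpsGeodesic h))).neg
  refine convexOn_of_hasDerivWithinAt2_nonneg (convex_Icc 0 1) hc
    (fun s hs => (hasDerivAt_funcJ hg.isOpen hb hg.fam (interior_Icc.subset hs)).hasDerivWithinAt)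
    (fun s hs =>
      (hasDerivAt_deriv_funcJ hg.isOpen hg.fam (interior_Icc.subset hs)).hasDerivWithinAt)
    fun s hs => ?_
  rw [hg.re_integral_hessDensity (interior_Icc.subset hs)]
  exact add_nonneg (hg.integral_phase_energy_nonneg (interior_Icc.subset hs))
    (hg.integral_energy_nonneg (interior_Icc.subset hs))

-- Integration in time gives `φ s = φ 0 + s c` up to the endpoints, by continuity there, and a
-- locally constant `c` does not contribute to `√-1 ∂∂̄φ`.
omit [T2Space X] [CompactSpace X] [MeasurableSpace X] [BorelSpace X] in
theorem not_isNontrivial_of_vel_eq (h : IsEpsGeodesic ω₀ α θ ε φ) {c : X → ℝ}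
    (hl : IsLocallyConstant c) (hc : ∀ s ∈ Ioo (0 : ℝ) 1, ∀ x, vel φ s x = c x) :
    ¬ IsNontrivial α φ := by
  rintro ⟨s, hs, hne⟩
  have hf := fam_of_isEpsGeodesic h
  have hg := h.isGeod
  have h0 : (0 : ℝ) ∈ Icc (0 : ℝ) 1 := left_mem_Icc.2 zero_le_one
  have hφ : ∀ x, φ s x = φ 0 x + s * c x := fun x => by
    have hcont : ContinuousOn (fun s => φ s x - s * c x) (Icc 0 1) :=
      (hf.continuousOn.comp (by fun_prop : ContinuousOn (fun s : ℝ => (s, x)) (Icc 0 1))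
        fun s hs => ⟨hs, mem_univ x⟩).sub (by fun_prop)
    have hd : ∀ s ∈ interior (Icc (0 : ℝ) 1),
        HasDerivWithinAt (fun s => φ s x - s * c x) 0 (interior (Icc (0 : ℝ) 1)) s := fun s hs => by
      have hs' := interior_Icc.subset hs
      refine (((hg.fam.hasDerivAt hg.isOpen hs' x).fun_sub
        ((hasDerivAt_id s).mul_const (c x))).congr_deriv ?_).hasDerivWithinAt
      rw [one_mul, sub_eq_zero]
      exact hc s hs' x
    have h1 := monotoneOn_of_hasDerivWithinAt_nonneg (convex_Icc 0 1) hcont hd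
      (fun _ _ => le_rfl) h0 hs hs.1
    have h2 := antitoneOn_of_hasDerivWithinAt_nonpos (convex_Icc 0 1) hcont hd
      (fun _ _ => le_rfl) h0 hs hs.1
    simp only [zero_mul, sub_zero] at h1 h2
    linarith
  refine hne ?_
  funext x u v
  have h3 : φ s = fun x => φ 0 x + s * c x := funext hφ
  rw [alphaPhi, alphaPhi, h3, iddbar_add_mul_of_isLocallyConstant hl (hf.isSm h0)]

/-- Rigidity is used at each interior time separately: a single zero of `𝒥''` already forces the
geodesic to be trivial, so for a non-trivial one `𝒥''` is positive throughout the open interval. -/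
theorem strictConvexOn_funcJ (hb : IsSm (n := n) φb) (h : IsEpsGeodesic ω₀ α θ ε φ)
    (hn : IsNontrivial α φ) : StrictConvexOn ℝ (Icc 0 1) fun s => funcJ ω₀ α θ φb (φ s) := by
  have hg := h.isGeod
  have hc : ContinuousOn (fun s => funcJ ω₀ α θ φb (φ s)) (Icc 0 1) :=
    (Complex.continuous_im.comp_continuousOn
      (continuousOn_phase_mul_CY hb (fam_of_isEpsGeodesic h))).neg
  refine strictConvexOn_of_deriv2_pos (convex_Icc 0 1) hc fun s hs => ?_
  have hs' := interior_Icc.subset hs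
  have h1 := deriv_deriv_eq_of_hasDerivAt hg.isOpen
    (fun s hs => hasDerivAt_funcJ (θ := θ) (ω₀ := ω₀) (α := α) hg.isOpen hb hg.fam hs)
    (fun s hs => hasDerivAt_deriv_funcJ hg.isOpen hg.fam hs) hs'
  change 0 < deriv (deriv _) s
  rw [h1]
  refine lt_of_le_of_ne ?_ fun h0 => ?_
  · rw [hg.re_integral_hessDensity hs']
    exact add_nonneg (hg.integral_phase_energy_nonneg hs') (hg.integral_energy_nonneg hs')
  -- The constant `k = -2` is the logarithmic derivative of the factor `e^{-2s}` in `4 ε² e^{-2s}`;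
  -- for `ε = 0` the equation `E' = kE` holds trivially.
  · obtain ⟨c, hl, hc⟩ := hg.exists_vel_eq (k := -2) (fun s _ => by
      refine ((((hasDerivAt_id s).const_mul (-2)).exp).const_mul (4 * ε ^ 2)).congr_deriv ?_
      simp only [id]
      ring) ordConnected_Ioo hs' h0.symm
    exact not_isNontrivial_of_vel_eq h hl hc hn

theorem exists_funcC_eq (hθ : IsPhaseAngle ω₀ α θ) (hb : IsSm (n := n) φb)
    (h : IsEpsGeodesic ω₀ α θ ε φ) :
    ∃ a b : ℝ, ∀ s ∈ Icc (0 : ℝ) 1, funcC ω₀ α θ φb (φ s) = a + b * s := by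
  have hg := h.isGeod
  have hc : ContinuousOn (fun s => funcC ω₀ α θ φb (φ s)) (Icc 0 1) :=
    Complex.continuous_re.comp_continuousOn
      (continuousOn_phase_mul_CY hb (fam_of_isEpsGeodesic h))
  have hd := fun s (hs : s ∈ interior (Icc (0 : ℝ) 1)) =>
    hasDerivAt_funcC (θ := θ) (ω₀ := ω₀) (α := α) hg.isOpen hb hg.fam (interior_Icc.subset hs)
  have hd2 := fun s (hs : s ∈ interior (Icc (0 : ℝ) 1)) =>
    (hasDerivAt_deriv_funcC (θ := θ) (ω₀ := ω₀) (α := α) hg.isOpen hg.fam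
      (interior_Icc.subset hs)).congr_deriv (hg.im_integral_hessDensity hθ (interior_Icc.subset hs))
  -- The second derivative is zero, so `𝒞` is convex and concave on the closed interval and agrees
  -- with its chord.
  have h1 := convexOn_of_hasDerivWithinAt2_nonneg (convex_Icc 0 1) hc
    (fun s hs => (hd s hs).hasDerivWithinAt) (fun s hs => (hd2 s hs).hasDerivWithinAt)
    fun _ _ => le_rfl
  have h2 := concaveOn_of_hasDerivWithinAt2_nonpos (convex_Icc 0 1) hc
    (fun s hs => (hd s hs).hasDerivWithinAt) (fun s hs => (hd2 s hs).hasDerivWithinAt)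
    fun _ _ => le_rfl
  refine ⟨funcC ω₀ α θ φb (φ 0), funcC ω₀ α θ φb (φ 1) - funcC ω₀ α θ φb (φ 0), fun s hs => ?_⟩
  have m0 : (0 : ℝ) ∈ Icc (0 : ℝ) 1 := left_mem_Icc.2 zero_le_one
  have m1 : (1 : ℝ) ∈ Icc (0 : ℝ) 1 := right_mem_Icc.2 zero_le_one
  have e1 := h1.2 m0 m1 (sub_nonneg.2 hs.2) hs.1 (sub_add_cancel 1 s)
  have e2 := h2.2 m0 m1 (sub_nonneg.2 hs.2) hs.1 (sub_add_cancel 1 s)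
  simp only [smul_eq_mul, mul_zero, mul_one, zero_add] at e1 e2
  linarith

end Convexity

end DHYM

theorem mainTheorem9 (n : ℕ) (X : Type*) [TopologicalSpace X] [T2Space X] [CompactSpace X]
    [ChartedSpace (DHYM.Cn n) X] [IsManifold 𝓘(ℂ, DHYM.Cn n) (⊤ : WithTop ℕ∞) X]
    (ω₀ : DHYM.KahlerForm n X) (α : DHYM.ClosedRealForm11 n X)
    (θ : ℝ) (hθ : DHYM.IsPhaseAngle ω₀ α θ)
    (φb : X → ℝ) (hφb : ContMDiff 𝓘(ℝ, DHYM.Cn n) 𝓘(ℝ, ℝ) ∞ φb) :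
    (∀ φ : ℝ → X → ℝ, DHYM.IsSmoothCurve ω₀ α θ φ →
      ContDiffOn ℝ 2 (fun s => DHYM.funcJ ω₀ α θ φb (φ s)) (Ioo 0 1) ∧
      ContDiffOn ℝ 2 (fun s => DHYM.funcC ω₀ α θ φb (φ s)) (Ioo 0 1) ∧
      ∀ t ∈ DHYM.annulus, ∀ u v : ℂ,
        DHYM.iddbar 𝓘(ℝ, ℂ) (fun t' : ℂ => DHYM.funcJ ω₀ α θ φb (φ (-Real.log ‖t'‖))) t u v =
          ((n : ℝ) + 1)⁻¹ * DHYM.fibreIntegral (fun (q : X × ℂ) w =>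
            (DHYM.phase θ * DHYM.wedgePow (DHYM.spaceTimeForm ω₀ α 0 φ q) (n + 1) w).re) t u v ∧
        DHYM.iddbar 𝓘(ℝ, ℂ) (fun t' : ℂ => DHYM.funcC ω₀ α θ φb (φ (-Real.log ‖t'‖))) t u v =
          ((n : ℝ) + 1)⁻¹ * DHYM.fibreIntegral (fun (q : X × ℂ) w =>
            (DHYM.phase θ * DHYM.wedgePow (DHYM.spaceTimeForm ω₀ α 0 φ q) (n + 1) w).im) t u v) ∧
    (∀ ε : ℝ, 0 ≤ ε → ∀ φ : ℝ → X → ℝ, DHYM.IsEpsGeodesic ω₀ α θ ε φ →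
      ConvexOn ℝ (Icc 0 1) (fun s => DHYM.funcJ ω₀ α θ φb (φ s)) ∧
      (DHYM.IsNontrivial α φ →
        StrictConvexOn ℝ (Icc 0 1) (fun s => DHYM.funcJ ω₀ α θ φb (φ s))) ∧
      ∃ a b : ℝ, ∀ s ∈ Icc (0 : ℝ) 1, DHYM.funcC ω₀ α θ φb (φ s) = a + b * s) := by
  -- The statement integrates only in charts and needs no measurable structure on `X`; the Borel one
  -- is introduced for the measure of `ωⁿ`.
  let _ : MeasurableSpace X := borel X
  have : BorelSpace X := ⟨rfl⟩
  have := DHYM.isManifold_real n X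
  have hb := DHYM.isSm_of_contMDiff hφb
  refine ⟨fun φ hφ => ?_, fun ε hε φ hφ => ?_⟩
  · have h := DHYM.Fam.of_contMDiffOn hφ.smooth
    refine ⟨DHYM.contDiffOn_funcJ isOpen_Ioo hb h, DHYM.contDiffOn_funcC isOpen_Ioo hb h,
      fun t ht u v => ?_⟩
    obtain ⟨h0, hs⟩ := DHYM.ne_zero_and_neg_log_mem_of_mem_annulus ht
    exact DHYM.iddbar_functionals hb isOpen_Ioo h h0 hs u v
  · exact ⟨DHYM.convexOn_funcJ hb hφ, DHYM.strictConvexOn_funcJ hb hφ, DHYM.exists_funcC_eq hθ hb hφ⟩
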